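/- **Setting.** Let $d_1\ge 2$ be even and $d_2\ge 1$, and let $G=\mathbb R^{d_1}\times\mathbb R^{d_2}$ be a group of Heisenberg type: there is a linear map $\mu\mapsto J_\mu$ from $\mathbb R^{d_2}$ to the skew-symmetric $d_1\times d_1$ matrices with $J_\mu^2=-|\mu|^2I$, and $(x,u)\cdot(x',u')=(x+x',\,u+u'+\tfrac12[x,x'])$, where $[x,x']\in\mathbb R^{d_2}$ has components $\langle J_{U_i}x,x'\rangle$ for the standard basis $U_1,\dots,U_{d_2}$ of $\mathbb R^{d_2}$. Let $X_1,\dots,X_{d_1}$ be the left-invariant vector fields $X_jf(p)=\frac{d}{dt}f(p\cdot(te_j,0))|_{t=0}$, and let $L=-\sum_jX_j^2$, which is essentially self-adjoint on $C_c^\infty(G)\subset L^2(G)$ (Lebesgue measure). Operators $m(L)$ are defined by the spectral theorem. **Proposition.** Let $\chi_1\in C_c^\infty(\mathbb R)$ (complex valued) with $\chi_1(s)=1$ for $s\in[1/4,4]$. Then to every $C^\infty$ function $g:\mathbb R\to\mathbb C$ that vanishes outside $(1/2,2)$ one can assign functions $a_\lambda(s)$ and $\rho_\lambda(s)$ that are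 $C^\infty$ in $(\lambda,s)\in(0,\infty)\times\mathbb R$, depend linearly on $g$ and do not depend on $G$, such that the following holds. 1. For all $\lambda\ge1$, $\operatorname{supp}a_\lambda\subset[1/16,4]$ and $\operatorname{supp}\rho_\lambda\subset\operatorname{supp}\chi_1$. 2. For every integer $K\ge2$ there is a constant $c(K)$ (depending also on $\chi_1$, but not on $g$, $\lambda$) such that for all integers $N_1,N_2\ge0$ with $N_1+N_2<\frac{K-1}2$, all $g$ and all $\lambda\ge1$, $$\sup_s\big|\partial_s^{N_1}\partial_\lambda^{N_2}a_\lambda(s)\big|\le c(K)\,\lambda^{-N_2}\sum_{\nu=0}^K\|g^{(\nu)}\|_\infty .$$ 3. For all integers $K\ge2$ and $N_2\ge0$ there is a constant $c(K,N_2)$ (depending also on $\chi_1$, but not on $g$, $\lambda$) such that for all integers $0\le N_1\le K-2$, all $g$ and all $\lambda\ge1$, $$\sup_s\big|\partial_s^{N_1}\partial_\lambda^{N_2}\rho_\lambda(s)\big|\le c(K,N_2)\,\lambda^{N_1+1-K}\sum_{\nu=0}^K\|g^{(\nu)}\|_\infty .$$ 4. For every $g$ and every $N\in\mathbb N$, the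 functions $\lambda^N\rho_\lambda$, $\lambda\ge1$, form a bounded set in the Schwartz space $\mathcal S(\mathbb R)$. 5. For every $G$ as above, every $g$ and every $\lambda\ge1$, as operators on $L^2(G)$, $$g(\lambda^{-1}\sqrt L)\,e^{i\sqrt L}=\chi_1(\lambda^{-2}L)\,\sqrt\lambda\int_{\mathbb R} e^{i\lambda/(4s)}\,a_\lambda(s)\,e^{isL/\lambda}\,ds+\rho_\lambda(\lambda^{-2}L),$$ where the integral, applied to any $f\in L^2(G)$, is an absolutely convergent $L^2(G)$-valued integral. 6. For every $G$ as above, every $g$ and every $N\in\mathbb N$ there is a constant $C$ such that for all $\lambda\ge1$ and all $1\le p\le\infty$ the operator $\rho_\lambda(\lambda^{-2}L)$ extends from $L^2(G)\cap L^p(G)$ to a bounded operator on $L^p(G)$ with norm at most $C\lambda^{-N}$. -/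

import Mathlib

open MeasureTheory Set
open scoped ContDiff ENNReal SchwartzMap InnerProductSpace

noncomputable section

theorem compAdjoint_props {H V : Type*} [NormedAddCommGroup H] [InnerProductSpace ℂ H]
    [CompleteSpace H] [NormedAddCommGroup V] [InnerProductSpace ℂ V]
    [CompleteSpace V] (j : V →L[ℂ] H) (hj1 : ∀ v, ‖j v‖ ≤ ‖v‖) (hd : DenseRange j) :
    0 ≤ j.comp (ContinuousLinearMap.adjoint j) ∧ ‖j.comp (ContinuousLinearMap.adjoint j)‖ ≤ 1 ∧
      DenseRange (j.comp (ContinuousLinearMap.adjoint j)) := by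
  refine ⟨?_, ?_, ?_⟩
  · rw [ContinuousLinearMap.nonneg_iff_isPositive]
    exact ContinuousLinearMap.isPositive_self_comp_adjoint j
  · have h1 : ‖j‖ ≤ 1 := j.opNorm_le_bound zero_le_one fun v => by simpa using hj1 v
    refine (ContinuousLinearMap.opNorm_comp_le _ _).trans ?_
    rw [LinearIsometryEquiv.norm_map]
    exact mul_le_one₀ h1 (norm_nonneg _) h1
  · set R := j.comp (ContinuousLinearMap.adjoint j) with hR
    have hsa : ContinuousLinearMap.adjoint R = R := by
      simp [hR, ContinuousLinearMap.adjoint_comp]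
    change Dense (range R)
    have : (LinearMap.range (R : H →ₗ[ℂ] H)).topologicalClosure = ⊤ := by
      rw [Submodule.topologicalClosure_eq_top_iff, Submodule.eq_bot_iff]
      intro f hf
      have h0 : R f = 0 := by
        refine ext_inner_left ℂ fun v => ?_
        rw [← hsa, ContinuousLinearMap.adjoint_inner_right, inner_zero_right]
        exact hf _ ⟨v, rfl⟩
      have h1 : ContinuousLinearMap.adjoint j f = 0 := by
        rw [← inner_self_eq_zero (𝕜 := ℂ), ContinuousLinearMap.adjoint_inner_left]
        change inner ℂ f (R f) = 0
        rw [h0, inner_zero_right]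
      have h2 : (fun g : H => inner ℂ f g) = fun _ => 0 := by
        refine hd.equalizer (by fun_prop) (by fun_prop) ?_
        funext v
        simp only [Function.comp_apply]
        rw [← ContinuousLinearMap.adjoint_inner_left, h1, inner_zero_left]
      exact inner_self_eq_zero.1 (congrFun h2 f)
    rw [Submodule.dense_iff_topologicalClosure_eq_top.symm] at this
    exact this

/-- For a closed subspace `V` of `A ⊕ B`, the operator `j j*` on `A`, where `j : V → A` is the first
projection. Thus `j* f` is the element `v` of `V` with `⟨v, w⟩ = ⟨f, w.fst⟩` for all `w` in `V`. -/
def fstCompAdjoint {A B : Type*} [NormedAddCommGroup A] [InnerProductSpace ℂ A] [CompleteSpace A]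
    [NormedAddCommGroup B] [InnerProductSpace ℂ B]
    (V : Submodule ℂ (WithLp 2 (A × B))) [CompleteSpace V] : A →L[ℂ] A :=
  ((WithLp.fstL 2 ℂ A B).comp V.subtypeL).comp
    (ContinuousLinearMap.adjoint ((WithLp.fstL 2 ℂ A B).comp V.subtypeL))

theorem fstCompAdjoint_props {A B : Type*} [NormedAddCommGroup A] [InnerProductSpace ℂ A]
    [CompleteSpace A] [NormedAddCommGroup B] [InnerProductSpace ℂ B]
    (V : Submodule ℂ (WithLp 2 (A × B))) [CompleteSpace V]
    (hd : Dense {x : A | ∃ v ∈ V, v.fst = x}) :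
    0 ≤ fstCompAdjoint V ∧ ‖fstCompAdjoint V‖ ≤ 1 ∧ DenseRange (fstCompAdjoint V) := by
  refine compAdjoint_props ((WithLp.fstL 2 ℂ A B).comp V.subtypeL)
    (fun v => WithLp.norm_fst_le _ v.1) (hd.mono ?_)
  rintro x ⟨v, hv, rfl⟩
  exact ⟨⟨v, hv⟩, rfl⟩

theorem fstCompAdjoint_apply {A B : Type*} [NormedAddCommGroup A] [InnerProductSpace ℂ A]
    [CompleteSpace A] [NormedAddCommGroup B] [InnerProductSpace ℂ B]
    (V : Submodule ℂ (WithLp 2 (A × B))) [CompleteSpace V] (f : A) (u : WithLp 2 (A × B))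
    (hu : u ∈ V) (h : ∀ v ∈ V, ⟪v.fst, f⟫_ℂ = ⟪v, u⟫_ℂ) : fstCompAdjoint V f = u.fst := by
  have h1 : ContinuousLinearMap.adjoint ((WithLp.fstL 2 ℂ A B).comp V.subtypeL) f = ⟨u, hu⟩ := by
    refine ext_inner_left ℂ fun v => ?_
    rw [ContinuousLinearMap.adjoint_inner_right]
    exact h v.1 v.2
  change ((WithLp.fstL 2 ℂ A B).comp V.subtypeL) _ = _
  exact (congrArg _ h1).trans rfl

/-- A group of Heisenberg type in coordinates. `J` is the linear map `μ ↦ J_μ` from the (dual of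
the) centre to the skew-symmetric endomorphisms of the first layer, with `J_μ² = -|μ|² I`. The
underlying manifold is `ℝ^{d₁} × ℝ^{d₂}`, with the group law `HTypeGroup.mul` below. -/
structure HTypeGroup (d₁ d₂ : ℕ) where
  d₁_pos : 0 < d₁
  d₁_even : Even d₁
  d₂_pos : 0 < d₂
  J : EuclideanSpace ℝ (Fin d₂) →ₗ[ℝ] EuclideanSpace ℝ (Fin d₁) →ₗ[ℝ] EuclideanSpace ℝ (Fin d₁)
  skew : ∀ μ x y, ⟪J μ x, y⟫_ℝ = -⟪x, J μ y⟫_ℝ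
  J_sq : ∀ μ x, J μ (J μ x) = -(‖μ‖ ^ 2) • x

/-- The underlying manifold `ℝ^{d₁} × ℝ^{d₂}`; its `volume` is the product Lebesgue measure, which
is a bi-invariant Haar measure of the group. -/
abbrev HPoint (d₁ d₂ : ℕ) : Type := EuclideanSpace ℝ (Fin d₁) × EuclideanSpace ℝ (Fin d₂)

/-- The Hilbert space `L²(G)`. -/
abbrev HL2 (d₁ d₂ : ℕ) : Type := Lp ℂ 2 (volume : Measure (HPoint d₁ d₂))

/-- The test functions `C_c^∞(G)`, complex valued. -/
def testFunctions (d₁ d₂ : ℕ) : Submodule ℂ (HPoint d₁ d₂ → ℂ) where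
  carrier := {φ | ContDiff ℝ ∞ φ ∧ HasCompactSupport φ}
  zero_mem' := ⟨contDiff_const, HasCompactSupport.zero⟩
  add_mem' := fun ha hb => ⟨ha.1.add hb.1, ha.2.add hb.2⟩
  smul_mem' := fun c _ ha => ⟨contDiff_const.smul ha.1, ha.2.smul_left (f := fun _ => c)⟩

theorem testFunctions_memLp {d₁ d₂ : ℕ} (φ : testFunctions d₁ d₂) :
    MemLp φ.1 2 (volume : Measure (HPoint d₁ d₂)) :=
  φ.2.1.continuous.memLp_of_hasCompactSupport φ.2.2

/-- The inclusion of `C_c^∞(G)` in `L²(G)`. -/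
def testToL2 (d₁ d₂ : ℕ) : testFunctions d₁ d₂ →ₗ[ℂ] HL2 d₁ d₂ where
  toFun φ := (testFunctions_memLp φ).toLp φ.1
  map_add' _ _ := rfl
  map_smul' _ _ := rfl

theorem integral_fderiv_eq_zero_aux {E : Type*} [NormedAddCommGroup E] [NormedSpace ℝ E]
    [MeasurableSpace E] [BorelSpace E] [FiniteDimensional ℝ E] (μ : Measure E) [μ.IsAddHaarMeasure]
    {g : E → ℂ} (hg : ContDiff ℝ ∞ g) (hc : HasCompactSupport g) (v : E) :
    ∫ x, fderiv ℝ g x v ∂μ = 0 := by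
  have hi : Integrable (fun x => fderiv ℝ g x v) μ := by
    refine Continuous.integrable_of_hasCompactSupport ?_ (hc.fderiv_apply (𝕜 := ℝ) v)
    exact (hg.continuous_fderiv (by simp)).clm_apply continuous_const
  have h := integral_mul_fderiv_eq_neg_fderiv_mul_of_integrable (μ := μ) (𝕜 := ℂ)
    (f := fun _ : E => (1 : ℂ)) (g := g) (v := v) (by simp) (by simpa using hi)
    (by simpa using hg.continuous.integrable_of_hasCompactSupport hc)
    (fun x _ => differentiableAt_const _) (fun x _ => hg.differentiable (by simp) x)
  simpa using h

namespace HTypeGroup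

variable {d₁ d₂ : ℕ} (G : HTypeGroup d₁ d₂)

/-- The Lie bracket of the first layer: the vector with components `⟨J_{U_i} x, y⟩`. -/
def bracket (x y : EuclideanSpace ℝ (Fin d₁)) : EuclideanSpace ℝ (Fin d₂) :=
  WithLp.toLp 2 fun i => ⟪G.J (EuclideanSpace.single i 1) x, y⟫_ℝ

/-- The group law `(x,u)·(x',u') = (x+x', u+u'+½[x,x'])`. -/
def mul (p q : HPoint d₁ d₂) : HPoint d₁ d₂ :=
  (p.1 + q.1, p.2 + q.2 + (1 / 2 : ℝ) • G.bracket p.1 q.1)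

/-- The left-invariant vector field of the unit vector `e_j` of the first layer:
`X_j f(p) = d/dt f(p · exp(t e_j))` at `t = 0`. -/
def vectorField (j : Fin d₁) (f : HPoint d₁ d₂ → ℂ) (p : HPoint d₁ d₂) : ℂ :=
  deriv (fun t : ℝ => f (G.mul p (t • EuclideanSpace.single j 1, 0))) 0

theorem vectorField_eq (j : Fin d₁) {f : HPoint d₁ d₂ → ℂ} (hf : Differentiable ℝ f)
    (p : HPoint d₁ d₂) :
    G.vectorField j f p = fderiv ℝ f p
      (EuclideanSpace.single j 1, (1 / 2 : ℝ) • G.bracket p.1 (EuclideanSpace.single j 1)) := by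
  set e : EuclideanSpace ℝ (Fin d₁) := EuclideanSpace.single j 1 with he
  set v : HPoint d₁ d₂ := (e, (1 / 2 : ℝ) • G.bracket p.1 e) with hv
  have hcurve : ∀ t : ℝ, G.mul p (t • e, 0) = p + t • v := by
    intro t
    have : G.bracket p.1 (t • e) = t • G.bracket p.1 e := by
      ext i
      simp [bracket, inner_smul_right]
    simp only [mul, this, hv]
    ext1
    · simp
    · simpa using smul_comm (2⁻¹ : ℝ) t (G.bracket p.1 e)
  have h1 : HasDerivAt (fun t : ℝ => p + t • v) v 0 := by
    simpa using ((hasDerivAt_id (0 : ℝ)).smul_const v).const_add p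
  have h2 : HasFDerivAt f (fderiv ℝ f p) (p + (0 : ℝ) • v) := by
    simpa using (hf p).hasFDerivAt
  have h3 := h2.comp_hasDerivAt (0 : ℝ) h1
  unfold vectorField
  simp only [← he, hcurve]
  exact h3.deriv

theorem vectorField_mem (j : Fin d₁) (φ : testFunctions d₁ d₂) :
    G.vectorField j φ.1 ∈ testFunctions d₁ d₂ := by
  have hd : Differentiable ℝ φ.1 := φ.2.1.differentiable (by simp)
  have hlin : ContDiff ℝ ∞ fun p : HPoint d₁ d₂ =>
      ((EuclideanSpace.single j 1, (1 / 2 : ℝ) • G.bracket p.1 (EuclideanSpace.single j 1)) :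
        HPoint d₁ d₂) := by
    refine contDiff_const.prodMk (ContDiff.const_smul (1 / 2 : ℝ) ?_)
    refine contDiff_euclidean.2 fun i => ?_
    have : ContDiff ℝ ∞ fun x : EuclideanSpace ℝ (Fin d₁) => G.J (EuclideanSpace.single i 1) x :=
      (G.J (EuclideanSpace.single i 1)).toContinuousLinearMap.contDiff
    exact (this.comp contDiff_fst).inner ℝ contDiff_const
  have heq : G.vectorField j φ.1 = fun p => fderiv ℝ φ.1 p
      (EuclideanSpace.single j 1, (1 / 2 : ℝ) • G.bracket p.1 (EuclideanSpace.single j 1)) :=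
    funext fun p => G.vectorField_eq j hd p
  refine ⟨?_, ?_⟩
  · rw [heq]
    exact (φ.2.1.fderiv_right (m := ∞) (by simp)).clm_apply hlin
  · refine (φ.2.2.fderiv (𝕜 := ℝ)).mono' ?_
    rw [heq]
    intro p hp
    refine subset_closure ?_
    intro h0
    exact hp (by simp [h0])

/-- `X_j` as a linear operator on `C_c^∞(G)`. -/
def X (j : Fin d₁) : testFunctions d₁ d₂ →ₗ[ℂ] testFunctions d₁ d₂ where
  toFun φ := ⟨G.vectorField j φ.1, G.vectorField_mem j φ⟩
  map_add' φ ψ := by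
    have h1 : Differentiable ℝ φ.1 := φ.2.1.differentiable (by simp)
    have h2 : Differentiable ℝ ψ.1 := ψ.2.1.differentiable (by simp)
    ext p
    change G.vectorField j (φ.1 + ψ.1) p = G.vectorField j φ.1 p + G.vectorField j ψ.1 p
    rw [G.vectorField_eq j (h1.add h2), G.vectorField_eq j h1, G.vectorField_eq j h2,
      fderiv_add (h1 p) (h2 p)]
    rfl
  map_smul' c φ := by
    have h1 : Differentiable ℝ φ.1 := φ.2.1.differentiable (by simp)
    ext p
    change G.vectorField j (c • φ.1) p = c • G.vectorField j φ.1 p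
    rw [G.vectorField_eq j (h1.const_smul c), G.vectorField_eq j h1, fderiv_const_smul (h1 p)]
    rfl

/-- The sub-Laplacian `L = -∑_j X_j²` on `C_c^∞(G)`. -/
def subLaplacian : testFunctions d₁ d₂ →ₗ[ℂ] testFunctions d₁ d₂ :=
  -∑ j, G.X j ∘ₗ G.X j

/-- The form norm graph: `φ ↦ (φ, X_1 φ, …, X_{d₁} φ)` in `L²(G) ⊕ L²(G)^{d₁}`. -/
def formGraph : testFunctions d₁ d₂ →ₗ[ℂ]
    WithLp 2 (HL2 d₁ d₂ × PiLp 2 (fun _ : Fin d₁ => HL2 d₁ d₂)) where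
  toFun φ := WithLp.toLp 2
    (testToL2 d₁ d₂ φ, WithLp.toLp 2 fun j => testToL2 d₁ d₂ (G.X j φ))
  map_add' φ ψ := by
    simp only [map_add]
    rfl
  map_smul' c φ := by
    simp only [map_smul]
    rfl

/-- The form domain: the completion of `C_c^∞(G)` for `‖φ‖² + ∑_j ‖X_j φ‖² = ⟨φ, (1 + L) φ⟩`,
realised as the closure of the form graph. -/
def formDomain : Submodule ℂ (WithLp 2 (HL2 d₁ d₂ × PiLp 2 (fun _ : Fin d₁ => HL2 d₁ d₂))) :=
  (LinearMap.range G.formGraph).topologicalClosure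

instance : CompleteSpace G.formDomain :=
  (LinearMap.range G.formGraph).isClosed_topologicalClosure.completeSpace_coe

/-- The resolvent `R = (1 + L)⁻¹` on `L²(G)`: for `f` in `L²(G)`, `R f` is the element `u` of the
form domain with `⟨u, v⟩ + ∑_j ⟨X_j u, X_j v⟩ = ⟨f, v⟩` for all `v` in the form domain.
By `resolventOp_props` and `resolventOp_apply`, `R⁻¹ - 1` is a nonnegative self-adjoint operator
that extends `L` from `C_c^∞(G)`. Since `L` is essentially self-adjoint on `C_c^∞(G)`, it is the
only self-adjoint extension, namely the closure of `L`. -/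
def resolventOp : HL2 d₁ d₂ →L[ℂ] HL2 d₁ d₂ :=
  fstCompAdjoint G.formDomain

/-- `X_j` is divergence free. -/
theorem integral_vectorField (j : Fin d₁) (φ : testFunctions d₁ d₂) :
    ∫ p, G.vectorField j φ.1 p = 0 := by
  have hd : Differentiable ℝ φ.1 := φ.2.1.differentiable (by simp)
  set e : EuclideanSpace ℝ (Fin d₁) := EuclideanSpace.single j 1 with he
  have hX := (G.vectorField_mem j φ)
  have hXi : Integrable (G.vectorField j φ.1) (volume : Measure (HPoint d₁ d₂)) :=
    hX.1.continuous.integrable_of_hasCompactSupport hX.2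
  have hconst : Integrable (fun p => fderiv ℝ φ.1 p (e, 0))
      (volume : Measure (HPoint d₁ d₂)) := by
    refine Continuous.integrable_of_hasCompactSupport ?_ (φ.2.2.fderiv_apply (𝕜 := ℝ) _)
    exact (φ.2.1.continuous_fderiv (by simp)).clm_apply continuous_const
  have hsplit : ∀ p, G.vectorField j φ.1 p - fderiv ℝ φ.1 p (e, 0) =
      fderiv ℝ φ.1 p (0, (1 / 2 : ℝ) • G.bracket p.1 e) := by
    intro p
    rw [G.vectorField_eq j hd, ← map_sub]
    simp [he]
  have h0 : ∫ p, fderiv ℝ φ.1 p (e, 0) = 0 :=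
    integral_fderiv_eq_zero_aux ((volume : Measure (EuclideanSpace ℝ (Fin d₁))).prod
      (volume : Measure (EuclideanSpace ℝ (Fin d₂)))) φ.2.1 φ.2.2 _
  have h1 : ∫ p, (G.vectorField j φ.1 p - fderiv ℝ φ.1 p (e, 0)) = 0 := by
    have hint : Integrable (fun p => G.vectorField j φ.1 p - fderiv ℝ φ.1 p (e, 0))
        (volume : Measure (HPoint d₁ d₂)) := hXi.sub hconst
    rw [Measure.volume_eq_prod] at hint ⊢
    rw [integral_prod _ hint]
    refine (integral_congr_ae (Filter.Eventually.of_forall fun x => ?_)).trans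
      (integral_zero _ _)
    simp only [hsplit]
    have hsl : ContDiff ℝ ∞ fun u : EuclideanSpace ℝ (Fin d₂) => φ.1 (x, u) :=
      φ.2.1.comp (contDiff_const.prodMk contDiff_id)
    have hcs : HasCompactSupport fun u : EuclideanSpace ℝ (Fin d₂) => φ.1 (x, u) :=
      φ.2.2.comp_isClosedEmbedding (Topology.IsClosedEmbedding.of_continuous_injective_isClosedMap
        (by fun_prop) (fun a b h => by simpa using h) (isClosedMap_prodMk_left x))
    rw [← integral_fderiv_eq_zero_aux volume hsl hcs ((1 / 2 : ℝ) • G.bracket x e)]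
    refine integral_congr_ae (Filter.Eventually.of_forall fun u => ?_)
    have hh : HasFDerivAt (fun u : EuclideanSpace ℝ (Fin d₂) => ((x, u) : HPoint d₁ d₂))
        (ContinuousLinearMap.inr ℝ _ _) u := hasFDerivAt_prodMk_right x u
    have := ((hd (x, u)).hasFDerivAt.comp u hh).fderiv
    change _ = fderiv ℝ (φ.1 ∘ fun u => (x, u)) u _
    rw [this]
    rfl
  rw [integral_sub hXi hconst, h0, sub_zero] at h1
  exact h1

/-- `X_j` is skew-symmetric on `C_c^∞(G)`. -/
theorem inner_X (j : Fin d₁) (φ ψ : testFunctions d₁ d₂) :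
    ⟪testToL2 d₁ d₂ (G.X j ψ), testToL2 d₁ d₂ φ⟫_ℂ =
      -⟪testToL2 d₁ d₂ ψ, testToL2 d₁ d₂ (G.X j φ)⟫_ℂ := by
  have hin : ∀ a b : testFunctions d₁ d₂, ⟪testToL2 d₁ d₂ a, testToL2 d₁ d₂ b⟫_ℂ =
      ∫ p, b.1 p * (starRingEnd ℂ) (a.1 p) := by
    intro a b
    rw [L2.inner_def]
    refine integral_congr_ae ?_
    filter_upwards [(testFunctions_memLp a).coeFn_toLp, (testFunctions_memLp b).coeFn_toLp]
      with p ha hb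
    change inner ℂ (((testFunctions_memLp a).toLp a.1 : HL2 d₁ d₂) p)
      (((testFunctions_memLp b).toLp b.1 : HL2 d₁ d₂) p) = _
    rw [ha, hb]
    rfl
  have hprod : ∀ a b : testFunctions d₁ d₂,
      (fun p => b.1 p * (starRingEnd ℂ) (a.1 p)) ∈ testFunctions d₁ d₂ := fun a b =>
    ⟨b.2.1.mul (Complex.conjCLE.contDiff.comp a.2.1), b.2.2.mul_right⟩
  have hi : ∀ a b : testFunctions d₁ d₂,
      Integrable (fun p => b.1 p * (starRingEnd ℂ) (a.1 p)) (volume : Measure (HPoint d₁ d₂)) :=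
    fun a b => (hprod a b).1.continuous.integrable_of_hasCompactSupport (hprod a b).2
  rw [hin, hin, eq_neg_iff_add_eq_zero, ← integral_add (hi _ _) (hi _ _),
    ← G.integral_vectorField j ⟨_, hprod ψ φ⟩]
  refine integral_congr_ae (Filter.Eventually.of_forall fun p => ?_)
  have hφ : Differentiable ℝ φ.1 := φ.2.1.differentiable (by simp)
  have hψ : Differentiable ℝ ψ.1 := ψ.2.1.differentiable (by simp)
  have hcψ : HasFDerivAt (fun p => (starRingEnd ℂ) (ψ.1 p))
      ((Complex.conjCLE : ℂ →L[ℝ] ℂ).comp (fderiv ℝ ψ.1 p)) p :=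
    (Complex.conjCLE : ℂ →L[ℝ] ℂ).hasFDerivAt.comp p (hψ p).hasFDerivAt
  have hm := ((hφ p).hasFDerivAt.mul hcψ).fderiv
  have hdm : Differentiable ℝ fun p => φ.1 p * (starRingEnd ℂ) (ψ.1 p) :=
    (hprod ψ φ).1.differentiable (by simp)
  change φ.1 p * (starRingEnd ℂ) (G.vectorField j ψ.1 p) +
    G.vectorField j φ.1 p * (starRingEnd ℂ) (ψ.1 p) = G.vectorField j _ p
  rw [G.vectorField_eq j hdm, G.vectorField_eq j hφ, G.vectorField_eq j hψ]
  erw [hm]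
  simp [mul_comm]

/-- `R (1 + L) φ = φ` for test functions `φ`. -/
theorem resolventOp_apply (φ : testFunctions d₁ d₂) :
    G.resolventOp (testToL2 d₁ d₂ (φ + G.subLaplacian φ)) = testToL2 d₁ d₂ φ := by
  have hmem : G.formGraph φ ∈ G.formDomain :=
    (LinearMap.range G.formGraph).le_topologicalClosure ⟨φ, rfl⟩
  have key : (G.formDomain : Set _) ⊆
      {v | ⟪v.fst, testToL2 d₁ d₂ (φ + G.subLaplacian φ)⟫_ℂ = ⟪v, G.formGraph φ⟫_ℂ} := by
    refine closure_minimal ?_ (isClosed_eq ?_ ?_)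
    · rintro _ ⟨ψ, rfl⟩
      simp only [mem_ofPred_eq, WithLp.prod_inner_apply, PiLp.inner_apply]
      change ⟪testToL2 d₁ d₂ ψ, _⟫_ℂ = ⟪testToL2 d₁ d₂ ψ, testToL2 d₁ d₂ φ⟫_ℂ +
        ∑ j, ⟪testToL2 d₁ d₂ (G.X j ψ), testToL2 d₁ d₂ (G.X j φ)⟫_ℂ
      simp [G.inner_X, subLaplacian, inner_add_right, inner_neg_right, inner_sum,
        LinearMap.sum_apply]
    · exact ((WithLp.fstL 2 ℂ (HL2 d₁ d₂) (PiLp 2 (fun _ : Fin d₁ => HL2 d₁ d₂))).continuous).inner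
        continuous_const
    · exact continuous_id.inner continuous_const
  exact fstCompAdjoint_apply G.formDomain _ (G.formGraph φ) hmem fun v hv => key hv

end HTypeGroup

section HilbertSpace

variable {H : Type*} [NormedAddCommGroup H] [InnerProductSpace ℂ H] [CompleteSpace H]

/-- Bounded continuous functional calculus of a nonnegative self-adjoint operator `A` given by its
resolvent `R = (1 + A)⁻¹`. For `m` continuous and bounded on `[0, ∞)` the function
`t ↦ t m(1/t - 1)` (with value `0` at `t = 0`) is continuous on the spectrum of `R`, and `m(A)` is
the unique bounded operator with `m(A) R = (t ↦ t m(1/t - 1))(R)`; the right-hand side is the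
continuous functional calculus of the bounded operator `R`. See `funCalc_apply`. -/
def funCalc (R : H →L[ℂ] H) (m : ℝ → ℂ) : H →L[ℂ] H :=
  (cfc (fun z : ℂ => z * m (z.re⁻¹ - 1)) R : H →L[ℂ] H).toLinearMap.extendOfNorm R.toLinearMap

open scoped ComplexOrder in
theorem funCalc_apply {R : H →L[ℂ] H} (hR : 0 ≤ R) (hR1 : ‖R‖ ≤ 1) (hd : DenseRange R)
    {m : ℝ → ℂ} (hm : ContinuousOn m (Ici 0)) {C : ℝ} (hC : ∀ x ∈ Ici 0, ‖m x‖ ≤ C) (f : H) :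
    funCalc R m (R f) = cfc (fun z : ℂ => z * m (z.re⁻¹ - 1)) R f := by
  refine LinearMap.extendOfNorm_eq (f := (cfc (fun z : ℂ => z * m (z.re⁻¹ - 1)) R :
    H →L[ℂ] H).toLinearMap) (e := R.toLinearMap) hd ⟨C, fun x => ?_⟩ f
  have hC0 : 0 ≤ C := (norm_nonneg _).trans (hC 0 (by simp))
  have hsa : IsSelfAdjoint R := IsSelfAdjoint.of_nonneg hR
  have hspec : ∀ z ∈ spectrum ℂ R, z = (z.re : ℂ) ∧ z.re ∈ Icc (0:ℝ) 1 := by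
    intro z hz
    have h0 : 0 ≤ z := spectrum_nonneg_of_nonneg hR hz
    have h1 : ‖z‖ ≤ 1 := by
      rcases subsingleton_or_nontrivial H with h | h
      · have : Subsingleton (H →L[ℂ] H) := inferInstance
        simp [spectrum.of_subsingleton] at hz
      · exact (spectrum.norm_le_norm_of_mem hz).trans hR1
    rw [Complex.nonneg_iff] at h0
    refine ⟨Complex.ext rfl (by simpa using h0.2.symm), h0.1, (Complex.re_le_norm z).trans h1⟩
  set h : ℂ → ℂ := fun z => z * m (z.re⁻¹ - 1) with hh
  have hb : ∀ z ∈ spectrum ℂ R, ‖h z‖ ≤ C * ‖z‖ := by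
    intro z hz
    obtain ⟨h1, h2, h3⟩ := hspec z hz
    rcases h2.eq_or_lt with h0 | h0
    · rw [h1, ← h0]; simp [hh]
    · rw [hh, norm_mul, mul_comm]
      gcongr
      exact hC _ (by simpa using (one_le_inv₀ h0).2 h3)
  have hcont : ContinuousOn h (spectrum ℂ R) := by
    intro z hz
    obtain ⟨h1, h2, h3⟩ := hspec z hz
    rcases h2.eq_or_lt with h0 | h0
    · have hz0 : z = 0 := by rw [h1, ← h0]; simp
      subst hz0
      unfold ContinuousWithinAt
      have : h 0 = 0 := by simp [hh]
      rw [this]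
      refine squeeze_zero_norm' (a := fun z => C * ‖z‖) ?_ ?_
      · filter_upwards [self_mem_nhdsWithin] with w hw using hb w hw
      · have : Continuous fun z : ℂ => C * ‖z‖ := by fun_prop
        simpa using (this.tendsto 0).mono_left nhdsWithin_le_nhds
    · refine continuousWithinAt_id.mul ?_
      have hopen : IsOpen {w : ℂ | 0 < w.re} := isOpen_lt continuous_const Complex.continuous_re
      refine ContinuousWithinAt.mono_of_mem_nhdsWithin
        (t := spectrum ℂ R ∩ {w : ℂ | 0 < w.re}) ?_ ?_
      · refine ContinuousWithinAt.comp (f := fun w : ℂ => w.re⁻¹ - 1) (t := Ici 0) (hm _ ?_) ?_ ?_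
        · simpa using (one_le_inv₀ h0).2 h3
        · exact ((Complex.continuous_re.continuousAt.inv₀ h0.ne').sub
            continuousAt_const).continuousWithinAt
        · rintro w ⟨hw, hw0⟩
          simpa using (one_le_inv₀ hw0).2 (hspec w hw).2.2
      · exact Filter.inter_mem self_mem_nhdsWithin (mem_nhdsWithin_of_mem_nhds (hopen.mem_nhds h0))
  have hpos : 0 ≤ cfc (fun z : ℂ => (((C * ‖z‖) ^ 2 - ‖h z‖ ^ 2 : ℝ) : ℂ)) R :=
    cfc_nonneg fun z hz => by
      rw [Complex.zero_le_real, sub_nonneg]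
      exact pow_le_pow_left₀ (norm_nonneg _) (hb z hz) 2
  have heq : cfc (fun z : ℂ => (((C * ‖z‖) ^ 2 - ‖h z‖ ^ 2 : ℝ) : ℂ)) R =
      ((C : ℂ) ^ 2) • (star R * R) - star (cfc h R) * cfc h R := by
    have e1 : (fun z : ℂ => (((C * ‖z‖) ^ 2 - ‖h z‖ ^ 2 : ℝ) : ℂ)) =
        fun z => (C : ℂ) ^ 2 • (star z * z) - star (h z) * h z := by
      funext z
      have a : ∀ w : ℂ, star w * w = ((‖w‖ ^ 2 : ℝ) : ℂ) := fun w => by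
        simpa using Complex.conj_mul' w
      rw [a, a]
      push_cast
      simp only [smul_eq_mul]
      ring
    rw [e1, cfc_sub _ _ R, cfc_smul _ _ R, cfc_mul _ _ R, cfc_mul _ _ R, cfc_star h R,
      cfc_star (fun z : ℂ => z) R, cfc_id' ℂ R hsa.isStarNormal]
  rw [heq, ContinuousLinearMap.nonneg_iff_isPositive] at hpos
  have h2 := hpos.re_inner_nonneg_left x
  change ‖cfc h R x‖ ≤ C * ‖R x‖
  refine (sq_le_sq₀ (norm_nonneg _) (by positivity)).1 ?_
  have e2 : ∀ T : H →L[ℂ] H, inner ℂ ((star T * T) x) x = ((‖T x‖ ^ 2 : ℝ) : ℂ) := by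
    intro T
    change inner ℂ (ContinuousLinearMap.adjoint T (T x)) x = _
    rw [ContinuousLinearMap.adjoint_inner_left, inner_self_eq_norm_sq_to_K]
    push_cast
    rfl
  rw [sub_apply, smul_apply, inner_sub_left,
    inner_smul_left, e2, e2] at h2
  have e3 : (starRingEnd ℂ) ((C : ℂ) ^ 2) * ((‖R x‖ ^ 2 : ℝ) : ℂ) - ((‖cfc h R x‖ ^ 2 : ℝ) : ℂ) =
      (((C * ‖R x‖) ^ 2 - ‖cfc h R x‖ ^ 2 : ℝ) : ℂ) := by
    push_cast
    rw [map_pow, Complex.conj_ofReal]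
    ring
  rw [e3] at h2
  exact sub_nonneg.1 h2
end HilbertSpace

namespace HTypeGroup

variable {d₁ d₂ : ℕ} (G : HTypeGroup d₁ d₂)

/-- `0 ≤ R ≤ 1` and `R` has dense range, hence is injective. -/
theorem resolventOp_props :
    0 ≤ G.resolventOp ∧ ‖G.resolventOp‖ ≤ 1 ∧ DenseRange G.resolventOp := by
  refine fstCompAdjoint_props G.formDomain ?_
  have hd := Lp.dense_hasCompactSupport_contDiff (F := ℂ) (p := 2)
    (μ := (volume : Measure (HPoint d₁ d₂))) (by simp)
  refine hd.mono ?_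
  rintro f ⟨g, hfg, hg1, hg2⟩
  refine ⟨G.formGraph ⟨g, hg2, hg1⟩,
    (LinearMap.range G.formGraph).le_topologicalClosure ⟨_, rfl⟩, ?_⟩
  refine Lp.ext ?_
  exact ((testFunctions_memLp ⟨g, hg2, hg1⟩).coeFn_toLp).trans hfg.symm

/-- The spectral multiplier `m(L)` on `L²(G)`, for `m` continuous and bounded on `[0, ∞)`. -/
def multiplier (m : ℝ → ℂ) : HL2 d₁ d₂ →L[ℂ] HL2 d₁ d₂ :=
  funCalc G.resolventOp m

/-- The defining property of `m(L)`. -/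
theorem multiplier_apply {m : ℝ → ℂ} (hm : ContinuousOn m (Ici 0)) {C : ℝ}
    (hC : ∀ x ∈ Ici 0, ‖m x‖ ≤ C) (f : HL2 d₁ d₂) :
    G.multiplier m (G.resolventOp f) =
      cfc (fun z : ℂ => z * m (z.re⁻¹ - 1)) G.resolventOp f :=
  funCalc_apply G.resolventOp_props.1 G.resolventOp_props.2.1 G.resolventOp_props.2.2 hm hC f

end HTypeGroup

/-- The smooth functions on `ℝ` that vanish outside the open interval `(1/2, 2)`. -/
def smoothDyadic : Submodule ℂ (ℝ → ℂ) where
  carrier := {g | ContDiff ℝ ∞ g ∧ Function.support g ⊆ Ioo (1 / 2) 2}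
  zero_mem' := ⟨contDiff_const, by simp⟩
  add_mem' := fun ha hb =>
    ⟨ha.1.add hb.1, (Function.support_add _ _).trans (union_subset ha.2 hb.2)⟩
  smul_mem' := fun c _ ha =>
    ⟨contDiff_const.smul ha.1, (Function.support_const_smul_subset c _).trans ha.2⟩

/-- `∑_{ν ≤ K} ‖g^{(ν)}‖_∞`. -/
def cNorm (K : ℕ) (g : ℝ → ℂ) : ℝ :=
  ∑ ν ∈ Finset.range (K + 1), ⨆ s : ℝ, ‖iteratedDeriv ν g s‖

/-- `∂_s^{N₁} ∂_l^{N₂} F_l(s)` at the point `(l, s)`. -/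
def mixedDeriv (N₁ N₂ : ℕ) (F : ℝ → ℝ → ℂ) (l s : ℝ) : ℂ :=
  iteratedDeriv N₁ (fun s' => iteratedDeriv N₂ (fun l' => F l' s') l) s

end

/-!
# Wave multipliers on groups of Heisenberg type as superpositions of Schrödinger propagators

*The operator identity.* By Fourier inversion, the function `y ↦ g(√y) e^{il√y}` of one real variable
is a superposition of exponentials `e^{iξy}`. The substitution `u = t²` turns the coefficient at the
frequency `ξ` into the oscillatory integral `∫ t g(t) e^{i(lt - ξt²)} dt` (`integral_oscInt`). The phase
is critical at `t = l / (2ξ)`, so only frequencies with `ξ / l` in a compact subset of `(0, ∞)` matter.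
A bump function in `ξ / l` splits the superposition. The part near the critical frequencies, with
`ξ = l s` and with the value `e^{il/(4s)}` of the exponential at the critical point taken out, defines
the amplitude; the rest, multiplied by the cutoff `χ`, defines the remainder
(`amplitude_add_remainder`). Multiplication by `χ` is harmless, as `χ = 1` where `g(√y)` is not zero.
The functional calculus, which commutes with integrals (`funCalc_integral`), transfers the scalar
identity to operators (`funCalc_wave_eq`). It is constructed from the continuous functional calculus of
the bounded operator `R = (1 + L)⁻¹`, so only bounded operators occur.

*Estimates for the symbols.* After completing the square, the oscillatory integral is a solution of the
free Schrödinger equation in the time `1 / l` (`freeEvol`). Hence a derivative in `l` equals two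
derivatives of the data and a factor of size `1 / l²`. The amplitudes belong to a family of functions
that is closed under differentiation (`DerivClosed`, `ampFamily`), and its members are bounded by
one derivative of the data because Fresnel integrals are bounded (`norm_freeEvol_le`). The remainders
belong to a similar family; there the phase is not stationary, and repeated integration by parts
(`exists_norm_oscInt_far_le`) gives arbitrary powers of decay in `l + |ξ|`.

*The heat semigroup.* The `L^p` bounds rest on an explicit heat kernel. Its Fourier transform is
`exp(-Φ)` with `Φ(ξ, μ) = (d₁ / 2) log cosh |ν| + |ω|² tanh |ν| / |ν|`, where `ω = 2πξ` and `ν = 2πμ`.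
This is a Schwartz function, smooth at `μ = 0` because `cosh √v` is entire. The heat equation, in
self-similar form, reduces to the Riccati equation for the logarithmic derivative of `cosh √v`
(`coshRatio_riccati`, `HTypeGroup.sum_schwartzX_heatKernel`). By uniqueness for the abstract heat
equation (`heat_unique`), `e^{-tL}` is the convolution with a dilate of this kernel
(`HTypeGroup.multiplier_heatSym`).

*From the heat kernel to `L^p` bounds.* Let `R` be a smooth function with compact support. Since
`R(tL) = R(tL) e^{tL} ∘ e^{-tL}`, the kernel of `R(tL)` is `R(tL) e^{tL}` applied to the heat kernel.
Now `R(x) e^x` is a smooth function with compact support of the variable `e^{-x}` (`logPull`), so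
`R(tL) e^{tL}` is a superposition of the unitary operators `e^{iτA}` with `A = e^{-tL}`. The operator
`A` is a convolution with a rapidly decreasing function, so its commutator with a weight of order `k` in
a homogeneous gauge is of order `k - 1` (`HTypeGroup.IsGauge.norm_commutator_le`), and weighted norms
grow only polynomially in `τ` (`HTypeGroup.IsGauge.norm_weightL2_unitarySym_le`). The rapid decay of
the Fourier transform of `logPull` compensates this growth. A weighted `L²` bound for the kernel gives an
`L¹` bound by the Cauchy–Schwarz inequality, uniformly in `t` by scaling, with a constant that is linear
in finitely many derivatives of `R` (`HTypeGroup.exists_kernel`). For the remainders these derivatives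
decay faster than any power of `l`, and Young's inequality (`HTypeGroup.norm_convLp_le`) finishes the
proof.
-/

open MeasureTheory Set
open scoped ContDiff ENNReal SchwartzMap InnerProductSpace

noncomputable section

/-! ### Functional calculus of a nonnegative self-adjoint operator given by its resolvent -/

section FunCalc

variable {H : Type*} [NormedAddCommGroup H] [InnerProductSpace ℂ H] [CompleteSpace H]

/-- `R` behaves like the resolvent `(1 + A)⁻¹` of a nonnegative self-adjoint operator `A`. -/
def IsResolvent (R : H →L[ℂ] H) : Prop := 0 ≤ R ∧ ‖R‖ ≤ 1 ∧ DenseRange R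

/-- The functions admitted by the functional calculus: continuous and bounded on `[0, ∞)`. -/
def IsSymbol (m : ℝ → ℂ) : Prop := ContinuousOn m (Ici 0) ∧ ∃ C : ℝ, ∀ x ∈ Ici (0:ℝ), ‖m x‖ ≤ C

namespace IsSymbol

theorem const (c : ℂ) : IsSymbol fun _ => c := ⟨continuousOn_const, ‖c‖, fun _ _ => le_rfl⟩

theorem mul {m₁ m₂ : ℝ → ℂ} (h₁ : IsSymbol m₁) (h₂ : IsSymbol m₂) :
    IsSymbol fun x => m₁ x * m₂ x := by
  obtain ⟨c₁, C₁, hC₁⟩ := h₁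
  obtain ⟨c₂, C₂, hC₂⟩ := h₂
  refine ⟨c₁.mul c₂, C₁ * C₂, fun x hx => ?_⟩
  rw [norm_mul]
  exact mul_le_mul (hC₁ x hx) (hC₂ x hx) (norm_nonneg _) ((norm_nonneg _).trans (hC₁ x hx))

theorem add {m₁ m₂ : ℝ → ℂ} (h₁ : IsSymbol m₁) (h₂ : IsSymbol m₂) :
    IsSymbol fun x => m₁ x + m₂ x := by
  obtain ⟨c₁, C₁, hC₁⟩ := h₁
  obtain ⟨c₂, C₂, hC₂⟩ := h₂
  exact ⟨c₁.add c₂, C₁ + C₂, fun x hx => (norm_add_le _ _).trans (add_le_add (hC₁ x hx) (hC₂ x hx))⟩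

theorem conj {m : ℝ → ℂ} (h : IsSymbol m) : IsSymbol fun x => (starRingEnd ℂ) (m x) := by
  obtain ⟨c, C, hC⟩ := h
  exact ⟨Complex.continuous_conj.comp_continuousOn c, C, fun x hx => by simpa using hC x hx⟩

theorem neg {m : ℝ → ℂ} (h : IsSymbol m) : IsSymbol fun x => -m x := by
  obtain ⟨c, C, hC⟩ := h
  exact ⟨c.neg, C, fun x hx => by simpa using hC x hx⟩

theorem sub {m₁ m₂ : ℝ → ℂ} (h₁ : IsSymbol m₁) (h₂ : IsSymbol m₂) :
    IsSymbol fun x => m₁ x - m₂ x := by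
  simpa only [sub_eq_add_neg] using h₁.add h₂.neg

theorem inv_one_add : IsSymbol fun x => ((1 + x : ℝ) : ℂ)⁻¹ := by
  refine ⟨ContinuousOn.inv₀ (by fun_prop) fun x hx => ?_, 1, fun x hx => ?_⟩
  · have : (0:ℝ) < 1 + x := by linarith [mem_Ici.1 hx]
    exact_mod_cast this.ne'
  · have : (1:ℝ) ≤ 1 + x := by linarith [mem_Ici.1 hx]
    rw [norm_inv, Complex.norm_real, Real.norm_of_nonneg (by linarith)]
    exact inv_le_one_of_one_le₀ this

end IsSymbol

variable {R : H →L[ℂ] H}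

open scoped ComplexOrder in
/-- The spectrum of `R` lies in `[0, 1]`. -/
theorem IsResolvent.spectrum (hR : IsResolvent R) {z : ℂ} (hz : z ∈ spectrum ℂ R) :
    z = (z.re : ℂ) ∧ z.re ∈ Icc (0:ℝ) 1 := by
  have h0 : 0 ≤ z := spectrum_nonneg_of_nonneg hR.1 hz
  have h1 : ‖z‖ ≤ 1 := by
    rcases subsingleton_or_nontrivial H with h | h
    · have : Subsingleton (H →L[ℂ] H) := inferInstance
      simp [spectrum.of_subsingleton] at hz
    · exact (spectrum.norm_le_norm_of_mem hz).trans hR.2.1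
  rw [Complex.nonneg_iff] at h0
  exact ⟨Complex.ext rfl (by simpa using h0.2.symm), h0.1, (Complex.re_le_norm z).trans h1⟩

theorem IsResolvent.isStarNormal (hR : IsResolvent R) : IsStarNormal R :=
  (IsSelfAdjoint.of_nonneg hR.1).isStarNormal

theorem IsResolvent.mem_Ici (hR : IsResolvent R) {z : ℂ} (hz : z ∈ _root_.spectrum ℂ R)
    (h0 : 0 < z.re) : z.re⁻¹ - 1 ∈ Ici (0:ℝ) := by
  simpa using (one_le_inv₀ h0).2 (hR.spectrum hz).2.2

/-- Joint continuity on the spectrum of the functions that define `funCalc`, for a family of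
symbols with a common bound. -/
theorem IsResolvent.continuousOn_family (hR : IsResolvent R) {X : Type*} [TopologicalSpace X]
    {F : X → ℝ → ℂ} (hF : ContinuousOn (Function.uncurry F) (univ ×ˢ Ici 0)) {C : ℝ}
    (hC : ∀ s, ∀ x ∈ Ici (0:ℝ), ‖F s x‖ ≤ C) :
    ContinuousOn (Function.uncurry fun (s : X) (z : ℂ) => z * F s (z.re⁻¹ - 1))
      (univ ×ˢ _root_.spectrum ℂ R) := by
  rintro ⟨s, z⟩ ⟨-, hz⟩
  change z ∈ _root_.spectrum ℂ R at hz
  have hb : ∀ p ∈ (univ : Set X) ×ˢ _root_.spectrum ℂ R,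
      ‖(Function.uncurry fun (s : X) (z : ℂ) => z * F s (z.re⁻¹ - 1)) p‖ ≤ C * ‖p.2‖ := by
    rintro ⟨s, z⟩ ⟨-, hz⟩
    change ‖z * F s (z.re⁻¹ - 1)‖ ≤ C * ‖z‖
    change z ∈ _root_.spectrum ℂ R at hz
    obtain ⟨h1, h2, h3⟩ := hR.spectrum hz
    rcases h2.eq_or_lt with h0 | h0
    · rw [h1, ← h0]; simp
    · rw [norm_mul, mul_comm]
      gcongr
      exact hC s _ (hR.mem_Ici hz h0)
  obtain ⟨h1, h2, h3⟩ := hR.spectrum hz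
  rcases h2.eq_or_lt with h0 | h0
  · have hz0 : z = 0 := by rw [h1, ← h0]; simp
    subst hz0
    unfold ContinuousWithinAt
    have h00 : (Function.uncurry fun (s : X) (z : ℂ) => z * F s (z.re⁻¹ - 1)) (s, 0) = 0 := by
      simp [Function.uncurry]
    rw [h00]
    refine squeeze_zero_norm' (a := fun p => C * ‖p.2‖) ?_ ?_
    · filter_upwards [self_mem_nhdsWithin] with w hw using hb w hw
    · have : Continuous fun p : X × ℂ => C * ‖p.2‖ := by fun_prop
      simpa using (this.tendsto (s, 0)).mono_left nhdsWithin_le_nhds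
  · refine ContinuousWithinAt.mul continuous_snd.continuousWithinAt ?_
    have hopen : IsOpen {p : X × ℂ | 0 < p.2.re} :=
      isOpen_lt continuous_const (Complex.continuous_re.comp continuous_snd)
    refine ContinuousWithinAt.mono_of_mem_nhdsWithin
      (t := (univ ×ˢ _root_.spectrum ℂ R) ∩ {p : X × ℂ | 0 < p.2.re}) ?_
      (Filter.inter_mem self_mem_nhdsWithin (mem_nhdsWithin_of_mem_nhds (hopen.mem_nhds h0)))
    refine ContinuousWithinAt.comp (f := fun p : X × ℂ => (p.1, p.2.re⁻¹ - 1))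
      (g := Function.uncurry F) (t := univ ×ˢ Ici 0) (hF _ ⟨mem_univ _, hR.mem_Ici hz h0⟩) ?_ ?_
    · refine ContinuousAt.continuousWithinAt (ContinuousAt.prodMk continuousAt_fst ?_)
      refine ContinuousAt.sub (ContinuousAt.inv₀ ?_ h0.ne') continuousAt_const
      exact (Complex.continuous_re.comp continuous_snd).continuousAt
    · rintro p ⟨⟨-, hp⟩, hp0⟩
      exact ⟨mem_univ _, hR.mem_Ici hp hp0⟩

theorem IsResolvent.continuousOn_symbol (hR : IsResolvent R) {m : ℝ → ℂ} (hm : IsSymbol m) :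
    ContinuousOn (fun z : ℂ => z * m (z.re⁻¹ - 1)) (_root_.spectrum ℂ R) := by
  obtain ⟨hc, C, hC⟩ := hm
  have h := hR.continuousOn_family (X := Unit) (F := fun _ => m)
    (hc.comp continuousOn_snd fun p hp => hp.2) fun _ => hC
  exact h.comp (f := fun z : ℂ => ((), z)) (by fun_prop) fun z hz => ⟨mem_univ _, hz⟩

theorem IsResolvent.funCalc_apply (hR : IsResolvent R) {m : ℝ → ℂ} (hm : IsSymbol m) (f : H) :
    funCalc R m (R f) = cfc (fun z : ℂ => z * m (z.re⁻¹ - 1)) R f := by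
  obtain ⟨hc, C, hC⟩ := hm
  exact _root_.funCalc_apply hR.1 hR.2.1 hR.2.2 hc hC f

theorem IsResolvent.cfc_commute (hR : IsResolvent R) (g : ℂ → ℂ) (f : H) :
    cfc g R (R f) = R (cfc g R f) := by
  have h : Commute (cfc g R) R :=
    Commute.cfc (Commute.refl R) (by rw [IsSelfAdjoint.of_nonneg hR.1]; exact Commute.refl R) g
  exact congrArg (fun T : H →L[ℂ] H => T f) h.eq

set_option linter.unusedSectionVars false in
/-- Two bounded operators that agree on the range of `R²` are equal. -/
theorem IsResolvent.ext (hR : IsResolvent R) {S T : H →L[ℂ] H} (h : ∀ f, S (R (R f)) = T (R (R f))) :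
    S = T := by
  have h1 : DenseRange (R ∘ R) := hR.2.2.comp hR.2.2 R.continuous
  exact DFunLike.coe_injective (h1.equalizer S.continuous T.continuous (funext h))

theorem funCalc_congr (hR : IsResolvent R) {m₁ m₂ : ℝ → ℂ} (h : ∀ x ∈ Ici (0:ℝ), m₁ x = m₂ x) :
    funCalc R m₁ = funCalc R m₂ := by
  unfold funCalc
  congr 2
  refine cfc_congr fun z hz => ?_
  obtain ⟨h1, h2, h3⟩ := hR.spectrum hz
  rcases h2.eq_or_lt with h0 | h0
  · have hz0 : z = 0 := by rw [h1, ← h0]; simp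
    simp [hz0]
  · simp only [h _ (hR.mem_Ici hz h0)]

theorem funCalc_mul (hR : IsResolvent R) {m₁ m₂ : ℝ → ℂ} (h₁ : IsSymbol m₁) (h₂ : IsSymbol m₂) :
    funCalc R m₁ ∘L funCalc R m₂ = funCalc R fun x => m₁ x * m₂ x := by
  refine hR.ext fun f => ?_
  have hn := hR.isStarNormal
  change funCalc R m₁ (funCalc R m₂ (R (R f))) = _
  rw [hR.funCalc_apply h₂, hR.cfc_commute, hR.funCalc_apply h₁, hR.funCalc_apply (h₁.mul h₂),
    ← ContinuousLinearMap.comp_apply, ← ContinuousLinearMap.comp_apply]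
  have e : R = cfc (fun z : ℂ => z) R := (cfc_id' ℂ R).symm
  conv_rhs => rw [show (cfc (fun z : ℂ => z * (m₁ (z.re⁻¹ - 1) * m₂ (z.re⁻¹ - 1))) R ∘SL R) =
    cfc (fun z : ℂ => z * (m₁ (z.re⁻¹ - 1) * m₂ (z.re⁻¹ - 1))) R * cfc (fun z : ℂ => z) R by
      rw [← e]; rfl]
  change (cfc _ R * cfc _ R) f = _
  rw [← cfc_mul _ _ R (hR.continuousOn_symbol h₁) (hR.continuousOn_symbol h₂),
    ← cfc_mul _ (fun z : ℂ => z) R (hR.continuousOn_symbol (h₁.mul h₂)) continuousOn_id]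
  congr 2
  funext z
  ring

theorem funCalc_mul_apply (hR : IsResolvent R) {m₁ m₂ : ℝ → ℂ} (h₁ : IsSymbol m₁)
    (h₂ : IsSymbol m₂) (f : H) :
    funCalc R m₁ (funCalc R m₂ f) = funCalc R (fun x => m₁ x * m₂ x) f := by
  rw [← funCalc_mul hR h₁ h₂]; rfl

theorem funCalc_add (hR : IsResolvent R) {m₁ m₂ : ℝ → ℂ} (h₁ : IsSymbol m₁) (h₂ : IsSymbol m₂) :
    (funCalc R fun x => m₁ x + m₂ x) = funCalc R m₁ + funCalc R m₂ := by
  refine hR.ext fun f => ?_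
  rw [_root_.add_apply, hR.funCalc_apply h₁, hR.funCalc_apply h₂,
    hR.funCalc_apply (h₁.add h₂), ← _root_.add_apply,
    ← cfc_add R _ _ (hR.continuousOn_symbol h₁) (hR.continuousOn_symbol h₂)]
  congr 2
  funext z
  ring

theorem funCalc_one (hR : IsResolvent R) : funCalc R (fun _ => 1) = ContinuousLinearMap.id ℂ H := by
  refine hR.ext fun f => ?_
  have hn := hR.isStarNormal
  rw [hR.funCalc_apply (IsSymbol.const 1)]
  simp only [mul_one]
  rw [cfc_id' ℂ R]
  rfl

theorem funCalc_const (hR : IsResolvent R) (c : ℂ) :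
    funCalc R (fun _ => c) = c • ContinuousLinearMap.id ℂ H := by
  refine hR.ext fun f => ?_
  have hn := hR.isStarNormal
  rw [hR.funCalc_apply (IsSymbol.const c)]
  have e : (fun z : ℂ => z * c) = fun z => c • z := funext fun z => mul_comm _ _
  rw [e, cfc_smul c (fun z : ℂ => z) R, cfc_id' ℂ R]
  simp

theorem funCalc_smul (hR : IsResolvent R) {m : ℝ → ℂ} (hm : IsSymbol m) (c : ℂ) :
    (funCalc R fun x => c * m x) = c • funCalc R m := by
  rw [← funCalc_mul hR (IsSymbol.const c) hm, funCalc_const hR]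
  rfl

theorem funCalc_sub (hR : IsResolvent R) {m₁ m₂ : ℝ → ℂ} (h₁ : IsSymbol m₁) (h₂ : IsSymbol m₂) :
    (funCalc R fun x => m₁ x - m₂ x) = funCalc R m₁ - funCalc R m₂ := by
  have : (funCalc R fun x => m₁ x - m₂ x) = funCalc R fun x => m₁ x + (-1) * m₂ x :=
    funCalc_congr hR fun x _ => by ring
  rw [this, funCalc_add hR h₁ ((IsSymbol.const (-1)).mul h₂), funCalc_smul hR h₂]
  simp [sub_eq_add_neg]

/-- `R` itself is the function `(1 + x)⁻¹` of the operator. -/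
theorem funCalc_inv_one_add (hR : IsResolvent R) :
    (funCalc R fun x => ((1 + x : ℝ) : ℂ)⁻¹) = R := by
  refine hR.ext fun f => ?_
  have hn := hR.isStarNormal
  rw [hR.funCalc_apply IsSymbol.inv_one_add]
  have e : cfc (fun z : ℂ => z * (((1 + (z.re⁻¹ - 1) : ℝ) : ℂ))⁻¹) R = R * R := by
    rw [show R * R = cfc (fun z : ℂ => z) R * cfc (fun z : ℂ => z) R by rw [cfc_id' ℂ R],
      ← cfc_mul _ _ R]
    refine cfc_congr fun z hz => ?_
    obtain ⟨h1, -⟩ := hR.spectrum hz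
    simp only [add_sub_cancel, Complex.ofReal_inv, inv_inv, ← h1]
  rw [e]
  rfl

theorem inner_funCalc (hR : IsResolvent R) {m : ℝ → ℂ} (hm : IsSymbol m) (f g : H) :
    ⟪funCalc R m f, g⟫_ℂ = ⟪f, funCalc R (fun x => (starRingEnd ℂ) (m x)) g⟫_ℂ := by
  have hsa : ContinuousLinearMap.adjoint R = R := IsSelfAdjoint.of_nonneg hR.1
  have h : ContinuousLinearMap.adjoint (funCalc R m) =
      funCalc R (fun x => (starRingEnd ℂ) (m x)) := by
    refine DFunLike.coe_injective (hR.2.2.equalizer (ContinuousLinearMap.continuous _)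
      (ContinuousLinearMap.continuous _) (funext fun g => ?_))
    refine ext_inner_left ℂ fun f => ?_
    have h2 : (fun f : H => ⟪f, ContinuousLinearMap.adjoint (funCalc R m) (R g)⟫_ℂ) =
        fun f => ⟪f, funCalc R (fun x => (starRingEnd ℂ) (m x)) (R g)⟫_ℂ := by
      refine hR.2.2.equalizer (by fun_prop) (by fun_prop) (funext fun f => ?_)
      simp only [Function.comp_apply]
      rw [ContinuousLinearMap.adjoint_inner_right, hR.funCalc_apply hm, hR.funCalc_apply hm.conj]
      have h3 : cfc (fun z : ℂ => z * (starRingEnd ℂ) (m (z.re⁻¹ - 1))) R =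
          ContinuousLinearMap.adjoint (cfc (fun z : ℂ => z * m (z.re⁻¹ - 1)) R) := by
        rw [← ContinuousLinearMap.star_eq_adjoint, ← cfc_star]
        refine cfc_congr fun z hz => ?_
        obtain ⟨h1, -⟩ := hR.spectrum hz
        have h4 : (starRingEnd ℂ) z = z := by rw [h1, Complex.conj_ofReal]
        simp [h4]
      rw [h3, ContinuousLinearMap.adjoint_inner_right, hR.cfc_commute]
      conv_rhs => rw [← ContinuousLinearMap.adjoint_inner_right, hsa]
    exact congrFun h2 f
  rw [← h, ContinuousLinearMap.adjoint_inner_right]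

/-- The functional calculus does not increase norms beyond the supremum of the symbol. With `q =
√(C² - |m|²)` one has `‖m(A) f‖² + ‖q(A) f‖² = C² ‖f‖²`. -/
theorem norm_funCalc_apply_le (hR : IsResolvent R) {m : ℝ → ℂ} (hm : ContinuousOn m (Ici 0)) {C : ℝ}
    (hC : ∀ x ∈ Ici (0:ℝ), ‖m x‖ ≤ C) (f : H) : ‖funCalc R m f‖ ≤ C * ‖f‖ := by
  have hC0 : 0 ≤ C := (norm_nonneg _).trans (hC 0 (by simp))
  have hms : IsSymbol m := ⟨hm, C, hC⟩
  set q : ℝ → ℂ := fun x => ((√(C ^ 2 - ‖m x‖ ^ 2) : ℝ) : ℂ) with hq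
  have hqs : IsSymbol q := by
    refine ⟨by fun_prop, C, fun x hx => ?_⟩
    rw [hq, Complex.norm_real, Real.norm_of_nonneg (Real.sqrt_nonneg _)]
    exact Real.sqrt_le_iff.2 ⟨hC0, by nlinarith [sq_nonneg ‖m x‖]⟩
  have e : ∀ m' : ℝ → ℂ, IsSymbol m' →
      ((‖funCalc R m' f‖ ^ 2 : ℝ) : ℂ) =
        ⟪f, funCalc R (fun x => ((‖m' x‖ ^ 2 : ℝ) : ℂ)) f⟫_ℂ := by
    intro m' hm'
    have h1 : ((‖funCalc R m' f‖ ^ 2 : ℝ) : ℂ) = ⟪funCalc R m' f, funCalc R m' f⟫_ℂ := by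
      rw [inner_self_eq_norm_sq_to_K]; push_cast; rfl
    rw [h1, inner_funCalc hR hm', funCalc_mul_apply hR hm'.conj hm']
    congr 2
    refine funCalc_congr hR fun x _ => ?_
    simpa using Complex.conj_mul' (m' x)
  have h2 : (C ^ 2 * ‖f‖ ^ 2 : ℝ) = ‖funCalc R m f‖ ^ 2 + ‖funCalc R q f‖ ^ 2 := by
    have hs : ∀ m' : ℝ → ℂ, IsSymbol m' → IsSymbol fun x => ((‖m' x‖ ^ 2 : ℝ) : ℂ) := by
      intro m' hm'
      have := hm'.conj.mul hm'
      have e2 : (fun x => (starRingEnd ℂ) (m' x) * m' x) = fun x => ((‖m' x‖ ^ 2 : ℝ) : ℂ) := by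
        funext x
        simpa using Complex.conj_mul' (m' x)
      rwa [e2] at this
    have h3 : ((C ^ 2 * ‖f‖ ^ 2 : ℝ) : ℂ) =
        ((‖funCalc R m f‖ ^ 2 + ‖funCalc R q f‖ ^ 2 : ℝ) : ℂ) := by
      rw [Complex.ofReal_add, e m hms, e q hqs, ← inner_add_right, ← _root_.add_apply,
        ← funCalc_add hR (hs m hms) (hs q hqs)]
      have h4 : funCalc R (fun x => ((‖m x‖ ^ 2 : ℝ) : ℂ) + ((‖q x‖ ^ 2 : ℝ) : ℂ)) =
          funCalc R (fun _ => ((C ^ 2 : ℝ) : ℂ)) := by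
        refine funCalc_congr hR fun x hx => ?_
        rw [← Complex.ofReal_add]
        congr 1
        rw [hq, Complex.norm_real, Real.norm_of_nonneg (Real.sqrt_nonneg _), Real.sq_sqrt]
        · ring
        · have := hC x hx
          nlinarith [norm_nonneg (m x)]
      rw [h4, funCalc_const hR]
      simp only [_root_.smul_apply, ContinuousLinearMap.id_apply, inner_smul_right,
        inner_self_eq_norm_sq_to_K]
      push_cast
      rfl
    exact_mod_cast h3
  refine (sq_le_sq₀ (norm_nonneg _) (by positivity)).1 ?_
  nlinarith [sq_nonneg ‖funCalc R q f‖]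

theorem norm_funCalc_le (hR : IsResolvent R) {m : ℝ → ℂ} (hm : ContinuousOn m (Ici 0)) {C : ℝ}
    (hC : ∀ x ∈ Ici (0:ℝ), ‖m x‖ ≤ C) : ‖funCalc R m‖ ≤ C :=
  ContinuousLinearMap.opNorm_le_bound _ ((norm_nonneg _).trans (hC 0 (by simp)))
    (norm_funCalc_apply_le hR hm hC)

/-- A bounded operator that commutes with the resolvent commutes with the functional calculus. -/
theorem funCalc_commute (hR : IsResolvent R) {S : H →L[ℂ] H} (hS : ∀ f, S (R f) = R (S f))
    {m : ℝ → ℂ} (hm : IsSymbol m) (f : H) : S (funCalc R m f) = funCalc R m (S f) := by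
  have hc : Commute R S := ContinuousLinearMap.ext fun f => (hS f).symm
  have h : S ∘L funCalc R m = funCalc R m ∘L S := by
    refine hR.ext fun f => ?_
    change S (funCalc R m (R (R f))) = funCalc R m (S (R (R f)))
    rw [hS, hR.funCalc_apply hm, hR.funCalc_apply hm]
    have := (Commute.cfc hc (by rw [IsSelfAdjoint.of_nonneg hR.1]; exact hc)
      (fun z : ℂ => z * m (z.re⁻¹ - 1))).eq
    exact (congrArg (fun T : H →L[ℂ] H => T (R f)) this).symm
  exact congrArg (fun T : H →L[ℂ] H => T f) h

/-- Strong continuity in a parameter. On the range of `R` the symbols converge uniformly on the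
spectrum of `R`, and the range of `R` is dense. -/
theorem continuous_funCalc_apply (hR : IsResolvent R) {X : Type*} [TopologicalSpace X]
    {F : X → ℝ → ℂ} (hF : ContinuousOn (Function.uncurry F) (univ ×ˢ Ici 0)) {C : ℝ}
    (hC : ∀ s, ∀ x ∈ Ici (0:ℝ), ‖F s x‖ ≤ C) (f : H) :
    Continuous fun s => funCalc R (F s) f := by
  have hFs : ∀ s, ContinuousOn (F s) (Ici 0) := fun s =>
    hF.comp (Continuous.prodMk_right s).continuousOn fun _ hz => ⟨mem_univ _, hz⟩
  have hj := hR.continuousOn_family hF hC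
  have h1 : ∀ f : H, Continuous fun s => funCalc R (F s) (R f) := by
    intro f
    have e : (fun s => funCalc R (F s) (R f)) =
        fun s => cfc (fun z : ℂ => z * F s (z.re⁻¹ - 1)) R f :=
      funext fun s => hR.funCalc_apply ⟨hFs s, C, hC s⟩ f
    rw [e]
    have h2 : Continuous fun s => cfc (fun z : ℂ => z * F s (z.re⁻¹ - 1)) R := by
      refine continuous_iff_continuousAt.2 fun s₀ => continuousAt_cfc_fun ?_
        (.of_forall fun s => hR.continuousOn_symbol ⟨hFs s, C, hC s⟩)
      intro u hu
      have h4 := (spectrum.isCompact (𝕜 := ℂ) R).mem_uniformity_of_prod (s := univ)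
        (f := fun (s : X) (z : ℂ) => z * F s (z.re⁻¹ - 1)) hj (mem_univ s₀) (symm_le_uniformity hu)
      obtain ⟨v, hv, hvu⟩ := h4
      rw [nhdsWithin_univ] at hv
      filter_upwards [hv] with s hs z hz using hvu s hs z hz
    exact h2.clm_apply continuous_const
  rw [Metric.continuous_iff']
  intro s₀ ε hε
  have hC0 : 0 ≤ C := (norm_nonneg _).trans (hC s₀ 0 (by simp))
  -- Approximate `f` by an element of the range of `R`, uniformly in the parameter.
  obtain ⟨g, hg⟩ := hR.2.2.exists_dist_lt f (ε := ε / (3 * (C + 1))) (by positivity)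
  have h3 := Metric.continuous_iff'.1 (h1 g) s₀ (ε / 3) (by positivity)
  filter_upwards [h3] with s hs
  have hb : ∀ s, dist (funCalc R (F s) f) (funCalc R (F s) (R g)) ≤ ε / 3 := by
    intro s
    rw [dist_eq_norm, ← map_sub]
    refine (norm_funCalc_apply_le hR (hFs s) (hC s) _).trans ?_
    rw [dist_eq_norm] at hg
    calc C * ‖f - R g‖ ≤ (C + 1) * (ε / (3 * (C + 1))) :=
          mul_le_mul (by linarith) hg.le (norm_nonneg _) (by linarith)
      _ = ε / 3 := by field_simp
  calc dist (funCalc R (F s) f) (funCalc R (F s₀) f)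
      ≤ dist (funCalc R (F s) f) (funCalc R (F s) (R g)) +
        dist (funCalc R (F s) (R g)) (funCalc R (F s₀) (R g)) +
        dist (funCalc R (F s₀) (R g)) (funCalc R (F s₀) f) := dist_triangle4 _ _ _ _
    _ < ε / 3 + ε / 3 + ε / 3 := by
        have := hb s₀
        rw [dist_comm] at this
        linarith [hb s]
    _ = ε := by ring

/-- An integrable superposition of symbols is a symbol. -/
theorem IsSymbol.integral {F : ℝ → ℝ → ℂ}
    (hF : ContinuousOn (Function.uncurry F) (univ ×ˢ Ici 0)) {b : ℝ → ℝ}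
    (hb : Integrable b) (hC : ∀ s, ∀ x ∈ Ici (0:ℝ), ‖F s x‖ ≤ b s) :
    IsSymbol fun x => ∫ s, F s x := by
  refine ⟨?_, ∫ s, b s, fun x hx => norm_integral_le_of_norm_le hb (.of_forall fun s => hC s x hx)⟩
  intro x hx
  refine continuousWithinAt_of_dominated (bound := b) ?_ ?_ hb ?_
  · filter_upwards [self_mem_nhdsWithin] with y hy
    have : Continuous fun s => F s y := by
      rw [← continuousOn_univ]
      exact hF.comp (f := fun s => (s, y)) (by fun_prop) fun s _ => ⟨mem_univ _, hy⟩
    exact this.aestronglyMeasurable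
  · filter_upwards [self_mem_nhdsWithin] with y hy using .of_forall fun s => hC s y hy
  · exact .of_forall fun s => (hF.comp (Continuous.prodMk_right s).continuousOn fun _ hz => ⟨mem_univ _, hz⟩) x hx

/-- The functional calculus commutes with integration in a parameter. -/
theorem funCalc_integral (hR : IsResolvent R) {F : ℝ → ℝ → ℂ}
    (hF : ContinuousOn (Function.uncurry F) (univ ×ˢ Ici 0)) {C : ℝ} {b : ℝ → ℝ}
    (hb : Integrable b) (hbC : ∀ s, b s ≤ C) (hC : ∀ s, ∀ x ∈ Ici (0:ℝ), ‖F s x‖ ≤ b s) (f : H) :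
    Integrable (fun s => funCalc R (F s) f) ∧
      funCalc R (fun x => ∫ s, F s x) f = ∫ s, funCalc R (F s) f := by
  have hn := hR.isStarNormal
  have hC' : ∀ s, ∀ x ∈ Ici (0:ℝ), ‖F s x‖ ≤ C := fun s x hx => (hC s x hx).trans (hbC s)
  have hFs : ∀ s, ContinuousOn (F s) (Ici 0) := fun s =>
    hF.comp (Continuous.prodMk_right s).continuousOn fun _ hz => ⟨mem_univ _, hz⟩
  have hint : ∀ f : H, Integrable (fun s => funCalc R (F s) f) := fun f =>
    (hb.mul_const ‖f‖).mono' (continuous_funCalc_apply hR hF hC' f).aestronglyMeasurable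
      (.of_forall fun s => norm_funCalc_apply_le hR (hFs s) (hC s) f)
  refine ⟨hint f, ?_⟩
  have hj := hR.continuousOn_family hF hC'
  have hI := IsSymbol.integral hF hb hC
  set T : H →L[ℂ] H := LinearMap.mkContinuous
    { toFun := fun f => ∫ s, funCalc R (F s) f
      map_add' := fun f g => by simp only [map_add]; exact integral_add (hint f) (hint g)
      map_smul' := fun c f => by simp only [map_smul]; exact integral_smul _ _ } (∫ s, b s)
    (fun f => by
      refine (norm_integral_le_of_norm_le (hb.mul_const ‖f‖) (.of_forall fun s =>
        norm_funCalc_apply_le hR (hFs s) (hC s) f)).trans_eq ?_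
      rw [integral_mul_const]) with hT
  have hTe : ∀ f, T f = ∫ s, funCalc R (F s) f := fun f => rfl
  rw [← hTe]
  have hz1 : ∀ z ∈ spectrum ℂ R, ‖z‖ ≤ 1 := fun z hz => by
    obtain ⟨h1, h2, h3⟩ := hR.spectrum hz
    rw [h1, Complex.norm_real, Real.norm_of_nonneg h2]; exact h3
  have hzb : ∀ s, ∀ z ∈ spectrum ℂ R, ‖z * F s (z.re⁻¹ - 1)‖ ≤ b s := by
    intro s z hz
    have hb0 : 0 ≤ b s := (norm_nonneg _).trans (hC s 0 (by simp))
    obtain ⟨h1, h2, h3⟩ := hR.spectrum hz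
    rcases h2.eq_or_lt with h0 | h0
    · rw [h1, ← h0]; simpa using hb0
    · rw [norm_mul]
      calc ‖z‖ * ‖F s (z.re⁻¹ - 1)‖ ≤ 1 * b s :=
            mul_le_mul (hz1 z hz) (hC s _ (hR.mem_Ici hz h0)) (norm_nonneg _) zero_le_one
        _ = b s := one_mul _
  -- The two operators agree on the range of `R`, where the functional calculus is `cfc` of a continuous
  -- function, and `cfc` commutes with integrals.
  have key : funCalc R (fun x => ∫ s, F s x) = T := by
    refine hR.ext fun f => ?_
    rw [hTe, hR.funCalc_apply hI]
    have e1 : (fun z : ℂ => z * ∫ s, F s (z.re⁻¹ - 1)) =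
        fun z : ℂ => ∫ s, z * F s (z.re⁻¹ - 1) := funext fun z => (integral_const_mul _ _).symm
    have e2 := cfc_integral (μ := volume) (fun (s : ℝ) (z : ℂ) => z * F s (z.re⁻¹ - 1)) b R hj
      (.of_forall hzb) hb.2
    have e3 := integrable_cfc (μ := volume) (fun (s : ℝ) (z : ℂ) => z * F s (z.re⁻¹ - 1)) b R hj
      (.of_forall hzb) hb.2
    rw [e1, e2, ContinuousLinearMap.integral_apply e3]
    exact integral_congr_ae (.of_forall fun s => (hR.funCalc_apply ⟨hFs s, C, hC' s⟩ _).symm)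
  rw [key]

/-- Differentiability in a parameter, from a second order Taylor bound that is uniform on
`[0, ∞)`. -/
theorem hasDerivAt_funCalc (hR : IsResolvent R) {F : ℝ → ℝ → ℂ} {F' : ℝ → ℂ} {s₀ K : ℝ} {U : Set ℝ}
    (hU : U ∈ nhds s₀) (hs₀ : s₀ ∈ U) (hF : ∀ s ∈ U, IsSymbol (F s)) (hF' : IsSymbol F')
    (hK : ∀ s ∈ U, ∀ x ∈ Ici (0:ℝ), ‖F s x - F s₀ x - (s - s₀) * F' x‖ ≤ K * (s - s₀) ^ 2) :
    HasDerivAt (fun s => funCalc R (F s)) (funCalc R F') s₀ := by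
  rw [hasDerivAt_iff_isLittleO]
  have hO : (fun s => funCalc R (F s) - funCalc R (F s₀) - (s - s₀) • funCalc R F') =O[nhds s₀]
      fun s => (s - s₀) ^ 2 := by
    refine Asymptotics.IsBigO.of_bound K ?_
    filter_upwards [hU] with s hs
    have e : funCalc R (F s) - funCalc R (F s₀) - (s - s₀) • funCalc R F' =
        funCalc R fun x => F s x - F s₀ x - ((s - s₀ : ℝ) : ℂ) * F' x := by
      rw [funCalc_sub hR ((hF s hs).sub (hF s₀ hs₀)) ((IsSymbol.const _).mul hF'),
        funCalc_sub hR (hF s hs) (hF s₀ hs₀), funCalc_smul hR hF']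
      ext v
      simp only [_root_.sub_apply, _root_.smul_apply, Complex.coe_smul]
    rw [e, Real.norm_of_nonneg (sq_nonneg _)]
    refine norm_funCalc_le hR (((hF s hs).sub (hF s₀ hs₀)).sub ((IsSymbol.const _).mul hF')).1
      fun x hx => ?_
    simpa using hK s hs x hx
  refine hO.trans_isLittleO ?_
  have h1 : (fun s : ℝ => (s - s₀) ^ 2) =o[nhds s₀] fun s => (s - s₀) ^ 1 := by
    have := (Asymptotics.isLittleO_pow_pow (𝕜 := ℝ) one_lt_two).comp_tendsto
      (show Filter.Tendsto (fun s : ℝ => s - s₀) (nhds s₀) (nhds 0) by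
        have : Continuous fun s : ℝ => s - s₀ := by fun_prop
        simpa using this.tendsto s₀)
    exact this
  simpa using h1

end FunCalc
end

noncomputable section

/-! ### Families of functions of `(l, s)` that are closed under both partial derivatives -/

section Family

variable {ι : Type*}

/-- The partial derivatives of each member `f i` on `l > 0` are the linear combinations of members
with the coefficient vectors `Dl i` and `Ds i`. -/
structure DerivClosed (f : ι → ℝ → ℝ → ℂ) (Dl Ds : ι → ι →₀ ℂ) : Prop where
  deriv_left : ∀ i (l s : ℝ), 0 < l →
    HasDerivAt (fun l => f i l s) (Finsupp.linearCombination ℂ f (Dl i) l s) l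
  deriv_right : ∀ i (l s : ℝ), 0 < l →
    HasDerivAt (fun s => f i l s) (Finsupp.linearCombination ℂ f (Ds i) l s) s
  continuousOn : ∀ i, ContinuousOn (Function.uncurry (f i)) (Ioi 0 ×ˢ univ)

namespace DerivClosed

variable {f : ι → ℝ → ℝ → ℂ} {Dl Ds : ι → ι →₀ ℂ}

theorem hasDerivAt_left (h : DerivClosed f Dl Ds) (x : ι →₀ ℂ) {l : ℝ} (hl : 0 < l) (s : ℝ) :
    HasDerivAt (fun l => Finsupp.linearCombination ℂ f x l s)
      (Finsupp.linearCombination ℂ f (Finsupp.linearCombination ℂ Dl x) l s) l := by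
  induction x using Finsupp.induction_linear with
  | zero => simpa using hasDerivAt_const l (0:ℂ)
  | add x y hx hy => simpa using! hx.add hy
  | single i c => simpa using! (h.deriv_left i l s hl).const_mul c

theorem hasDerivAt_right (h : DerivClosed f Dl Ds) (x : ι →₀ ℂ) {l : ℝ} (hl : 0 < l) (s : ℝ) :
    HasDerivAt (fun s => Finsupp.linearCombination ℂ f x l s)
      (Finsupp.linearCombination ℂ f (Finsupp.linearCombination ℂ Ds x) l s) s := by
  induction x using Finsupp.induction_linear with
  | zero => simpa using hasDerivAt_const s (0:ℂ)
  | add x y hx hy => simpa using! hx.add hy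
  | single i c => simpa using! (h.deriv_right i l s hl).const_mul c

theorem continuousOn_eval (h : DerivClosed f Dl Ds) (x : ι →₀ ℂ) :
    ContinuousOn (Function.uncurry (Finsupp.linearCombination ℂ f x)) (Ioi 0 ×ˢ univ) := by
  induction x using Finsupp.induction_linear with
  | zero => simpa using! continuousOn_const
  | add x y hx hy => simpa using! hx.add hy
  | single i c => simpa using! (h.continuousOn i).const_smul c

theorem hasFDerivAt (h : DerivClosed f Dl Ds) (x : ι →₀ ℂ) {p : ℝ × ℝ} (hp : 0 < p.1) :
    HasFDerivAt (Function.uncurry (Finsupp.linearCombination ℂ f x))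
      ((ContinuousLinearMap.toSpanSingleton ℝ
        (Finsupp.linearCombination ℂ f (Finsupp.linearCombination ℂ Dl x) p.1 p.2)).coprod
      (ContinuousLinearMap.toSpanSingleton ℝ
        (Finsupp.linearCombination ℂ f (Finsupp.linearCombination ℂ Ds x) p.1 p.2))) p := by
  have hopen : IsOpen (Ioi (0:ℝ) ×ˢ (univ : Set ℝ)) := isOpen_Ioi.prod isOpen_univ
  have hev : ∀ᶠ v : ℝ × ℝ in nhds p, 0 < v.1 :=
    (isOpen_lt continuous_const continuous_fst).mem_nhds hp
  have hc : ∀ y : ι →₀ ℂ, ContinuousAt (Function.uncurry fun l s =>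
      ContinuousLinearMap.toSpanSingleton ℝ (Finsupp.linearCombination ℂ f y l s)) p := by
    intro y
    have h1 := (h.continuousOn_eval y).continuousAt (hopen.mem_nhds (x := p) ⟨hp, mem_univ _⟩)
    exact (ContinuousLinearMap.toSpanSingletonCLE (𝕜 := ℝ) (E := ℂ)).continuous.continuousAt.comp h1
  exact (hasStrictFDerivAt_uncurry_coprod (𝕜 := ℝ) (f := Finsupp.linearCombination ℂ f x)
    (f₁ := fun l s => ContinuousLinearMap.toSpanSingleton ℝ
        (Finsupp.linearCombination ℂ f (Finsupp.linearCombination ℂ Dl x) l s))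
    (f₂ := fun l s => ContinuousLinearMap.toSpanSingleton ℝ
        (Finsupp.linearCombination ℂ f (Finsupp.linearCombination ℂ Ds x) l s))
    (hev.mono fun v hv => (h.hasDerivAt_left x hv v.2).hasFDerivAt)
    (hev.mono fun v hv => (h.hasDerivAt_right x hv v.2).hasFDerivAt) (hc _) (hc _)).hasFDerivAt

/-- The members of a family that is closed under differentiation are smooth, since each derivative
is again a linear combination of members. -/
theorem contDiffOn (h : DerivClosed f Dl Ds) (x : ι →₀ ℂ) :
    ContDiffOn ℝ ∞ (Function.uncurry (Finsupp.linearCombination ℂ f x)) (Ioi 0 ×ˢ univ) := by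
  have hopen : IsOpen (Ioi (0:ℝ) ×ˢ (univ : Set ℝ)) := isOpen_Ioi.prod isOpen_univ
  refine contDiffOn_infty.2 fun n => ?_
  induction n generalizing x with
  | zero => exact contDiffOn_zero.2 (h.continuousOn_eval x)
  | succ n ih =>
    push_cast
    rw [contDiffOn_succ_iff_fderiv_of_isOpen hopen]
    refine ⟨fun p hp => (h.hasFDerivAt x hp.1).differentiableAt.differentiableWithinAt, by simp, ?_⟩
    have hts : ∀ y : ι →₀ ℂ, ContDiffOn ℝ n (fun p : ℝ × ℝ => ContinuousLinearMap.toSpanSingleton ℝ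
        (Finsupp.linearCombination ℂ f y p.1 p.2)) (Ioi 0 ×ˢ univ) := fun y =>
      (ContinuousLinearMap.toSpanSingletonCLE (𝕜 := ℝ) (E := ℂ)).contDiff.comp_contDiffOn (ih y)
    have h1 : ContDiffOn ℝ n (fun p : ℝ × ℝ =>
      (ContinuousLinearMap.toSpanSingleton ℝ (Finsupp.linearCombination ℂ f
        (Finsupp.linearCombination ℂ Dl x) p.1 p.2)).comp (ContinuousLinearMap.fst ℝ ℝ ℝ) +
      (ContinuousLinearMap.toSpanSingleton ℝ (Finsupp.linearCombination ℂ f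
        (Finsupp.linearCombination ℂ Ds x) p.1 p.2)).comp (ContinuousLinearMap.snd ℝ ℝ ℝ))
      (Ioi 0 ×ˢ univ) :=
      ((hts _).clm_comp contDiffOn_const).add ((hts _).clm_comp contDiffOn_const)
    refine h1.congr fun p hp => ?_
    rw [(h.hasFDerivAt x hp.1).fderiv]
    ext <;> simp

theorem iteratedDeriv_left (h : DerivClosed f Dl Ds) (n : ℕ) (x : ι →₀ ℂ) {l : ℝ} (hl : 0 < l)
    (s : ℝ) : iteratedDeriv n (fun l => Finsupp.linearCombination ℂ f x l s) l =
      Finsupp.linearCombination ℂ f ((Finsupp.linearCombination ℂ Dl)^[n] x) l s := by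
  induction n generalizing x with
  | zero => simp
  | succ n ih =>
    rw [iteratedDeriv_succ', Function.iterate_succ_apply, ← ih]
    refine Filter.EventuallyEq.iteratedDeriv_eq n ?_
    filter_upwards [lt_mem_nhds hl] with l' hl' using (h.hasDerivAt_left x hl' s).deriv

theorem iteratedDeriv_right (h : DerivClosed f Dl Ds) (n : ℕ) (x : ι →₀ ℂ) {l : ℝ} (hl : 0 < l)
    (s : ℝ) : iteratedDeriv n (fun s => Finsupp.linearCombination ℂ f x l s) s =
      Finsupp.linearCombination ℂ f ((Finsupp.linearCombination ℂ Ds)^[n] x) l s := by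
  induction n generalizing x with
  | zero => simp
  | succ n ih =>
    rw [iteratedDeriv_succ', Function.iterate_succ_apply, ← ih]
    congr 1
    exact funext fun s => (h.hasDerivAt_right x hl s).deriv

/-- Mixed derivatives are computed by iterating the two coefficient maps. -/
theorem mixedDeriv_eq (h : DerivClosed f Dl Ds) (N₁ N₂ : ℕ) (x : ι →₀ ℂ) {l : ℝ} (hl : 0 < l)
    (s : ℝ) : mixedDeriv N₁ N₂ (Finsupp.linearCombination ℂ f x) l s =
      Finsupp.linearCombination ℂ f ((Finsupp.linearCombination ℂ Ds)^[N₁]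
        ((Finsupp.linearCombination ℂ Dl)^[N₂] x)) l s := by
  unfold mixedDeriv
  simp only [h.iteratedDeriv_left N₂ x hl]
  exact h.iteratedDeriv_right N₁ _ hl s

end DerivClosed

/-- A coefficient map that sends indices of `A` to vectors supported in `B` sends vectors supported
in `A` to vectors supported in `B`. -/
theorem linearCombination_mem_supported {D : ι → ι →₀ ℂ} {A B : Set ι}
    (h : ∀ i ∈ A, D i ∈ Finsupp.supported ℂ ℂ B) {x : ι →₀ ℂ} (hx : x ∈ Finsupp.supported ℂ ℂ A) :
    Finsupp.linearCombination ℂ D x ∈ Finsupp.supported ℂ ℂ B := by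
  rw [Finsupp.linearCombination_apply]
  exact Submodule.sum_mem _ fun i hi => Submodule.smul_mem _ _ (h i (hx hi))

theorem iterate_mem_supported {D : ι → ι →₀ ℂ} {A : ℕ → Set ι}
    (h : ∀ n, ∀ i ∈ A n, D i ∈ Finsupp.supported ℂ ℂ (A (n + 1))) {x : ι →₀ ℂ} {k : ℕ}
    (hx : x ∈ Finsupp.supported ℂ ℂ (A k)) (n : ℕ) :
    (Finsupp.linearCombination ℂ D)^[n] x ∈ Finsupp.supported ℂ ℂ (A (k + n)) := by
  induction n with
  | zero => simpa using hx
  | succ n ih =>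
    rw [Function.iterate_succ_apply']
    exact linearCombination_mem_supported (h _) ih

/-- A bound for the members with indices in `A` passes to linear combinations, with a constant that
depends only on the coefficients. -/
theorem norm_linearCombination_le {f : ι → ℝ → ℝ → ℂ} {A : Set ι} {C : ι → ℝ} {B l s : ℝ}
    (h : ∀ i ∈ A, ‖f i l s‖ ≤ C i * B) {x : ι →₀ ℂ} (hx : x ∈ Finsupp.supported ℂ ℂ A) :
    ‖Finsupp.linearCombination ℂ f x l s‖ ≤ (∑ i ∈ x.support, ‖x i‖ * C i) * B := by
  rw [Finsupp.linearCombination_apply, Finsupp.sum, Finset.sum_apply, Finset.sum_apply,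
    Finset.sum_mul]
  refine (norm_sum_le _ _).trans (Finset.sum_le_sum fun i hi => ?_)
  simp only [Pi.smul_apply, smul_eq_mul, norm_mul, mul_assoc]
  exact mul_le_mul_of_nonneg_left (h i (hx hi)) (norm_nonneg _)

end Family

/-! ### Smooth functions on `(1/2, 2)` -/

section Dyadic

theorem smoothDyadic_eq_zero (h : smoothDyadic) {t : ℝ} (ht : t ∉ Ioo (1/2 : ℝ) 2) : h.1 t = 0 := by
  by_contra h0
  exact ht (h.2.2 h0)

theorem smoothDyadic_hasCompactSupport (h : smoothDyadic) : HasCompactSupport h.1 :=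
  HasCompactSupport.of_support_subset_isCompact isCompact_Icc (h.2.2.trans Ioo_subset_Icc_self)

/-- Multiplication by the variable. -/
def mulVar : smoothDyadic →ₗ[ℂ] smoothDyadic where
  toFun h := ⟨fun t => t * h.1 t, (Complex.ofRealCLM.contDiff.of_le le_top).mul h.2.1, fun t ht => by
    refine h.2.2 fun h0 => ht ?_
    simp [h0]⟩
  map_add' g h := by
    ext t
    change (t : ℂ) * (g.1 t + h.1 t) = t * g.1 t + t * h.1 t
    ring
  map_smul' c h := by
    ext t
    change (t : ℂ) * (c * h.1 t) = c * (t * h.1 t)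
    ring

theorem mulVar_apply (h : smoothDyadic) (t : ℝ) : (mulVar h).1 t = t * h.1 t := rfl

/-- The derivative. -/
def derivDyadic : smoothDyadic →ₗ[ℂ] smoothDyadic where
  toFun h := ⟨deriv h.1, h.2.1.deriv' , fun t ht => by
    have hc : Continuous (deriv h.1) := (h.2.1.deriv' (n := ∞)).continuous
    by_contra hn
    have hz : ∀ U : Set ℝ, IsOpen U → (∀ x ∈ U, x ∉ Ioo (1/2 : ℝ) 2) → t ∈ closure U → False := by
      intro U hU hx htU
      have h1 : closure U ⊆ {x | deriv h.1 x = 0} := by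
        refine closure_minimal (fun x hxU => ?_) (isClosed_eq hc continuous_const)
        have : h.1 =ᶠ[nhds x] fun _ => 0 := by
          filter_upwards [hU.mem_nhds hxU] with y hy using smoothDyadic_eq_zero h (hx y hy)
        exact this.deriv_eq.trans (by simp)
      exact ht (h1 htU)
    rcases le_or_gt t (1/2) with h1 | h1
    · exact hz (Iio (1/2)) isOpen_Iio (fun x hx hx' => absurd hx'.1 (not_lt.2 (le_of_lt hx)))
        (by rw [closure_Iio]; exact h1)
    · rcases lt_or_ge t 2 with h2 | h2
      · exact hn ⟨h1, h2⟩
      · exact hz (Ioi 2) isOpen_Ioi (fun x hx hx' => absurd hx'.2 (not_lt.2 (le_of_lt hx)))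
          (by rw [closure_Ioi]; exact h2)⟩
  map_add' g h := by
    ext t
    exact deriv_add (g.2.1.differentiable (by simp) t) (h.2.1.differentiable (by simp) t)
  map_smul' c h := by
    ext t
    exact deriv_const_smul c (h.2.1.differentiable (by simp) t)

theorem derivDyadic_val (h : smoothDyadic) : (derivDyadic h).1 = deriv h.1 := rfl

theorem hasDerivAt_dyadic (h : smoothDyadic) (t : ℝ) : HasDerivAt h.1 ((derivDyadic h).1 t) t :=
  (h.2.1.differentiable (by simp) t).hasDerivAt

theorem derivDyadic_iterate (h : smoothDyadic) (n : ℕ) :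
    (derivDyadic^[n] h).1 = iteratedDeriv n h.1 := by
  induction n with
  | zero => simp
  | succ n ih => rw [Function.iterate_succ_apply', derivDyadic_val, ih, iteratedDeriv_succ]

theorem derivDyadic_mulVar (h : smoothDyadic) :
    derivDyadic (mulVar h) = h + mulVar (derivDyadic h) := by
  ext t
  have h1 : HasDerivAt (fun t : ℝ => (t : ℂ) * h.1 t) (1 * h.1 t + t * (derivDyadic h).1 t) t :=
    (Complex.ofRealCLM.hasDerivAt).mul (hasDerivAt_dyadic h t)
  change deriv (fun t : ℝ => (t : ℂ) * h.1 t) t = h.1 t + t * (derivDyadic h).1 t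
  rw [h1.deriv, one_mul]

theorem dyadic_bddAbove (h : smoothDyadic) : BddAbove (range fun s : ℝ => ‖h.1 s‖) := by
  obtain ⟨C, hC⟩ := h.2.1.continuous.bounded_above_of_compact_support (smoothDyadic_hasCompactSupport h)
  exact ⟨C, by rintro _ ⟨s, rfl⟩; exact hC s⟩

theorem norm_dyadic_le (h : smoothDyadic) (t : ℝ) : ‖h.1 t‖ ≤ ⨆ s : ℝ, ‖h.1 s‖ :=
  le_ciSup (dyadic_bddAbove h) t

theorem iSup_dyadic_nonneg (g : ℝ → ℂ) : 0 ≤ ⨆ s : ℝ, ‖g s‖ := Real.iSup_nonneg fun _ => norm_nonneg _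

theorem cNorm_nonneg (K : ℕ) (g : ℝ → ℂ) : 0 ≤ cNorm K g :=
  Finset.sum_nonneg fun _ _ => iSup_dyadic_nonneg _

theorem cNorm_mono {K K' : ℕ} (h : K ≤ K') (g : ℝ → ℂ) : cNorm K g ≤ cNorm K' g :=
  Finset.sum_le_sum_of_subset_of_nonneg (Finset.range_mono (by lia)) fun _ _ _ => iSup_dyadic_nonneg _

theorem norm_iterate_le_cNorm (h : smoothDyadic) {ν K : ℕ} (hν : ν ≤ K) (t : ℝ) :
    ‖(derivDyadic^[ν] h).1 t‖ ≤ cNorm K h.1 := by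
  refine (norm_dyadic_le _ t).trans ?_
  rw [derivDyadic_iterate]
  exact Finset.single_le_sum (f := fun ν => ⨆ s : ℝ, ‖iteratedDeriv ν h.1 s‖)
    (fun i _ => iSup_dyadic_nonneg _) (Finset.mem_range.2 (by lia))

theorem cNorm_derivDyadic_le (h : smoothDyadic) (K : ℕ) :
    cNorm K (derivDyadic h).1 ≤ cNorm (K + 1) h.1 := by
  unfold cNorm
  rw [Finset.sum_range_succ' _ (K + 1)]
  have : ∀ ν, iteratedDeriv ν (derivDyadic h).1 = iteratedDeriv (ν + 1) h.1 := fun ν => by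
    rw [derivDyadic_val, iteratedDeriv_succ']
  simp only [this]
  exact le_add_of_nonneg_right (iSup_dyadic_nonneg _)

theorem iterate_derivDyadic_mulVar (h : smoothDyadic) (n : ℕ) :
    derivDyadic^[n + 1] (mulVar h) =
      (n + 1 : ℂ) • derivDyadic^[n] h + mulVar (derivDyadic^[n + 1] h) := by
  induction n with
  | zero => simp [derivDyadic_mulVar]
  | succ n ih =>
    rw [Function.iterate_succ_apply', ih, map_add, map_smul, derivDyadic_mulVar,
      ← Function.iterate_succ_apply' derivDyadic n, ← Function.iterate_succ_apply' derivDyadic (n + 1)]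
    push_cast
    module

/-- The polynomial factor is a crude count; only its independence of `h` matters. -/
theorem cNorm_mulVar_le (h : smoothDyadic) (K : ℕ) :
    cNorm K (mulVar h).1 ≤ (K + 1) * (K + 2) * cNorm K h.1 := by
  have hm : ∀ (k : smoothDyadic) (t : ℝ), ‖(mulVar k).1 t‖ ≤ 2 * ⨆ s : ℝ, ‖k.1 s‖ := by
    intro k t
    by_cases ht : t ∈ Ioo (1/2 : ℝ) 2
    · rw [mulVar_apply, norm_mul, Complex.norm_real, Real.norm_of_nonneg (by linarith [ht.1])]
      exact mul_le_mul ht.2.le (norm_dyadic_le k t) (norm_nonneg _) (by norm_num)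
    · rw [smoothDyadic_eq_zero _ ht, norm_zero]
      exact mul_nonneg (by norm_num) (iSup_dyadic_nonneg _)
  have hν : ∀ ν ∈ Finset.range (K + 1),
      (⨆ s : ℝ, ‖iteratedDeriv ν (mulVar h).1 s‖) ≤ (K + 2) * cNorm K h.1 := by
    intro ν hν
    have hνK : ν ≤ K := by have := Finset.mem_range.1 hν; lia
    refine ciSup_le fun t => ?_
    rw [← derivDyadic_iterate]
    have hi : ∀ ν ≤ K, (⨆ s : ℝ, ‖(derivDyadic^[ν] h).1 s‖) ≤ cNorm K h.1 := fun ν hν =>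
      ciSup_le fun t => norm_iterate_le_cNorm h hν t
    have h0 := cNorm_nonneg K h.1
    rcases ν with _ | n
    · refine (hm h t).trans ?_
      have := hi 0 (by lia)
      simp only [Function.iterate_zero, id_eq] at this
      nlinarith [(Nat.cast_nonneg K : (0:ℝ) ≤ K)]
    · rw [iterate_derivDyadic_mulVar]
      change ‖(n + 1 : ℂ) * (derivDyadic^[n] h).1 t + (mulVar (derivDyadic^[n + 1] h)).1 t‖ ≤ _
      refine (norm_add_le _ _).trans ?_
      have h1 := norm_iterate_le_cNorm h (show n ≤ K by lia) t
      have h2 := (hm (derivDyadic^[n + 1] h) t).trans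
        (mul_le_mul_of_nonneg_left (hi (n + 1) hνK) (by norm_num))
      have h3 : ‖(n + 1 : ℂ)‖ = n + 1 := by
        rw [show (n + 1 : ℂ) = ((n + 1 : ℝ) : ℂ) by push_cast; rfl, Complex.norm_real,
          Real.norm_of_nonneg (by positivity)]
      rw [norm_mul, h3]
      have h4 : (n + 1 : ℝ) ≤ K := by exact_mod_cast hνK
      nlinarith [norm_nonneg ((derivDyadic^[n] h).1 t)]
  refine (Finset.sum_le_sum hν).trans ?_
  rw [Finset.sum_const, Finset.card_range, nsmul_eq_mul]
  push_cast
  exact le_of_eq (by ring)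

theorem exists_cNorm_iterate_mulVar_le (j K : ℕ) :
    ∃ C : ℝ, 0 ≤ C ∧ ∀ h : smoothDyadic, cNorm K (mulVar^[j] h).1 ≤ C * cNorm K h.1 := by
  induction j with
  | zero => exact ⟨1, zero_le_one, fun h => by simp⟩
  | succ j ih =>
    obtain ⟨C, hC0, hC⟩ := ih
    refine ⟨(K + 1) * (K + 2) * C, by positivity, fun h => ?_⟩
    rw [Function.iterate_succ_apply']
    refine (cNorm_mulVar_le _ K).trans ?_
    rw [mul_assoc ((K + 1 : ℝ) * (K + 2))]
    exact mul_le_mul_of_nonneg_left (hC h) (by positivity)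

end Dyadic

/-! ### The oscillatory integral `∫ h(t) exp(i(l t - ξ t²)) dt` -/

section Oscillatory

/-- Differentiation under the integral sign for jointly continuous integrands. -/
theorem hasDerivAt_intervalIntegral {F F' : ℝ → ℝ → ℂ} (hF : Continuous (Function.uncurry F))
    (hF' : Continuous (Function.uncurry F'))
    (h : ∀ x t, HasDerivAt (fun x => F x t) (F' x t) x) (a b x₀ : ℝ) :
    HasDerivAt (fun x => ∫ t in a..b, F x t) (∫ t in a..b, F' x₀ t) x₀ := by
  obtain ⟨C, hC⟩ := ((isCompact_closedBall x₀ 1).prod (isCompact_uIcc (a := a) (b := b))).bddAbove_image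
    hF'.norm.continuousOn
  refine (intervalIntegral.hasDerivAt_integral_of_dominated_loc_of_deriv_le
    (s := Metric.closedBall x₀ 1) (bound := fun _ => C) (Metric.closedBall_mem_nhds x₀ one_pos)
    ?_ ?_ ?_ ?_ intervalIntegrable_const ?_).2
  · exact .of_forall fun x => (hF.comp (Continuous.prodMk_right x)).aestronglyMeasurable
  · exact (hF.comp (Continuous.prodMk_right x₀)).intervalIntegrable _ _
  · exact (hF'.comp (Continuous.prodMk_right x₀)).aestronglyMeasurable
  · exact .of_forall fun t ht x hx => hC ⟨(x, t), ⟨hx, uIoc_subset_uIcc ht⟩, rfl⟩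
  · exact .of_forall fun t _ x _ => h x t

/-- `W h l ξ = ∫ h(t) exp(i(l t - ξ t²)) dt`. -/
def oscInt (h : smoothDyadic) (l ξ : ℝ) : ℂ :=
  ∫ t in (1/2 : ℝ)..2, h.1 t * Complex.exp ((l * t - ξ * t ^ 2 : ℝ) * Complex.I)

theorem oscInt_add (g h : smoothDyadic) (l ξ : ℝ) :
    oscInt (g + h) l ξ = oscInt g l ξ + oscInt h l ξ := by
  unfold oscInt
  rw [← intervalIntegral.integral_add]
  · exact intervalIntegral.integral_congr fun t _ => add_mul _ _ _
  · exact Continuous.intervalIntegrable (g.2.1.continuous.mul (by fun_prop)) _ _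
  · exact Continuous.intervalIntegrable (h.2.1.continuous.mul (by fun_prop)) _ _

theorem oscInt_smul (c : ℂ) (h : smoothDyadic) (l ξ : ℝ) :
    oscInt (c • h) l ξ = c * oscInt h l ξ := by
  unfold oscInt
  rw [← intervalIntegral.integral_const_mul]
  exact intervalIntegral.integral_congr fun t _ => mul_assoc _ _ _

theorem continuous_oscInt (h : smoothDyadic) : Continuous (Function.uncurry (oscInt h)) := by
  have hc := h.2.1.continuous
  refine intervalIntegral.continuous_parametric_intervalIntegral_of_continuous'
    (f := fun (p : ℝ × ℝ) t => h.1 t * Complex.exp ((p.1 * t - p.2 * t ^ 2 : ℝ) * Complex.I)) ?_ _ _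
  fun_prop

theorem hasDerivAt_oscInt_left (h : smoothDyadic) (l ξ : ℝ) :
    HasDerivAt (fun l => oscInt h l ξ) (Complex.I * oscInt (mulVar h) l ξ) l := by
  have hc := h.2.1.continuous
  have h1 := hasDerivAt_intervalIntegral
    (F := fun l t => h.1 t * Complex.exp ((l * t - ξ * t ^ 2 : ℝ) * Complex.I))
    (F' := fun l t => Complex.I * ((t * h.1 t) * Complex.exp ((l * t - ξ * t ^ 2 : ℝ) * Complex.I)))
    (by fun_prop) (by fun_prop) (fun l t => by
      have h2 : HasDerivAt (fun l : ℝ => l * t - ξ * t ^ 2) t l := by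
        simpa using ((hasDerivAt_id l).mul_const t).sub_const (ξ * t ^ 2)
      refine (((h2.ofReal_comp.mul_const Complex.I).cexp).const_mul (h.1 t)).congr_deriv ?_
      ring) (1/2) 2 l
  rw [intervalIntegral.integral_const_mul] at h1
  exact h1

theorem hasDerivAt_oscInt_right (h : smoothDyadic) (l ξ : ℝ) :
    HasDerivAt (fun ξ => oscInt h l ξ) (-Complex.I * oscInt (mulVar (mulVar h)) l ξ) ξ := by
  have hc := h.2.1.continuous
  have h1 := hasDerivAt_intervalIntegral
    (F := fun ξ t => h.1 t * Complex.exp ((l * t - ξ * t ^ 2 : ℝ) * Complex.I))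
    (F' := fun ξ t => -Complex.I * ((t * (t * h.1 t)) *
      Complex.exp ((l * t - ξ * t ^ 2 : ℝ) * Complex.I)))
    (by fun_prop) (by fun_prop) (fun ξ t => by
      have h2 : HasDerivAt (fun ξ : ℝ => l * t - ξ * t ^ 2) (-(t ^ 2)) ξ := by
        simpa using ((hasDerivAt_id ξ).mul_const (t ^ 2)).const_sub (l * t)
      refine (((h2.ofReal_comp.mul_const Complex.I).cexp).const_mul (h.1 t)).congr_deriv ?_
      push_cast
      ring) (1/2) 2 ξ
  rw [intervalIntegral.integral_const_mul] at h1
  exact h1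

theorem hasFDerivAt_oscInt (h : smoothDyadic) (p : ℝ × ℝ) :
    HasFDerivAt (Function.uncurry (oscInt h))
      ((ContinuousLinearMap.toSpanSingleton ℝ (Complex.I * oscInt (mulVar h) p.1 p.2)).coprod
      (ContinuousLinearMap.toSpanSingleton ℝ
        (-Complex.I * oscInt (mulVar (mulVar h)) p.1 p.2))) p := by
  refine (hasStrictFDerivAt_uncurry_coprod (𝕜 := ℝ) (f := oscInt h)
    (f₁ := fun l s => ContinuousLinearMap.toSpanSingleton ℝ (Complex.I * oscInt (mulVar h) l s))
    (f₂ := fun l s => ContinuousLinearMap.toSpanSingleton ℝ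
        (-Complex.I * oscInt (mulVar (mulVar h)) l s))
    (.of_forall fun v => (hasDerivAt_oscInt_left h v.1 v.2).hasFDerivAt)
    (.of_forall fun v => (hasDerivAt_oscInt_right h v.1 v.2).hasFDerivAt) ?_ ?_).hasFDerivAt
  · exact (ContinuousLinearMap.toSpanSingletonCLE (𝕜 := ℝ) (E := ℂ)).continuous.continuousAt.comp
      (continuous_const.mul (continuous_oscInt (mulVar h))).continuousAt
  · exact (ContinuousLinearMap.toSpanSingletonCLE (𝕜 := ℝ) (E := ℂ)).continuous.continuousAt.comp
      (continuous_const.mul (continuous_oscInt (mulVar (mulVar h)))).continuousAt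

/-- Integration by parts: `l W[h] - 2 ξ W[t h] = i W[h']`. -/
theorem oscInt_by_parts (h : smoothDyadic) (l ξ : ℝ) :
    l * oscInt h l ξ - 2 * ξ * oscInt (mulVar h) l ξ = Complex.I * oscInt (derivDyadic h) l ξ := by
  have hc := h.2.1.continuous
  have hc' := (derivDyadic h).2.1.continuous
  have hd : ∀ t : ℝ, HasDerivAt
      (fun t : ℝ => h.1 t * Complex.exp ((l * t - ξ * t ^ 2 : ℝ) * Complex.I))
      ((derivDyadic h).1 t * Complex.exp ((l * t - ξ * t ^ 2 : ℝ) * Complex.I) +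
        (Complex.I * l * (h.1 t * Complex.exp ((l * t - ξ * t ^ 2 : ℝ) * Complex.I)) -
        Complex.I * (2 * ξ) *
          ((t * h.1 t) * Complex.exp ((l * t - ξ * t ^ 2 : ℝ) * Complex.I)))) t := by
    intro t
    have h2 : HasDerivAt (fun t : ℝ => l * t - ξ * t ^ 2) (l - ξ * (2 * t)) t := by
      simpa using! ((hasDerivAt_id t).const_mul l).sub ((hasDerivAt_pow 2 t).const_mul ξ)
    refine ((hasDerivAt_dyadic h t).mul (h2.ofReal_comp.mul_const Complex.I).cexp).congr_deriv ?_
    push_cast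
    ring
  have h1 := intervalIntegral.integral_eq_sub_of_hasDerivAt (a := 1/2) (b := 2) (fun t _ => hd t)
    (Continuous.intervalIntegrable (by fun_prop) _ _)
  rw [smoothDyadic_eq_zero h (t := 2) (by simp), smoothDyadic_eq_zero h (t := 1/2) (by simp),
    intervalIntegral.integral_add (Continuous.intervalIntegrable (by fun_prop) _ _)
      (Continuous.intervalIntegrable (by fun_prop) _ _),
    intervalIntegral.integral_sub (Continuous.intervalIntegrable (by fun_prop) _ _)
      (Continuous.intervalIntegrable (by fun_prop) _ _),
    intervalIntegral.integral_const_mul, intervalIntegral.integral_const_mul] at h1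
  have h2 : oscInt (derivDyadic h) l ξ + (Complex.I * l * oscInt h l ξ -
      Complex.I * (2 * ξ) * oscInt (mulVar h) l ξ) = 0 := by
    refine Eq.trans ?_ (h1.trans (by simp))
    rfl
  linear_combination (-Complex.I) * h2 + (l * oscInt h l ξ - 2 * ξ * oscInt (mulVar h) l ξ) *
    Complex.I_mul_I

end Oscillatory
end

noncomputable section

/-! ### The amplitude -/

section Amplitude

/-- `V h l s = √l ∫ h(t) exp(-i l s (t - 1/(2s))²) dt`, the normalised oscillatory integral at
`ξ = l s` without the value `exp(i l / (4 s))` of the exponential at the critical point. -/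
def freeEvol (h : smoothDyadic) (l s : ℝ) : ℂ :=
  ((√l : ℝ) : ℂ) * Complex.exp ((-(l / (4 * s)) : ℝ) * Complex.I) * oscInt h l (l * s)

/-- Integration by parts, solved for the integral with the additional factor `t`. -/
theorem oscInt_mulVar (h : smoothDyadic) {l s : ℝ} (hl : 0 < l) (hs : 0 < s) :
    oscInt (mulVar h) l (l * s) =
      oscInt h l (l * s) / (2 * s) - Complex.I / (2 * l * s) * oscInt (derivDyadic h) l (l * s) := by
  have h1 := oscInt_by_parts h l (l * s)
  have hl' : (l : ℂ) ≠ 0 := by exact_mod_cast hl.ne'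
  have hs' : (s : ℂ) ≠ 0 := by exact_mod_cast hs.ne'
  push_cast at h1
  field_simp
  linear_combination (-1) * h1

theorem oscInt_mulVar_mulVar (h : smoothDyadic) {l s : ℝ} (hl : 0 < l) (hs : 0 < s) :
    oscInt (mulVar (mulVar h)) l (l * s) =
      (1 / (4 * s ^ 2) - Complex.I / (2 * l * s)) * oscInt h l (l * s) -
        Complex.I / (2 * l * s ^ 2) * oscInt (derivDyadic h) l (l * s) -
        1 / (4 * l ^ 2 * s ^ 2) * oscInt (derivDyadic (derivDyadic h)) l (l * s) := by
  have hl' : (l : ℂ) ≠ 0 := by exact_mod_cast hl.ne'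
  have hs' : (s : ℂ) ≠ 0 := by exact_mod_cast hs.ne'
  rw [oscInt_mulVar (mulVar h) hl hs, derivDyadic_mulVar, oscInt_add, oscInt_mulVar h hl hs,
    oscInt_mulVar (derivDyadic h) hl hs]
  field_simp
  ring_nf
  simp only [Complex.I_sq]
  ring

/-- `V h` solves a free Schrödinger equation in the time variable `1 / l`. -/
theorem hasDerivAt_freeEvol_left (h : smoothDyadic) {l s : ℝ} (hl : 0 < l) (hs : 0 < s) :
    HasDerivAt (fun l => freeEvol h l s)
      (Complex.I / (4 * l ^ 2 * s) * freeEvol (derivDyadic (derivDyadic h)) l s) l := by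
  have hl' : (l : ℂ) ≠ 0 := by exact_mod_cast hl.ne'
  have hs' : (s : ℂ) ≠ 0 := by exact_mod_cast hs.ne'
  have h1 : HasDerivAt (fun l : ℝ => ((√l : ℝ) : ℂ)) ((1 / (2 * √l) : ℝ) : ℂ) l :=
    (Real.hasDerivAt_sqrt hl.ne').ofReal_comp
  have h2 : HasDerivAt (fun l : ℝ => -(l / (4 * s))) (-(1 / (4 * s))) l :=
    ((hasDerivAt_id l).div_const _).neg
  have h3 := (h2.ofReal_comp.mul_const Complex.I).cexp
  have h4 : HasDerivAt (fun l : ℝ => (l, l * s)) ((1:ℝ), s) l := by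
    simpa using (hasDerivAt_id l).prodMk ((hasDerivAt_id l).mul_const s)
  have h5 := (hasFDerivAt_oscInt h (l, l * s)).comp_hasDerivAt l h4
  refine ((h1.mul h3).mul h5).congr_deriv ?_
  have hsq : ((√l : ℝ) : ℂ) ^ 2 = l := by exact_mod_cast Real.sq_sqrt hl.le
  have hsq0 : ((√l : ℝ) : ℂ) ≠ 0 := by exact_mod_cast (Real.sqrt_pos.2 hl).ne'
  have e1 : ((1 / (2 * √l) : ℝ) : ℂ) = ((√l : ℝ) : ℂ) / (2 * l) := by
    rw [← hsq]; push_cast; field_simp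
  simp only [Function.comp_apply, Function.uncurry, ContinuousLinearMap.coprod_apply,
    ContinuousLinearMap.toSpanSingleton_apply, one_smul, Complex.real_smul, e1,
    oscInt_mulVar_mulVar h hl hs, oscInt_mulVar h hl hs, freeEvol, Pi.mul_apply]
  push_cast
  field_simp
  ring_nf
  simp only [Complex.I_sq]
  ring

/-- The dependence on `s` is a shift of the critical point `1 / (2s)`, which differentiates `h`
once, together with a change of the time `1 / (l s)`, which differentiates it twice. -/
theorem hasDerivAt_freeEvol_right (h : smoothDyadic) {l s : ℝ} (hl : 0 < l) (hs : 0 < s) :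
    HasDerivAt (fun s => freeEvol h l s)
      (-1 / (2 * s) * freeEvol h l s - 1 / (2 * s ^ 2) * freeEvol (derivDyadic h) l s +
        Complex.I / (4 * l * s ^ 2) * freeEvol (derivDyadic (derivDyadic h)) l s) s := by
  have hl' : (l : ℂ) ≠ 0 := by exact_mod_cast hl.ne'
  have hs' : (s : ℂ) ≠ 0 := by exact_mod_cast hs.ne'
  have h2 : HasDerivAt (fun s : ℝ => -(l / (4 * s))) (l / (4 * s ^ 2)) s := by
    have := ((hasDerivAt_inv hs.ne').const_mul (l / 4)).neg
    refine (this.congr_of_eventuallyEq ?_).congr_deriv ?_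
    · filter_upwards [lt_mem_nhds hs] with y hy
      simp only [Pi.neg_apply]
      field_simp
    · field_simp
  have h3 := (h2.ofReal_comp.mul_const Complex.I).cexp
  have h4 : HasDerivAt (fun s : ℝ => l * s) l s := by
    simpa using (hasDerivAt_id s).const_mul l
  have h5 := (hasDerivAt_oscInt_right h l (l * s)).scomp s h4
  refine ((h3.const_mul ((√l : ℝ) : ℂ)).mul h5).congr_deriv ?_
  simp only [Function.comp_apply, Complex.real_smul,
    oscInt_mulVar_mulVar h hl hs, freeEvol]
  push_cast
  field_simp
  ring_nf
  simp only [Complex.I_sq]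
  ring

/-- The Fresnel integrals are bounded. -/
theorem norm_fresnel_le (y : ℝ) :
    ‖∫ u in (0:ℝ)..y, Complex.exp ((-(u ^ 2) : ℝ) * Complex.I)‖ ≤ 2 := by
  have hcont : Continuous fun u : ℝ => Complex.exp ((-(u ^ 2) : ℝ) * Complex.I) := by fun_prop
  have hii : ∀ a b : ℝ, IntervalIntegrable
      (fun u : ℝ => Complex.exp ((-(u ^ 2) : ℝ) * Complex.I)) volume a b := fun a b =>
    hcont.intervalIntegrable a b
  have hn : ∀ u : ℝ, ‖Complex.exp ((-(u ^ 2) : ℝ) * Complex.I)‖ = 1 := fun u =>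
    Complex.norm_exp_ofReal_mul_I _
  have hsmall : ∀ y : ℝ, 0 ≤ y → y ≤ 1 →
      ‖∫ u in (0:ℝ)..y, Complex.exp ((-(u ^ 2) : ℝ) * Complex.I)‖ ≤ 1 := by
    intro y h0 h1
    refine (intervalIntegral.norm_integral_le_of_norm_le_const (C := 1)
      fun u _ => (hn u).le).trans ?_
    rw [sub_zero, abs_of_nonneg h0]
    linarith
  have hpos : ∀ y : ℝ, 0 ≤ y →
      ‖∫ u in (0:ℝ)..y, Complex.exp ((-(u ^ 2) : ℝ) * Complex.I)‖ ≤ 2 := by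
    intro y h0
    rcases le_total y 1 with h1 | h1
    · exact (hsmall y h0 h1).trans (by norm_num)
    rw [← intervalIntegral.integral_add_adjacent_intervals (hii 0 1) (hii 1 y)]
    refine (norm_add_le _ _).trans ?_
    have hpos' : ∀ u ∈ uIcc 1 y, 0 < u := fun u hu => by
      rw [uIcc_of_le h1] at hu; linarith [hu.1]
    -- away from the origin, integrate by parts with `e^{-iu²} = (i/(2u)) d/du e^{-iu²}`
    have hd : ∀ u ∈ uIcc 1 y, HasDerivAt
        (fun u : ℝ => Complex.I / 2 * ((u⁻¹ : ℝ) : ℂ) * Complex.exp ((-(u ^ 2) : ℝ) * Complex.I))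
        (-(Complex.I / 2 * (((u ^ 2)⁻¹ : ℝ) : ℂ)) * Complex.exp ((-(u ^ 2) : ℝ) * Complex.I) +
          Complex.exp ((-(u ^ 2) : ℝ) * Complex.I)) u := by
      intro u hu
      have hu0 := (hpos' u hu).ne'
      have h2 : HasDerivAt (fun u : ℝ => -(u ^ 2)) (-(2 * u)) u := by
        simpa using! (hasDerivAt_pow 2 u).neg
      have h3 := (h2.ofReal_comp.mul_const Complex.I).cexp
      have h4 := ((hasDerivAt_inv hu0).ofReal_comp).const_mul (Complex.I / 2)
      refine (h4.mul h3).congr_deriv ?_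
      have hu' : (u : ℂ) ≠ 0 := by exact_mod_cast hu0
      push_cast
      field_simp
      ring_nf
      simp only [Complex.I_sq]
      ring
    have hcd : ContinuousOn (fun u : ℝ => -(Complex.I / 2 * (((u ^ 2)⁻¹ : ℝ) : ℂ)) *
        Complex.exp ((-(u ^ 2) : ℝ) * Complex.I)) (uIcc 1 y) := by
      refine ContinuousOn.mul (ContinuousOn.neg (continuousOn_const.mul
        (Complex.continuous_ofReal.comp_continuousOn
          ((continuousOn_pow 2).inv₀ fun u hu => ?_)))) hcont.continuousOn
      exact pow_ne_zero _ (hpos' u hu).ne'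
    have h5 := intervalIntegral.integral_eq_sub_of_hasDerivAt hd
      (hcd.intervalIntegrable.add (hii 1 y))
    rw [intervalIntegral.integral_add hcd.intervalIntegrable (hii 1 y)] at h5
    have hy0 : 0 < y := by linarith
    have h6 : ‖∫ u in (1:ℝ)..y, -(Complex.I / 2 * (((u ^ 2)⁻¹ : ℝ) : ℂ)) *
        Complex.exp ((-(u ^ 2) : ℝ) * Complex.I)‖ ≤ 1 / 2 - 1 / 2 * y⁻¹ := by
      have hr : ∀ u ∈ uIcc 1 y, HasDerivAt (fun u : ℝ => -(1 / 2) * u⁻¹)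
          (1 / 2 * (u ^ 2)⁻¹) u := fun u hu => by
        refine ((hasDerivAt_inv (hpos' u hu).ne').const_mul (-(1/2))).congr_deriv ?_
        ring
      have hrc : ContinuousOn (fun u : ℝ => 1 / 2 * (u ^ 2)⁻¹) (uIcc 1 y) :=
        continuousOn_const.mul ((continuousOn_pow 2).inv₀ fun u hu =>
          pow_ne_zero _ (hpos' u hu).ne')
      have h7 := intervalIntegral.integral_eq_sub_of_hasDerivAt hr hrc.intervalIntegrable
      calc _ ≤ ∫ u in (1:ℝ)..y, 1 / 2 * (u ^ 2)⁻¹ := by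
            refine intervalIntegral.norm_integral_le_of_norm_le h1 (.of_forall fun u hu => ?_)
              hrc.intervalIntegrable
            rw [norm_mul, hn, norm_neg, norm_mul, norm_div, Complex.norm_I, Complex.norm_real,
              Real.norm_of_nonneg (by positivity)]
            simp
        _ = _ := by rw [h7]; norm_num; ring
    have h8 : ‖∫ u in (1:ℝ)..y, Complex.exp ((-(u ^ 2) : ℝ) * Complex.I)‖ ≤ 1 := by
      rw [add_comm] at h5
      rw [eq_sub_of_add_eq h5]
      refine (norm_sub_le _ _).trans ((add_le_add (norm_sub_le _ _) h6).trans ?_)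
      simp only [norm_mul, hn, norm_div, Complex.norm_I, Complex.norm_real,
        Real.norm_of_nonneg (inv_nonneg.2 hy0.le)]
      norm_num
      linarith
    linarith [hsmall 1 zero_le_one le_rfl]
  rcases le_total 0 y with h0 | h0
  · exact hpos y h0
  · have h1 := hpos (-y) (by linarith)
    have h2 := intervalIntegral.integral_comp_neg (a := 0) (b := -y)
      (fun u : ℝ => Complex.exp ((-(u ^ 2) : ℝ) * Complex.I))
    simp only [neg_sq, neg_neg, neg_zero] at h2
    rw [h2, intervalIntegral.integral_symm, norm_neg] at h1
    exact h1

/-- A bound that is uniform in `l`, at the cost of one derivative of `h`: the oscillating factor is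
the derivative of a bounded Fresnel integral, divided by `√(l s)`. -/
theorem norm_freeEvol_le (h : smoothDyadic) {l s : ℝ} (hl : 0 < l) (hs : 1 / 16 ≤ s) :
    ‖freeEvol h l s‖ ≤ 12 * ⨆ t : ℝ, ‖(derivDyadic h).1 t‖ := by
  have hs0 : 0 < s := by linarith
  have hls : 0 < l * s := mul_pos hl hs0
  set κ := √(l * s) with hκ
  have hκ0 : 0 < κ := Real.sqrt_pos.2 hls
  have hκ2 : κ ^ 2 = l * s := Real.sq_sqrt hls.le
  -- The primitive of the oscillating factor, which is bounded.
  set E : ℝ → ℂ := fun y => ∫ u in (0:ℝ)..y, Complex.exp ((-(u ^ 2) : ℝ) * Complex.I) with hE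
  have hcont : Continuous fun u : ℝ => Complex.exp ((-(u ^ 2) : ℝ) * Complex.I) := by fun_prop
  have hEd : ∀ y, HasDerivAt E (Complex.exp ((-(y ^ 2) : ℝ) * Complex.I)) y := fun y =>
    intervalIntegral.integral_hasDerivAt_right (hcont.intervalIntegrable _ _)
      (hcont.stronglyMeasurableAtFilter _ _) hcont.continuousAt
  have hEc : Continuous E := continuous_iff_continuousAt.2 fun y => (hEd y).continuousAt
  have hd : ∀ t : ℝ, HasDerivAt (fun t : ℝ => h.1 t * E (κ * (t - 1 / (2 * s))))
      ((derivDyadic h).1 t * E (κ * (t - 1 / (2 * s))) +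
        κ * (h.1 t * Complex.exp ((-((κ * (t - 1 / (2 * s))) ^ 2) : ℝ) * Complex.I))) t := by
    intro t
    have h2 : HasDerivAt (fun t : ℝ => κ * (t - 1 / (2 * s))) κ t := by
      simpa using ((hasDerivAt_id t).sub_const (1 / (2 * s))).const_mul κ
    refine ((hasDerivAt_dyadic h t).mul ((hEd _).scomp t h2)).congr_deriv ?_
    simp only [Function.comp_apply, Complex.real_smul]
    ring
  have hc := h.2.1.continuous
  have hc' := (derivDyadic h).2.1.continuous
  have h1 := intervalIntegral.integral_eq_sub_of_hasDerivAt (a := 1/2) (b := 2) (fun t _ => hd t)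
    (Continuous.intervalIntegrable (by fun_prop) _ _)
  rw [smoothDyadic_eq_zero h (t := 2) (by simp), smoothDyadic_eq_zero h (t := 1/2) (by simp),
    intervalIntegral.integral_add (Continuous.intervalIntegrable (by fun_prop) _ _)
      (Continuous.intervalIntegrable (by fun_prop) _ _),
    intervalIntegral.integral_const_mul, zero_mul, zero_mul, sub_zero] at h1
  -- complete the square in the phase
  have h2 : Complex.exp ((-(l / (4 * s)) : ℝ) * Complex.I) * oscInt h l (l * s) =
      ∫ t in (1/2 : ℝ)..2,
        h.1 t * Complex.exp ((-((κ * (t - 1 / (2 * s))) ^ 2) : ℝ) * Complex.I) := by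
    unfold oscInt
    rw [← intervalIntegral.integral_const_mul]
    refine intervalIntegral.integral_congr fun t _ => ?_
    rw [mul_left_comm, ← Complex.exp_add, ← add_mul, ← Complex.ofReal_add, mul_pow, hκ2]
    congr 4
    field_simp
    ring
  have h3 : freeEvol h l s = -(((√l / κ : ℝ) : ℂ) *
      ∫ t in (1/2 : ℝ)..2, (derivDyadic h).1 t * E (κ * (t - 1 / (2 * s)))) := by
    have hκ' : (κ : ℂ) ≠ 0 := by exact_mod_cast hκ0.ne'
    unfold freeEvol
    rw [mul_assoc, h2, eq_neg_of_add_eq_zero_left h1, Complex.ofReal_div, mul_neg, neg_neg,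
      ← mul_assoc, div_mul_cancel₀ _ hκ']
  -- This is `1 / √s ≤ 4`, where the lower bound for `s` is used.
  have hratio : √l / κ ≤ 4 := by
    rw [div_le_iff₀ hκ0, hκ]
    refine Real.sqrt_le_iff.2 ⟨by positivity, ?_⟩
    rw [mul_pow, Real.sq_sqrt hls.le]
    nlinarith
  have h4 : ‖∫ t in (1/2 : ℝ)..2, (derivDyadic h).1 t * E (κ * (t - 1 / (2 * s)))‖ ≤
      (⨆ t : ℝ, ‖(derivDyadic h).1 t‖) * 2 * |2 - 1/2| :=
    intervalIntegral.norm_integral_le_of_norm_le_const fun t _ => by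
      rw [norm_mul]
      exact mul_le_mul (norm_dyadic_le _ t) (norm_fresnel_le _) (norm_nonneg _)
        (iSup_dyadic_nonneg _)
  rw [h3, norm_neg, norm_mul, Complex.norm_real, Real.norm_of_nonneg (by positivity)]
  refine (mul_le_mul hratio h4 (norm_nonneg _) (by norm_num)).trans (le_of_eq ?_)
  norm_num
  ring

end Amplitude
end

noncomputable section

section Amplitude

/-- The smooth functions with support in `[1/16, 4]`, the cutoffs in the variable `s`. -/
abbrev TimeCutoff : Type := {b : ℝ → ℂ // ContDiff ℝ ∞ b ∧ tsupport b ⊆ Icc (1 / 16) 4}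

theorem TimeCutoff.eq_zero (b : TimeCutoff) {s : ℝ} (hs : s ≤ 0) : b.1 s = 0 := by
  by_contra h
  have := (b.2.2 (subset_tsupport _ h)).1
  linarith

theorem TimeCutoff.eventually_eq_zero (b : TimeCutoff) {s : ℝ} (hs : s ≤ 0) :
    b.1 =ᶠ[nhds s] 0 :=
  notMem_tsupport_iff_eventuallyEq.1 fun h => by have := (b.2.2 h).1; linarith

/-- The derivative of a cutoff. -/
def TimeCutoff.deriv (b : TimeCutoff) : TimeCutoff :=
  ⟨_root_.deriv b.1, b.2.1.deriv', (closure_minimal support_deriv_subset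
    (isClosed_tsupport _)).trans b.2.2⟩

/-- The cutoff `b(s) / s ^ n`. -/
def TimeCutoff.divPow (n : ℕ) (b : TimeCutoff) : TimeCutoff :=
  ⟨fun s => b.1 s * ((s : ℂ) ^ n)⁻¹, by
    refine contDiff_iff_contDiffAt.2 fun s => ?_
    rcases le_or_gt s 0 with hs | hs
    · refine (contDiffAt_const (c := (0 : ℂ))).congr_of_eventuallyEq ?_
      filter_upwards [b.eventually_eq_zero hs] with y hy
      simp [hy]
    · refine b.2.1.contDiffAt.mul (ContDiffAt.inv ?_ ?_)
      · exact ((Complex.ofRealCLM.contDiff.of_le le_top).pow n).contDiffAt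
      · exact pow_ne_zero _ (by exact_mod_cast hs.ne'),
   (closure_mono (Function.support_mul_subset_left _ _)).trans b.2.2⟩

theorem TimeCutoff.exists_bound (b : TimeCutoff) : ∃ C : ℝ, 0 ≤ C ∧ ∀ s, ‖b.1 s‖ ≤ C := by
  have hc : HasCompactSupport b.1 := isCompact_Icc.of_isClosed_subset (isClosed_tsupport _) b.2.2
  obtain ⟨C, hC⟩ := b.2.1.continuous.bounded_above_of_compact_support hc
  exact ⟨C, (norm_nonneg _).trans (hC 0), hC⟩

/-- The family `b(s) l^{-q} V_{h^{(j)}}(l, s)` that contains the amplitudes and is closed under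
differentiation. -/
def ampFamily (h : smoothDyadic) (i : TimeCutoff × ℕ × ℕ) (l s : ℝ) : ℂ :=
  i.1.1 s * ((l : ℂ) ^ i.2.1)⁻¹ * freeEvol (derivDyadic^[i.2.2] h) l s

/-- The coefficients of `∂_l`. -/
def ampDl (i : TimeCutoff × ℕ × ℕ) : TimeCutoff × ℕ × ℕ →₀ ℂ :=
  Finsupp.single (i.1, i.2.1 + 1, i.2.2) (-(i.2.1 : ℂ)) +
    Finsupp.single (i.1.divPow 1, i.2.1 + 2, i.2.2 + 2) (Complex.I / 4)

/-- The coefficients of `∂_s`. -/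
def ampDs (i : TimeCutoff × ℕ × ℕ) : TimeCutoff × ℕ × ℕ →₀ ℂ :=
  Finsupp.single (i.1.deriv, i.2.1, i.2.2) 1 +
    Finsupp.single (i.1.divPow 1, i.2.1, i.2.2) (-(1 / 2)) +
    Finsupp.single (i.1.divPow 2, i.2.1, i.2.2 + 1) (-(1 / 2)) +
    Finsupp.single (i.1.divPow 2, i.2.1 + 1, i.2.2 + 2) (Complex.I / 4)

theorem continuousAt_freeEvol (h : smoothDyadic) {l s : ℝ} (hs : 0 < s) :
    ContinuousAt (fun p : ℝ × ℝ => freeEvol h p.1 p.2) (l, s) := by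
  unfold freeEvol
  have h1 : ContinuousAt (fun p : ℝ × ℝ => -(p.1 / (4 * p.2))) (l, s) :=
    (continuousAt_fst.div (continuousAt_const.mul continuousAt_snd) (by simpa using hs.ne')).neg
  have h2 : Continuous fun p : ℝ × ℝ => oscInt h p.1 (p.1 * p.2) :=
    (continuous_oscInt h).comp (f := fun p : ℝ × ℝ => (p.1, p.1 * p.2)) (by fun_prop)
  refine ContinuousAt.mul (ContinuousAt.mul ?_ ?_) h2.continuousAt
  · fun_prop
  · exact (((Complex.continuous_ofReal.continuousAt).comp h1).mul continuousAt_const).cexp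

theorem derivClosed_ampFamily (h : smoothDyadic) : DerivClosed (ampFamily h) ampDl ampDs where
  deriv_left := by
    rintro ⟨b, q, j⟩ l s hl
    have hl' : (l : ℂ) ≠ 0 := by exact_mod_cast hl.ne'
    rcases le_or_gt s 0 with hs | hs
    · simpa [ampFamily, ampDl, TimeCutoff.eq_zero _ hs] using hasDerivAt_const l (0:ℂ)
    have hs' : (s : ℂ) ≠ 0 := by exact_mod_cast hs.ne'
    have h1 : HasDerivAt (fun l : ℝ => ((l : ℂ) ^ q)⁻¹) (-q * ((l : ℂ) ^ (q + 1))⁻¹) l := by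
      have h2 := ((hasDerivAt_pow q (l : ℂ)).comp_ofReal).inv (pow_ne_zero q hl')
      refine h2.congr_deriv ?_
      rcases q with _ | q
      · simp
      · rw [Nat.add_sub_cancel]; push_cast; field_simp; ring
    refine ((h1.const_mul (b.1 s)).mul (hasDerivAt_freeEvol_left (derivDyadic^[j] h) hl hs)).congr_deriv ?_
    simp only [ampDl, map_add, Finsupp.linearCombination_single, Pi.add_apply, Pi.smul_apply,
      ampFamily, TimeCutoff.divPow, smul_eq_mul, Function.iterate_succ_apply']
    field_simp
    ring
  deriv_right := by
    rintro ⟨b, q, j⟩ l s hl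
    have hl' : (l : ℂ) ≠ 0 := by exact_mod_cast hl.ne'
    rcases le_or_gt s 0 with hs | hs
    · have : (fun s => ampFamily h (b, q, j) l s) =ᶠ[nhds s] fun _ => 0 := by
        filter_upwards [b.eventually_eq_zero hs] with y hy
        simp [ampFamily, hy]
      refine ((hasDerivAt_const s (0:ℂ)).congr_of_eventuallyEq this).congr_deriv ?_
      simp [ampFamily, ampDs, TimeCutoff.eq_zero _ hs]
    have hs' : (s : ℂ) ≠ 0 := by exact_mod_cast hs.ne'
    have h1 : HasDerivAt b.1 (b.deriv.1 s) s := (b.2.1.differentiable (by simp) s).hasDerivAt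
    refine ((h1.mul_const _).mul (hasDerivAt_freeEvol_right (derivDyadic^[j] h) hl hs)).congr_deriv ?_
    simp only [ampDs, map_add, Finsupp.linearCombination_single, Pi.add_apply, Pi.smul_apply,
      ampFamily, TimeCutoff.divPow, smul_eq_mul, Function.iterate_succ_apply']
    field_simp
    ring
  continuousOn := by
    rintro ⟨b, q, j⟩ ⟨l, s⟩ ⟨hl, -⟩
    have hl' : (l : ℂ) ≠ 0 := by exact_mod_cast (ne_of_gt hl)
    refine ContinuousAt.continuousWithinAt ?_
    rcases le_or_gt s 0 with hs | hs
    · refine (continuousAt_const (y := (0:ℂ))).congr ?_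
      filter_upwards [continuousAt_snd.eventually (b.eventually_eq_zero hs)] with p hp
      simp [ampFamily, Function.uncurry, hp]
    · refine ContinuousAt.mul (ContinuousAt.mul ?_ ?_) (continuousAt_freeEvol _ hs)
      · exact (b.2.1.continuous.comp continuous_snd).continuousAt
      · refine ContinuousAt.inv₀ ?_ (pow_ne_zero _ hl')
        exact (Continuous.pow (Complex.continuous_ofReal.comp continuous_fst) q).continuousAt

/-- Each `∂_l` gains a factor `1 / l` and costs at most two derivatives of `h`, each `∂_s` costs at
most two derivatives; one further derivative is used by the uniform bound for `freeEvol`. -/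
theorem exists_norm_mixedDeriv_ampFamily_le (b : TimeCutoff) (N₁ N₂ : ℕ) :
    ∃ C : ℝ, 0 ≤ C ∧ ∀ (h : smoothDyadic) (l : ℝ), 1 ≤ l → ∀ s : ℝ,
      ‖mixedDeriv N₁ N₂ (ampFamily h (b, 0, 0)) l s‖ ≤
        C * ((l ^ N₂)⁻¹ * cNorm (2 * (N₁ + N₂) + 1) h.1) := by
  choose B hB0 hB using TimeCutoff.exists_bound
  set x : TimeCutoff × ℕ × ℕ →₀ ℂ := (Finsupp.linearCombination ℂ ampDs)^[N₁]
        ((Finsupp.linearCombination ℂ ampDl)^[N₂] (Finsupp.single (b, 0, 0) 1)) with hx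
  have hs0 : Finsupp.single (b, 0, 0) (1:ℂ) ∈
      Finsupp.supported ℂ ℂ {i : TimeCutoff × ℕ × ℕ | 0 ≤ i.2.1 ∧ i.2.2 ≤ 2 * 0} :=
    Finsupp.single_mem_supported ℂ _ ⟨le_rfl, le_rfl⟩
  -- An index `(b, q, j)` reached by `n` derivatives `∂_l` has `q ≥ n` and `j ≤ 2 n`.
  have hs1 := iterate_mem_supported (D := ampDl)
    (A := fun n => {i : TimeCutoff × ℕ × ℕ | n ≤ i.2.1 ∧ i.2.2 ≤ 2 * n}) (by
      rintro n ⟨b, q, j⟩ ⟨hq, hj⟩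
      simp only at hq hj
      refine Submodule.add_mem _ (Finsupp.single_mem_supported ℂ _ ⟨?_, ?_⟩)
        (Finsupp.single_mem_supported ℂ _ ⟨?_, ?_⟩) <;> simp only <;> lia) hs0 N₂
  rw [zero_add] at hs1
  -- The derivatives `∂_s` do not lower `q` and raise `j` by at most `2` each.
  have hs2 := iterate_mem_supported (D := ampDs) (k := 0)
    (A := fun n => {i : TimeCutoff × ℕ × ℕ | N₂ ≤ i.2.1 ∧ i.2.2 ≤ 2 * (n + N₂)}) (by
      rintro n ⟨b, q, j⟩ ⟨hq, hj⟩
      simp only at hq hj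
      refine Submodule.add_mem _ (Submodule.add_mem _ (Submodule.add_mem _
        (Finsupp.single_mem_supported ℂ _ ⟨?_, ?_⟩) (Finsupp.single_mem_supported ℂ _ ⟨?_, ?_⟩))
        (Finsupp.single_mem_supported ℂ _ ⟨?_, ?_⟩)) (Finsupp.single_mem_supported ℂ _ ⟨?_, ?_⟩)
        <;> simp only <;> lia) (by simpa using hs1) N₁
  rw [zero_add] at hs2
  refine ⟨∑ i ∈ x.support, ‖x i‖ * (12 * B i.1), Finset.sum_nonneg fun i _ => ?_, ?_⟩
  · have := hB0 i.1
    positivity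
  intro h l hl s
  have hl0 : 0 < l := by linarith
  have h1 := (derivClosed_ampFamily h).mixedDeriv_eq N₁ N₂ (Finsupp.single (b, 0, 0) 1) hl0 s
  rw [Finsupp.linearCombination_single, one_smul, ← hx] at h1
  rw [h1]
  refine norm_linearCombination_le ?_ hs2
  rintro ⟨b, q, j⟩ ⟨hq, hj⟩
  simp only at hq hj
  have hcn := cNorm_nonneg (2 * (N₁ + N₂) + 1) h.1
  by_cases hs : s ∈ tsupport b.1
  · have h2 := norm_freeEvol_le (derivDyadic^[j] h) hl0 (b.2.2 hs).1
    have h3 : (⨆ t : ℝ, ‖(derivDyadic (derivDyadic^[j] h)).1 t‖) ≤ cNorm (2 * (N₁ + N₂) + 1) h.1 :=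
      ciSup_le fun t => by
        rw [← Function.iterate_succ_apply' derivDyadic]
        exact norm_iterate_le_cNorm h (by lia) t
    have h4 : (l ^ q)⁻¹ ≤ (l ^ N₂)⁻¹ := inv_anti₀ (by positivity) (pow_le_pow_right₀ hl hq)
    simp only [ampFamily, norm_mul, norm_inv, norm_pow, Complex.norm_real, Real.norm_of_nonneg hl0.le]
    calc _ ≤ B b * (l ^ N₂)⁻¹ * (12 * cNorm (2 * (N₁ + N₂) + 1) h.1) := by
          gcongr
          · exact mul_nonneg (hB0 b) (by positivity)
          · exact hB0 b
          · exact hB b s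
          · exact h2.trans (by gcongr)
      _ = _ := by ring
  · have : b.1 s = 0 := image_eq_zero_of_notMem_tsupport hs
    simp only [ampFamily, this, zero_mul, norm_zero]
    have := hB0 b
    positivity

/-- A bump function equal to `1` on `[1/8, 2]` with support in `[1/16, 33/16]`. -/
def timeBump : ContDiffBump (17 / 16 : ℝ) := ⟨15 / 16, 1, by norm_num, by norm_num⟩

theorem timeBump_eq_one {s : ℝ} (hs : s ∈ Icc (1 / 8 : ℝ) 2) : timeBump s = 1 := by
  refine timeBump.one_of_mem_closedBall ?_
  rw [Metric.mem_closedBall, Real.dist_eq, abs_le]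
  change -(15/16 : ℝ) ≤ _ ∧ _ ≤ (15/16 : ℝ)
  constructor <;> linarith [hs.1, hs.2]

theorem tsupport_timeBump : tsupport timeBump ⊆ Icc (1 / 16 : ℝ) (33 / 16) := by
  rw [timeBump.tsupport_eq, Real.closedBall_eq_Icc]
  change Icc (17 / 16 - 1 : ℝ) (17 / 16 + 1) ⊆ _
  norm_num

/-- The cutoff `ς / π` of the amplitudes. -/
def ampCutoff : TimeCutoff :=
  ⟨fun s => ((Real.pi⁻¹ : ℝ) : ℂ) * (timeBump s : ℂ),
    contDiff_const.mul ((Complex.ofRealCLM.contDiff.of_le le_top).comp timeBump.contDiff), by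
    refine (closure_mono (Function.support_mul_subset_right _ _)).trans ?_
    have : Function.support (fun s => (timeBump s : ℂ)) = Function.support timeBump := by
      ext s; simp
    rw [this]
    exact tsupport_timeBump.trans (Icc_subset_Icc_right (by norm_num))⟩

theorem ampFamily_add (h k : smoothDyadic) (b : TimeCutoff) : ampFamily (h + k) (b, 0, 0) =
    ampFamily h (b, 0, 0) + ampFamily k (b, 0, 0) := by
  funext l s
  simp only [ampFamily, freeEvol, Function.iterate_zero, id_eq, oscInt_add, Pi.add_apply]
  ring

theorem ampFamily_smul (c : ℂ) (h : smoothDyadic) (b : TimeCutoff) :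
    ampFamily (c • h) (b, 0, 0) = c • ampFamily h (b, 0, 0) := by
  funext l s
  simp only [ampFamily, freeEvol, Function.iterate_zero, id_eq, oscInt_smul, Pi.smul_apply,
    smul_eq_mul]
  ring

/-- The amplitudes `a_l(s)`. -/
def amplitude : smoothDyadic →ₗ[ℂ] (ℝ → ℝ → ℂ) where
  toFun g := ampFamily (mulVar g) (ampCutoff, 0, 0)
  map_add' g h := by rw [map_add, ampFamily_add]
  map_smul' c g := by rw [map_smul, ampFamily_smul]; rfl

theorem contDiffOn_amplitude (g : smoothDyadic) :
    ContDiffOn ℝ ∞ (fun q : ℝ × ℝ => amplitude g q.1 q.2) (Ioi 0 ×ˢ univ) := by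
  have := (derivClosed_ampFamily (mulVar g)).contDiffOn (Finsupp.single (ampCutoff, 0, 0) 1)
  rw [Finsupp.linearCombination_single, one_smul] at this
  exact this

theorem tsupport_amplitude (g : smoothDyadic) (l : ℝ) : tsupport (amplitude g l) ⊆ Icc (1/16) 4 := by
  refine (closure_mono ?_).trans ampCutoff.2.2
  intro s hs h0
  exact hs (by simp [amplitude, ampFamily, h0])

theorem exists_norm_mixedDeriv_amplitude_le : ∃ c : ℕ → ℝ, ∀ K N₁ N₂ : ℕ, 2 ≤ K →
    (N₁ + N₂ : ℝ) < ((K : ℝ) - 1) / 2 → ∀ (g : smoothDyadic) (l : ℝ), 1 ≤ l → ∀ s : ℝ,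
      ‖mixedDeriv N₁ N₂ (amplitude g) l s‖ ≤ c K * l ^ (-(N₂ : ℤ)) * cNorm K g := by
  choose C hC0 hC using exists_norm_mixedDeriv_ampFamily_le ampCutoff
  choose M hM0 hM using exists_cNorm_iterate_mulVar_le 1
  refine ⟨fun K => (∑ i ∈ Finset.range K, ∑ j ∈ Finset.range K, C i j) * M K, ?_⟩
  intro K N₁ N₂ hK hN g l hl s
  have hN' : 2 * (N₁ + N₂) + 1 < K := by
    have : (2 * (N₁ + N₂) + 1 : ℝ) < K := by linarith
    exact_mod_cast this
  have h1 := hC N₁ N₂ (mulVar g) l hl s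
  have h2 := hM K g
  have h3 := cNorm_mono hN'.le (mulVar g).1
  have h4 : C N₁ N₂ ≤ ∑ i ∈ Finset.range K, ∑ j ∈ Finset.range K, C i j :=
    (Finset.single_le_sum (f := fun j => C N₁ j) (fun j _ => hC0 _ _)
      (Finset.mem_range.2 (by lia : N₂ < K))).trans
    (Finset.single_le_sum (f := fun i => ∑ j ∈ Finset.range K, C i j)
      (fun i _ => Finset.sum_nonneg fun j _ => hC0 _ _) (Finset.mem_range.2 (by lia : N₁ < K)))
  have hl0 : 0 < l := by linarith
  have h5 := hC0 N₁ N₂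
  rw [zpow_neg, zpow_natCast]
  calc _ ≤ C N₁ N₂ * ((l ^ N₂)⁻¹ * (M K * cNorm K g.1)) := by
        refine h1.trans ?_
        gcongr
        exact h3.trans h2
    _ ≤ (∑ i ∈ Finset.range K, ∑ j ∈ Finset.range K, C i j) * ((l ^ N₂)⁻¹ * (M K * cNorm K g.1)) := by
        have := cNorm_nonneg K g.1
        have := hM0 K
        gcongr
    _ = _ := by ring

end Amplitude
end

noncomputable section

/-! ### Nonstationary phase -/

section NonstationaryPhase

theorem cNorm_succ (K : ℕ) (h : smoothDyadic) :
    cNorm (K + 1) h.1 = (⨆ t : ℝ, ‖h.1 t‖) + cNorm K (derivDyadic h).1 := by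
  unfold cNorm
  rw [Finset.sum_range_succ' _ (K + 1), add_comm]
  simp only [derivDyadic_val, iteratedDeriv_succ', iteratedDeriv_zero]

theorem cNorm_zero (h : smoothDyadic) : cNorm 0 h.1 = ⨆ t : ℝ, ‖h.1 t‖ := by
  simp [cNorm]

theorem iSup_le_cNorm (K : ℕ) (h : smoothDyadic) : (⨆ t : ℝ, ‖h.1 t‖) ≤ cNorm K h.1 := by
  rw [← cNorm_zero]; exact cNorm_mono (Nat.zero_le _) _

theorem cNorm_add_le (K : ℕ) (h k : smoothDyadic) :
    cNorm K (h + k).1 ≤ cNorm K h.1 + cNorm K k.1 := by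
  have h0 : ∀ h k : smoothDyadic, (⨆ t : ℝ, ‖(h + k).1 t‖) ≤
      (⨆ t : ℝ, ‖h.1 t‖) + ⨆ t : ℝ, ‖k.1 t‖ := fun h k => ciSup_le fun t =>
    (norm_add_le _ _).trans (add_le_add (norm_dyadic_le h t) (norm_dyadic_le k t))
  induction K generalizing h k with
  | zero => simpa only [cNorm_zero] using h0 h k
  | succ K ih =>
    rw [cNorm_succ, cNorm_succ, cNorm_succ, map_add]
    linarith [h0 h k, ih (derivDyadic h) (derivDyadic k)]

theorem cNorm_smul (K : ℕ) (c : ℂ) (h : smoothDyadic) :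
    cNorm K (c • h).1 = ‖c‖ * cNorm K h.1 := by
  have h0 : ∀ h : smoothDyadic, (⨆ t : ℝ, ‖(c • h).1 t‖) = ‖c‖ * ⨆ t : ℝ, ‖h.1 t‖ := fun h => by
    rw [Real.mul_iSup_of_nonneg (norm_nonneg _)]
    exact iSup_congr fun t => norm_mul _ _
  induction K generalizing h with
  | zero => simpa only [cNorm_zero] using h0 h
  | succ K ih => rw [cNorm_succ, cNorm_succ, map_smul, h0, ih, mul_add]

/-- The frequencies `ξ` for which the phase `l t - ξ t ^ 2` has no critical point near `[1/2, 2]`. -/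
def IsFar (l ξ : ℝ) : Prop := 0 < l ∧ ξ / l ∉ Ioo (1 / 8 : ℝ) 2

/-- Away from the critical frequencies, the derivative of the phase is comparable to `l + |ξ|`. -/
theorem IsFar.le {l ξ : ℝ} (h : IsFar l ξ) {t : ℝ} (ht : t ∈ Icc (1 / 2 : ℝ) 2) :
    l + |ξ| ≤ 3 * |l - 2 * ξ * t| := by
  obtain ⟨hl, hξ⟩ := h
  obtain ⟨h1, h2⟩ := ht
  rcases le_total ξ 0 with h0 | h0
  · rw [abs_of_nonpos h0, abs_of_nonneg (by nlinarith)]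
    nlinarith
  rw [abs_of_nonneg h0]
  rcases le_or_gt (ξ / l) (1/8) with h3 | h3
  · rw [div_le_iff₀ hl] at h3
    have h4 := le_abs_self (l - 2 * ξ * t)
    nlinarith
  · have h4 : 2 ≤ ξ / l := by
      by_contra h5
      exact hξ ⟨h3, not_le.1 h5⟩
    rw [le_div_iff₀ hl] at h4
    have h5 := neg_le_abs (l - 2 * ξ * t)
    nlinarith

theorem IsFar.pos {l ξ : ℝ} (h : IsFar l ξ) : 0 < l + |ξ| :=
  add_pos_of_pos_of_nonneg h.1 (abs_nonneg _)

theorem IsFar.ne {l ξ : ℝ} (h : IsFar l ξ) {t : ℝ} (ht : t ∈ Icc (1 / 2 : ℝ) 2) :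
    l - 2 * ξ * t ≠ 0 := by
  intro h0
  have := h.le ht
  rw [h0, abs_zero, mul_zero] at this
  exact absurd h.pos (not_lt.2 this)

open scoped Classical in
/-- The quotient `(l + |ξ|) h(t) / (l - 2 ξ t)` by the normalised derivative of the phase. -/
def divPhase {l ξ : ℝ} (hf : IsFar l ξ) (h : smoothDyadic) : smoothDyadic :=
  ⟨fun t => h.1 t * (((l + |ξ|) / (l - 2 * ξ * t) : ℝ) : ℂ), by
    refine contDiff_iff_contDiffAt.2 fun t => ?_
    by_cases ht : t ∈ Icc (1 / 2 : ℝ) 2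
    · refine h.2.1.contDiffAt.mul ((Complex.ofRealCLM.contDiff.of_le le_top).contDiffAt.comp t ?_)
      refine contDiffAt_const.div ?_ (hf.ne ht)
      fun_prop
    · refine (contDiffAt_const (c := (0 : ℂ))).congr_of_eventuallyEq ?_
      filter_upwards [isClosed_Icc.isOpen_compl.mem_nhds ht] with y hy
      rw [smoothDyadic_eq_zero h fun h' => hy (Ioo_subset_Icc_self h'), zero_mul],
  (Function.support_mul_subset_left _ _).trans h.2.2⟩

/-- One step of integration by parts: `l + |ξ|` times the integral of `h` is an integral of the same
kind with `(divPhase h)'` in place of `h`. -/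
theorem oscInt_divPhase {l ξ : ℝ} (hf : IsFar l ξ) (h : smoothDyadic) :
    (l + |ξ| : ℝ) * oscInt h l ξ = Complex.I * oscInt (derivDyadic (divPhase hf h)) l ξ := by
  rw [← oscInt_by_parts]
  have h1 : ((l + |ξ| : ℝ) : ℂ) • h =
      (l : ℂ) • divPhase hf h + (-(2 * ξ) : ℂ) • mulVar (divPhase hf h) := by
    ext t
    change ((l + |ξ| : ℝ) : ℂ) * h.1 t = l * (h.1 t * (((l + |ξ|) / (l - 2 * ξ * t) : ℝ) : ℂ)) +
      (-(2 * ξ)) * (t * (h.1 t * (((l + |ξ|) / (l - 2 * ξ * t) : ℝ) : ℂ)))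
    by_cases ht : t ∈ Ioo (1 / 2 : ℝ) 2
    · have h2 : ((l - 2 * ξ * t : ℝ) : ℂ) ≠ 0 := by
        exact_mod_cast hf.ne (Ioo_subset_Icc_self ht)
      rw [Complex.ofReal_div]
      field_simp
      push_cast
      ring
    · simp [smoothDyadic_eq_zero h ht]
  have h2 := congrArg (fun k => oscInt k l ξ) h1
  simp only [oscInt_add, oscInt_smul] at h2
  rw [h2]
  ring

/-- Derivatives of the quotient are quotients again, with coefficients bounded uniformly in `l` and
`ξ`. -/
theorem derivDyadic_divPhase {l ξ : ℝ} (hf : IsFar l ξ) (h : smoothDyadic) :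
    derivDyadic (divPhase hf h) = divPhase hf (derivDyadic h) +
      ((2 * ξ / (l + |ξ|) : ℝ) : ℂ) • divPhase hf (divPhase hf h) := by
  ext t
  change deriv (fun t => h.1 t * (((l + |ξ|) / (l - 2 * ξ * t) : ℝ) : ℂ)) t =
    (derivDyadic h).1 t * (((l + |ξ|) / (l - 2 * ξ * t) : ℝ) : ℂ) +
    ((2 * ξ / (l + |ξ|) : ℝ) : ℂ) *
      (h.1 t * (((l + |ξ|) / (l - 2 * ξ * t) : ℝ) : ℂ) * (((l + |ξ|) / (l - 2 * ξ * t) : ℝ) : ℂ))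
  by_cases ht : t ∈ Icc (1 / 2 : ℝ) 2
  · have h0 := hf.ne ht
    have hp := hf.pos.ne'
    have h1 : HasDerivAt (fun t : ℝ => l - 2 * ξ * t) (-(2 * ξ)) t := by
      simpa using ((hasDerivAt_id t).const_mul (2 * ξ)).const_sub l
    have h2 : HasDerivAt (fun t : ℝ => (l + |ξ|) / (l - 2 * ξ * t))
        (2 * ξ / (l + |ξ|) * ((l + |ξ|) / (l - 2 * ξ * t)) * ((l + |ξ|) / (l - 2 * ξ * t))) t := by
      refine ((hasDerivAt_const t (l + |ξ|)).div h1 h0).congr_deriv ?_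
      field_simp
      ring
    refine ((hasDerivAt_dyadic h t).mul h2.ofReal_comp).deriv.trans ?_
    push_cast
    ring
  · have h1 : (fun t => h.1 t * (((l + |ξ|) / (l - 2 * ξ * t) : ℝ) : ℂ)) =ᶠ[nhds t] fun _ => 0 := by
      filter_upwards [isClosed_Icc.isOpen_compl.mem_nhds ht] with y hy
      rw [smoothDyadic_eq_zero h fun h' => hy (Ioo_subset_Icc_self h'), zero_mul]
    rw [h1.deriv_eq, smoothDyadic_eq_zero h fun h' => ht (Ioo_subset_Icc_self h'),
      smoothDyadic_eq_zero (derivDyadic h) fun h' => ht (Ioo_subset_Icc_self h')]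
    simp

/-- Division by the normalised derivative of the phase is bounded in every `C^K` norm, uniformly
over the far frequencies. -/
theorem exists_cNorm_divPhase_le (K : ℕ) : ∃ C : ℝ, 0 ≤ C ∧ ∀ {l ξ : ℝ} (hf : IsFar l ξ)
    (h : smoothDyadic), cNorm K (divPhase hf h).1 ≤ C * cNorm K h.1 := by
  have h0 : ∀ {l ξ : ℝ} (hf : IsFar l ξ) (h : smoothDyadic),
      (⨆ t : ℝ, ‖(divPhase hf h).1 t‖) ≤ 3 * ⨆ t : ℝ, ‖h.1 t‖ := by
    intro l ξ hf h
    refine ciSup_le fun t => ?_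
    change ‖h.1 t * (((l + |ξ|) / (l - 2 * ξ * t) : ℝ) : ℂ)‖ ≤ _
    by_cases ht : t ∈ Icc (1 / 2 : ℝ) 2
    · rw [norm_mul, Complex.norm_real, norm_div, Real.norm_of_nonneg hf.pos.le, Real.norm_eq_abs,
        mul_comm]
      refine mul_le_mul ?_ (norm_dyadic_le h t) (norm_nonneg _) (by norm_num)
      rw [div_le_iff₀ (abs_pos.2 (hf.ne ht))]
      exact hf.le ht
    · rw [smoothDyadic_eq_zero h fun h' => ht (Ioo_subset_Icc_self h'), zero_mul, norm_zero]
      exact mul_nonneg (by norm_num) (iSup_dyadic_nonneg _)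
  induction K with
  | zero => exact ⟨3, by norm_num, fun hf h => by simpa only [cNorm_zero] using h0 hf h⟩
  | succ K ih =>
    obtain ⟨C, hC0, hC⟩ := ih
    refine ⟨3 + C + 2 * (C * C), by positivity, fun {l ξ} hf h => ?_⟩
    have h1 : ‖((2 * ξ / (l + |ξ|) : ℝ) : ℂ)‖ ≤ 2 := by
      rw [Complex.norm_real, norm_div, Real.norm_of_nonneg hf.pos.le, div_le_iff₀ hf.pos, norm_mul,
        Real.norm_eq_abs ξ]
      simp only [Real.norm_ofNat]
      linarith [hf.1]
    have h2 : cNorm K (divPhase hf (divPhase hf h)).1 ≤ C * (C * cNorm (K + 1) h.1) :=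
      (hC hf _).trans (mul_le_mul_of_nonneg_left ((hC hf h).trans
        (mul_le_mul_of_nonneg_left (cNorm_mono (Nat.le_succ K) _) hC0)) hC0)
    have h3 : cNorm K (divPhase hf (derivDyadic h)).1 ≤ C * cNorm (K + 1) h.1 :=
      (hC hf _).trans (mul_le_mul_of_nonneg_left (cNorm_derivDyadic_le h K) hC0)
    have h4 := (h0 hf h).trans (mul_le_mul_of_nonneg_left (iSup_le_cNorm (K + 1) h) (by norm_num))
    rw [cNorm_succ, derivDyadic_divPhase]
    have h5 := cNorm_add_le K (divPhase hf (derivDyadic h))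
      (((2 * ξ / (l + |ξ|) : ℝ) : ℂ) • divPhase hf (divPhase hf h))
    rw [cNorm_smul] at h5
    have h6 := mul_le_mul h1 h2 (cNorm_nonneg _ _) (by norm_num)
    linarith

theorem norm_oscInt_le (h : smoothDyadic) (l ξ : ℝ) :
    ‖oscInt h l ξ‖ ≤ 2 * ⨆ t : ℝ, ‖h.1 t‖ := by
  have h0 := iSup_dyadic_nonneg h.1
  refine (intervalIntegral.norm_integral_le_of_norm_le_const (C := ⨆ t : ℝ, ‖h.1 t‖)
    fun t _ => ?_).trans ?_
  · rw [norm_mul, Complex.norm_exp_ofReal_mul_I, mul_one]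
    exact norm_dyadic_le h t
  · rw [mul_comm]
    refine mul_le_mul_of_nonneg_right ?_ h0
    norm_num

/-- Repeated integration by parts, away from the critical frequencies. -/
theorem exists_norm_oscInt_far_le (K : ℕ) : ∃ C : ℝ, 0 ≤ C ∧ ∀ {l ξ : ℝ} (_ : IsFar l ξ)
    (h : smoothDyadic), ‖oscInt h l ξ‖ ≤ C * ((l + |ξ|) ^ K)⁻¹ * cNorm K h.1 := by
  induction K with
  | zero =>
    refine ⟨2, by norm_num, fun _ h => ?_⟩
    rw [pow_zero, inv_one, mul_one, cNorm_zero]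
    exact norm_oscInt_le h _ _
  | succ K ih =>
    obtain ⟨C, hC0, hC⟩ := ih
    obtain ⟨D, hD0, hD⟩ := exists_cNorm_divPhase_le (K + 1)
    refine ⟨C * D, by positivity, fun {l ξ} hf h => ?_⟩
    have hp := hf.pos
    have h1 := congrArg norm (oscInt_divPhase hf h)
    rw [norm_mul, norm_mul, Complex.norm_I, one_mul, Complex.norm_real, Real.norm_of_nonneg hp.le] at h1
    have h2 := (hC hf (derivDyadic (divPhase hf h))).trans (mul_le_mul_of_nonneg_left
      ((cNorm_derivDyadic_le _ K).trans (hD hf h)) (by positivity))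
    rw [← h1, ← le_div_iff₀' hp] at h2
    refine h2.trans (le_of_eq ?_)
    field_simp
    ring

end NonstationaryPhase
end

noncomputable section

/-! ### The remainder -/

section Remainder

/-- The smooth functions that vanish on `(1/8, 2)` and are constant near infinity. -/
abbrev FarCutoff : Type := {η : ℝ → ℂ // ContDiff ℝ ∞ η ∧ (∀ σ ∈ Ioo (1 / 8 : ℝ) 2, η σ = 0) ∧
  ∃ c : ℂ, HasCompactSupport fun σ => η σ - c}

theorem FarCutoff.exists_bound (η : FarCutoff) : ∃ C : ℝ, 0 ≤ C ∧ ∀ σ, ‖η.1 σ‖ ≤ C := by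
  obtain ⟨c, hc⟩ := η.2.2.2
  obtain ⟨C, hC⟩ := (η.2.1.sub contDiff_const).continuous.bounded_above_of_compact_support hc
  refine ⟨C + ‖c‖, add_nonneg ((norm_nonneg _).trans (hC 0)) (norm_nonneg _), fun σ => ?_⟩
  calc ‖η.1 σ‖ = ‖(η.1 σ - c) + c‖ := by rw [sub_add_cancel]
    _ ≤ _ := (norm_add_le _ _).trans (add_le_add_left (hC σ) _)

/-- The cutoff `-σ η'(σ)`, which arises when `η(ξ / l)` is differentiated in `l`. -/
def FarCutoff.dilDeriv (η : FarCutoff) : FarCutoff :=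
  ⟨fun σ => -(σ : ℂ) * deriv η.1 σ,
    (Complex.ofRealCLM.contDiff.of_le le_top).neg.mul η.2.1.deriv', by
    intro σ hσ
    have : η.1 =ᶠ[nhds σ] fun _ => 0 := by
      filter_upwards [isOpen_Ioo.mem_nhds hσ] with y hy using η.2.2.1 y hy
    simp [this.deriv_eq], 0, by
    obtain ⟨c, hc⟩ := η.2.2.2
    have h1 : HasCompactSupport (deriv η.1) := by
      have := hc.deriv
      rwa [show deriv (fun σ => η.1 σ - c) = deriv η.1 from
        funext fun σ => deriv_sub_const c] at this
    simpa only [sub_zero] using! h1.mul_left (f := fun σ : ℝ => -(σ : ℂ))⟩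

/-- The integrand of the remainder and of its derivatives. -/
def farIntegrand (η : FarCutoff) (m : ℕ) (h : smoothDyadic) (l x ξ : ℝ) : ℂ :=
  η.1 (ξ / l) * (Complex.I * ξ) ^ m * oscInt h l ξ * Complex.exp ((ξ * x : ℝ) * Complex.I)

/-- `∫ η(ξ / l) (i ξ) ^ m W[h](l, ξ) exp(i ξ x) dξ`. -/
def farInt (η : FarCutoff) (m : ℕ) (h : smoothDyadic) (l x : ℝ) : ℂ :=
  ∫ ξ : ℝ, farIntegrand η m h l x ξ

/-- Each power of `ξ` costs one derivative of `h`, and so does each power of decay in `l + |ξ|`. -/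
theorem exists_norm_farIntegrand_le (η : FarCutoff) (m k : ℕ) : ∃ C : ℝ, 0 ≤ C ∧
    ∀ (h : smoothDyadic) (l : ℝ), 0 < l → ∀ x ξ : ℝ,
      ‖farIntegrand η m h l x ξ‖ ≤ C * cNorm (m + k) h.1 * ((l + |ξ|) ^ k)⁻¹ := by
  obtain ⟨B, hB0, hB⟩ := η.exists_bound
  obtain ⟨C, hC0, hC⟩ := exists_norm_oscInt_far_le (m + k)
  refine ⟨B * C, by positivity, fun h l hl x ξ => ?_⟩
  have hcn := cNorm_nonneg (m + k) h.1
  have hp : 0 < l + |ξ| := by positivity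
  by_cases hξ : ξ / l ∈ Ioo (1 / 8 : ℝ) 2
  · rw [farIntegrand, η.2.2.1 _ hξ]
    simp only [zero_mul, norm_zero]
    positivity
  · have h1 := hC ⟨hl, hξ⟩ h
    have h2 : |ξ| ^ m ≤ (l + |ξ|) ^ m := pow_le_pow_left₀ (abs_nonneg _) (by linarith) m
    rw [farIntegrand, norm_mul, Complex.norm_exp_ofReal_mul_I, mul_one, norm_mul, norm_mul, norm_pow,
      norm_mul, Complex.norm_I, one_mul, Complex.norm_real, Real.norm_eq_abs]
    calc _ ≤ B * (l + |ξ|) ^ m * (C * ((l + |ξ|) ^ (m + k))⁻¹ * cNorm (m + k) h.1) := by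
          gcongr
          exact hB _
      _ = _ := by
          rw [pow_add]
          field_simp

theorem integrable_inv_sq {l : ℝ} (hl : 0 < l) : Integrable fun ξ : ℝ => ((l + |ξ|) ^ 2)⁻¹ := by
  have h1 : Integrable fun ξ : ℝ => ((1 + |ξ|) ^ 2)⁻¹ := by
    have := integrable_one_add_norm (E := ℝ) (μ := volume) (r := 2) (by simp)
    refine this.congr (.of_forall fun ξ => ?_)
    simp only [Real.norm_eq_abs]
    rw [Real.rpow_neg (by positivity)]
    norm_cast
  have h2 := (h1.comp_div hl.ne').const_mul (l ^ 2)⁻¹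
  refine h2.congr (.of_forall fun ξ => ?_)
  simp only
  rw [← mul_inv, ← mul_pow, mul_add, mul_one, abs_div, abs_of_pos hl, mul_div_cancel₀ _ hl.ne']

theorem integral_inv_sq {l : ℝ} (hl : 0 < l) :
    ∫ ξ : ℝ, ((l + |ξ|) ^ 2)⁻¹ = l⁻¹ * ∫ ξ : ℝ, ((1 + |ξ|) ^ 2)⁻¹ := by
  have h1 := Measure.integral_comp_div (fun ξ : ℝ => ((1 + |ξ|) ^ 2)⁻¹) l
  have h2 : ∀ ξ : ℝ, ((l + |ξ|) ^ 2)⁻¹ = (l ^ 2)⁻¹ * ((1 + |ξ / l|) ^ 2)⁻¹ := fun ξ => by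
    rw [← mul_inv, ← mul_pow, mul_add, mul_one, abs_div, abs_of_pos hl, mul_div_cancel₀ _ hl.ne']
  simp only [h2]
  rw [integral_const_mul, h1, abs_of_pos hl, smul_eq_mul]
  field_simp

theorem continuous_farIntegrand (η : FarCutoff) (m : ℕ) (h : smoothDyadic) (l x : ℝ) :
    Continuous (farIntegrand η m h l x) := by
  have h1 : Continuous fun ξ => oscInt h l ξ :=
    (continuous_oscInt h).comp (Continuous.prodMk_right l)
  have h2 := η.2.1.continuous
  unfold farIntegrand
  fun_prop

theorem integrable_farIntegrand (η : FarCutoff) (m : ℕ) (h : smoothDyadic) {l : ℝ} (hl : 0 < l)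
    (x : ℝ) : Integrable (farIntegrand η m h l x) := by
  obtain ⟨C, -, hC⟩ := exists_norm_farIntegrand_le η m 2
  exact ((integrable_inv_sq hl).const_mul _).mono'
    (continuous_farIntegrand η m h l x).aestronglyMeasurable (.of_forall fun ξ => hC h l hl x ξ)

/-- Two powers of decay make the integral over `ξ` converge and contribute `1 / l`; the other `k`
powers are bounded by those of `1 / l`. -/
theorem exists_norm_farInt_le (η : FarCutoff) (m k : ℕ) : ∃ C : ℝ, 0 ≤ C ∧
    ∀ (h : smoothDyadic) (l : ℝ), 1 ≤ l → ∀ x : ℝ,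
      ‖farInt η m h l x‖ ≤ C * cNorm (m + (k + 2)) h.1 * (l ^ (k + 1))⁻¹ := by
  obtain ⟨C, hC0, hC⟩ := exists_norm_farIntegrand_le η m (k + 2)
  refine ⟨C * ∫ ξ : ℝ, ((1 + |ξ|) ^ 2)⁻¹,
    mul_nonneg hC0 (integral_nonneg fun ξ => by positivity), fun h l hl x => ?_⟩
  have hl0 : 0 < l := by linarith
  have hcn := cNorm_nonneg (m + (k + 2)) h.1
  refine (norm_integral_le_of_norm_le (((integrable_inv_sq hl0).const_mul
    (C * cNorm (m + (k + 2)) h.1 * (l ^ k)⁻¹))) (.of_forall fun ξ => ?_)).trans (le_of_eq ?_)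
  · refine (hC h l hl0 x ξ).trans ?_
    rw [mul_assoc _ (l ^ k)⁻¹, ← mul_inv, pow_add]
    gcongr
    linarith [abs_nonneg ξ]
  · rw [integral_const_mul, integral_inv_sq hl0]
    rw [pow_succ, mul_inv]
    ring

theorem hasDerivAt_farInt_left (η : FarCutoff) (m : ℕ) (h : smoothDyadic) {l : ℝ} (hl : 0 < l)
    (x : ℝ) : HasDerivAt (fun l => farInt η m h l x)
      ((l : ℂ)⁻¹ * farInt η.dilDeriv m h l x + Complex.I * farInt η m (mulVar h) l x) l := by
  obtain ⟨C, hC0, hC⟩ := exists_norm_farIntegrand_le η.dilDeriv m 2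
  obtain ⟨D, hD0, hD⟩ := exists_norm_farIntegrand_le η m 2
  have hl2 : 0 < l / 2 := by linarith
  have h1 := hasDerivAt_integral_of_dominated_loc_of_deriv_le (μ := volume)
    (F := fun l ξ => farIntegrand η m h l x ξ)
    (F' := fun l ξ => (l : ℂ)⁻¹ * farIntegrand η.dilDeriv m h l x ξ +
      Complex.I * farIntegrand η m (mulVar h) l x ξ) (x₀ := l) (s := Ioi (l / 2))
    (bound := fun ξ => ((l / 2)⁻¹ * (C * cNorm (m + 2) h.1) + D * cNorm (m + 2) (mulVar h).1) *
      ((l / 2 + |ξ|) ^ 2)⁻¹) (Ioi_mem_nhds (by linarith))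
    (.of_forall fun l => (continuous_farIntegrand η m h l x).aestronglyMeasurable)
    (integrable_farIntegrand η m h hl x)
    (((continuous_farIntegrand η.dilDeriv m h l x).const_smul (l : ℂ)⁻¹).add
      ((continuous_farIntegrand η m (mulVar h) l x).const_smul Complex.I)).aestronglyMeasurable
    (.of_forall fun ξ l' hl' => ?_) ((integrable_inv_sq hl2).const_mul _)
    (.of_forall fun ξ l' hl' => ?_)
  · refine h1.2.congr_deriv ?_
    rw [integral_add ((integrable_farIntegrand _ m h hl x).const_mul _)
      ((integrable_farIntegrand _ m _ hl x).const_mul _), integral_const_mul, integral_const_mul]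
    rfl
  · have hl'' : l / 2 < l' := hl'
    have hl0 : 0 < l' := by linarith
    have h2 := hC h l' hl0 x ξ
    have h3 := hD (mulVar h) l' hl0 x ξ
    have h4 : ((l' + |ξ|) ^ 2)⁻¹ ≤ ((l / 2 + |ξ|) ^ 2)⁻¹ := by gcongr
    have hc1 := cNorm_nonneg (m + 2) h.1
    have hc2 := cNorm_nonneg (m + 2) (mulVar h).1
    refine (norm_add_le _ _).trans ?_
    rw [norm_mul, norm_mul, Complex.norm_I, one_mul, norm_inv, Complex.norm_real,
      Real.norm_of_nonneg hl0.le, add_mul]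
    refine add_le_add ?_ (h3.trans (by gcongr))
    rw [mul_assoc (l / 2)⁻¹]
    exact mul_le_mul (inv_anti₀ hl2 hl''.le) (h2.trans (by gcongr)) (norm_nonneg _) (by positivity)
  · have hl'' : l / 2 < l' := hl'
    have hl0 : 0 < l' := by linarith
    have h2 : HasDerivAt (fun l : ℝ => ξ / l) (-(ξ / l' ^ 2)) l' := by
      refine ((hasDerivAt_inv hl0.ne').const_mul ξ).congr_deriv ?_
      field_simp
    have h3 : HasDerivAt η.1 (deriv η.1 (ξ / l')) (ξ / l') :=
      (η.2.1.differentiable (by simp) _).hasDerivAt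
    have h4 := (((h3.scomp l' h2).mul_const ((Complex.I * ξ) ^ m)).mul
      (hasDerivAt_oscInt_left h l' ξ)).mul_const (Complex.exp ((ξ * x : ℝ) * Complex.I))
    refine h4.congr_deriv ?_
    have hl' : (l' : ℂ) ≠ 0 := by exact_mod_cast hl0.ne'
    simp only [farIntegrand, FarCutoff.dilDeriv, Complex.real_smul, Function.comp_apply]
    push_cast
    field_simp

theorem hasDerivAt_farInt_right (η : FarCutoff) (m : ℕ) (h : smoothDyadic) {l : ℝ} (hl : 0 < l)
    (x : ℝ) : HasDerivAt (fun x => farInt η m h l x) (farInt η (m + 1) h l x) x := by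
  obtain ⟨D, hD0, hD⟩ := exists_norm_farIntegrand_le η (m + 1) 2
  refine (hasDerivAt_integral_of_dominated_loc_of_deriv_le (μ := volume)
    (F := fun x ξ => farIntegrand η m h l x ξ)
    (F' := fun x ξ => farIntegrand η (m + 1) h l x ξ) (x₀ := x) (s := univ)
    (bound := fun ξ => D * cNorm (m + 1 + 2) h.1 * ((l + |ξ|) ^ 2)⁻¹) Filter.univ_mem
    (.of_forall fun x => (continuous_farIntegrand η m h l x).aestronglyMeasurable)
    (integrable_farIntegrand η m h hl x)
    (continuous_farIntegrand η (m + 1) h l x).aestronglyMeasurable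
    (.of_forall fun ξ x' _ => hD h l hl x' ξ) ((integrable_inv_sq hl).const_mul _)
    (.of_forall fun ξ x' _ => ?_)).2
  have h2 : HasDerivAt (fun x : ℝ => ξ * x) ξ x' := by
    simpa using (hasDerivAt_id x').const_mul ξ
  have h3 := ((h2.ofReal_comp.mul_const Complex.I).cexp).const_mul
    (η.1 (ξ / l) * (Complex.I * ξ) ^ m * oscInt h l ξ)
  refine h3.congr_deriv ?_
  simp only [farIntegrand]
  ring

theorem continuousOn_farInt (η : FarCutoff) (m : ℕ) (h : smoothDyadic) :
    ContinuousOn (fun p : ℝ × ℝ => farInt η m h p.1 p.2) (Ioi 0 ×ˢ univ) := by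
  rintro ⟨l, x⟩ ⟨hl, -⟩
  have hl : 0 < l := hl
  obtain ⟨C, hC0, hC⟩ := exists_norm_farIntegrand_le η m 2
  have hl2 : 0 < l / 2 := by linarith
  refine ContinuousAt.continuousWithinAt (continuousAt_of_dominated
    (bound := fun ξ => C * cNorm (m + 2) h.1 * ((l / 2 + |ξ|) ^ 2)⁻¹)
    (.of_forall fun p => (continuous_farIntegrand η m h p.1 p.2).aestronglyMeasurable) ?_
    ((integrable_inv_sq hl2).const_mul _) (.of_forall fun ξ => ?_))
  · have : ∀ᶠ p : ℝ × ℝ in nhds (l, x), l / 2 < p.1 :=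
      (isOpen_lt continuous_const continuous_fst).mem_nhds (by simp; linarith)
    filter_upwards [this] with p hp
    refine .of_forall fun ξ => (hC h p.1 (by linarith) p.2 ξ).trans ?_
    have := cNorm_nonneg (m + 2) h.1
    gcongr
  · unfold farIntegrand
    have h1 : ContinuousAt (fun p : ℝ × ℝ => ξ / p.1) (l, x) :=
      continuousAt_const.div continuousAt_fst hl.ne'
    have h2 : Continuous fun p : ℝ × ℝ => oscInt h p.1 ξ :=
      (continuous_oscInt h).comp (f := fun p : ℝ × ℝ => (p.1, ξ)) (by fun_prop)
    have h3 : ContinuousAt (fun p : ℝ × ℝ => η.1 (ξ / p.1)) (l, x) :=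
      ContinuousAt.comp (f := fun p : ℝ × ℝ => ξ / p.1) η.2.1.continuous.continuousAt h1
    exact ((h3.mul continuousAt_const).mul h2.continuousAt).mul (by fun_prop)

/-- The smooth functions with compact support on `ℝ`. -/
abbrev SpectralCutoff : Type := {χ : ℝ → ℂ // ContDiff ℝ ∞ χ ∧ HasCompactSupport χ}

/-- The derivative of a cutoff. -/
def SpectralCutoff.deriv (χ : SpectralCutoff) : SpectralCutoff :=
  ⟨_root_.deriv χ.1, χ.2.1.deriv', χ.2.2.deriv⟩

theorem SpectralCutoff.exists_bound (χ : SpectralCutoff) : ∃ C : ℝ, 0 ≤ C ∧ ∀ s, ‖χ.1 s‖ ≤ C := by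
  obtain ⟨C, hC⟩ := χ.2.1.continuous.bounded_above_of_compact_support χ.2.2
  exact ⟨C, (norm_nonneg _).trans (hC 0), hC⟩

/-- The indices `(χ, q, m, η, j)` of the functions
`χ(x) l^{-q} ∫ η(ξ / l) (i ξ) ^ m W[t ^ j h](l, ξ) exp(i ξ x) dξ`. -/
abbrev RemIndex : Type := SpectralCutoff × ℕ × ℕ × FarCutoff × ℕ

/-- The family that contains the remainders and is closed under differentiation. It is extended
by zero to `l ≤ 0`. -/
def remFamily (h : smoothDyadic) (i : RemIndex) (l x : ℝ) : ℂ :=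
  if 0 < l then i.1.1 x * ((l : ℂ) ^ i.2.1)⁻¹ * farInt i.2.2.2.1 i.2.2.1 (mulVar^[i.2.2.2.2] h) l x
  else 0

/-- The coefficients of `∂_l`. -/
def remDl (i : RemIndex) : RemIndex →₀ ℂ :=
  Finsupp.single (i.1, i.2.1 + 1, i.2.2.1, i.2.2.2.1, i.2.2.2.2) (-(i.2.1 : ℂ)) +
    Finsupp.single (i.1, i.2.1 + 1, i.2.2.1, i.2.2.2.1.dilDeriv, i.2.2.2.2) 1 +
    Finsupp.single (i.1, i.2.1, i.2.2.1, i.2.2.2.1, i.2.2.2.2 + 1) Complex.I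

/-- The coefficients of `∂_x`. -/
def remDx (i : RemIndex) : RemIndex →₀ ℂ :=
  Finsupp.single (i.1.deriv, i.2.1, i.2.2.1, i.2.2.2.1, i.2.2.2.2) 1 +
    Finsupp.single (i.1, i.2.1, i.2.2.1 + 1, i.2.2.2.1, i.2.2.2.2) 1

theorem derivClosed_remFamily (h : smoothDyadic) : DerivClosed (remFamily h) remDl remDx where
  deriv_left := by
    rintro ⟨χ, q, m, η, j⟩ l x hl
    have hl' : (l : ℂ) ≠ 0 := by exact_mod_cast hl.ne'
    have h1 : HasDerivAt (fun l : ℝ => ((l : ℂ) ^ q)⁻¹) (-q * ((l : ℂ) ^ (q + 1))⁻¹) l := by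
      have h2 := ((hasDerivAt_pow q (l : ℂ)).comp_ofReal).inv (pow_ne_zero q hl')
      refine h2.congr_deriv ?_
      rcases q with _ | q
      · simp
      · rw [Nat.add_sub_cancel]; push_cast; field_simp; ring
    refine (((h1.const_mul (χ.1 x)).mul (hasDerivAt_farInt_left η m (mulVar^[j] h) hl x)
      ).congr_of_eventuallyEq ?_).congr_deriv ?_
    · filter_upwards [lt_mem_nhds hl] with y hy
      simp [remFamily, hy]
    · simp only [remDl, map_add, Finsupp.linearCombination_single, Pi.add_apply, Pi.smul_apply,
        remFamily, if_pos hl, smul_eq_mul, Function.iterate_succ_apply']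
      field_simp
      ring
  deriv_right := by
    rintro ⟨χ, q, m, η, j⟩ l x hl
    have h1 : HasDerivAt χ.1 (χ.deriv.1 x) x := (χ.2.1.differentiable (by simp) x).hasDerivAt
    simp only [remDx, map_add, Finsupp.linearCombination_single, Pi.add_apply, Pi.smul_apply,
      remFamily, if_pos hl, smul_eq_mul]
    refine ((h1.mul_const _).mul (hasDerivAt_farInt_right η m (mulVar^[j] h) hl x)).congr_deriv ?_
    ring
  continuousOn := by
    rintro ⟨χ, q, m, η, j⟩
    have : ContinuousOn (fun p : ℝ × ℝ => χ.1 p.2 * ((p.1 : ℂ) ^ q)⁻¹ *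
        farInt η m (mulVar^[j] h) p.1 p.2) (Ioi 0 ×ˢ univ) := by
      refine ContinuousOn.mul (ContinuousOn.mul ?_ ?_) (continuousOn_farInt _ _ _)
      · exact (χ.2.1.continuous.comp continuous_snd).continuousOn
      · refine ContinuousOn.inv₀ (Continuous.continuousOn (by fun_prop)) ?_
        rintro ⟨l, x⟩ ⟨hl, -⟩
        exact pow_ne_zero _ (by exact_mod_cast (ne_of_gt hl))
    refine this.congr ?_
    rintro ⟨l, x⟩ ⟨hl, -⟩
    exact if_pos hl

/-- Only `∂_x` produces powers of `ξ`, hence losses of `l`. The operator `∂_l` produces factors `t`,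
derivatives of the cutoff and factors `1 / l`, which are harmless. -/
theorem exists_norm_mixedDeriv_remFamily_le (χ : SpectralCutoff) (η : FarCutoff) (K N₁ N₂ : ℕ)
    (hN : N₁ + 2 ≤ K) : ∃ C : ℝ, 0 ≤ C ∧ ∀ (h : smoothDyadic) (l : ℝ), 1 ≤ l → ∀ x : ℝ,
      ‖mixedDeriv N₁ N₂ (remFamily h (χ, 0, 0, η, 0)) l x‖ ≤
        C * (l ^ ((N₁ : ℤ) + 1 - K) * cNorm K h.1) := by
  choose B hB0 hB using SpectralCutoff.exists_bound
  choose D hD0 hD using exists_norm_farInt_le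
  choose M hM0 hM using fun j => exists_cNorm_iterate_mulVar_le j K
  set x : RemIndex →₀ ℂ := (Finsupp.linearCombination ℂ remDx)^[N₁]
        ((Finsupp.linearCombination ℂ remDl)^[N₂] (Finsupp.single (χ, 0, 0, η, 0) 1)) with hx
  -- The exponent `m` of `ξ` stays zero under `∂_l` and is at most `N₁` after `N₁` derivatives `∂_x`.
  have hs1 := iterate_mem_supported (D := remDl) (k := 0) (x := Finsupp.single (χ, 0, 0, η, 0) 1)
    (A := fun _ => {i : RemIndex | i.2.2.1 ≤ 0}) (by
      rintro n ⟨χ, q, m, η, j⟩ hm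
      exact Submodule.add_mem _ (Submodule.add_mem _ (Finsupp.single_mem_supported ℂ _ hm)
        (Finsupp.single_mem_supported ℂ _ hm)) (Finsupp.single_mem_supported ℂ _ hm))
      (Finsupp.single_mem_supported ℂ _ (le_refl 0)) N₂
  have hs2 := iterate_mem_supported (D := remDx) (k := 0)
    (A := fun n => {i : RemIndex | i.2.2.1 ≤ n}) (by
      rintro n ⟨χ, q, m, η, j⟩ hm
      exact Submodule.add_mem _ (Finsupp.single_mem_supported ℂ _ (Nat.le_succ_of_le hm))
        (Finsupp.single_mem_supported ℂ _ (Nat.succ_le_succ hm))) hs1 N₁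
  rw [zero_add] at hs2
  refine ⟨∑ i ∈ x.support, ‖x i‖ * (B i.1 * (D i.2.2.2.1 i.2.2.1 (K - 2 - i.2.2.1) * M i.2.2.2.2)),
    Finset.sum_nonneg fun i _ => ?_, ?_⟩
  · have := hB0 i.1
    have := hD0 i.2.2.2.1 i.2.2.1 (K - 2 - i.2.2.1)
    have := hM0 i.2.2.2.2
    positivity
  intro h l hl s
  have hl0 : 0 < l := by linarith
  have h1 := (derivClosed_remFamily h).mixedDeriv_eq N₁ N₂ (Finsupp.single (χ, 0, 0, η, 0) 1) hl0 s
  rw [Finsupp.linearCombination_single, one_smul, ← hx] at h1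
  rw [h1]
  refine norm_linearCombination_le ?_ hs2
  rintro ⟨χ, q, m, η, j⟩ hm
  have hm : m ≤ N₁ := hm
  have hcn := cNorm_nonneg K h.1
  -- All `K` derivatives are spent: `m` on powers of `ξ`, two on convergence, the others on decay.
  have h2 := hD η m (K - 2 - m) (mulVar^[j] h) l hl s
  rw [show m + (K - 2 - m + 2) = K by lia] at h2
  have h3 : (l ^ (K - 2 - m + 1))⁻¹ ≤ l ^ ((N₁ : ℤ) + 1 - K) := by
    rw [← zpow_natCast, ← zpow_neg]
    exact zpow_le_zpow_right₀ hl (by lia)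
  have h4 : (l ^ q)⁻¹ ≤ 1 := inv_le_one_of_one_le₀ (one_le_pow₀ hl)
  have h5 := hB0 χ
  have h6 := hD0 η m (K - 2 - m)
  have h7 := hM0 j
  simp only [remFamily, if_pos hl0, norm_mul, norm_inv, norm_pow, Complex.norm_real,
    Real.norm_of_nonneg hl0.le]
  calc _ ≤ B χ * 1 * (D η m (K - 2 - m) * (M j * cNorm K h.1) * l ^ ((N₁ : ℤ) + 1 - K)) := by
        gcongr
        · exact hB χ s
        · refine h2.trans ?_
          gcongr
          exact hM j h
    _ = _ := by ring

end Remainder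
end

noncomputable section

section Remainder

/-- The cutoff `1 - ς`. -/
def farCutoff : FarCutoff :=
  ⟨fun σ => 1 - (timeBump σ : ℂ),
    contDiff_const.sub ((Complex.ofRealCLM.contDiff.of_le le_top).comp timeBump.contDiff),
    fun σ hσ => by simp [timeBump_eq_one (Ioo_subset_Icc_self hσ)], 1, by
    have : HasCompactSupport fun σ => (timeBump σ : ℂ) :=
      timeBump.hasCompactSupport.comp_left (g := fun x : ℝ => (x : ℂ)) Complex.ofReal_zero
    simpa using! this.neg⟩

/-- The cutoff `χ₁ / π`. -/
def remCutoff {χ : ℝ → ℂ} (hχ : ContDiff ℝ ∞ χ) (hc : HasCompactSupport χ) : SpectralCutoff :=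
  ⟨fun x => ((Real.pi⁻¹ : ℝ) : ℂ) * χ x, contDiff_const.mul hχ,
    hc.mul_left (f := fun _ => ((Real.pi⁻¹ : ℝ) : ℂ))⟩

theorem farInt_add (η : FarCutoff) (h k : smoothDyadic) {l : ℝ} (hl : 0 < l) (x : ℝ) :
    farInt η 0 (h + k) l x = farInt η 0 h l x + farInt η 0 k l x := by
  unfold farInt
  rw [← integral_add (integrable_farIntegrand η 0 h hl x) (integrable_farIntegrand η 0 k hl x)]
  refine integral_congr_ae (.of_forall fun ξ => ?_)
  simp only [farIntegrand, oscInt_add]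
  ring

theorem farInt_smul (η : FarCutoff) (c : ℂ) (h : smoothDyadic) (l x : ℝ) :
    farInt η 0 (c • h) l x = c * farInt η 0 h l x := by
  unfold farInt
  rw [← integral_const_mul]
  refine integral_congr_ae (.of_forall fun ξ => ?_)
  simp only [farIntegrand, oscInt_smul]
  ring

variable {χ : ℝ → ℂ} (hχ : ContDiff ℝ ∞ χ) (hc : HasCompactSupport χ)

/-- The remainders `ρ_l(x)`. -/
def remainder : smoothDyadic →ₗ[ℂ] (ℝ → ℝ → ℂ) where
  toFun g := remFamily (mulVar g) (remCutoff hχ hc, 0, 0, farCutoff, 0)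
  map_add' g h := by
    funext l x
    rw [map_add]
    by_cases hl : 0 < l
    · simp only [remFamily, if_pos hl, Function.iterate_zero, id_eq, Pi.add_apply, farInt_add _ _ _ hl]
      ring
    · simp [remFamily, hl]
  map_smul' c g := by
    funext l x
    rw [map_smul]
    by_cases hl : 0 < l
    · simp only [remFamily, if_pos hl, Function.iterate_zero, id_eq, Pi.smul_apply, farInt_smul,
        smul_eq_mul, RingHom.id_apply]
      ring
    · simp [remFamily, hl]

theorem remainder_apply (g : smoothDyadic) {l : ℝ} (hl : 0 < l) (x : ℝ) :
    remainder hχ hc g l x =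
      ((Real.pi⁻¹ : ℝ) : ℂ) * χ x * farInt farCutoff 0 (mulVar g) l x := by
  change remFamily _ _ l x = _
  simp [remFamily, hl, remCutoff]

theorem contDiffOn_remainder (g : smoothDyadic) :
    ContDiffOn ℝ ∞ (fun q : ℝ × ℝ => remainder hχ hc g q.1 q.2) (Ioi 0 ×ˢ univ) := by
  have := (derivClosed_remFamily (mulVar g)).contDiffOn
    (Finsupp.single (remCutoff hχ hc, 0, 0, farCutoff, 0) 1)
  rw [Finsupp.linearCombination_single, one_smul] at this
  exact this

theorem contDiff_remainder (g : smoothDyadic) (l : ℝ) : ContDiff ℝ ∞ (remainder hχ hc g l) := by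
  by_cases hl : 0 < l
  · rw [← contDiffOn_univ]
    exact (contDiffOn_remainder hχ hc g).comp (f := fun x : ℝ => (l, x)) (by fun_prop)
      fun x _ => ⟨hl, mem_univ _⟩
  · have : remainder hχ hc g l = fun _ => 0 := by
      funext x
      change remFamily _ _ l x = _
      simp [remFamily, hl]
    rw [this]
    exact contDiff_const

theorem remainder_eq_zero (g : smoothDyadic) (l : ℝ) {x : ℝ} (hx : χ x = 0) :
    remainder hχ hc g l x = 0 := by
  change remFamily _ _ l x = _
  simp [remFamily, remCutoff, hx]

theorem tsupport_remainder (g : smoothDyadic) (l : ℝ) :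
    tsupport (remainder hχ hc g l) ⊆ tsupport χ :=
  closure_mono fun _ hs h0 => hs (remainder_eq_zero hχ hc g l h0)

theorem hasCompactSupport_remainder (g : smoothDyadic) (l : ℝ) :
    HasCompactSupport (remainder hχ hc g l) :=
  IsCompact.of_isClosed_subset hc (isClosed_tsupport _) (tsupport_remainder hχ hc g l)

/-- The constant may depend on `N₂` but not on `N₁`, which takes finitely many values for given `K`.
-/
theorem exists_norm_mixedDeriv_remainder_le : ∃ c : ℕ → ℕ → ℝ, ∀ K N₁ N₂ : ℕ, 2 ≤ K →
    N₁ ≤ K - 2 → ∀ (g : smoothDyadic) (l : ℝ), 1 ≤ l → ∀ s : ℝ,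
      ‖mixedDeriv N₁ N₂ (remainder hχ hc g) l s‖ ≤
        c K N₂ * l ^ ((N₁ : ℤ) + 1 - K) * cNorm K g := by
  have key : ∀ K N₁ N₂ : ℕ, ∃ C : ℝ, 0 ≤ C ∧ (N₁ + 2 ≤ K → ∀ (h : smoothDyadic) (l : ℝ), 1 ≤ l →
      ∀ x : ℝ, ‖mixedDeriv N₁ N₂ (remFamily h (remCutoff hχ hc, 0, 0, farCutoff, 0)) l x‖ ≤
        C * (l ^ ((N₁ : ℤ) + 1 - K) * cNorm K h.1)) := by
    intro K N₁ N₂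
    by_cases hN : N₁ + 2 ≤ K
    · obtain ⟨C, hC0, hC⟩ :=
        exists_norm_mixedDeriv_remFamily_le (remCutoff hχ hc) farCutoff K N₁ N₂ hN
      exact ⟨C, hC0, fun _ => hC⟩
    · exact ⟨0, le_rfl, fun h => absurd h hN⟩
  choose C hC0 hC using key
  choose M hM0 hM using exists_cNorm_iterate_mulVar_le 1
  refine ⟨fun K N₂ => (∑ i ∈ Finset.range K, C K i N₂) * M K, ?_⟩
  intro K N₁ N₂ hK hN g l hl s
  have h1 := hC K N₁ N₂ (by lia) (mulVar g) l hl s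
  have h2 : cNorm K (mulVar g).1 ≤ M K * cNorm K g.1 := hM K g
  have h4 : C K N₁ N₂ ≤ ∑ i ∈ Finset.range K, C K i N₂ :=
    Finset.single_le_sum (f := fun i => C K i N₂) (fun i _ => hC0 _ _ _)
      (Finset.mem_range.2 (by lia : N₁ < K))
  have hl0 : 0 < l := by linarith
  have h5 := hC0 K N₁ N₂
  have h6 := hM0 K
  have h7 := cNorm_nonneg K g.1
  calc _ ≤ (∑ i ∈ Finset.range K, C K i N₂) * (l ^ ((N₁ : ℤ) + 1 - K) * (M K * cNorm K g.1)) := by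
        have h8 := cNorm_nonneg K (mulVar g).1
        have h9 := h5.trans h4
        refine h1.trans ?_
        gcongr
    _ = _ := by ring

/-- The derivatives of the remainder decay rapidly in `l`. -/
theorem exists_norm_iteratedDeriv_remainder_le (g : smoothDyadic) (n N : ℕ) :
    ∃ C : ℝ, 0 ≤ C ∧ ∀ l : ℝ, 1 ≤ l → ∀ x : ℝ,
      l ^ N * ‖iteratedDeriv n (remainder hχ hc g l) x‖ ≤ C := by
  obtain ⟨c, hcn⟩ := exists_norm_mixedDeriv_remainder_le hχ hc
  have h1 : ∀ l : ℝ, 1 ≤ l → ∀ x : ℝ, l ^ N * ‖iteratedDeriv n (remainder hχ hc g l) x‖ ≤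
      c (n + 2 + N) 0 * cNorm (n + 2 + N) g.1 := by
    intro l hl x
    have hl0 : 0 < l := by linarith
    have h2 := hcn (n + 2 + N) n 0 (by lia) (by lia) g l hl x
    have h0 : 0 ≤ c (n + 2 + N) 0 * cNorm (n + 2 + N) g.1 := by
      have h3 := (norm_nonneg _).trans h2
      have h4 : 0 < l ^ ((n : ℤ) + 1 - (n + 2 + N : ℕ)) := by positivity
      rw [mul_right_comm] at h3
      exact nonneg_of_mul_nonneg_left h3 h4
    have h5 : l ^ N * l ^ ((n : ℤ) + 1 - (n + 2 + N : ℕ)) ≤ 1 := by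
      rw [← zpow_natCast, ← zpow_add₀ hl0.ne']
      exact zpow_le_one_of_nonpos₀ hl (by push_cast; lia)
    have h6 : mixedDeriv n 0 (remainder hχ hc g) l x = iteratedDeriv n (remainder hχ hc g l) x := by
      simp [mixedDeriv]
    rw [h6] at h2
    calc _ ≤ l ^ N * (c (n + 2 + N) 0 * l ^ ((n : ℤ) + 1 - (n + 2 + N : ℕ)) *
          cNorm (n + 2 + N) g.1) := by gcongr
      _ = c (n + 2 + N) 0 * cNorm (n + 2 + N) g.1 *
          (l ^ N * l ^ ((n : ℤ) + 1 - (n + 2 + N : ℕ))) := by ring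
      _ ≤ _ := mul_le_of_le_one_right h0 h5
  exact ⟨_, (by positivity : (0:ℝ) ≤ 1 ^ N * ‖iteratedDeriv n (remainder hχ hc g 1) 0‖).trans
    (h1 1 le_rfl 0), h1⟩

theorem exists_schwartz_remainder (g : smoothDyadic) (N : ℕ) : ∃ Φ : ℝ → 𝓢(ℝ, ℂ),
    (∀ l : ℝ, 1 ≤ l → ∀ s : ℝ, Φ l s = (l : ℂ) ^ N * remainder hχ hc g l s) ∧
      Bornology.IsVonNBounded ℂ (Φ '' Ici 1) := by
  set Φ : ℝ → 𝓢(ℝ, ℂ) := fun l => ((hasCompactSupport_remainder hχ hc g l).mul_left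
    (f := fun _ => (l : ℂ) ^ N)).toSchwartzMap
      (contDiff_const.mul (contDiff_remainder hχ hc g l)) with hΦ
  refine ⟨Φ, fun l _ s => rfl, ?_⟩
  rw [(schwartz_withSeminorms ℂ ℝ ℂ).image_isVonNBounded_iff_seminorm_bounded]
  rintro ⟨k, n⟩
  obtain ⟨C, hC0, hC⟩ := exists_norm_iteratedDeriv_remainder_le hχ hc g n N
  obtain ⟨R, hR⟩ := hc.isBounded.exists_norm_le
  have hR0 : 0 ≤ max R 0 := le_max_right _ _
  refine ⟨(max R 0) ^ k * C + 1, by positivity, fun l hl => ?_⟩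
  have hl : (1:ℝ) ≤ l := hl
  have hl0 : 0 < l := by linarith
  refine lt_of_le_of_lt ?_ (lt_add_one _)
  refine SchwartzMap.seminorm_le_bound ℂ k n _ (by positivity) fun x => ?_
  rw [norm_iteratedFDeriv_eq_norm_iteratedDeriv]
  have h1 : iteratedDeriv n (Φ l) x = (l : ℂ) ^ N * iteratedDeriv n (remainder hχ hc g l) x :=
    iteratedDeriv_const_mul_field _ _
  rw [h1, norm_mul, norm_pow, Complex.norm_real, Real.norm_of_nonneg hl0.le]
  by_cases hx : x ∈ tsupport χ
  · have := hC l hl x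
    have h2 := (hR x hx).trans (le_max_left R 0)
    gcongr
  · have h2 : iteratedDeriv n (remainder hχ hc g l) x = 0 := by
      rw [iteratedDeriv_eq_iteratedFDeriv, Function.notMem_support.1 fun h =>
        hx (tsupport_remainder hχ hc g l (support_iteratedFDeriv_subset n h))]
      rfl
    rw [h2, norm_zero, mul_zero, mul_zero]
    positivity

end Remainder

/-! ### Fourier inversion -/

section Inversion

/-- The integrand is a compactly supported continuous function near the critical frequencies and
decays by nonstationary phase elsewhere. -/
theorem integrable_oscInt (h : smoothDyadic) {l : ℝ} (hl : 0 < l) : Integrable (oscInt h l) := by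
  have hcont : Continuous fun ξ => oscInt h l ξ :=
    (continuous_oscInt h).comp (Continuous.prodMk_right l)
  have h1 : Integrable fun ξ => (timeBump (ξ / l) : ℂ) * oscInt h l ξ := by
    refine Continuous.integrable_of_hasCompactSupport ?_ ?_
    · exact (Complex.continuous_ofReal.comp (timeBump.continuous.comp (by fun_prop))).mul hcont
    · refine HasCompactSupport.mul_right ?_
      have h2 : HasCompactSupport fun σ => (timeBump σ : ℂ) :=
        timeBump.hasCompactSupport.comp_left (g := fun x : ℝ => (x : ℂ)) Complex.ofReal_zero
      exact h2.comp_homeomorph (Homeomorph.mulRight₀ l⁻¹ (inv_ne_zero hl.ne'))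
  refine (h1.add (integrable_farIntegrand farCutoff 0 h hl 0)).congr (.of_forall fun ξ => ?_)
  simp [farIntegrand, farCutoff]
  ring

open scoped FourierTransform in
/-- Fourier inversion for the function `g(√u) exp(i l √u)` of `u`, whose Fourier transform becomes
an oscillatory integral by the substitution `u = t²`. -/
theorem integral_oscInt (g : smoothDyadic) {l : ℝ} (hl : 0 < l) (y : ℝ) :
    ∫ ξ : ℝ, oscInt (mulVar g) l ξ * Complex.exp ((ξ * y : ℝ) * Complex.I) =
      Real.pi * (g.1 √y * Complex.exp ((l * √y : ℝ) * Complex.I)) := by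
  set F : ℝ → ℂ := fun u => g.1 √u * Complex.exp ((l * √u : ℝ) * Complex.I) with hF
  have hgc := g.2.1.continuous
  have hFc : Continuous F := by
    have := Real.continuous_sqrt
    fun_prop
  have hF0 : ∀ u ∉ Ioo (1/4 : ℝ) 4, F u = 0 := by
    intro u hu
    have : √u ∉ Ioo (1/2 : ℝ) 2 := fun h => hu ⟨by
      have := Real.lt_sqrt (x := 1/2) (y := u) (by norm_num) |>.1 h.1
      linarith, by
      have := (Real.sqrt_lt' (x := u) (y := 2) (by norm_num)).1 h.2
      linarith⟩
    simp only [hF, smoothDyadic_eq_zero g this, zero_mul]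
  have hFs : HasCompactSupport F :=
    HasCompactSupport.of_support_subset_isCompact (isCompact_Icc (a := 1/4) (b := 4)) fun u hu => by
      by_contra h
      exact hu (hF0 u fun h' => h (Ioo_subset_Icc_self h'))
  have hft : ∀ w : ℝ, 𝓕 F w = 2 * oscInt (mulVar g) l (2 * Real.pi * w) := by
    intro w
    rw [Real.fourier_real_eq_integral_exp_smul]
    have h1 : ∫ u : ℝ, Complex.exp (↑(-2 * Real.pi * u * w) * Complex.I) • F u =
        ∫ u in (1/4 : ℝ)..4, Complex.exp (↑(-2 * Real.pi * u * w) * Complex.I) • F u := by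
      refine (intervalIntegral.integral_eq_integral_of_support_subset fun u hu => ?_).symm
      by_contra h
      exact hu (by simp only [hF0 u fun h' => h (Ioo_subset_Ioc_self h'), smul_zero])
    have h2 := intervalIntegral.integral_deriv_smul_comp (a := 1/2) (b := 2) (f := fun t : ℝ => t ^ 2)
      (f' := fun t => 2 * t) (g := fun u => Complex.exp (↑(-2 * Real.pi * u * w) * Complex.I) • F u)
      (fun t _ => by simpa using hasDerivAt_pow 2 t) (by fun_prop) (by fun_prop)
    rw [show ((1 / 2 : ℝ)) ^ 2 = 1 / 4 by norm_num, show (2 : ℝ) ^ 2 = 4 by norm_num] at h2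
    rw [h1, ← h2, oscInt, ← intervalIntegral.integral_const_mul]
    refine intervalIntegral.integral_congr fun t ht => ?_
    rw [uIcc_of_le (by norm_num)] at ht
    have ht0 : 0 ≤ t := by linarith [ht.1]
    have e1 : Complex.exp (((l * t - 2 * Real.pi * w * t ^ 2 : ℝ) : ℂ) * Complex.I) =
        Complex.exp ((-(2 * Real.pi * t ^ 2 * w) : ℝ) * Complex.I) *
          Complex.exp ((l * t : ℝ) * Complex.I) := by
      rw [← Complex.exp_add]
      congr 1
      push_cast
      ring
    simp only [hF, Function.comp_apply, Real.sqrt_sq ht0, mulVar_apply, e1,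
      Complex.real_smul]
    push_cast
    ring_nf
  have hint := (integrable_oscInt (mulVar g) hl)
  have hπ : (0:ℝ) < 2 * Real.pi := by positivity
  have hFi : Integrable (𝓕 F) := by
    have : 𝓕 F = fun w => 2 * oscInt (mulVar g) l (2 * Real.pi * w) := funext hft
    rw [this]
    exact ((hint.comp_mul_left' hπ.ne').const_mul 2)
  have hinv := congrFun (hFc.fourierInv_fourier_eq
    (hFc.integrable_of_hasCompactSupport hFs) hFi) y
  rw [Real.fourierInv_eq'] at hinv
  have h3 : ∀ w : ℝ, Complex.exp (↑(2 * Real.pi * ⟪w, y⟫_ℝ) * Complex.I) • 𝓕 F w =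
      (fun ξ : ℝ => 2 * (oscInt (mulVar g) l ξ * Complex.exp ((ξ * y : ℝ) * Complex.I)))
        (2 * Real.pi * w) := by
    intro w
    rw [hft]
    simp only [smul_eq_mul, RCLike.inner_apply, conj_trivial]
    rw [show 2 * Real.pi * (y * w) = 2 * Real.pi * w * y by ring]
    ring
  rw [integral_congr_ae (.of_forall h3)] at hinv
  rw [Measure.integral_comp_mul_left (fun ξ : ℝ => 2 * (oscInt (mulVar g) l ξ *
    Complex.exp ((ξ * y : ℝ) * Complex.I))), integral_const_mul, abs_of_pos (by positivity),
    Complex.real_smul] at hinv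
  change _ = F y at hinv
  change _ = Real.pi * F y
  rw [← hinv]
  have hπ' : (Real.pi : ℂ) ≠ 0 := by exact_mod_cast Real.pi_ne_zero
  generalize (∫ ξ : ℝ, oscInt (mulVar g) l ξ * Complex.exp ((ξ * y : ℝ) * Complex.I)) = A
  push_cast
  field_simp

end Inversion
end

noncomputable section

/-! ### The operator identity -/

section OperatorIdentity

/-- The oscillating factor restores the exponential at the critical point that was removed from the
amplitude. At `s = 0` both sides vanish because of the bump. -/
theorem exp_mul_amplitude (g : smoothDyadic) (l s : ℝ) :
    Complex.exp (Complex.I * (l / (4 * s))) * amplitude g l s =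
      ((Real.pi⁻¹ * timeBump s * √l : ℝ) : ℂ) * oscInt (mulVar g) l (l * s) := by
  change _ * (((Real.pi⁻¹ : ℝ) : ℂ) * (timeBump s : ℂ) * ((l : ℂ) ^ 0)⁻¹ *
    (((√l : ℝ) : ℂ) * Complex.exp ((-(l / (4 * s)) : ℝ) * Complex.I) *
      oscInt (mulVar g) l (l * s))) = _
  have h : Complex.exp (Complex.I * (l / (4 * s))) *
      Complex.exp ((-(l / (4 * s)) : ℝ) * Complex.I) = 1 := by
    rw [← Complex.exp_add, ← Complex.exp_zero]
    congr 1
    push_cast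
    ring
  push_cast at h ⊢
  linear_combination ((Real.pi : ℂ)⁻¹ * (timeBump s : ℂ) * (√l : ℂ) *
    oscInt (mulVar g) l (l * s)) * h

theorem continuous_exp_mul_amplitude (g : smoothDyadic) (l : ℝ) :
    Continuous fun s : ℝ => Complex.exp (Complex.I * (l / (4 * s))) * amplitude g l s := by
  simp only [exp_mul_amplitude]
  have h1 := timeBump.continuous
  have h2 : Continuous fun s => oscInt (mulVar g) l (l * s) :=
    (continuous_oscInt (mulVar g)).comp (f := fun s : ℝ => (l, l * s)) (by fun_prop)
  fun_prop

theorem integrable_exp_mul_amplitude (g : smoothDyadic) (l : ℝ) :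
    Integrable fun s : ℝ => Complex.exp (Complex.I * (l / (4 * s))) * amplitude g l s := by
  refine (continuous_exp_mul_amplitude g l).integrable_of_hasCompactSupport ?_
  exact HasCompactSupport.mul_left (isCompact_Icc.of_isClosed_subset (isClosed_tsupport _)
    (tsupport_amplitude g l))

/-- The scalar identity behind the operator identity, with `y` in place of `L / l²`: the integral of
Fourier inversion is split by the bump in `ξ / l`, and `ξ = l s` in the part near the critical
frequencies. -/
theorem amplitude_add_remainder {χ : ℝ → ℂ} (hχ : ContDiff ℝ ∞ χ) (hc : HasCompactSupport χ)
    (hχ1 : ∀ s ∈ Icc (1 / 4 : ℝ) 4, χ s = 1) (g : smoothDyadic) {l : ℝ} (hl : 0 < l) (y : ℝ) :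
    χ y * ((√l : ℂ) * ∫ s : ℝ, (Complex.exp (Complex.I * (l / (4 * s))) * amplitude g l s) *
      Complex.exp (Complex.I * (s * l * y))) + remainder hχ hc g l y =
        g.1 √y * Complex.exp ((l * √y : ℝ) * Complex.I) := by
  set W : ℝ → ℂ := fun ξ => oscInt (mulVar g) l ξ * Complex.exp ((ξ * y : ℝ) * Complex.I) with hW
  have hWi : Integrable W := by
    refine (integrable_oscInt (mulVar g) hl).mul_bdd (c := 1)
      (Continuous.aestronglyMeasurable (by fun_prop)) (.of_forall fun ξ => ?_)
    rw [Complex.norm_exp_ofReal_mul_I]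
  have hfar : Integrable fun ξ => (1 - (timeBump (ξ / l) : ℂ)) * W ξ := by
    refine (integrable_farIntegrand farCutoff 0 (mulVar g) hl y).congr (.of_forall fun ξ => ?_)
    simp [farIntegrand, farCutoff, hW, mul_assoc]
  have hnear : Integrable fun ξ => (timeBump (ξ / l) : ℂ) * W ξ := by
    refine (hWi.sub hfar).congr (.of_forall fun ξ => ?_)
    simp only [Pi.sub_apply]
    ring
  have h1 : farInt farCutoff 0 (mulVar g) l y = ∫ ξ, (1 - (timeBump (ξ / l) : ℂ)) * W ξ := by
    refine integral_congr_ae (.of_forall fun ξ => ?_)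
    simp [farIntegrand, farCutoff, hW, mul_assoc]
  have hsq : (√l : ℂ) * √l = l := by exact_mod_cast Real.mul_self_sqrt hl.le
  have hl' : (l : ℂ) ≠ 0 := by exact_mod_cast hl.ne'
  have h2 : (√l : ℂ) * ∫ s : ℝ, (Complex.exp (Complex.I * (l / (4 * s))) * amplitude g l s) *
      Complex.exp (Complex.I * (s * l * y)) =
      ((Real.pi⁻¹ : ℝ) : ℂ) * ∫ ξ, (timeBump (ξ / l) : ℂ) * W ξ := by
    have h3 := Measure.integral_comp_mul_left (fun ξ => (timeBump (ξ / l) : ℂ) * W ξ) l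
    rw [abs_of_pos (inv_pos.2 hl), Complex.real_smul, Complex.ofReal_inv,
      eq_inv_mul_iff_mul_eq₀ hl'] at h3
    rw [← h3, ← integral_const_mul, ← integral_const_mul, ← integral_const_mul]
    refine integral_congr_ae (.of_forall fun s => ?_)
    simp only [exp_mul_amplitude, hW]
    rw [mul_div_cancel_left₀ _ hl.ne', show Complex.I * (s * l * y) = (l * s * y : ℝ) * Complex.I by
      push_cast; ring]
    push_cast
    linear_combination ((Real.pi : ℂ)⁻¹ * (timeBump s : ℂ) *
      oscInt (mulVar g) l (l * s) * Complex.exp (l * s * y * Complex.I)) * hsq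
  have h3 : (∫ ξ, (timeBump (ξ / l) : ℂ) * W ξ) + ∫ ξ, (1 - (timeBump (ξ / l) : ℂ)) * W ξ =
      Real.pi * (g.1 √y * Complex.exp ((l * √y : ℝ) * Complex.I)) := by
    rw [← integral_add hnear hfar, ← integral_oscInt g hl y]
    refine integral_congr_ae (.of_forall fun ξ => ?_)
    simp only
    ring
  -- The cutoff equals `1` where `g(√y)` does not vanish.
  have h4 : χ y * (g.1 √y * Complex.exp ((l * √y : ℝ) * Complex.I)) =
      g.1 √y * Complex.exp ((l * √y : ℝ) * Complex.I) := by
    by_cases hy : √y ∈ Ioo (1/2 : ℝ) 2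
    · have h5 : y ∈ Icc (1/4 : ℝ) 4 := by
        have h6 := (Real.lt_sqrt (by norm_num)).1 hy.1
        have h7 := (Real.sqrt_lt' (by norm_num)).1 hy.2
        constructor <;> linarith
      rw [hχ1 y h5, one_mul]
    · rw [smoothDyadic_eq_zero g hy]
      simp
  rw [remainder_apply hχ hc g hl, h1, h2]
  have hπ' : (Real.pi : ℂ) ≠ 0 := by exact_mod_cast Real.pi_ne_zero
  rw [← h4]
  push_cast at h3 ⊢
  linear_combination ((Real.pi : ℂ)⁻¹ * χ y) * h3 +
    χ y * (g.1 √y * Complex.exp (l * √y * Complex.I)) * (inv_mul_cancel₀ hπ')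

variable {H : Type*} [NormedAddCommGroup H] [InnerProductSpace ℂ H] [CompleteSpace H]
  {R : H →L[ℂ] H}

theorem isSymbol_of_continuous_of_hasCompactSupport {m : ℝ → ℂ} (hm : Continuous m)
    (hc : HasCompactSupport m) : IsSymbol m := by
  obtain ⟨C, hC⟩ := hm.bounded_above_of_compact_support hc
  exact ⟨hm.continuousOn, C, fun x _ => hC x⟩

theorem IsSymbol.comp_mul {m : ℝ → ℂ} (hm : IsSymbol m) {c : ℝ} (hc : 0 ≤ c) :
    IsSymbol fun x => m (c * x) := by
  obtain ⟨h1, C, hC⟩ := hm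
  refine ⟨h1.comp (by fun_prop) fun x hx => mul_nonneg hc hx, C, fun x hx => hC _ (mul_nonneg hc hx)⟩

/-- The scalar identity, transferred to a nonnegative operator with resolvent `R` by the functional
calculus. -/
theorem funCalc_wave_eq (hR : IsResolvent R) {χ : ℝ → ℂ} (hχ : ContDiff ℝ ∞ χ)
    (hc : HasCompactSupport χ) (hχ1 : ∀ s ∈ Icc (1 / 4 : ℝ) 4, χ s = 1) (g : smoothDyadic)
    {l : ℝ} (hl : 0 < l) (f : H) :
    Integrable (fun s : ℝ => (Complex.exp (Complex.I * (l / (4 * s))) * amplitude g l s) •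
      funCalc R (fun x => Complex.exp (Complex.I * (s * x / l))) f) ∧
    funCalc R (fun x => g.1 (l⁻¹ * √x)) (funCalc R (fun x => Complex.exp (Complex.I * √x)) f) =
      funCalc R (fun x => χ ((l ^ 2)⁻¹ * x))
        ((√l : ℂ) • ∫ s : ℝ, (Complex.exp (Complex.I * (l / (4 * s))) * amplitude g l s) •
          funCalc R (fun x => Complex.exp (Complex.I * (s * x / l))) f) +
      funCalc R (fun x => remainder hχ hc g l ((l ^ 2)⁻¹ * x)) f := by
  set c : ℝ → ℂ := fun s => Complex.exp (Complex.I * (l / (4 * s))) * amplitude g l s with hcdef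
  have hcc := continuous_exp_mul_amplitude g l
  have hci := integrable_exp_mul_amplitude g l
  have hexp : ∀ r : ℝ, ‖Complex.exp (Complex.I * r)‖ = 1 := fun r => by
    rw [mul_comm]; exact Complex.norm_exp_ofReal_mul_I r
  have hE : ∀ s : ℝ, IsSymbol fun x => Complex.exp (Complex.I * (s * x / l)) := fun s =>
    ⟨Continuous.continuousOn (by fun_prop), 1, fun x _ => by
      have := hexp (s * x / l)
      push_cast at this
      exact this.le⟩
  have hsm : ∀ s : ℝ, (Complex.exp (Complex.I * (l / (4 * s))) * amplitude g l s) • funCalc R (fun x => Complex.exp (Complex.I * (s * x / l))) f =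
      funCalc R (fun x => c s * Complex.exp (Complex.I * (s * x / l))) f := fun s => by
    rw [funCalc_smul hR (hE s)]
    rfl
  simp only [hsm]
  have hF : ContinuousOn (Function.uncurry fun (s x : ℝ) =>
      c s * Complex.exp (Complex.I * (s * x / l))) (univ ×ˢ Ici 0) := by
    refine Continuous.continuousOn ?_
    exact (hcc.comp continuous_fst).mul (by fun_prop)
  obtain ⟨C, hC⟩ : ∃ C, ∀ s, ‖c s‖ ≤ C :=
    hcc.bounded_above_of_compact_support (HasCompactSupport.mul_left
      (isCompact_Icc.of_isClosed_subset (isClosed_tsupport _) (tsupport_amplitude g l)))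
  have hb : ∀ s, ∀ x ∈ Ici (0:ℝ), ‖c s * Complex.exp (Complex.I * (s * x / l))‖ ≤ ‖c s‖ := by
    intro s x _
    have := hexp (s * x / l)
    push_cast at this
    rw [norm_mul, this, mul_one]
  obtain ⟨h1, h2⟩ := funCalc_integral hR hF hci.norm hC hb f
  refine ⟨h1, ?_⟩
  have hI : IsSymbol fun x => ∫ s, c s * Complex.exp (Complex.I * (s * x / l)) :=
    IsSymbol.integral hF hci.norm hb
  have hl2 : 0 ≤ (l ^ 2)⁻¹ := by positivity
  have hχs : IsSymbol fun x => χ ((l ^ 2)⁻¹ * x) :=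
    (isSymbol_of_continuous_of_hasCompactSupport hχ.continuous hc).comp_mul hl2
  have hρs : IsSymbol fun x => remainder hχ hc g l ((l ^ 2)⁻¹ * x) :=
    (isSymbol_of_continuous_of_hasCompactSupport (contDiff_remainder hχ hc g l).continuous
      (hasCompactSupport_remainder hχ hc g l)).comp_mul hl2
  have hgs : IsSymbol fun x => g.1 (l⁻¹ * √x) := by
    refine ⟨(g.2.1.continuous.comp (by fun_prop)).continuousOn, ⨆ t : ℝ, ‖g.1 t‖, fun x _ =>
      norm_dyadic_le g _⟩
  have hws : IsSymbol fun x => Complex.exp (Complex.I * √x) :=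
    ⟨Continuous.continuousOn (by fun_prop), 1, fun x _ => (hexp _).le⟩
  have hIs : IsSymbol fun x => (√l : ℂ) * ∫ s, c s * Complex.exp (Complex.I * (s * x / l)) :=
    (IsSymbol.const _).mul hI
  rw [← h2, funCalc_mul_apply hR hgs hws]
  have h3 : (√l : ℂ) • funCalc R (fun x => ∫ s, c s * Complex.exp (Complex.I * (s * x / l))) f =
      funCalc R (fun x => (√l : ℂ) * ∫ s, c s * Complex.exp (Complex.I * (s * x / l))) f := by
    rw [funCalc_smul hR hI]
    rfl
  rw [h3, funCalc_mul_apply hR hχs hIs, ← _root_.add_apply,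
    ← funCalc_add hR (hχs.mul hIs) hρs]
  refine congrArg (fun T : H →L[ℂ] H => T f) (funCalc_congr hR fun x hx => ?_)
  have hx : 0 ≤ x := hx
  have h4 := amplitude_add_remainder hχ hc hχ1 g hl ((l ^ 2)⁻¹ * x)
  have h5 : √((l ^ 2)⁻¹ * x) = l⁻¹ * √x := by
    rw [Real.sqrt_mul (by positivity), Real.sqrt_inv, Real.sqrt_sq hl.le]
  have h6 : ∀ s : ℝ, Complex.exp (Complex.I * (s * l * ((l ^ 2)⁻¹ * x : ℝ))) =
      Complex.exp (Complex.I * (s * x / l)) := fun s => by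
    have hl' : (l : ℂ) ≠ 0 := by exact_mod_cast hl.ne'
    congr 1
    push_cast
    field_simp
  rw [h5, mul_inv_cancel_left₀ hl.ne'] at h4
  simp only [h6] at h4
  rw [h4, mul_comm Complex.I]

end OperatorIdentity
end

noncomputable section

/-! ### The function `cosh √v` and its logarithmic derivative -/

section CoshSqrt

/-- The coefficients of the power series of the `k`-th derivative of `cosh √v`. -/
def coshCoeff (k j : ℕ) : ℝ := ((j + k).factorial : ℝ) / (j.factorial * (2 * (j + k)).factorial)

/-- The `k`-th derivative of the entire function `cosh √v = ∑ v ^ j / (2 j)!`. -/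
def coshDeriv (k : ℕ) (v : ℝ) : ℝ := ∑' j : ℕ, coshCoeff k j * v ^ j

theorem coshCoeff_pos (k j : ℕ) : 0 < coshCoeff k j := by
  unfold coshCoeff
  positivity

theorem coshCoeff_le (k j : ℕ) : coshCoeff k j ≤ ((j.factorial : ℝ))⁻¹ := by
  unfold coshCoeff
  rw [div_le_iff₀ (by positivity), inv_mul_cancel_left₀ (by positivity)]
  exact_mod_cast Nat.factorial_le (by lia)

theorem coshCoeff_succ (k j : ℕ) : coshCoeff k (j + 1) * (j + 1) = coshCoeff (k + 1) j := by
  unfold coshCoeff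
  rw [Nat.factorial_succ j, show j + 1 + k = j + (k + 1) by lia]
  push_cast
  field_simp

theorem coshCoeff_succ_le (k j : ℕ) : coshCoeff (k + 1) j ≤ coshCoeff k j := by
  unfold coshCoeff
  rw [show 2 * (j + (k + 1)) = (2 * (j + k) + 1) + 1 by lia, Nat.factorial_succ (2 * (j + k) + 1),
    Nat.factorial_succ (2 * (j + k)), ← add_assoc, Nat.factorial_succ (j + k)]
  rw [div_le_div_iff₀ (by positivity) (by positivity)]
  have h1 : (j + k + 1) * 1 ≤ (2 * (j + k) + 1 + 1) * (2 * (j + k) + 1) := by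
    refine Nat.mul_le_mul ?_ ?_ <;> lia
  have h2 : ((j + k + 1 : ℕ) : ℝ) ≤ ((2 * (j + k) + 1 + 1 : ℕ) : ℝ) * ((2 * (j + k) + 1 : ℕ) : ℝ) := by
    rw [mul_one] at h1
    exact_mod_cast h1
  push_cast at h2 ⊢
  have h3 : (0:ℝ) < (j + k).factorial * (j.factorial * (2 * (j + k)).factorial) := by positivity
  nlinarith

theorem summable_coshDeriv (k : ℕ) (v : ℝ) : Summable fun j : ℕ => coshCoeff k j * v ^ j := by
  refine Summable.of_norm_bounded (Real.summable_pow_div_factorial |v|) fun j => ?_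
  rw [norm_mul, norm_pow, Real.norm_eq_abs v, Real.norm_of_nonneg (coshCoeff_pos k j).le,
    div_eq_inv_mul]
  exact mul_le_mul_of_nonneg_right (coshCoeff_le k j) (by positivity)

theorem hasDerivAt_coshDeriv (k : ℕ) (v : ℝ) : HasDerivAt (coshDeriv k) (coshDeriv (k + 1) v) v := by
  set M : ℝ := |v| + 1
  have hM : 0 < M := by positivity
  have hsum : Summable fun j : ℕ => coshCoeff k j * (j * M ^ (j - 1)) := by
    rw [← summable_nat_add_iff 1]
    refine (summable_coshDeriv (k + 1) M).congr fun j => ?_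
    rw [← coshCoeff_succ]
    push_cast
    ring
  have h1 := hasDerivAt_tsum_of_isPreconnected (y := v) (y₀ := v) hsum (t := Ioo (-M) M) isOpen_Ioo
    isPreconnected_Ioo (g := fun j y => coshCoeff k j * y ^ j)
    (g' := fun j y => coshCoeff k j * (j * y ^ (j - 1)))
    (fun j y _ => (hasDerivAt_pow j y).const_mul _) (fun j y hy => ?_)
    (abs_lt.1 (lt_add_one |v|)) (summable_coshDeriv k v) (abs_lt.1 (lt_add_one |v|))
  · refine h1.congr_deriv ?_
    have hs : Summable fun j : ℕ => coshCoeff k j * (j * v ^ (j - 1)) := by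
      rw [← summable_nat_add_iff 1]
      refine (summable_coshDeriv (k + 1) v).congr fun j => ?_
      rw [← coshCoeff_succ]
      push_cast
      ring
    rw [hs.tsum_eq_zero_add]
    simp only [Nat.cast_zero, zero_mul, mul_zero, zero_add]
    refine tsum_congr fun j => ?_
    rw [← coshCoeff_succ, Nat.add_sub_cancel]
    push_cast
    ring
  · have hy' : |y| ≤ M := (abs_lt.2 hy).le
    rw [norm_mul, norm_mul, norm_pow, Real.norm_eq_abs y, Real.norm_of_nonneg (coshCoeff_pos k j).le,
      Real.norm_of_nonneg (Nat.cast_nonneg j)]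
    have := coshCoeff_pos k j
    gcongr

theorem coshDeriv_nonneg (k : ℕ) {v : ℝ} (hv : 0 ≤ v) : 0 ≤ coshDeriv k v :=
  tsum_nonneg fun j => mul_nonneg (coshCoeff_pos k j).le (pow_nonneg hv j)

theorem coshDeriv_le (k : ℕ) {v : ℝ} (hv : 0 ≤ v) : coshDeriv k v ≤ coshDeriv 0 v := by
  induction k with
  | zero => exact le_rfl
  | succ k ih => exact ((summable_coshDeriv (k + 1) v).tsum_le_tsum (fun j =>
      mul_le_mul_of_nonneg_right (coshCoeff_succ_le k j) (pow_nonneg hv j))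
      (summable_coshDeriv k v)).trans ih

theorem coshDeriv_sq (y : ℝ) : coshDeriv 0 (y ^ 2) = Real.cosh y := by
  rw [Real.cosh_eq_tsum]
  refine tsum_congr fun j => ?_
  unfold coshCoeff
  rw [← pow_mul]
  simp only [add_zero]
  field_simp

theorem one_le_coshDeriv {v : ℝ} (hv : 0 ≤ v) : 1 ≤ coshDeriv 0 v := by
  rw [← Real.sq_sqrt hv, coshDeriv_sq]
  exact Real.one_le_cosh _

theorem coshDeriv_one_sq (y : ℝ) : 2 * y * coshDeriv 1 (y ^ 2) = Real.sinh y := by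
  have h1 : HasDerivAt (fun y : ℝ => coshDeriv 0 (y ^ 2)) (coshDeriv 1 (y ^ 2) * (2 * y)) y := by
    have := (hasDerivAt_coshDeriv 0 (y ^ 2)).comp y (hasDerivAt_pow 2 y)
    simpa using! this
  simp only [coshDeriv_sq] at h1
  have := h1.unique (Real.hasDerivAt_cosh y)
  linarith

/-- The differential equation of `cosh √v`. -/
theorem coshDeriv_ode (v : ℝ) : 4 * v * coshDeriv 2 v + 2 * coshDeriv 1 v = coshDeriv 0 v := by
  have h2 : v * coshDeriv 2 v = ∑' j : ℕ, coshCoeff 1 j * j * v ^ j := by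
    have hs : Summable fun j : ℕ => coshCoeff 1 j * j * v ^ j := by
      rw [← summable_nat_add_iff 1]
      refine ((summable_coshDeriv 2 v).mul_left v).congr fun j => ?_
      rw [← coshCoeff_succ]
      push_cast
      ring
    rw [hs.tsum_eq_zero_add, coshDeriv, ← tsum_mul_left]
    simp only [Nat.cast_zero, mul_zero, zero_mul, zero_add]
    refine tsum_congr fun j => ?_
    rw [← coshCoeff_succ]
    push_cast
    ring
  have hs : Summable fun j : ℕ => coshCoeff 1 j * j * v ^ j := by
    rw [← summable_nat_add_iff 1]
    refine ((summable_coshDeriv 2 v).mul_left v).congr fun j => ?_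
    rw [← coshCoeff_succ]
    push_cast
    ring
  rw [mul_assoc, h2]
  unfold coshDeriv
  rw [← tsum_mul_left, ← tsum_mul_left, ← (hs.mul_left 4).tsum_add
    ((summable_coshDeriv 1 v).mul_left 2)]
  refine tsum_congr fun j => ?_
  have : 4 * (coshCoeff 1 j * j) + 2 * coshCoeff 1 j = coshCoeff 0 j := by
    unfold coshCoeff
    rw [add_zero, show 2 * (j + 1) = (2 * j + 1) + 1 by lia, Nat.factorial_succ (2 * j + 1),
      Nat.factorial_succ (2 * j), Nat.factorial_succ j]
    push_cast
    field_simp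
    ring
  rw [← this]
  ring

/-- The quotients `(cosh √v)^{(k)} / cosh √v`. -/
def coshRatio (k : ℕ) (v : ℝ) : ℝ := coshDeriv k v / coshDeriv 0 v

theorem coshRatio_nonneg (k : ℕ) {v : ℝ} (hv : 0 ≤ v) : 0 ≤ coshRatio k v :=
  div_nonneg (coshDeriv_nonneg k hv) (coshDeriv_nonneg 0 hv)

theorem coshRatio_le_one (k : ℕ) {v : ℝ} (hv : 0 ≤ v) : coshRatio k v ≤ 1 :=
  div_le_one_of_le₀ (coshDeriv_le k hv) (coshDeriv_nonneg 0 hv)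

theorem hasDerivAt_coshRatio (k : ℕ) {v : ℝ} (hv : 0 ≤ v) : HasDerivAt (coshRatio k)
    (coshRatio (k + 1) v - coshRatio k v * coshRatio 1 v) v := by
  have h0 : coshDeriv 0 v ≠ 0 := by linarith [one_le_coshDeriv hv]
  refine ((hasDerivAt_coshDeriv k v).div (hasDerivAt_coshDeriv 0 v) h0).congr_deriv ?_
  simp only [coshRatio]
  field_simp

theorem hasDerivAt_log_cosh {v : ℝ} (hv : 0 ≤ v) :
    HasDerivAt (fun v => Real.log (coshDeriv 0 v)) (coshRatio 1 v) v :=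
  (hasDerivAt_coshDeriv 0 v).log (by linarith [one_le_coshDeriv hv])

/-- The Riccati equation of the logarithmic derivative. -/
theorem coshRatio_riccati {v : ℝ} (hv : 0 ≤ v) :
    4 * v * (coshRatio 2 v - coshRatio 1 v * coshRatio 1 v) =
      1 - 2 * coshRatio 1 v - 4 * v * coshRatio 1 v ^ 2 := by
  have h0 : coshDeriv 0 v ≠ 0 := by linarith [one_le_coshDeriv hv]
  have h1 := coshDeriv_ode v
  have h2 : 4 * v * coshRatio 2 v + 2 * coshRatio 1 v = 1 := by
    unfold coshRatio
    field_simp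
    linarith
  linear_combination h2

/-- `tanh y / y ≥ 1 / (1 + y)`. -/
theorem coshRatio_one_ge {y : ℝ} (hy : 0 ≤ y) : 1 ≤ 2 * coshRatio 1 (y ^ 2) * (1 + y) := by
  rcases hy.eq_or_lt with h0 | h0
  · subst h0
    have := coshRatio_riccati (v := 0) le_rfl
    norm_num at this ⊢
    linarith
  · have h1 := coshDeriv_one_sq y
    have hc := Real.cosh_pos y
    have h2 : 2 * coshRatio 1 (y ^ 2) = Real.sinh y / (y * Real.cosh y) := by
      rw [coshRatio, coshDeriv_sq, ← h1]
      field_simp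
    rw [h2, div_mul_eq_mul_div, le_div_iff₀ (by positivity), one_mul]
    -- `y (cosh y - sinh y) = y e^{-y} ≤ sinh y`
    have h3 : y * (Real.cosh y - Real.sinh y) ≤ Real.sinh y := by
      rw [Real.cosh_sub_sinh]
      have h4 : Real.exp (-y) ≤ 1 := Real.exp_le_one_iff.2 (by linarith)
      have h5 : y ≤ Real.sinh y := Real.self_le_sinh_iff.2 hy
      nlinarith
    nlinarith

/-- The function `log cosh` grows linearly. -/
theorem log_coshDeriv_sq_ge (y : ℝ) :
    y - Real.log 2 ≤ Real.log (coshDeriv 0 (y ^ 2)) := by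
  rw [coshDeriv_sq]
  have h1 : Real.exp y / 2 ≤ Real.cosh y := by
    rw [Real.cosh_eq]
    linarith [Real.exp_pos (-y)]
  have h2 := Real.log_le_log (by positivity) h1
  rwa [Real.log_div (Real.exp_pos y).ne' (by norm_num), Real.log_exp] at h2

/-- The algebra generated by `log cosh √v` and the functions `coshRatio k`. It is closed under
differentiation on `[0, ∞)`, and its members have polynomial growth. -/
inductive CoshAlgebra : (ℝ → ℝ) → Prop
  | log : CoshAlgebra fun v => Real.log (coshDeriv 0 v)
  | ratio (k : ℕ) : CoshAlgebra (coshRatio k)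
  | add {f g : ℝ → ℝ} : CoshAlgebra f → CoshAlgebra g → CoshAlgebra fun v => f v + g v
  | sub {f g : ℝ → ℝ} : CoshAlgebra f → CoshAlgebra g → CoshAlgebra fun v => f v - g v
  | mul {f g : ℝ → ℝ} : CoshAlgebra f → CoshAlgebra g → CoshAlgebra fun v => f v * g v

theorem CoshAlgebra.exists_deriv {f : ℝ → ℝ} (hf : CoshAlgebra f) :
    ∃ f', CoshAlgebra f' ∧ ∀ v : ℝ, 0 ≤ v → HasDerivAt f (f' v) v := by
  induction hf with
  | log => exact ⟨_, .ratio 1, fun v hv => hasDerivAt_log_cosh hv⟩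
  | ratio k => exact ⟨_, .sub (.ratio (k + 1)) (.mul (.ratio k) (.ratio 1)),
      fun v hv => hasDerivAt_coshRatio k hv⟩
  | add _ _ ihf ihg =>
    obtain ⟨f', h1, h2⟩ := ihf
    obtain ⟨g', h3, h4⟩ := ihg
    exact ⟨_, h1.add h3, fun v hv => (h2 v hv).add (h4 v hv)⟩
  | sub _ _ ihf ihg =>
    obtain ⟨f', h1, h2⟩ := ihf
    obtain ⟨g', h3, h4⟩ := ihg
    exact ⟨_, h1.sub h3, fun v hv => (h2 v hv).sub (h4 v hv)⟩
  | mul hf hg ihf ihg =>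
    obtain ⟨f', h1, h2⟩ := ihf
    obtain ⟨g', h3, h4⟩ := ihg
    exact ⟨_, (h1.mul hg).add (hf.mul h3), fun v hv => (h2 v hv).mul (h4 v hv)⟩

theorem CoshAlgebra.exists_bound {f : ℝ → ℝ} (hf : CoshAlgebra f) :
    ∃ (k : ℕ) (C : ℝ), 0 ≤ C ∧ ∀ v : ℝ, 0 ≤ v → |f v| ≤ C * (1 + v) ^ k := by
  have hsum : ∀ {f g : ℝ → ℝ} {k₁ k₂ : ℕ} {C₁ C₂ : ℝ}, 0 ≤ C₁ → 0 ≤ C₂ →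
      (∀ v : ℝ, 0 ≤ v → |f v| ≤ C₁ * (1 + v) ^ k₁) → (∀ v : ℝ, 0 ≤ v → |g v| ≤ C₂ * (1 + v) ^ k₂) →
      ∀ v : ℝ, 0 ≤ v → |f v| + |g v| ≤ (C₁ + C₂) * (1 + v) ^ (k₁ + k₂) := by
    intro f g k₁ k₂ C₁ C₂ h1 h2 hf hg v hv
    have e1 : (1 + v) ^ k₁ ≤ (1 + v) ^ (k₁ + k₂) := pow_le_pow_right₀ (by linarith) (by lia)
    have e2 : (1 + v) ^ k₂ ≤ (1 + v) ^ (k₁ + k₂) := pow_le_pow_right₀ (by linarith) (by lia)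
    rw [add_mul]
    exact add_le_add ((hf v hv).trans (by gcongr)) ((hg v hv).trans (by gcongr))
  induction hf with
  | log =>
    refine ⟨1, 1, zero_le_one, fun v hv => ?_⟩
    have h1 := one_le_coshDeriv hv
    rw [abs_of_nonneg (Real.log_nonneg h1), pow_one, one_mul, Real.log_le_iff_le_exp (by linarith)]
    have h2 : coshDeriv 0 v ≤ Real.exp v := by
      rw [Real.exp_eq_exp_ℝ, NormedSpace.exp_eq_tsum_div]
      refine (summable_coshDeriv 0 v).tsum_le_tsum (fun j => ?_) (Real.summable_pow_div_factorial v)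
      rw [div_eq_inv_mul]
      exact mul_le_mul_of_nonneg_right (coshCoeff_le 0 j) (by positivity)
    exact h2.trans (Real.exp_le_exp.2 (by linarith))
  | ratio k =>
    refine ⟨0, 1, zero_le_one, fun v hv => ?_⟩
    rw [abs_of_nonneg (coshRatio_nonneg k hv)]
    simpa using coshRatio_le_one k hv
  | add _ _ ihf ihg =>
    obtain ⟨k₁, C₁, h1, h2⟩ := ihf
    obtain ⟨k₂, C₂, h3, h4⟩ := ihg
    exact ⟨_, _, add_nonneg h1 h3, fun v hv => (abs_add_le _ _).trans (hsum h1 h3 h2 h4 v hv)⟩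
  | sub _ _ ihf ihg =>
    obtain ⟨k₁, C₁, h1, h2⟩ := ihf
    obtain ⟨k₂, C₂, h3, h4⟩ := ihg
    exact ⟨_, _, add_nonneg h1 h3, fun v hv => (abs_sub _ _).trans (hsum h1 h3 h2 h4 v hv)⟩
  | mul _ _ ihf ihg =>
    obtain ⟨k₁, C₁, h1, h2⟩ := ihf
    obtain ⟨k₂, C₂, h3, h4⟩ := ihg
    refine ⟨k₁ + k₂, C₁ * C₂, mul_nonneg h1 h3, fun v hv => ?_⟩
    rw [abs_mul, pow_add, mul_mul_mul_comm]
    exact mul_le_mul (h2 v hv) (h4 v hv) (abs_nonneg _) (by positivity)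

theorem CoshAlgebra.exists_iteratedDerivWithin {f : ℝ → ℝ} (hf : CoshAlgebra f) (n : ℕ) :
    ∃ g, CoshAlgebra g ∧ ∀ v ∈ Ici (0:ℝ), iteratedDerivWithin n f (Ici 0) v = g v := by
  induction n with
  | zero => exact ⟨f, hf, fun v _ => by simp⟩
  | succ n ih =>
    obtain ⟨g, hg, h1⟩ := ih
    obtain ⟨g', hg', h2⟩ := hg.exists_deriv
    refine ⟨g', hg', fun v hv => ?_⟩
    rw [iteratedDerivWithin_succ, derivWithin_congr h1 (h1 v hv)]
    exact (h2 v hv).hasDerivWithinAt.derivWithin (uniqueDiffOn_Ici 0 v hv)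

theorem CoshAlgebra.contDiffOn {f : ℝ → ℝ} (hf : CoshAlgebra f) : ContDiffOn ℝ ∞ f (Ici 0) := by
  refine contDiffOn_of_differentiableOn_deriv fun n _ v hv => ?_
  obtain ⟨g, hg, h1⟩ := hf.exists_iteratedDerivWithin n
  obtain ⟨g', -, h2⟩ := hg.exists_deriv
  exact (h2 v hv).differentiableAt.differentiableWithinAt.congr h1 (h1 v hv)

/-- Members of the algebra have temperate growth on `[0, ∞)`, so they may be composed with
nonnegative functions of temperate growth. -/
theorem CoshAlgebra.hasTemperateGrowth_comp {f : ℝ → ℝ} (hf : CoshAlgebra f) {D : Type*}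
    [NormedAddCommGroup D] [NormedSpace ℝ D] {φ : D → ℝ} (hφ : φ.HasTemperateGrowth)
    (h0 : ∀ x, 0 ≤ φ x) : (fun x => f (φ x)).HasTemperateGrowth := by
  refine Function.HasTemperateGrowth.comp' (t := Ici 0) (by rintro _ ⟨x, rfl⟩; exact h0 x)
    (uniqueDiffOn_Ici 0) hf.contDiffOn (fun N => ?_) hφ
  have key : ∀ n : ℕ, ∃ (k : ℕ) (C : ℝ), 0 ≤ C ∧ ∀ v ∈ Ici (0:ℝ),
      ‖iteratedFDerivWithin ℝ n f (Ici 0) v‖ ≤ C * (1 + ‖v‖) ^ k := by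
    intro n
    obtain ⟨g, hg, h1⟩ := hf.exists_iteratedDerivWithin n
    obtain ⟨k, C, hC, h2⟩ := hg.exists_bound
    refine ⟨k, C, hC, fun v hv => ?_⟩
    rw [norm_iteratedFDerivWithin_eq_norm_iteratedDerivWithin, h1 v hv, Real.norm_of_nonneg hv]
    exact h2 v hv
  choose k C hC h using key
  refine ⟨∑ n ∈ Finset.range (N + 1), k n, ∑ n ∈ Finset.range (N + 1), C n,
    Finset.sum_nonneg fun n _ => hC n, fun n hn v hv => (h n v hv).trans ?_⟩
  have hn' : n ∈ Finset.range (N + 1) := Finset.mem_range.2 (by lia)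
  have e1 : k n ≤ ∑ n ∈ Finset.range (N + 1), k n :=
    Finset.single_le_sum (f := k) (fun _ _ => Nat.zero_le _) hn'
  have e2 : C n ≤ ∑ n ∈ Finset.range (N + 1), C n :=
    Finset.single_le_sum (f := C) (fun n _ => hC n) hn'
  refine mul_le_mul e2 (pow_le_pow_right₀ (by linarith [norm_nonneg v]) e1) (by positivity)
    (Finset.sum_nonneg fun n _ => hC n)

end CoshSqrt
end

noncomputable section

/-! ### The heat kernel and its Fourier transform -/

section SchwartzExp

variable {D : Type*} [NormedAddCommGroup D] [NormedSpace ℝ D]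

/-- `exp(-f)` is a Schwartz function if the derivatives of `f` have polynomial growth and `f` grows
at least linearly. -/
theorem exp_neg_decay {f : D → ℝ} (hf : f.HasTemperateGrowth) {a b : ℝ} (ha : 0 < a)
    (hb : ∀ x, a * ‖x‖ - b ≤ f x) (k n : ℕ) : ∃ C : ℝ, ∀ x : D,
      ‖x‖ ^ k * ‖iteratedFDeriv ℝ n (fun x => ((Real.exp (-f x) : ℝ) : ℂ)) x‖ ≤ C := by
  obtain ⟨q, C₀, hC₀, hC⟩ := hf.norm_iteratedFDeriv_le_uniform n
  have hsm : ContDiff ℝ ∞ fun x => Real.exp (-f x) := Real.contDiff_exp.comp hf.1.neg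
  have h1 : ∀ x : D, ‖iteratedFDeriv ℝ n (fun x => ((Real.exp (-f x) : ℝ) : ℂ)) x‖ ≤
      n.factorial * Real.exp (-f x) * ((1 + C₀) * (1 + ‖x‖) ^ q) ^ n := by
    intro x
    have e1 := (Complex.ofRealLI).norm_iteratedFDeriv_comp_left (x := x) (i := n)
      (hsm.contDiffAt) (by exact_mod_cast le_top)
    refine (le_of_eq e1).trans (norm_iteratedFDeriv_comp_le (g := Real.exp) (f := fun x => -f x)
      Real.contDiff_exp hf.1.neg (by exact_mod_cast le_top) x (fun i _ => ?_) (fun i hi hin => ?_))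
    · rw [norm_iteratedFDeriv_eq_norm_iteratedDeriv, iteratedDeriv_eq_iterate, Real.iter_deriv_exp,
        Real.norm_of_nonneg (Real.exp_pos _).le]
    · have e2 : ‖iteratedFDeriv ℝ i (fun x => -f x) x‖ = ‖iteratedFDeriv ℝ i f x‖ := by
        rw [show (fun x => -f x) = -f from rfl, iteratedFDeriv_neg, Pi.neg_apply, norm_neg]
      rw [e2]
      have e3 : 1 ≤ (1 + ‖x‖) ^ q := one_le_pow₀ (by linarith [norm_nonneg x])
      have e4 : 1 ≤ (1 + C₀) * (1 + ‖x‖) ^ q := by nlinarith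
      refine (hC i hin x).trans (le_trans ?_ (le_self_pow₀ e4 (by lia)))
      nlinarith
  have h2 : ∀ x : D, Real.exp (-f x) * (1 + ‖x‖) ^ (k + q * n) ≤
      Real.exp (a + b) * ((k + q * n).factorial / a ^ (k + q * n)) := by
    intro x
    have e1 := Real.pow_div_factorial_le_exp (a * (1 + ‖x‖)) (by positivity) (k + q * n)
    have e2 : (1 + ‖x‖) ^ (k + q * n) ≤
        Real.exp (a * (1 + ‖x‖)) * ((k + q * n).factorial / a ^ (k + q * n)) := by
      rw [mul_pow, div_le_iff₀ (by positivity)] at e1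
      rw [← mul_div_assoc, le_div_iff₀ (by positivity)]
      linarith
    calc _ ≤ Real.exp (b - a * ‖x‖) *
          (Real.exp (a * (1 + ‖x‖)) * ((k + q * n).factorial / a ^ (k + q * n))) := by
          gcongr
          linarith [hb x]
      _ = _ := by
          rw [← mul_assoc, ← Real.exp_add]
          congr 2
          ring
  refine ⟨n.factorial * (1 + C₀) ^ n *
    (Real.exp (a + b) * ((k + q * n).factorial / a ^ (k + q * n))), fun x => ?_⟩
  calc _ ≤ (1 + ‖x‖) ^ k * (n.factorial * Real.exp (-f x) * ((1 + C₀) * (1 + ‖x‖) ^ q) ^ n) := by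
        gcongr
        · linarith
        · exact h1 x
    _ = n.factorial * (1 + C₀) ^ n * (Real.exp (-f x) * (1 + ‖x‖) ^ (k + q * n)) := by
        rw [mul_pow, pow_add, pow_mul]
        ring
    _ ≤ _ := by
        exact mul_le_mul_of_nonneg_left (h2 x) (by positivity)

end SchwartzExp

/-- The group `ℝ^{d₁} × ℝ^{d₂}` with the Euclidean norm, as the domain of the Fourier transform. -/
abbrev HFreq (d₁ d₂ : ℕ) : Type :=
  WithLp 2 (EuclideanSpace ℝ (Fin d₁) × EuclideanSpace ℝ (Fin d₂))

section HeatSymbol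

variable {d₁ d₂ : ℕ}

/-- The phase `Φ(ξ, μ)` for which `exp(-Φ)` is the Fourier transform of the heat kernel at time `1`.
With `ω = 2πξ` and `ν = 2πμ` it is `(d₁ / 2) log cosh |ν| + |ω|² tanh |ν| / |ν|`. -/
def heatPhase (d₁ d₂ : ℕ) (w : HFreq d₁ d₂) : ℝ :=
  d₁ / 2 * Real.log (coshDeriv 0 (4 * Real.pi ^ 2 * ‖w.snd‖ ^ 2)) +
    8 * Real.pi ^ 2 * ‖w.fst‖ ^ 2 * coshRatio 1 (4 * Real.pi ^ 2 * ‖w.snd‖ ^ 2)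

theorem hasTemperateGrowth_fst_sq :
    (fun w : HFreq d₁ d₂ => ‖w.fst‖ ^ 2).HasTemperateGrowth :=
  (Function.hasTemperateGrowth_norm_sq (EuclideanSpace ℝ (Fin d₁))).comp
    (WithLp.fstL 2 ℝ (EuclideanSpace ℝ (Fin d₁)) (EuclideanSpace ℝ (Fin d₂))).hasTemperateGrowth

theorem hasTemperateGrowth_snd_sq :
    (fun w : HFreq d₁ d₂ => 4 * Real.pi ^ 2 * ‖w.snd‖ ^ 2).HasTemperateGrowth :=
  (Function.HasTemperateGrowth.const (4 * Real.pi ^ 2)).mul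
    ((Function.hasTemperateGrowth_norm_sq (EuclideanSpace ℝ (Fin d₂))).comp
    (WithLp.sndL 2 ℝ (EuclideanSpace ℝ (Fin d₁)) (EuclideanSpace ℝ (Fin d₂))).hasTemperateGrowth)

theorem hasTemperateGrowth_heatPhase : (heatPhase d₁ d₂).HasTemperateGrowth := by
  have h0 : ∀ w : HFreq d₁ d₂, 0 ≤ 4 * Real.pi ^ 2 * ‖w.snd‖ ^ 2 := fun w => by positivity
  have h1 := CoshAlgebra.hasTemperateGrowth_comp CoshAlgebra.log
    (hasTemperateGrowth_snd_sq (d₁ := d₁) (d₂ := d₂)) h0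
  have h2 := CoshAlgebra.hasTemperateGrowth_comp (CoshAlgebra.ratio 1)
    (hasTemperateGrowth_snd_sq (d₁ := d₁) (d₂ := d₂)) h0
  exact ((Function.HasTemperateGrowth.const ((d₁ : ℝ) / 2)).mul h1).add
    (((Function.HasTemperateGrowth.const (8 * Real.pi ^ 2)).mul hasTemperateGrowth_fst_sq).mul h2)

/-- The phase grows at least linearly: the term with `log cosh` controls `|μ|`, and the other one,
at least `|ω|² / (1 + |ν|)`, controls `|ξ|` together with it. -/
theorem norm_sub_le_heatPhase (hd : 2 ≤ d₁) (w : HFreq d₁ d₂) :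
    1 * ‖w‖ - (d₁ / 2 * Real.log 2 + 1) ≤ heatPhase d₁ d₂ w := by
  have hd' : (1 : ℝ) ≤ d₁ / 2 := by
    have : (2 : ℝ) ≤ d₁ := by exact_mod_cast hd
    linarith
  set r := 2 * Real.pi * ‖w.snd‖ with hr
  set o := 2 * Real.pi * ‖w.fst‖ with ho
  have hr0 : 0 ≤ r := by positivity
  have ho0 : 0 ≤ o := by positivity
  have e1 : 4 * Real.pi ^ 2 * ‖w.snd‖ ^ 2 = r ^ 2 := by rw [hr]; ring
  have e2 : 8 * Real.pi ^ 2 * ‖w.fst‖ ^ 2 = 2 * o ^ 2 := by rw [ho]; ring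
  have h1 := log_coshDeriv_sq_ge r
  have h2 := coshRatio_one_ge hr0
  have h3 : r - d₁ / 2 * Real.log 2 ≤ d₁ / 2 * Real.log (coshDeriv 0 (r ^ 2)) := by nlinarith
  have h4 : 2 * o - (1 + r) ≤ 2 * o ^ 2 * coshRatio 1 (r ^ 2) := by
    have : o ^ 2 ≤ 2 * o ^ 2 * coshRatio 1 (r ^ 2) * (1 + r) := by nlinarith [sq_nonneg o]
    have h5 : 2 * o * (1 + r) - (1 + r) ^ 2 ≤ o ^ 2 := by nlinarith [sq_nonneg (o - (1 + r))]
    by_contra! hc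
    nlinarith
  have h5 : 0 ≤ 2 * o ^ 2 * coshRatio 1 (r ^ 2) := by
    have := coshRatio_nonneg 1 (sq_nonneg r)
    positivity
  have h6 : ‖w‖ ≤ ‖w.fst‖ + ‖w.snd‖ := by
    refine abs_le_of_sq_le_sq' ?_ (by positivity) |>.2
    rw [WithLp.prod_norm_sq_eq_of_L2]
    nlinarith [norm_nonneg w.fst, norm_nonneg w.snd]
  have h7 : 2 * ‖w.fst‖ ≤ o := by
    rw [ho]; nlinarith [norm_nonneg w.fst, Real.pi_gt_three]
  have h8 : 2 * ‖w.snd‖ ≤ r := by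
    rw [hr]; nlinarith [norm_nonneg w.snd, Real.pi_gt_three]
  rw [heatPhase, e1, e2]
  linarith

/-- The Fourier transform `exp(-Φ)` of the heat kernel at time `1`. -/
def heatSymbol (d₁ d₂ : ℕ) (hd : 2 ≤ d₁) : 𝓢(HFreq d₁ d₂, ℂ) where
  toFun w := ((Real.exp (-heatPhase d₁ d₂ w) : ℝ) : ℂ)
  smooth' := Complex.ofRealCLM.contDiff.comp
    (Real.contDiff_exp.comp hasTemperateGrowth_heatPhase.1.neg)
  decay' k n := exp_neg_decay hasTemperateGrowth_heatPhase one_pos (norm_sub_le_heatPhase hd) k n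

end HeatSymbol

section FourierInverse

open scoped LineDeriv FourierTransform

variable {V : Type*} [NormedAddCommGroup V] [InnerProductSpace ℝ V]

/-- Multiplication by the linear functional `⟨·, m⟩` on Schwartz functions. -/
abbrev coordMul (m : V) : 𝓢(V, ℂ) →L[ℝ] 𝓢(V, ℂ) :=
  SchwartzMap.smulLeftCLM ℂ fun x : V => inner ℝ x m

theorem coordMul_apply (m : V) (f : 𝓢(V, ℂ)) (x : V) :
    coordMul m f x = (inner ℝ x m : ℝ) * f x := by
  rw [coordMul, SchwartzMap.smulLeftCLM_apply_apply (by fun_prop)]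
  simp

/-- The commutator of a derivative with the multiplication by a linear function. -/
theorem lineDeriv_coordMul (m v : V) (f : 𝓢(V, ℂ)) :
    ∂_{v} (coordMul m f) = (inner ℝ v m : ℝ) • f + coordMul m (∂_{v} f) := by
  ext x
  have h1 : HasFDerivAt (fun x : V => ((inner ℝ x m : ℝ) : ℂ))
      (Complex.ofRealCLM.comp ((innerSL ℝ).flip m)) x :=
    (Complex.ofRealCLM.comp ((innerSL ℝ).flip m)).hasFDerivAt
  have h2 := h1.mul (f.differentiableAt (x := x)).hasFDerivAt
  have h3 : (coordMul m f : V → ℂ) = fun x => ((inner ℝ x m : ℝ) : ℂ) * f x :=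
    funext fun x => coordMul_apply m f x
  rw [SchwartzMap.lineDerivOp_apply_eq_fderiv, h3]
  refine (congrArg (fun L : V →L[ℝ] ℂ => L v) h2.fderiv).trans ?_
  have h4 : ((innerSL ℝ) m) v = inner ℝ v m := real_inner_comm _ _
  simp [coordMul_apply, SchwartzMap.lineDerivOp_apply_eq_fderiv, h4]
  ring

variable [FiniteDimensional ℝ V] [MeasurableSpace V] [BorelSpace V]

theorem lineDeriv_fourierInv (m : V) (f : 𝓢(V, ℂ)) :
    ∂_{m} (𝓕⁻ f) = 𝓕⁻ ((2 * Real.pi * Complex.I) • coordMul m f) :=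
  SchwartzMap.lineDerivOp_fourierInv_eq f m

theorem coordMul_fourierInv (m : V) (f : 𝓢(V, ℂ)) :
    coordMul m (𝓕⁻ f) = 𝓕⁻ ((Complex.I / (2 * Real.pi)) • ∂_{m} f) := by
  have h1 := SchwartzMap.fourierInv_lineDerivOp_eq f m
  have h2 : (Complex.I / (2 * Real.pi)) * -(2 * Real.pi * Complex.I) = 1 := by
    have : (Real.pi : ℂ) ≠ 0 := by exact_mod_cast Real.pi_ne_zero
    field_simp
    simp
  rw [FourierTransform.fourierInv_smul, h1, smul_smul, h2, one_smul]

end FourierInverse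

section HeatEquation

open scoped LineDeriv FourierTransform

variable {d₁ d₂ : ℕ} (G : HTypeGroup d₁ d₂)

theorem HTypeGroup.inner_J_self (μ : EuclideanSpace ℝ (Fin d₂)) (x : EuclideanSpace ℝ (Fin d₁)) :
    inner ℝ x (G.J μ x) = (0 : ℝ) := by
  have := G.skew μ x x
  rw [real_inner_comm] at this
  linarith

theorem HTypeGroup.norm_J_sq (μ : EuclideanSpace ℝ (Fin d₂)) (x : EuclideanSpace ℝ (Fin d₁)) :
    ‖G.J μ x‖ ^ 2 = ‖μ‖ ^ 2 * ‖x‖ ^ 2 := by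
  rw [← real_inner_self_eq_norm_sq, G.skew, G.J_sq, inner_smul_right, real_inner_self_eq_norm_sq]
  ring

/-- The vector `(x, 0)` of the first layer. -/
abbrev layerOne (d₂ : ℕ) (x : EuclideanSpace ℝ (Fin d₁)) : HFreq d₁ d₂ := WithLp.toLp 2 (x, 0)

/-- The vector `(0, U_i)` of the second layer. -/
abbrev layerTwo (d₁ : ℕ) (i : Fin d₂) : HFreq d₁ d₂ :=
  WithLp.toLp 2 (0, EuclideanSpace.single i 1)

theorem HFreq.ext {a b : HFreq d₁ d₂}
    (h₁ : WithLp.fstL 2 ℝ (EuclideanSpace ℝ (Fin d₁)) (EuclideanSpace ℝ (Fin d₂)) a =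
      WithLp.fstL 2 ℝ (EuclideanSpace ℝ (Fin d₁)) (EuclideanSpace ℝ (Fin d₂)) b)
    (h₂ : WithLp.sndL 2 ℝ (EuclideanSpace ℝ (Fin d₁)) (EuclideanSpace ℝ (Fin d₂)) a =
      WithLp.sndL 2 ℝ (EuclideanSpace ℝ (Fin d₁)) (EuclideanSpace ℝ (Fin d₂)) b) : a = b :=
  WithLp.ofLp_injective 2 (Prod.ext h₁ h₂)

theorem fstL_layerOne (x : EuclideanSpace ℝ (Fin d₁)) :
    WithLp.fstL 2 ℝ (EuclideanSpace ℝ (Fin d₁)) (EuclideanSpace ℝ (Fin d₂)) (layerOne d₂ x) = x :=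
  rfl

theorem sndL_layerOne (x : EuclideanSpace ℝ (Fin d₁)) :
    WithLp.sndL 2 ℝ (EuclideanSpace ℝ (Fin d₁)) (EuclideanSpace ℝ (Fin d₂)) (layerOne d₂ x) = 0 :=
  rfl

theorem fstL_layerTwo (i : Fin d₂) :
    WithLp.fstL 2 ℝ (EuclideanSpace ℝ (Fin d₁)) (EuclideanSpace ℝ (Fin d₂)) (layerTwo d₁ i) = 0 :=
  rfl

theorem sndL_layerTwo (i : Fin d₂) :
    WithLp.sndL 2 ℝ (EuclideanSpace ℝ (Fin d₁)) (EuclideanSpace ℝ (Fin d₂)) (layerTwo d₁ i) =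
      EuclideanSpace.single i 1 :=
  rfl

/-- The vector field `X_j` on Schwartz functions over `HFreq`. -/
def HTypeGroup.freqX (j : Fin d₁) (f : 𝓢(HFreq d₁ d₂, ℂ)) : 𝓢(HFreq d₁ d₂, ℂ) :=
  ∂_{layerOne d₂ (EuclideanSpace.single j (1 : ℝ))} f - ∑ i, (1 / 2 : ℝ) •
    coordMul (layerOne d₂ (G.J (EuclideanSpace.single i 1) (EuclideanSpace.single j 1)))
      (∂_{layerTwo d₁ i} f)

/-- The conjugate `Y_j` of `X_j` by the Fourier transform:
`Y_j f(ξ, μ) = 2πi ξ_j f + ½ ∂_{(J_μ e_j, 0)} f`. -/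
def HTypeGroup.freqY (j : Fin d₁) (f : 𝓢(HFreq d₁ d₂, ℂ)) : 𝓢(HFreq d₁ d₂, ℂ) :=
  (2 * Real.pi * Complex.I) • coordMul (layerOne d₂ (EuclideanSpace.single j (1 : ℝ))) f +
    ∑ i, (1 / 2 : ℝ) • coordMul (layerTwo d₁ i)
      (∂_{layerOne d₂ (G.J (EuclideanSpace.single i 1) (EuclideanSpace.single j 1))} f)

/-- The Fourier transform conjugates `X_j` to `Y_j`. The two factors in the second order term
commute because `J_{U_i} e_j` and `U_i` lie in different layers. -/
theorem HTypeGroup.freqX_fourierInv (j : Fin d₁) (f : 𝓢(HFreq d₁ d₂, ℂ)) :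
    G.freqX j (𝓕⁻ f) = 𝓕⁻ (G.freqY j f) := by
  have h2 : (Complex.I / (2 * Real.pi)) * (2 * Real.pi * Complex.I) = -1 := by
    have : (Real.pi : ℂ) ≠ 0 := by exact_mod_cast Real.pi_ne_zero
    field_simp
    simp
  have h3 : ∀ i : Fin d₂, coordMul (layerOne d₂ (G.J (EuclideanSpace.single i 1)
      (EuclideanSpace.single j 1))) (∂_{layerTwo d₁ i} (𝓕⁻ f)) =
      𝓕⁻ (-coordMul (layerTwo d₁ i)
        (∂_{layerOne d₂ (G.J (EuclideanSpace.single i 1) (EuclideanSpace.single j 1))} f)) := by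
    intro i
    rw [lineDeriv_fourierInv, coordMul_fourierInv]
    congr 1
    rw [LineDeriv.lineDerivOp_smul, smul_smul, h2, lineDeriv_coordMul]
    simp
  rw [freqX, freqY, FourierTransform.fourierInv_add, ← lineDeriv_fourierInv, sub_eq_add_neg]
  congr 1
  rw [FourierTransform.fourierInv_sum, ← Finset.sum_neg_distrib]
  refine Finset.sum_congr rfl fun i _ => ?_
  rw [h3, FourierTransform.fourierInv_neg, FourierTransform.fourierInv_smul, smul_neg, neg_neg]

theorem fderiv_eq_of_hasDerivAt_line {V : Type*} [NormedAddCommGroup V] [NormedSpace ℝ V]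
    (f : 𝓢(V, ℂ)) {w v : V} {d : ℂ} (h : HasDerivAt (fun t : ℝ => f (w + t • v)) d 0) :
    fderiv ℝ f w v = d := by
  have h1 : HasDerivAt (fun t : ℝ => w + t • v) v 0 := by
    simpa using ((hasDerivAt_id (0 : ℝ)).smul_const v).const_add w
  have h2 : HasFDerivAt f (fderiv ℝ f w) (w + (0 : ℝ) • v) := by
    simpa using f.differentiableAt.hasFDerivAt
  exact (h2.comp_hasDerivAt (0 : ℝ) h1).unique h

theorem HTypeGroup.freqY_apply (j : Fin d₁) (f : 𝓢(HFreq d₁ d₂, ℂ)) (w : HFreq d₁ d₂) :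
    G.freqY j f w = 2 * Real.pi * Complex.I * w.fst j * f w +
      1 / 2 * fderiv ℝ f w (layerOne d₂ (G.J w.snd (EuclideanSpace.single j 1))) := by
  have h1 : layerOne d₂ (G.J w.snd (EuclideanSpace.single j 1)) = ∑ i, w.snd i •
      layerOne d₂ (G.J (EuclideanSpace.single i 1) (EuclideanSpace.single j 1)) := by
    have e1 : w.snd = ∑ i, w.snd i • EuclideanSpace.single i (1 : ℝ) := by
      simpa using ((EuclideanSpace.basisFun (Fin d₂) ℝ).sum_repr w.snd).symm
    let T : EuclideanSpace ℝ (Fin d₂) →ₗ[ℝ] HFreq d₁ d₂ :=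
      { toFun := fun μ => layerOne d₂ (G.J μ (EuclideanSpace.single j 1))
        map_add' := fun a b => by
          rw [map_add, LinearMap.add_apply]
          exact congrArg (WithLp.toLp 2) (Prod.ext rfl (add_zero 0).symm)
        map_smul' := fun c a => by
          rw [map_smul, LinearMap.smul_apply]
          exact congrArg (WithLp.toLp 2) (Prod.ext rfl (smul_zero c).symm) }
    change T w.snd = ∑ i, w.snd i • T (EuclideanSpace.single i 1)
    conv_lhs => rw [e1]
    simp
  rw [h1, freqY, map_sum]
  simp only [map_smul, add_apply, smul_apply, sum_apply,
    coordMul_apply, SchwartzMap.lineDerivOp_apply_eq_fderiv, WithLp.prod_inner_apply,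
    Complex.real_smul, Finset.mul_sum]
  simp [EuclideanSpace.inner_single_right, mul_assoc]

theorem hasDerivAt_heatSymbol_fst (hd : 2 ≤ d₁) (w : HFreq d₁ d₂)
    (a : EuclideanSpace ℝ (Fin d₁)) :
    HasDerivAt (fun t : ℝ => heatSymbol d₁ d₂ hd (w + t • layerOne d₂ a))
      (-(16 * Real.pi ^ 2 * coshRatio 1 (4 * Real.pi ^ 2 * ‖w.snd‖ ^ 2) * inner ℝ w.fst a : ℝ) *
        heatSymbol d₁ d₂ hd w) 0 := by
  have h1 : HasDerivAt (fun t : ℝ => ‖w.fst + t • a‖ ^ 2) (2 * inner ℝ w.fst a) 0 := by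
    have e1 : HasDerivAt (fun t : ℝ => w.fst + t • a) a 0 := by
      simpa using ((hasDerivAt_id (0 : ℝ)).smul_const a).const_add w.fst
    simpa using e1.norm_sq
  have h2 : ∀ t : ℝ, heatPhase d₁ d₂ (w + t • layerOne d₂ a) =
      d₁ / 2 * Real.log (coshDeriv 0 (4 * Real.pi ^ 2 * ‖w.snd‖ ^ 2)) +
    8 * Real.pi ^ 2 * ‖w.fst + t • a‖ ^ 2 * coshRatio 1 (4 * Real.pi ^ 2 * ‖w.snd‖ ^ 2) := by
    intro t
    simp [heatPhase]
  have h3 : HasDerivAt (fun t : ℝ => heatPhase d₁ d₂ (w + t • layerOne d₂ a))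
      (16 * Real.pi ^ 2 * coshRatio 1 (4 * Real.pi ^ 2 * ‖w.snd‖ ^ 2) * inner ℝ w.fst a) 0 := by
    simp only [h2]
    refine (((h1.const_mul (8 * Real.pi ^ 2)).mul_const _).const_add _).congr_deriv ?_
    ring
  refine h3.neg.exp.ofReal_comp.congr_deriv ?_
  rw [Pi.neg_apply, zero_smul, add_zero, mul_comm, Complex.ofReal_mul, Complex.ofReal_neg]
  rfl

/-- The derivative of the symbol along the dilations. The Riccati equation removes the second
logarithmic derivative of `cosh √v` from it. -/
theorem hasDerivAt_heatSymbol_dilation (hd : 2 ≤ d₁) (w : HFreq d₁ d₂) :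
    HasDerivAt (fun t : ℝ => heatSymbol d₁ d₂ hd (w + t • WithLp.toLp 2 ((1 / 2 : ℝ) • w.fst, w.snd)))
      (-(4 * Real.pi ^ 2 * ‖w.fst‖ ^ 2 - 16 * Real.pi ^ 2 * (4 * Real.pi ^ 2 * ‖w.snd‖ ^ 2) *
        coshRatio 1 (4 * Real.pi ^ 2 * ‖w.snd‖ ^ 2) ^ 2 * ‖w.fst‖ ^ 2 +
        d₁ * coshRatio 1 (4 * Real.pi ^ 2 * ‖w.snd‖ ^ 2) * (4 * Real.pi ^ 2 * ‖w.snd‖ ^ 2) : ℝ) *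
        heatSymbol d₁ d₂ hd w) 0 := by
  set v := 4 * Real.pi ^ 2 * ‖w.snd‖ ^ 2 with hv
  have hv0 : 0 ≤ v := by positivity
  have hg : HasDerivAt (fun t : ℝ => v * (1 + t) ^ 2) (2 * v) 0 := by
    refine ((((hasDerivAt_id (0 : ℝ)).const_add 1).pow 2).const_mul v).congr_deriv ?_
    simp
    ring
  have hk : HasDerivAt (fun t : ℝ => 8 * Real.pi ^ 2 * (‖w.fst‖ ^ 2 * (1 + t / 2) ^ 2))
      (8 * Real.pi ^ 2 * ‖w.fst‖ ^ 2) 0 := by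
    refine ((((((hasDerivAt_id (0 : ℝ)).div_const 2).const_add 1).pow 2).const_mul
      (‖w.fst‖ ^ 2)).const_mul (8 * Real.pi ^ 2)).congr_deriv ?_
    simp
  have h2 : ∀ t : ℝ, heatPhase d₁ d₂ (w + t • WithLp.toLp 2 ((1 / 2 : ℝ) • w.fst, w.snd)) =
      d₁ / 2 * Real.log (coshDeriv 0 (v * (1 + t) ^ 2)) +
        8 * Real.pi ^ 2 * (‖w.fst‖ ^ 2 * (1 + t / 2) ^ 2) * coshRatio 1 (v * (1 + t) ^ 2) := by
    intro t
    have e1 : (w + t • WithLp.toLp 2 ((1 / 2 : ℝ) • w.fst, w.snd)).fst = (1 + t / 2) • w.fst := by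
      change w.fst + t • (1 / 2 : ℝ) • w.fst = (1 + t / 2) • w.fst
      module
    have e2 : (w + t • WithLp.toLp 2 ((1 / 2 : ℝ) • w.fst, w.snd)).snd = (1 + t) • w.snd := by
      change w.snd + t • w.snd = (1 + t) • w.snd
      module
    simp only [heatPhase, e1, e2, norm_smul, mul_pow, Real.norm_eq_abs, sq_abs, hv]
    ring_nf
  have hz : v * (1 + (0 : ℝ)) ^ 2 = v := by ring
  have hlog : HasDerivAt (fun t : ℝ => Real.log (coshDeriv 0 (v * (1 + t) ^ 2)))
      (coshRatio 1 v * (2 * v)) 0 := by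
    have := hasDerivAt_log_cosh hv0
    rw [← hz] at this
    exact (this.comp (0 : ℝ) hg).congr_deriv (by rw [hz])
  have hr : HasDerivAt (fun t : ℝ => coshRatio 1 (v * (1 + t) ^ 2))
      ((coshRatio 2 v - coshRatio 1 v * coshRatio 1 v) * (2 * v)) 0 := by
    have := hasDerivAt_coshRatio 1 hv0
    rw [← hz] at this
    exact (this.comp (0 : ℝ) hg).congr_deriv (by rw [hz])
  have h3 : HasDerivAt (fun t : ℝ => heatPhase d₁ d₂
      (w + t • WithLp.toLp 2 ((1 / 2 : ℝ) • w.fst, w.snd)))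
      (4 * Real.pi ^ 2 * ‖w.fst‖ ^ 2 - 16 * Real.pi ^ 2 * v *
        coshRatio 1 v ^ 2 * ‖w.fst‖ ^ 2 + d₁ * coshRatio 1 v * v) 0 := by
    simp only [h2]
    refine ((hlog.const_mul ((d₁ : ℝ) / 2)).add (hk.mul hr)).congr_deriv ?_
    have := coshRatio_riccati hv0
    simp only [add_zero, zero_div, one_pow, mul_one]
    linear_combination (4 * Real.pi ^ 2 * ‖w.fst‖ ^ 2) * this
  refine h3.neg.exp.ofReal_comp.congr_deriv ?_
  rw [Pi.neg_apply, zero_smul, add_zero, mul_comm, Complex.ofReal_mul, Complex.ofReal_neg]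
  rfl

theorem HTypeGroup.freqY_heatSymbol (hd : 2 ≤ d₁) (j : Fin d₁) (w : HFreq d₁ d₂) :
    G.freqY j (heatSymbol d₁ d₂ hd) w = (2 * Real.pi * Complex.I * w.fst j -
      8 * Real.pi ^ 2 * coshRatio 1 (4 * Real.pi ^ 2 * ‖w.snd‖ ^ 2) *
        (inner ℝ w.fst (G.J w.snd (EuclideanSpace.single j 1)) : ℝ)) * heatSymbol d₁ d₂ hd w := by
  rw [G.freqY_apply, fderiv_eq_of_hasDerivAt_line _ (hasDerivAt_heatSymbol_fst hd w _)]
  push_cast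
  ring

/-- Applying `Y_j` a second time. The derivative in the direction `J_μ e_j` does not act on the
factor `ξ_j`, as `J_μ e_j` is orthogonal to `e_j`. -/
theorem HTypeGroup.freqY_freqY_heatSymbol (hd : 2 ≤ d₁) (j : Fin d₁) (w : HFreq d₁ d₂) :
    G.freqY j (G.freqY j (heatSymbol d₁ d₂ hd)) w = ((2 * Real.pi * Complex.I * w.fst j -
      8 * Real.pi ^ 2 * coshRatio 1 (4 * Real.pi ^ 2 * ‖w.snd‖ ^ 2) *
        (inner ℝ w.fst (G.J w.snd (EuclideanSpace.single j 1)) : ℝ)) ^ 2 -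
      4 * Real.pi ^ 2 * coshRatio 1 (4 * Real.pi ^ 2 * ‖w.snd‖ ^ 2) * ‖w.snd‖ ^ 2) *
        heatSymbol d₁ d₂ hd w := by
  set a := G.J w.snd (EuclideanSpace.single j 1) with ha
  set r := coshRatio 1 (4 * Real.pi ^ 2 * ‖w.snd‖ ^ 2) with hr
  have haj : a j = 0 := by
    have := G.inner_J_self w.snd (EuclideanSpace.single j 1)
    rw [← ha] at this
    simpa [EuclideanSpace.inner_single_left] using this
  have haa : inner ℝ a a = ‖w.snd‖ ^ 2 := by
    rw [real_inner_self_eq_norm_sq, ha, G.norm_J_sq]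
    simp
  have h1 : ∀ t : ℝ, G.freqY j (heatSymbol d₁ d₂ hd) (w + t • layerOne d₂ a) =
      (2 * Real.pi * Complex.I * w.fst j - 8 * Real.pi ^ 2 * r *
        ((inner ℝ w.fst a : ℝ) + ‖w.snd‖ ^ 2 * t)) * heatSymbol d₁ d₂ hd (w + t • layerOne d₂ a) := by
    intro t
    rw [G.freqY_heatSymbol]
    have e1 : (w + t • layerOne d₂ a).snd = w.snd := by simp
    have e2 : (w + t • layerOne d₂ a).fst = w.fst + t • a := by simp
    rw [e1, e2, ← ha, ← hr, inner_add_left, inner_smul_left, haa]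
    simp [haj]
    ring_nf
    simp
  have h2 : HasDerivAt (fun t : ℝ => 2 * Real.pi * Complex.I * w.fst j - 8 * Real.pi ^ 2 * r *
        ((inner ℝ w.fst a : ℝ) + ‖w.snd‖ ^ 2 * (t : ℂ)))
      (-(8 * Real.pi ^ 2 * r * ‖w.snd‖ ^ 2) : ℂ) 0 := by
    have e : HasDerivAt (fun t : ℝ => (t : ℂ)) 1 0 := (hasDerivAt_id (0 : ℝ)).ofReal_comp
    refine ((((e.const_mul ((‖w.snd‖ : ℂ) ^ 2)).const_add _).const_mul _).const_sub _).congr_deriv ?_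
    ring
  have h3 := h2.mul (hasDerivAt_heatSymbol_fst hd w a)
  have h4 := fderiv_eq_of_hasDerivAt_line (G.freqY j (heatSymbol d₁ d₂ hd)) (w := w)
    (v := layerOne d₂ a) (h3.congr_of_eventuallyEq (Filter.Eventually.of_forall h1))
  rw [G.freqY_apply, ← ha, h4, G.freqY_heatSymbol, ← ha, ← hr]
  simp
  ring

/-- The heat equation on the Fourier side, in self-similar form: `∑ Y_j²` acts on `exp(-Φ)` as the
generator of the dilations. -/
theorem HTypeGroup.sum_freqY_freqY_heatSymbol (hd : 2 ≤ d₁) (w : HFreq d₁ d₂) :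
    ∑ j, G.freqY j (G.freqY j (heatSymbol d₁ d₂ hd)) w =
      fderiv ℝ (heatSymbol d₁ d₂ hd) w (WithLp.toLp 2 ((1 / 2 : ℝ) • w.fst, w.snd)) := by
  rw [fderiv_eq_of_hasDerivAt_line _ (hasDerivAt_heatSymbol_dilation hd w)]
  simp only [G.freqY_freqY_heatSymbol, ← Finset.sum_mul]
  congr 1
  set r := coshRatio 1 (4 * Real.pi ^ 2 * ‖w.snd‖ ^ 2) with hr
  have h1 : ∀ j, inner ℝ w.fst (G.J w.snd (EuclideanSpace.single j 1)) = -G.J w.snd w.fst j := by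
    intro j
    rw [real_inner_comm, G.skew, EuclideanSpace.inner_single_left]
    simp
  have h2 : ∑ j, w.fst j ^ 2 = ‖w.fst‖ ^ 2 := (EuclideanSpace.real_norm_sq_eq _).symm
  have h3 : ∑ j, G.J w.snd w.fst j ^ 2 = ‖w.snd‖ ^ 2 * ‖w.fst‖ ^ 2 := by
    rw [← G.norm_J_sq, EuclideanSpace.real_norm_sq_eq]
  have h4 : ∑ j, w.fst j * G.J w.snd w.fst j = 0 := by
    rw [← G.inner_J_self w.snd w.fst, PiLp.inner_apply]
    refine Finset.sum_congr rfl fun j _ => ?_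
    simp [mul_comm]
  have h5 : ∀ j, (2 * Real.pi * Complex.I * w.fst j - 8 * Real.pi ^ 2 * r *
      (inner ℝ w.fst (G.J w.snd (EuclideanSpace.single j 1)) : ℝ)) ^ 2 -
      4 * Real.pi ^ 2 * r * ‖w.snd‖ ^ 2 =
      -(4 * Real.pi ^ 2) * ((w.fst j ^ 2 : ℝ) : ℂ) + 64 * Real.pi ^ 4 * r ^ 2 *
        ((G.J w.snd w.fst j ^ 2 : ℝ) : ℂ) + 32 * Real.pi ^ 3 * r * Complex.I *
        ((w.fst j * G.J w.snd w.fst j : ℝ) : ℂ) - 4 * Real.pi ^ 2 * r * ‖w.snd‖ ^ 2 := by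
    intro j
    rw [h1]
    push_cast
    linear_combination 4 * (Real.pi : ℂ) ^ 2 * (w.fst j : ℂ) ^ 2 * Complex.I_sq
  simp only [h5, Finset.sum_add_distrib, Finset.sum_sub_distrib, ← Finset.mul_sum,
    ← Complex.ofReal_sum, h2, h3, h4]
  simp
  ring

/-- The derivative along the dilations, `½ ξ·∂_ξ + μ·∂_μ`. -/
def freqEuler (f : 𝓢(HFreq d₁ d₂, ℂ)) : 𝓢(HFreq d₁ d₂, ℂ) :=
  ∑ j, (1 / 2 : ℝ) • coordMul (layerOne d₂ (EuclideanSpace.single j (1 : ℝ)))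
      (∂_{layerOne d₂ (EuclideanSpace.single j (1 : ℝ))} f) +
    ∑ i, coordMul (layerTwo d₁ i) (∂_{layerTwo d₁ i} f)

theorem freqEuler_apply (f : 𝓢(HFreq d₁ d₂, ℂ)) (w : HFreq d₁ d₂) :
    freqEuler f w = fderiv ℝ f w (WithLp.toLp 2 ((1 / 2 : ℝ) • w.fst, w.snd)) := by
  have e1 : w.fst = ∑ i, w.fst i • EuclideanSpace.single i (1 : ℝ) := by
    simpa using ((EuclideanSpace.basisFun (Fin d₁) ℝ).sum_repr w.fst).symm
  have e2 : w.snd = ∑ i, w.snd i • EuclideanSpace.single i (1 : ℝ) := by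
    simpa using ((EuclideanSpace.basisFun (Fin d₂) ℝ).sum_repr w.snd).symm
  have e3 : WithLp.toLp 2 ((1 / 2 : ℝ) • w.fst, w.snd) =
      ∑ j, ((1 / 2 : ℝ) * w.fst j) • layerOne d₂ (EuclideanSpace.single j (1 : ℝ)) +
        ∑ i, w.snd i • layerTwo d₁ i := by
    refine HFreq.ext ?_ ?_
    · have : (1 / 2 : ℝ) • w.fst =
          ∑ j, ((1 / 2 : ℝ) * w.fst j) • EuclideanSpace.single j (1 : ℝ) := by
        conv_lhs => rw [e1]
        simp [Finset.smul_sum, smul_smul]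
      simp only [map_add, map_sum, map_smul, fstL_layerOne, fstL_layerTwo, smul_zero,
        Finset.sum_const_zero, add_zero]
      exact this
    · simp only [map_add, map_sum, map_smul, sndL_layerOne, sndL_layerTwo, smul_zero,
        Finset.sum_const_zero, zero_add]
      exact e2
  rw [e3, freqEuler, map_add, map_sum, map_sum]
  simp only [map_smul, add_apply, smul_apply, sum_apply,
    coordMul_apply, SchwartzMap.lineDerivOp_apply_eq_fderiv, WithLp.prod_inner_apply,
    Complex.real_smul]
  simp [EuclideanSpace.inner_single_right, mul_assoc]

/-- The Fourier transform turns the generator of the dilations into minus its transpose. -/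
theorem freqEuler_fourierInv (f : 𝓢(HFreq d₁ d₂, ℂ)) :
    freqEuler (𝓕⁻ f) = 𝓕⁻ (-((d₁ / 2 + d₂ : ℝ) • f) - freqEuler f) := by
  have h2 : (Complex.I / (2 * Real.pi)) * (2 * Real.pi * Complex.I) = -1 := by
    have : (Real.pi : ℂ) ≠ 0 := by exact_mod_cast Real.pi_ne_zero
    field_simp
    simp
  have h3 : ∀ m : HFreq d₁ d₂, inner ℝ m m = (1 : ℝ) →
      coordMul m (∂_{m} (𝓕⁻ f)) = 𝓕⁻ (-(f + coordMul m (∂_{m} f))) := by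
    intro m hm
    rw [lineDeriv_fourierInv, coordMul_fourierInv]
    congr 1
    rw [LineDeriv.lineDerivOp_smul, smul_smul, h2, lineDeriv_coordMul, hm]
    module
  have h4 : ∀ j : Fin d₁, inner ℝ (layerOne d₂ (EuclideanSpace.single j (1 : ℝ)))
      (layerOne d₂ (EuclideanSpace.single j (1 : ℝ))) = (1 : ℝ) := by
    intro j
    simp
  have h5 : ∀ j : Fin d₂, inner ℝ (layerTwo d₁ j) (layerTwo d₁ j) = (1 : ℝ) := by
    intro j
    simp
  rw [freqEuler]
  simp only [h3 _ (h4 _), h3 _ (h5 _), ← FourierTransform.fourierInv_smul,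
    ← FourierTransform.fourierInv_sum, ← FourierTransform.fourierInv_add]
  congr 1
  rw [freqEuler]
  simp only [smul_neg, smul_add, neg_add, Finset.sum_add_distrib, Finset.sum_neg_distrib,
    Finset.sum_const, Finset.card_univ, Fintype.card_fin, ← Nat.cast_smul_eq_nsmul ℝ]
  module

theorem HTypeGroup.freqX_apply (j : Fin d₁) (f : 𝓢(HFreq d₁ d₂, ℂ)) (w : HFreq d₁ d₂) :
    G.freqX j f w = fderiv ℝ f w (WithLp.toLp 2 (EuclideanSpace.single j 1,
      (1 / 2 : ℝ) • G.bracket w.fst (EuclideanSpace.single j 1))) := by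
  have e2 : G.bracket w.fst (EuclideanSpace.single j 1) =
      ∑ i, (-inner ℝ w.fst (G.J (EuclideanSpace.single i 1) (EuclideanSpace.single j 1))) •
        EuclideanSpace.single i (1 : ℝ) := by
    ext k
    simp [bracket, G.skew, Finset.sum_apply, Pi.single_apply]
  have e3 : WithLp.toLp 2 (EuclideanSpace.single j 1,
      (1 / 2 : ℝ) • G.bracket w.fst (EuclideanSpace.single j 1)) =
      layerOne d₂ (EuclideanSpace.single j (1 : ℝ)) +
        ∑ i, (-(1 / 2 * inner ℝ w.fst (G.J (EuclideanSpace.single i 1)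
          (EuclideanSpace.single j 1)))) • layerTwo d₁ i := by
    refine HFreq.ext ?_ ?_
    · simp only [map_add, map_sum, map_smul, fstL_layerOne, fstL_layerTwo, smul_zero,
        Finset.sum_const_zero, add_zero]
      rfl
    · simp only [map_add, map_sum, map_smul, sndL_layerOne, sndL_layerTwo, zero_add]
      rw [e2]
      simp [Finset.smul_sum, smul_smul]
  rw [e3, freqX, map_add, map_sum]
  simp only [map_smul, sub_apply, smul_apply, sum_apply,
    coordMul_apply, SchwartzMap.lineDerivOp_apply_eq_fderiv, WithLp.prod_inner_apply,
    Complex.real_smul]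
  simp [mul_assoc, sub_eq_add_neg]

/-- The product carrying the Euclidean norm, identified with `HPoint`. -/
abbrev freqEquiv (d₁ d₂ : ℕ) : HFreq d₁ d₂ ≃L[ℝ] HPoint d₁ d₂ :=
  WithLp.prodContinuousLinearEquiv 2 ℝ (EuclideanSpace ℝ (Fin d₁)) (EuclideanSpace ℝ (Fin d₂))

/-- The vector field `X_j` on Schwartz functions. -/
def HTypeGroup.schwartzX (j : Fin d₁) (f : 𝓢(HPoint d₁ d₂, ℂ)) : 𝓢(HPoint d₁ d₂, ℂ) :=
  SchwartzMap.compCLMOfContinuousLinearEquiv ℂ (freqEquiv d₁ d₂).symm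
    (G.freqX j (SchwartzMap.compCLMOfContinuousLinearEquiv ℂ (freqEquiv d₁ d₂) f))

theorem HTypeGroup.schwartzX_apply (j : Fin d₁) (f : 𝓢(HPoint d₁ d₂, ℂ)) (z : HPoint d₁ d₂) :
    G.schwartzX j f z = fderiv ℝ f z (EuclideanSpace.single j 1,
      (1 / 2 : ℝ) • G.bracket z.1 (EuclideanSpace.single j 1)) := by
  rw [schwartzX, SchwartzMap.compCLMOfContinuousLinearEquiv_apply, Function.comp_apply,
    G.freqX_apply, SchwartzMap.compCLMOfContinuousLinearEquiv_apply,
    ContinuousLinearEquiv.comp_right_fderiv]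
  simp

/-- The heat kernel at time `1`. -/
def heatKernel (d₁ d₂ : ℕ) (hd : 2 ≤ d₁) : 𝓢(HPoint d₁ d₂, ℂ) :=
  SchwartzMap.compCLMOfContinuousLinearEquiv ℂ (freqEquiv d₁ d₂).symm (𝓕⁻ (heatSymbol d₁ d₂ hd))

/-- The self-similar form of the heat equation, `-∑ X_j² p = (Q / 2 + ½ x·∂_x + u·∂_u) p`. -/
theorem HTypeGroup.sum_schwartzX_heatKernel (hd : 2 ≤ d₁) (z : HPoint d₁ d₂) :
    -∑ j, G.schwartzX j (G.schwartzX j (heatKernel d₁ d₂ hd)) z =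
      (d₁ / 2 + d₂ : ℝ) * heatKernel d₁ d₂ hd z +
        fderiv ℝ (heatKernel d₁ d₂ hd) z ((1 / 2 : ℝ) • z.1, z.2) := by
  have hcomp : ∀ f : 𝓢(HFreq d₁ d₂, ℂ), SchwartzMap.compCLMOfContinuousLinearEquiv ℂ
      (freqEquiv d₁ d₂) (SchwartzMap.compCLMOfContinuousLinearEquiv ℂ (freqEquiv d₁ d₂).symm f) =
      f := by
    intro f
    ext w
    simp
  have h1 : ∑ j, G.freqY j (G.freqY j (heatSymbol d₁ d₂ hd)) = freqEuler (heatSymbol d₁ d₂ hd) := by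
    ext w
    rw [sum_apply, G.sum_freqY_freqY_heatSymbol, freqEuler_apply]
  have h2 : -∑ j, G.freqX j (G.freqX j (𝓕⁻ (heatSymbol d₁ d₂ hd))) =
      (d₁ / 2 + d₂ : ℝ) • 𝓕⁻ (heatSymbol d₁ d₂ hd) + freqEuler (𝓕⁻ (heatSymbol d₁ d₂ hd)) := by
    simp only [G.freqX_fourierInv]
    rw [← FourierTransform.fourierInv_sum, h1, freqEuler_fourierInv, ←
      FourierTransform.fourierInv_neg, ← FourierTransform.fourierInv_smul,
      ← FourierTransform.fourierInv_add]
    congr 1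
    module
  have h3 := congrArg (fun f : 𝓢(HFreq d₁ d₂, ℂ) => f ((freqEquiv d₁ d₂).symm z)) h2
  simp only [neg_apply, sum_apply, add_apply, smul_apply, freqEuler_apply] at h3
  simp only [schwartzX, heatKernel, hcomp]
  simp only [SchwartzMap.compCLMOfContinuousLinearEquiv_apply, Function.comp_apply,
    ContinuousLinearEquiv.comp_right_fderiv]
  rw [h3]
  simp

/-- The integral of the heat kernel is the value of its Fourier transform at the origin. -/
theorem integral_heatKernel (hd : 2 ≤ d₁) : ∫ z, heatKernel d₁ d₂ hd z = 1 := by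
  have h1 : ∫ z, heatKernel d₁ d₂ hd z = ∫ w, 𝓕⁻ (heatSymbol d₁ d₂ hd) w :=
    (WithLp.volume_preserving_toLp (EuclideanSpace ℝ (Fin d₁))
      (EuclideanSpace ℝ (Fin d₂))).integral_comp
      (MeasurableEquiv.toLp 2 (HPoint d₁ d₂)).measurableEmbedding
      (fun w => 𝓕⁻ (heatSymbol d₁ d₂ hd) w)
  have h2 : 𝓕 (𝓕⁻ (heatSymbol d₁ d₂ hd)) 0 = heatSymbol d₁ d₂ hd 0 := by
    rw [FourierTransform.fourier_fourierInv_eq]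
  have h3 : heatSymbol d₁ d₂ hd 0 = 1 := by
    change ((Real.exp (-heatPhase d₁ d₂ 0) : ℝ) : ℂ) = 1
    have : coshDeriv 0 0 = 1 := by simpa using coshDeriv_sq 0
    simp [heatPhase, this]
  rw [h1, ← h3, ← h2, SchwartzMap.fourier_coe, Real.fourier_eq]
  simp

end HeatEquation
end

noncomputable section

/-! ### Translations and convolution on the group -/

namespace HTypeGroup

variable {d₁ d₂ : ℕ} (G : HTypeGroup d₁ d₂)

theorem bracket_apply (x y : EuclideanSpace ℝ (Fin d₁)) (i : Fin d₂) :
    G.bracket x y i = inner ℝ (G.J (EuclideanSpace.single i 1) x) y := rfl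

theorem bracket_add_left (x x' y : EuclideanSpace ℝ (Fin d₁)) :
    G.bracket (x + x') y = G.bracket x y + G.bracket x' y := by
  ext i
  simp [bracket_apply, inner_add_left]

theorem bracket_add_right (x y y' : EuclideanSpace ℝ (Fin d₁)) :
    G.bracket x (y + y') = G.bracket x y + G.bracket x y' := by
  ext i
  simp [bracket_apply, inner_add_right]

theorem bracket_smul_left (c : ℝ) (x y : EuclideanSpace ℝ (Fin d₁)) :
    G.bracket (c • x) y = c • G.bracket x y := by
  ext i
  simp [bracket_apply, inner_smul_left]

theorem bracket_smul_right (c : ℝ) (x y : EuclideanSpace ℝ (Fin d₁)) :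
    G.bracket x (c • y) = c • G.bracket x y := by
  ext i
  simp [bracket_apply, inner_smul_right]

theorem bracket_neg_left (x y : EuclideanSpace ℝ (Fin d₁)) :
    G.bracket (-x) y = -G.bracket x y := by
  ext i
  simp [bracket_apply]

theorem bracket_neg_right (x y : EuclideanSpace ℝ (Fin d₁)) :
    G.bracket x (-y) = -G.bracket x y := by
  ext i
  simp [bracket_apply]

theorem bracket_self (x : EuclideanSpace ℝ (Fin d₁)) : G.bracket x x = 0 := by
  ext i
  rw [bracket_apply, real_inner_comm, G.inner_J_self]
  rfl

theorem bracket_swap (x y : EuclideanSpace ℝ (Fin d₁)) : G.bracket y x = -G.bracket x y := by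
  ext i
  rw [PiLp.neg_apply, bracket_apply, bracket_apply, G.skew, real_inner_comm]

theorem norm_bracket_le (x y : EuclideanSpace ℝ (Fin d₁)) : ‖G.bracket x y‖ ≤ ‖x‖ * ‖y‖ := by
  have h1 : ∀ μ : EuclideanSpace ℝ (Fin d₂), inner ℝ μ (G.bracket x y) = inner ℝ (G.J μ x) y := by
    intro μ
    have e1 : G.J μ x = ∑ i, μ i • G.J (EuclideanSpace.single i 1) x := by
      have e : μ = ∑ i, μ i • EuclideanSpace.single i (1 : ℝ) := by
        simpa using ((EuclideanSpace.basisFun (Fin d₂) ℝ).sum_repr μ).symm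
      conv_lhs => rw [e]
      simp
    rw [e1, sum_inner, PiLp.inner_apply]
    refine Finset.sum_congr rfl fun i _ => ?_
    rw [inner_smul_left, bracket_apply]
    simp [mul_comm]
  have h2 : ∀ μ : EuclideanSpace ℝ (Fin d₂), ‖G.J μ x‖ = ‖μ‖ * ‖x‖ := by
    intro μ
    rw [← sq_eq_sq₀ (by positivity) (by positivity), G.norm_J_sq, mul_pow]
  have h3 := real_inner_le_norm (G.J (G.bracket x y) x) y
  rw [← h1, h2, real_inner_self_eq_norm_sq] at h3
  rcases (norm_nonneg (G.bracket x y)).eq_or_lt with h | h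
  · rw [← h]; positivity
  · nlinarith

@[fun_prop]
theorem continuous_bracket {X : Type*} [TopologicalSpace X] {f g : X → EuclideanSpace ℝ (Fin d₁)}
    (hf : Continuous f) (hg : Continuous g) : Continuous fun x => G.bracket (f x) (g x) := by
  refine (PiLp.continuous_toLp 2 _).comp (continuous_pi fun i => ?_)
  exact ((LinearMap.continuous_of_finiteDimensional _).comp hf).inner hg

@[fun_prop]
theorem continuous_mul {X : Type*} [TopologicalSpace X] {f g : X → HPoint d₁ d₂}
    (hf : Continuous f) (hg : Continuous g) : Continuous fun x => G.mul (f x) (g x) := by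
  unfold mul
  fun_prop

theorem mul_assoc (a b c : HPoint d₁ d₂) : G.mul (G.mul a b) c = G.mul a (G.mul b c) := by
  refine Prod.ext (add_assoc _ _ _) ?_
  simp only [mul, bracket_add_left, bracket_add_right, smul_add]
  abel

theorem mul_neg_cancel (a b : HPoint d₁ d₂) : G.mul (G.mul a b) (-b) = a := by
  refine Prod.ext (by simp [mul]) ?_
  simp only [mul, bracket_add_left, bracket_neg_right, bracket_self, Prod.snd_neg, Prod.fst_neg,
    smul_neg, add_zero]
  abel

theorem mul_neg_cancel' (a b : HPoint d₁ d₂) : G.mul (G.mul a (-b)) b = a := by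
  simpa using G.mul_neg_cancel a (-b)

theorem neg_mul_cancel (a b : HPoint d₁ d₂) : G.mul (-a) (G.mul a b) = b := by
  refine Prod.ext (by simp [mul]) ?_
  simp only [mul, bracket_add_right, bracket_neg_left, bracket_self, Prod.snd_neg, Prod.fst_neg,
    smul_neg, neg_zero, zero_add]
  abel

theorem mul_cancel_neg (a b : HPoint d₁ d₂) : G.mul a (G.mul (-a) b) = b := by
  simpa using G.neg_mul_cancel (-a) b

theorem neg_mul (a b : HPoint d₁ d₂) : -G.mul a b = G.mul (-b) (-a) := by
  refine Prod.ext (by simp [mul, add_comm]) ?_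
  simp [mul, bracket_neg_left, bracket_neg_right, G.bracket_swap a.1 b.1]
  abel

theorem mul_zero (a : HPoint d₁ d₂) : G.mul a 0 = a := by
  have : G.bracket a.1 0 = 0 := by simpa using G.bracket_smul_right 0 a.1 0
  exact Prod.ext (by simp [mul]) (by simp [mul, this])

/-- Right translation by `b`. -/
def mulRight (b : HPoint d₁ d₂) : HPoint d₁ d₂ ≃ₜ HPoint d₁ d₂ where
  toFun z := G.mul z b
  invFun z := G.mul z (-b)
  left_inv z := G.mul_neg_cancel z b
  right_inv z := G.mul_neg_cancel' z b
  continuous_toFun := by fun_prop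
  continuous_invFun := by fun_prop

/-- Left translation by `a`. -/
def mulLeft (a : HPoint d₁ d₂) : HPoint d₁ d₂ ≃ₜ HPoint d₁ d₂ where
  toFun z := G.mul a z
  invFun z := G.mul (-a) z
  left_inv z := G.neg_mul_cancel a z
  right_inv z := G.mul_cancel_neg a z
  continuous_toFun := by fun_prop
  continuous_invFun := by fun_prop

/-- The map `w ↦ z w⁻¹`. -/
def mulNeg (z : HPoint d₁ d₂) : HPoint d₁ d₂ ≃ₜ HPoint d₁ d₂ where
  toFun w := G.mul z (-w)
  invFun y := G.mul (-y) z
  left_inv w := by simp [neg_mul, mul_neg_cancel']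
  right_inv y := by simp [neg_mul, mul_cancel_neg]
  continuous_toFun := by fun_prop
  continuous_invFun := by fun_prop

theorem measurePreserving_mul_right (b : HPoint d₁ d₂) :
    MeasurePreserving (fun z => G.mul z b) volume volume := by
  have h := (measurePreserving_add_right (volume : Measure (EuclideanSpace ℝ (Fin d₁))) b.1)
    |>.skew_product (μc := (volume : Measure (EuclideanSpace ℝ (Fin d₂)))) (μd := volume)
    (g := fun x u => u + (b.2 + (1 / 2 : ℝ) • G.bracket x b.1))
    (by
      have : Continuous fun z : HPoint d₁ d₂ => z.2 + (b.2 + (1 / 2 : ℝ) • G.bracket z.1 b.1) := by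
        fun_prop
      exact this.measurable)
    (Filter.Eventually.of_forall fun x => (measurePreserving_add_right volume _).map_eq)
  convert! h using 2 with z
  simp [mul, add_assoc]

theorem measurePreserving_mul_left (a : HPoint d₁ d₂) :
    MeasurePreserving (fun z => G.mul a z) volume volume := by
  have h := (measurePreserving_add_left (volume : Measure (EuclideanSpace ℝ (Fin d₁))) a.1)
    |>.skew_product (μc := (volume : Measure (EuclideanSpace ℝ (Fin d₂)))) (μd := volume)
    (g := fun x u => u + (a.2 + (1 / 2 : ℝ) • G.bracket a.1 x))
    (by
      have : Continuous fun z : HPoint d₁ d₂ => z.2 + (a.2 + (1 / 2 : ℝ) • G.bracket a.1 z.1) := by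
        fun_prop
      exact this.measurable)
    (Filter.Eventually.of_forall fun x => (measurePreserving_add_right volume _).map_eq)
  convert! h using 2 with z
  simp only [mul, Prod.mk.injEq, true_and]
  abel

theorem measurePreserving_neg : MeasurePreserving (fun z : HPoint d₁ d₂ => -z) volume volume :=
  (Measure.measurePreserving_neg (volume : Measure (EuclideanSpace ℝ (Fin d₁)))).prod
    (Measure.measurePreserving_neg (volume : Measure (EuclideanSpace ℝ (Fin d₂))))

theorem measurePreserving_mul_neg (z : HPoint d₁ d₂) :
    MeasurePreserving (fun w => G.mul z (-w)) volume volume :=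
  (G.measurePreserving_mul_left z).comp measurePreserving_neg

/-- Convolution on the group, `(f * h)(z) = ∫ f(z w⁻¹) h(w) dw`; here `w⁻¹ = -w`. -/
def conv (f h : HPoint d₁ d₂ → ℂ) (z : HPoint d₁ d₂) : ℂ :=
  ∫ w, f (G.mul z (-w)) * h w

/-- `(z, w) ↦ (z w⁻¹, w)` preserves the measure. -/
theorem measurePreserving_shear : MeasurePreserving
    (fun q : HPoint d₁ d₂ × HPoint d₁ d₂ => (G.mul q.1 (-q.2), q.2))
    (volume.prod volume) (volume.prod volume) := by
  have h := (MeasurePreserving.id (volume : Measure (HPoint d₁ d₂))).skew_product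
    (μc := (volume : Measure (HPoint d₁ d₂))) (μd := volume)
    (g := fun w z => G.mul z (-w))
    (by
      have : Continuous fun q : HPoint d₁ d₂ × HPoint d₁ d₂ => G.mul q.2 (-q.1) := by fun_prop
      exact this.measurable)
    (Filter.Eventually.of_forall fun w => (G.measurePreserving_mul_right (-w)).map_eq)
  exact (Measure.measurePreserving_swap.comp h).comp Measure.measurePreserving_swap

theorem aestronglyMeasurable_comp_shear {f : HPoint d₁ d₂ → ℂ} (hf : AEStronglyMeasurable f) :
    AEStronglyMeasurable (fun q : HPoint d₁ d₂ × HPoint d₁ d₂ => f (G.mul q.1 (-q.2)))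
      (volume.prod volume) :=
  (hf.comp_fst (ν := volume)).comp_measurePreserving G.measurePreserving_shear

theorem aestronglyMeasurable_conv {f h : HPoint d₁ d₂ → ℂ} (hf : AEStronglyMeasurable f)
    (hh : AEStronglyMeasurable h) : AEStronglyMeasurable (G.conv f h) :=
  ((G.aestronglyMeasurable_comp_shear hf).mul hh.comp_snd).integral_prod_right'

theorem conv_eq (f h : HPoint d₁ d₂ → ℂ) (z : HPoint d₁ d₂) :
    G.conv f h z = ∫ y, f y * h (G.mul (-y) z) := by
  rw [← (G.measurePreserving_mul_neg z).integral_comp (G.mulNeg z).measurableEmbedding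
    (fun y => f y * h (G.mul (-y) z))]
  refine integral_congr_ae (Filter.Eventually.of_forall fun w => ?_)
  simp [neg_mul, mul_neg_cancel']

theorem conv_congr_ae {f f' h h' : HPoint d₁ d₂ → ℂ} (hf : f =ᵐ[volume] f') (hh : h =ᵐ[volume] h')
    (z : HPoint d₁ d₂) : G.conv f h z = G.conv f' h' z := by
  refine integral_congr_ae ?_
  filter_upwards [(G.measurePreserving_mul_neg z).quasiMeasurePreserving.ae_eq_comp hf, hh]
    with w h1 h2
  simp only [Function.comp_apply] at h1
  rw [h1, h2]

/-- The Hölder inequality behind Young's inequality. -/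
theorem lintegral_mul_rpow_le {X : Type*} [MeasurableSpace X] {ν : Measure X} {F H : X → ℝ≥0∞}
    (hF : AEMeasurable F ν) (hH : AEMeasurable H ν) {p : ℝ} (hp : 1 ≤ p) :
    (∫⁻ x, F x * H x ∂ν) ^ p ≤ (∫⁻ x, H x ∂ν) ^ (p - 1) * ∫⁻ x, F x ^ p * H x ∂ν := by
  rcases hp.eq_or_lt with rfl | hp
  · simp
  have hpq := Real.HolderConjugate.conjExponent hp
  set q := p.conjExponent with hq
  have hp0 : 0 < p := by linarith
  have h1 := ENNReal.lintegral_mul_le_Lp_mul_Lq ν hpq (f := fun x => F x * H x ^ (1 / p))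
    (g := fun x => H x ^ (1 / q)) (hF.mul (hH.pow_const _)) (hH.pow_const _)
  have e1 : ∀ x, ((fun x => F x * H x ^ (1 / p)) * fun x => H x ^ (1 / q)) x = F x * H x := by
    intro x
    simp only [Pi.mul_apply]
    rw [_root_.mul_assoc, ← ENNReal.rpow_add_of_nonneg _ _ (by positivity)
      (by have := hpq.symm.pos; positivity)]
    have : 1 / p + 1 / q = 1 := by simpa using hpq.inv_add_inv_eq_one
    rw [this, ENNReal.rpow_one]
  have e2 : ∀ x, (F x * H x ^ (1 / p)) ^ p = F x ^ p * H x := by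
    intro x
    rw [ENNReal.mul_rpow_of_nonneg _ _ hp0.le, ← ENNReal.rpow_mul]
    simp [hp0.ne']
  have e3 : ∀ x, (H x ^ (1 / q)) ^ q = H x := by
    intro x
    rw [← ENNReal.rpow_mul]
    simp [hpq.symm.pos.ne']
  simp only [e1, e2, e3] at h1
  refine (ENNReal.rpow_le_rpow h1 hp0.le).trans_eq ?_
  rw [ENNReal.mul_rpow_of_nonneg _ _ hp0.le, ← ENNReal.rpow_mul, ← ENNReal.rpow_mul, mul_comm]
  have e4 : 1 / p * p = 1 := by field_simp
  have e5 : 1 / q * p = p - 1 := by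
    have : 1 / q = 1 - 1 / p := by
      have : 1 / p + 1 / q = 1 := by simpa using hpq.inv_add_inv_eq_one
      linarith
    rw [this]
    field_simp
  rw [e4, e5, ENNReal.rpow_one]

/-- The nonnegative form of Young's inequality `L^p * L¹ ⊆ L^p`. -/
theorem eLpNorm_lconv_le {f h : HPoint d₁ d₂ → ℂ} (hf : AEStronglyMeasurable f)
    (hh : AEStronglyMeasurable h) {p : ℝ≥0∞} (hp : 1 ≤ p) :
    eLpNorm (fun z => ∫⁻ w, ‖f (G.mul z (-w))‖ₑ * ‖h w‖ₑ) p volume ≤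
      eLpNorm f p volume * eLpNorm h 1 volume := by
  rw [eLpNorm_one_eq_lintegral_enorm]
  rcases eq_or_ne p ∞ with rfl | hpt
  · rw [eLpNorm_exponent_top, eLpNorm_exponent_top]
    refine eLpNormEssSup_le_of_ae_enorm_bound (Filter.Eventually.of_forall fun z => ?_)
    rw [enorm_eq_self, ← lintegral_const_mul'' _ hh.enorm]
    refine lintegral_mono_ae ?_
    have := (G.measurePreserving_mul_neg z).quasiMeasurePreserving.ae
      (enorm_ae_le_eLpNormEssSup f volume)
    filter_upwards [this] with w hw
    gcongr
  · have hp0 : p ≠ 0 := (zero_lt_one.trans_le hp).ne'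
    have hp1 : 1 ≤ p.toReal := by
      rwa [← ENNReal.ofReal_le_iff_le_toReal hpt, ENNReal.ofReal_one]
    have hpp : 0 < p.toReal := by linarith
    rw [eLpNorm_eq_lintegral_rpow_enorm_toReal hp0 hpt, eLpNorm_eq_lintegral_rpow_enorm_toReal hp0 hpt]
    set A := ∫⁻ w, ‖h w‖ₑ with hA
    have hm : AEMeasurable (fun q : HPoint d₁ d₂ × HPoint d₁ d₂ =>
        ‖f (G.mul q.1 (-q.2))‖ₑ ^ p.toReal * ‖h q.2‖ₑ) (volume.prod volume) :=
      ((G.aestronglyMeasurable_comp_shear hf).enorm.pow_const _).mul hh.comp_snd.enorm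
    have h1 : ∫⁻ z, ‖∫⁻ w, ‖f (G.mul z (-w))‖ₑ * ‖h w‖ₑ‖ₑ ^ p.toReal ≤
        A ^ (p.toReal - 1) * ∫⁻ z, ∫⁻ w, ‖f (G.mul z (-w))‖ₑ ^ p.toReal * ‖h w‖ₑ := by
      rw [← lintegral_const_mul'' _ hm.lintegral_prod_right']
      refine lintegral_mono fun z => ?_
      rw [enorm_eq_self]
      refine lintegral_mul_rpow_le ?_ hh.enorm hp1
      exact (hf.comp_measurePreserving (G.measurePreserving_mul_neg z)).enorm
    have h2 : ∫⁻ z, ∫⁻ w, ‖f (G.mul z (-w))‖ₑ ^ p.toReal * ‖h w‖ₑ =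
        (∫⁻ z, ‖f z‖ₑ ^ p.toReal) * A := by
      rw [lintegral_lintegral_swap hm]
      have : ∀ w, ∫⁻ z, ‖f (G.mul z (-w))‖ₑ ^ p.toReal * ‖h w‖ₑ =
          (∫⁻ z, ‖f z‖ₑ ^ p.toReal) * ‖h w‖ₑ := by
        intro w
        have hmp := G.measurePreserving_mul_right (-w)
        refine (lintegral_mul_const'' _
          ((hf.comp_measurePreserving hmp).enorm.pow_const _)).trans ?_
        congr 1
        exact hmp.lintegral_comp_emb (G.mulRight (-w)).measurableEmbedding
          (fun z => ‖f z‖ₑ ^ p.toReal)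
      simp only [this]
      rw [lintegral_const_mul'' _ hh.enorm]
    calc _ ≤ (A ^ (p.toReal - 1) * ((∫⁻ z, ‖f z‖ₑ ^ p.toReal) * A)) ^ (1 / p.toReal) := by
          rw [← h2]
          exact ENNReal.rpow_le_rpow h1 (by positivity)
      _ = _ := by
          have : A ^ (p.toReal - 1) * ((∫⁻ z, ‖f z‖ₑ ^ p.toReal) * A) =
              (∫⁻ z, ‖f z‖ₑ ^ p.toReal) * A ^ p.toReal := by
            rw [mul_comm, _root_.mul_assoc, mul_comm A]
            congr 1
            nth_rewrite 2 [← ENNReal.rpow_one A]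
            rw [← ENNReal.rpow_add_of_nonneg _ _ (by linarith) zero_le_one]
            simp
          rw [this, ENNReal.mul_rpow_of_nonneg _ _ (by positivity), ← ENNReal.rpow_mul A]
          have : p.toReal * (1 / p.toReal) = 1 := by field_simp
          rw [this, ENNReal.rpow_one]

/-- Young's inequality `‖f * h‖_p ≤ ‖f‖_p ‖h‖_1`. -/
theorem eLpNorm_conv_le {f h : HPoint d₁ d₂ → ℂ} (hf : AEStronglyMeasurable f)
    (hh : AEStronglyMeasurable h) {p : ℝ≥0∞} (hp : 1 ≤ p) :
    eLpNorm (G.conv f h) p volume ≤ eLpNorm f p volume * eLpNorm h 1 volume := by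
  refine (eLpNorm_mono_enorm fun z => ?_).trans (G.eLpNorm_lconv_le hf hh hp)
  refine (enorm_integral_le_lintegral_enorm _).trans_eq ?_
  simp [enorm_mul]

theorem memLp_conv {f h : HPoint d₁ d₂ → ℂ} {p : ℝ≥0∞} (hp : 1 ≤ p) (hf : MemLp f p)
    (hh : Integrable h) : MemLp (G.conv f h) p :=
  ⟨G.aestronglyMeasurable_conv hf.1 hh.1, (G.eLpNorm_conv_le hf.1 hh.1 hp).trans_lt
    (ENNReal.mul_lt_top hf.2 (memLp_one_iff_integrable.2 hh).2)⟩

theorem ae_integrable_conv {f h : HPoint d₁ d₂ → ℂ} {p : ℝ≥0∞} (hp : 1 ≤ p) (hf : MemLp f p)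
    (hh : Integrable h) : ∀ᵐ z, Integrable fun w => f (G.mul z (-w)) * h w := by
  have h1 : eLpNorm (fun z => ∫⁻ w, ‖f (G.mul z (-w))‖ₑ * ‖h w‖ₑ) p volume < ⊤ :=
    (G.eLpNorm_lconv_le hf.1 hh.1 hp).trans_lt
      (ENNReal.mul_lt_top hf.2 (memLp_one_iff_integrable.2 hh).2)
  have hm : AEMeasurable fun z => ∫⁻ w, ‖f (G.mul z (-w))‖ₑ * ‖h w‖ₑ :=
    ((G.aestronglyMeasurable_comp_shear hf.1).enorm.mul hh.1.comp_snd.enorm).lintegral_prod_right'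
  have h2 : ∀ᵐ z, ∫⁻ w, ‖f (G.mul z (-w))‖ₑ * ‖h w‖ₑ < ⊤ := by
    rcases eq_or_ne p ⊤ with rfl | hpt
    · rw [eLpNorm_exponent_top] at h1
      filter_upwards [enorm_ae_le_eLpNormEssSup
        (fun z => ∫⁻ w, ‖f (G.mul z (-w))‖ₑ * ‖h w‖ₑ) volume] with z hz
      exact (enorm_eq_self _).symm.trans_lt (hz.trans_lt h1)
    · have hp0 : p ≠ 0 := (zero_lt_one.trans_le hp).ne'
      have h3 := (lintegral_rpow_enorm_lt_top_of_eLpNorm_lt_top hp0 hpt h1).ne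
      filter_upwards [ae_lt_top' (hm.enorm.pow_const _) h3] with z hz
      rw [enorm_eq_self] at hz
      by_contra! hc
      rw [top_le_iff.1 hc, ENNReal.top_rpow_of_pos (ENNReal.toReal_pos hp0 hpt)] at hz
      exact lt_irrefl _ hz
  filter_upwards [h2] with z hz
  refine ⟨(hf.1.comp_measurePreserving (G.measurePreserving_mul_neg z)).mul hh.1, ?_⟩
  simpa [HasFiniteIntegral, enorm_mul] using hz

/-- Convolution by an integrable function from the right, as a bounded operator on `L^p`. -/
def convLp (h : HPoint d₁ d₂ → ℂ) (hh : Integrable h) (p : ℝ≥0∞) [hp : Fact (1 ≤ p)] :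
    Lp ℂ p (volume : Measure (HPoint d₁ d₂)) →L[ℂ] Lp ℂ p (volume : Measure (HPoint d₁ d₂)) :=
  LinearMap.mkContinuous
    { toFun := fun f => (G.memLp_conv hp.out (Lp.memLp f) hh).toLp _
      map_add' := fun f g => by
        rw [← MemLp.toLp_add]
        refine MemLp.toLp_congr _ _ ?_
        filter_upwards [G.ae_integrable_conv hp.out (Lp.memLp f) hh,
          G.ae_integrable_conv hp.out (Lp.memLp g) hh] with z hf hg
        rw [G.conv_congr_ae (Lp.coeFn_add f g) (Filter.EventuallyEq.refl _ h), Pi.add_apply]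
        simp only [conv]
        rw [← integral_add hf hg]
        simp [add_mul]
      map_smul' := fun c f => by
        rw [RingHom.id_apply, ← MemLp.toLp_const_smul]
        refine MemLp.toLp_congr _ _ (Filter.Eventually.of_forall fun z => ?_)
        rw [G.conv_congr_ae (Lp.coeFn_smul c f) (Filter.EventuallyEq.refl _ h), Pi.smul_apply]
        simp only [conv]
        rw [← integral_smul]
        simp [_root_.mul_assoc] }
    (eLpNorm h 1 volume).toReal fun f => by
      change ‖(G.memLp_conv hp.out (Lp.memLp f) hh).toLp _‖ ≤ _
      rw [Lp.norm_toLp, Lp.norm_def, ← ENNReal.toReal_mul, mul_comm]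
      exact ENNReal.toReal_mono (ENNReal.mul_ne_top (Lp.memLp f).2.ne
        (memLp_one_iff_integrable.2 hh).2.ne) (G.eLpNorm_conv_le (Lp.memLp f).1 hh.1 hp.out)

theorem norm_convLp_le {h : HPoint d₁ d₂ → ℂ} (hh : Integrable h) (p : ℝ≥0∞) [Fact (1 ≤ p)] :
    ‖G.convLp h hh p‖ ≤ ∫ z, ‖h z‖ := by
  refine (LinearMap.mkContinuous_norm_le _ ENNReal.toReal_nonneg _).trans_eq ?_
  rw [eLpNorm_one_eq_lintegral_enorm, integral_norm_eq_lintegral_enorm hh.1]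

theorem coeFn_convLp {h : HPoint d₁ d₂ → ℂ} (hh : Integrable h) (p : ℝ≥0∞) [hp : Fact (1 ≤ p)]
    (f : Lp ℂ p (volume : Measure (HPoint d₁ d₂))) :
    G.convLp h hh p f =ᵐ[volume] G.conv f h :=
  (G.memLp_conv hp.out (Lp.memLp f) hh).coeFn_toLp

/-- Left translation `(λ_a f)(z) = f(a⁻¹ z)` on `L²`. -/
def transL (a : HPoint d₁ d₂) : HL2 d₁ d₂ →ₗᵢ[ℂ] HL2 d₁ d₂ :=
  Lp.compMeasurePreservingₗᵢ ℂ (fun z => G.mul (-a) z) (G.measurePreserving_mul_left (-a))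

theorem coeFn_transL (a : HPoint d₁ d₂) (f : HL2 d₁ d₂) :
    G.transL a f =ᵐ[volume] fun z => f (G.mul (-a) z) :=
  Lp.coeFn_compMeasurePreserving f (G.measurePreserving_mul_left (-a))

/-- The integrability behind Fubini's theorem for superpositions of translates of a function. -/
theorem integrable_superposition {τ : HPoint d₁ d₂ → HPoint d₁ d₂ → HPoint d₁ d₂}
    (hτ : MeasurePreserving (fun q : HPoint d₁ d₂ × HPoint d₁ d₂ => (q.1, τ q.1 q.2))
      (volume.prod volume) (volume.prod volume))
    (hτ₁ : ∀ y, MeasurePreserving (τ y) volume volume) (hτ₂ : ∀ y, MeasurableEmbedding (τ y))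
    {f u φ : HPoint d₁ d₂ → ℂ} (hf : Integrable f) (hu : MemLp u 2) (hφ : MemLp φ 2) :
    Integrable (fun q : HPoint d₁ d₂ × HPoint d₁ d₂ =>
      f q.1 * (u (τ q.1 q.2) * (starRingEnd ℂ) (φ q.2))) (volume.prod volume) := by
  have hmeas : AEStronglyMeasurable (fun q : HPoint d₁ d₂ × HPoint d₁ d₂ =>
      f q.1 * (u (τ q.1 q.2) * (starRingEnd ℂ) (φ q.2))) (volume.prod volume) := by
    refine hf.1.comp_fst.mul (AEStronglyMeasurable.mul ?_ ?_)
    · exact (hu.1.comp_snd (μ := volume)).comp_measurePreserving hτ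
    · exact Complex.continuous_conj.comp_aestronglyMeasurable hφ.1.comp_snd
  have hfin : ∀ {u : HPoint d₁ d₂ → ℂ}, MemLp u 2 → ∫⁻ z, ‖u z‖ₑ ^ (2 : ℝ) < ⊤ := by
    intro u hu
    simpa using lintegral_rpow_enorm_lt_top_of_eLpNorm_lt_top two_ne_zero (by simp) hu.2
  refine ⟨hmeas, ?_⟩
  rw [hasFiniteIntegral_iff_enorm, lintegral_prod _ hmeas.enorm]
  set C := (∫⁻ z, ‖u z‖ₑ ^ (2 : ℝ)) ^ (1 / (2 : ℝ)) * (∫⁻ z, ‖φ z‖ₑ ^ (2 : ℝ)) ^ (1 / (2 : ℝ))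
  have hC : C < ⊤ := ENNReal.mul_lt_top (ENNReal.rpow_lt_top_of_nonneg (by norm_num) (hfin hu).ne)
    (ENNReal.rpow_lt_top_of_nonneg (by norm_num) (hfin hφ).ne)
  have hle : ∀ y, ∫⁻ z, ‖f y * (u (τ y z) * (starRingEnd ℂ) (φ z))‖ₑ ≤ ‖f y‖ₑ * C := by
    intro y
    have huy := hu.1.comp_measurePreserving (hτ₁ y)
    simp only [enorm_mul]
    refine (lintegral_const_mul'' _ (huy.enorm.mul
      (Complex.continuous_conj.comp_aestronglyMeasurable hφ.1).enorm)).trans_le ?_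
    gcongr
    have e1 := ENNReal.lintegral_mul_le_Lp_mul_Lq volume Real.HolderConjugate.two_two huy.enorm
      hφ.1.enorm
    have e2 : ∫⁻ z, ‖(u ∘ τ y) z‖ₑ ^ (2 : ℝ) = ∫⁻ z, ‖u z‖ₑ ^ (2 : ℝ) :=
      (hτ₁ y).lintegral_comp_emb (hτ₂ y) (fun z => ‖u z‖ₑ ^ (2 : ℝ))
    rw [e2] at e1
    refine le_trans (le_of_eq ?_) e1
    refine lintegral_congr fun z => ?_
    simp
  refine (lintegral_mono hle).trans_lt ?_
  rw [lintegral_mul_const'' _ hf.1.enorm]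
  exact ENNReal.mul_lt_top hf.2 hC

/-- The convolution `f * h` is the superposition of the translates `λ_y h` with weights `f(y)`. -/
theorem inner_conv_eq {f : HPoint d₁ d₂ → ℂ} (hf : Integrable f) (hf2 : MemLp f 2)
    (h : HL2 d₁ d₂) (hh : Integrable h) (φ : HL2 d₁ d₂) :
    ⟪φ, (G.memLp_conv one_le_two hf2 hh).toLp _⟫_ℂ = ∫ y, f y * ⟪φ, G.transL y h⟫_ℂ := by
  have hmp : MeasurePreserving (fun q : HPoint d₁ d₂ × HPoint d₁ d₂ => (q.1, G.mul (-q.1) q.2))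
      (volume.prod volume) (volume.prod volume) :=
    (MeasurePreserving.id (volume : Measure (HPoint d₁ d₂))).skew_product
      (g := fun y z => G.mul (-y) z)
      (by
        have : Continuous fun q : HPoint d₁ d₂ × HPoint d₁ d₂ => G.mul (-q.1) q.2 := by fun_prop
        exact this.measurable)
      (Filter.Eventually.of_forall fun y => (G.measurePreserving_mul_left (-y)).map_eq)
  have hint := integrable_superposition (τ := fun y z => G.mul (-y) z) hmp
    (fun y => G.measurePreserving_mul_left (-y)) (fun y => (G.mulLeft (-y)).measurableEmbedding)
    hf (Lp.memLp h) (Lp.memLp φ)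
  rw [L2.inner_def]
  calc _ = ∫ z, ∫ y, f y * (h (G.mul (-y) z) * (starRingEnd ℂ) (φ z)) := by
        refine integral_congr_ae ?_
        filter_upwards [(G.memLp_conv one_le_two hf2 hh).coeFn_toLp] with z hz
        rw [hz, G.conv_eq]
        change (∫ y, f y * h (G.mul (-y) z)) * (starRingEnd ℂ) (φ z) = _
        rw [← integral_mul_const]
        simp only [_root_.mul_assoc]
    _ = ∫ y, ∫ z, f y * (h (G.mul (-y) z) * (starRingEnd ℂ) (φ z)) :=
        (integral_integral_swap (f := fun y z => f y * (h (G.mul (-y) z) * (starRingEnd ℂ) (φ z)))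
          hint).symm
    _ = _ := by
        refine integral_congr_ae (Filter.Eventually.of_forall fun y => ?_)
        simp only []
        rw [integral_const_mul, L2.inner_def]
        congr 1
        refine integral_congr_ae ?_
        filter_upwards [G.coeFn_transL y h] with z hz
        rw [hz]
        rfl

/-- Right translation `(ρ_a f)(z) = f(z a⁻¹)` on `L²`. -/
def transR (a : HPoint d₁ d₂) : HL2 d₁ d₂ →ₗᵢ[ℂ] HL2 d₁ d₂ :=
  Lp.compMeasurePreservingₗᵢ ℂ (fun z => G.mul z (-a)) (G.measurePreserving_mul_right (-a))

theorem coeFn_transR (a : HPoint d₁ d₂) (f : HL2 d₁ d₂) :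
    G.transR a f =ᵐ[volume] fun z => f (G.mul z (-a)) :=
  Lp.coeFn_compMeasurePreserving f (G.measurePreserving_mul_right (-a))

/-- The convolution `f * h` is the superposition of the translates `ρ_w f` with weights `h(w)`. -/
theorem inner_convLp_eq {h : HPoint d₁ d₂ → ℂ} (hh : Integrable h) (f φ : HL2 d₁ d₂) :
    ⟪φ, G.convLp h hh 2 f⟫_ℂ = ∫ w, h w * ⟪φ, G.transR w f⟫_ℂ := by
  have hmp : MeasurePreserving (fun q : HPoint d₁ d₂ × HPoint d₁ d₂ => (q.1, G.mul q.2 (-q.1)))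
      (volume.prod volume) (volume.prod volume) :=
    (MeasurePreserving.id (volume : Measure (HPoint d₁ d₂))).skew_product
      (g := fun w z => G.mul z (-w))
      (by
        have : Continuous fun q : HPoint d₁ d₂ × HPoint d₁ d₂ => G.mul q.2 (-q.1) := by fun_prop
        exact this.measurable)
      (Filter.Eventually.of_forall fun w => (G.measurePreserving_mul_right (-w)).map_eq)
  have hint := integrable_superposition (τ := fun w z => G.mul z (-w)) hmp
    (fun w => G.measurePreserving_mul_right (-w)) (fun w => (G.mulRight (-w)).measurableEmbedding)
    hh (Lp.memLp f) (Lp.memLp φ)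
  rw [L2.inner_def]
  calc _ = ∫ z, ∫ w, h w * (f (G.mul z (-w)) * (starRingEnd ℂ) (φ z)) := by
        refine integral_congr_ae ?_
        filter_upwards [G.coeFn_convLp hh 2 f] with z hz
        rw [hz]
        change (∫ w, f (G.mul z (-w)) * h w) * (starRingEnd ℂ) (φ z) = _
        rw [← integral_mul_const]
        refine integral_congr_ae (Filter.Eventually.of_forall fun w => ?_)
        ring
    _ = ∫ w, ∫ z, h w * (f (G.mul z (-w)) * (starRingEnd ℂ) (φ z)) :=
        (integral_integral_swap (f := fun w z => h w * (f (G.mul z (-w)) *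
          (starRingEnd ℂ) (φ z))) hint).symm
    _ = _ := by
        refine integral_congr_ae (Filter.Eventually.of_forall fun w => ?_)
        simp only []
        rw [integral_const_mul, L2.inner_def]
        congr 1
        refine integral_congr_ae ?_
        filter_upwards [G.coeFn_transR w f] with z hz
        rw [hz]
        rfl

theorem continuous_transR (f : HL2 d₁ d₂) : Continuous fun w => G.transR w f := by
  have hc : Continuous fun w => (⟨⟨fun z => G.mul z (-w), by fun_prop⟩,
      G.measurePreserving_mul_right (-w)⟩ :
      {g : C(HPoint d₁ d₂, HPoint d₁ d₂) // MeasurePreserving g volume volume}) := by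
    refine Continuous.subtype_mk (ContinuousMap.continuous_of_continuous_uncurry _ ?_) _
    have : Continuous fun q : HPoint d₁ d₂ × HPoint d₁ d₂ => G.mul q.2 (-q.1) := by fun_prop
    exact this
  exact (Lp.compMeasurePreserving_continuous (volume : Measure (HPoint d₁ d₂)) volume ℂ
    (p := 2) (by simp)).comp (continuous_const.prodMk hc)

/-- A bounded operator that commutes with the left translations acts on a convolution through its
second factor. -/
theorem map_conv {S : HL2 d₁ d₂ →L[ℂ] HL2 d₁ d₂} (hS : ∀ y f, S (G.transL y f) = G.transL y (S f))
    {h : HL2 d₁ d₂} (hh : Integrable h) (hK : Integrable (S h)) (f : HL2 d₁ d₂) :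
    S (G.convLp h hh 2 f) = G.convLp (S h) hK 2 f := by
  have hd := Lp.dense_hasCompactSupport_contDiff (F := ℂ) (p := 2)
    (μ := (volume : Measure (HPoint d₁ d₂))) (by simp)
  have key : (fun f => S (G.convLp h hh 2 f)) = fun f => G.convLp (S h) hK 2 f := by
    refine Continuous.ext_on hd (by fun_prop) (by fun_prop) ?_
    rintro f ⟨g, hfg, hg1, hg2⟩
    have hfi : Integrable f :=
      (hg2.continuous.integrable_of_hasCompactSupport hg1).congr hfg.symm
    refine ext_inner_left ℂ fun φ => ?_
    have e1 : ∀ (u : HL2 d₁ d₂) (hu : Integrable u) (ψ : HL2 d₁ d₂), ⟪ψ, G.convLp u hu 2 f⟫_ℂ =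
        ∫ y, f y * ⟪ψ, G.transL y u⟫_ℂ := fun u hu ψ => G.inner_conv_eq hfi (Lp.memLp f) u hu ψ
    change ⟪φ, S (G.convLp h hh 2 f)⟫_ℂ = ⟪φ, G.convLp (S h) hK 2 f⟫_ℂ
    rw [← ContinuousLinearMap.adjoint_inner_left, e1, e1]
    simp only [ContinuousLinearMap.adjoint_inner_left, hS]
  exact congrFun key f

end HTypeGroup
end

noncomputable section

/-! ### Schwartz functions and translations in the form domain -/

instance isAddHaarMeasure_volume_hPoint (d₁ d₂ : ℕ) :
    (volume : Measure (HPoint d₁ d₂)).IsAddHaarMeasure :=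
  inferInstanceAs (((volume : Measure (EuclideanSpace ℝ (Fin d₁))).prod
    (volume : Measure (EuclideanSpace ℝ (Fin d₂)))).IsAddHaarMeasure)

namespace HTypeGroup

variable {d₁ d₂ : ℕ} (G : HTypeGroup d₁ d₂)

/-- The Hilbert space `L² ⊕ (L²)^{d₁}` that contains the form domain. -/
abbrev FormSpace (d₁ d₂ : ℕ) : Type :=
  WithLp 2 (HL2 d₁ d₂ × PiLp 2 (fun _ : Fin d₁ => HL2 d₁ d₂))

/-- The class in `L²` of a Schwartz function. -/
abbrev schwartzToL2 (v : 𝓢(HPoint d₁ d₂, ℂ)) : HL2 d₁ d₂ := v.toLp 2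

/-- `(v, X_1 v, …, X_{d₁} v)` for a Schwartz function `v`. -/
def schwartzGraph (v : 𝓢(HPoint d₁ d₂, ℂ)) : FormSpace d₁ d₂ :=
  WithLp.toLp 2 (schwartzToL2 v, WithLp.toLp 2 fun j => schwartzToL2 (G.schwartzX j v))

/-- The smooth function `z ↦ χ(z / (n + 1)) v(z)`, where `χ` is a bump function. -/
def cutoffMul (χ : ContDiffBump (0 : HPoint d₁ d₂)) (v : 𝓢(HPoint d₁ d₂, ℂ)) (n : ℕ) :
    testFunctions d₁ d₂ :=
  ⟨fun z => ((χ (((n : ℝ) + 1)⁻¹ • z) : ℝ) : ℂ) * v z, by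
    refine ⟨?_, ?_⟩
    · exact (Complex.ofRealCLM.contDiff.comp (χ.contDiff.comp (contDiff_const_smul _))).mul
        (v.smooth ⊤)
    · refine HasCompactSupport.mul_right ?_
      have h1 : HasCompactSupport fun z : HPoint d₁ d₂ => χ (((n : ℝ) + 1)⁻¹ • z) :=
        χ.hasCompactSupport.comp_homeomorph (Homeomorph.smulOfNeZero (((n : ℝ) + 1)⁻¹)
          (by positivity))
      exact h1.comp_left (g := fun x : ℝ => (x : ℂ)) Complex.ofReal_zero⟩

/-- A sequence that is dominated by `u / (n + 1)` with `u` in `L²` tends to zero in `L²`. -/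
theorem tendsto_toLp_of_le {X : Type*} [MeasurableSpace X] {μ : Measure X} {f : ℕ → X → ℂ}
    {g : X → ℂ} (hf : ∀ n, MemLp (f n) 2 μ) (hg : MemLp g 2 μ) {u : X → ℝ} (hu : MemLp u 2 μ)
    (h : ∀ n x, ‖f n x - g x‖ ≤ ((n : ℝ) + 1)⁻¹ * u x) :
    Filter.Tendsto (fun n => (hf n).toLp (f n)) Filter.atTop (nhds (hg.toLp g)) := by
  rw [tendsto_iff_norm_sub_tendsto_zero]
  have h1 : ∀ n, ‖(hf n).toLp (f n) - hg.toLp g‖ ≤ ((n : ℝ) + 1)⁻¹ * (eLpNorm u 2 μ).toReal := by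
    intro n
    rw [← MemLp.toLp_sub, Lp.norm_toLp]
    have h2 : eLpNorm (f n - g) 2 μ ≤ ENNReal.ofReal (((n : ℝ) + 1)⁻¹) * eLpNorm u 2 μ := by
      refine eLpNorm_le_mul_eLpNorm_of_ae_le_mul (Filter.Eventually.of_forall fun x => ?_) 2
      refine (h n x).trans ?_
      gcongr
      exact le_abs_self _
    refine (ENNReal.toReal_mono (ENNReal.mul_ne_top (by simp) hu.2.ne) h2).trans_eq ?_
    rw [ENNReal.toReal_mul, ENNReal.toReal_ofReal (by positivity)]
  refine squeeze_zero (fun n => norm_nonneg _) h1 ?_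
  have := (tendsto_one_div_add_atTop_nhds_zero_nat (𝕜 := ℝ)).mul_const (eLpNorm u 2 μ).toReal
  simpa using this

/-- The coefficients of `X_j` grow at most linearly. -/
theorem norm_hField_le (j : Fin d₁) (z : HPoint d₁ d₂) :
    ‖((EuclideanSpace.single j 1, (1 / 2 : ℝ) • G.bracket z.1 (EuclideanSpace.single j 1)) :
      HPoint d₁ d₂)‖ ≤ 1 + ‖z‖ := by
  have h1 := G.norm_bracket_le z.1 (EuclideanSpace.single j 1)
  have h2 : ‖z.1‖ ≤ ‖z‖ := norm_fst_le z
  rw [Prod.norm_def]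
  refine max_le ?_ ?_
  · simp
  · rw [norm_smul]
    simp only [PiLp.norm_single, norm_one, mul_one] at h1
    norm_num
    linarith [norm_nonneg z.1]

theorem exists_schwartz_decay {E : Type*} [NormedAddCommGroup E] [NormedSpace ℝ E] (v : 𝓢(E, ℂ))
    (k : ℕ) : ∃ C, 0 ≤ C ∧ ∀ z, ‖v z‖ * (1 + ‖z‖) ^ k ≤ C := by
  refine ⟨2 ^ k * ((Finset.Iic (k, 0)).sup fun m : ℕ × ℕ => SchwartzMap.seminorm ℝ m.1 m.2) v,
    by positivity, fun z => ?_⟩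
  have := SchwartzMap.one_add_le_sup_seminorm_apply (𝕜 := ℝ) (m := (k, 0)) le_rfl le_rfl v z
  rwa [norm_iteratedFDeriv_zero, mul_comm] at this

/-- Polynomial decay of order `d₁ + d₂ + 1` gives square integrability. -/
theorem memLp_two_of_decay {E : Type*} [NormedAddCommGroup E] {f : HPoint d₁ d₂ → E}
    (hf : AEStronglyMeasurable f) {C : ℝ} (h : ∀ z, ‖f z‖ * (1 + ‖z‖) ^ (d₁ + d₂ + 1) ≤ C) :
    MemLp f 2 (volume : Measure (HPoint d₁ d₂)) := by
  rw [memLp_two_iff_integrable_sq_norm hf]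
  have h1 : Integrable (fun z : HPoint d₁ d₂ => (1 + ‖z‖) ^ (-((d₁ + d₂ + 1 : ℕ) : ℝ))) volume :=
    integrable_one_add_norm (by simp)
  refine (h1.const_mul (C ^ 2)).mono' (hf.norm.pow 2) (Filter.Eventually.of_forall fun z => ?_)
  rw [Real.norm_of_nonneg (by positivity), Real.rpow_neg (by positivity), Real.rpow_natCast,
    ← div_eq_mul_inv, le_div_iff₀ (by positivity)]
  have h2 : (1 : ℝ) ≤ (1 + ‖z‖) ^ (d₁ + d₂ + 1) := one_le_pow₀ (by linarith [norm_nonneg z])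
  calc _ ≤ ‖f z‖ ^ 2 * ((1 + ‖z‖) ^ (d₁ + d₂ + 1)) ^ 2 := by
        gcongr
        nlinarith
    _ ≤ _ := by
        rw [← mul_pow]
        exact pow_le_pow_left₀ (by positivity) (h z) 2

theorem memLp_norm_mul_schwartz (v : 𝓢(HPoint d₁ d₂, ℂ)) :
    MemLp (fun z => ‖z‖ * ‖v z‖) 2 (volume : Measure (HPoint d₁ d₂)) := by
  obtain ⟨C, -, hC⟩ := exists_schwartz_decay v (d₁ + d₂ + 2)
  refine memLp_two_of_decay (C := C) ?_ fun z => ?_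
  · exact (continuous_norm.mul v.continuous.norm).aestronglyMeasurable
  · rw [Real.norm_of_nonneg (by positivity)]
    refine le_trans ?_ (hC z)
    rw [show d₁ + d₂ + 2 = (d₁ + d₂ + 1) + 1 from rfl, pow_succ (1 + ‖z‖) (d₁ + d₂ + 1)]
    have : 0 ≤ ‖v z‖ * (1 + ‖z‖) ^ (d₁ + d₂ + 1) := by positivity
    linarith

/-- Schwartz functions belong to the form domain: the cut-off functions `χ(z / (n + 1)) v`
approximate `v` together with the derivatives `X_j v`, with an error of size `1 / (n + 1)`. -/
theorem schwartzGraph_mem (v : 𝓢(HPoint d₁ d₂, ℂ)) : G.schwartzGraph v ∈ G.formDomain := by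
  let χ : ContDiffBump (0 : HPoint d₁ d₂) := ⟨1, 2, one_pos, one_lt_two⟩
  have hχ1 : ∀ y : HPoint d₁ d₂, |χ y - 1| ≤ ‖y‖ := by
    intro y
    rcases le_total ‖y‖ 1 with h | h
    · rw [χ.one_of_mem_closedBall (by simpa [χ] using h)]
      simp
    · rw [abs_le]
      constructor <;> linarith [χ.nonneg (x := y), χ.le_one (x := y)]
  obtain ⟨C, hC⟩ : ∃ C : ℝ, ∀ y : HPoint d₁ d₂, ‖fderiv ℝ χ y‖ ≤ C :=
    (χ.hasCompactSupport.fderiv (𝕜 := ℝ)).exists_bound_of_continuous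
      ((χ.contDiff (n := 1)).continuous_fderiv one_ne_zero)
  have hC0 : 0 ≤ C := (norm_nonneg _).trans (hC 0)
  have hlim : Filter.Tendsto (fun n => G.formGraph (cutoffMul χ v n)) Filter.atTop
      (nhds (G.schwartzGraph v)) := by
    refine ((WithLp.prod_continuous_toLp 2 _ _).tendsto _).comp (Filter.Tendsto.prodMk_nhds ?_ ?_)
    · refine tendsto_toLp_of_le (fun n => testFunctions_memLp (cutoffMul χ v n)) (v.memLp 2)
        (memLp_norm_mul_schwartz v) fun n z => ?_
      have e1 : (cutoffMul χ v n).1 z - v z = ((χ (((n : ℝ) + 1)⁻¹ • z) - 1 : ℝ) : ℂ) * v z := by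
        simp [cutoffMul]
        ring
      rw [e1, norm_mul, Complex.norm_real]
      refine (mul_le_mul_of_nonneg_right (hχ1 _) (norm_nonneg _)).trans_eq ?_
      rw [norm_smul, Real.norm_of_nonneg (by positivity)]
      ring
    · refine ((PiLp.continuous_toLp 2 _).tendsto _).comp (tendsto_pi_nhds.2 fun j => ?_)
      refine tendsto_toLp_of_le (fun n => testFunctions_memLp (G.X j (cutoffMul χ v n)))
        ((G.schwartzX j v).memLp 2) ((memLp_norm_mul_schwartz (G.schwartzX j v)).add
          (((v.memLp 2).norm.add (memLp_norm_mul_schwartz v)).const_mul C)) fun n z => ?_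
      set a : HPoint d₁ d₂ := (EuclideanSpace.single j 1,
        (1 / 2 : ℝ) • G.bracket z.1 (EuclideanSpace.single j 1)) with ha
      have e2 : (G.X j (cutoffMul χ v n)).1 z = ((χ (((n : ℝ) + 1)⁻¹ • z) : ℝ) : ℂ) *
          G.schwartzX j v z + ((((n : ℝ) + 1)⁻¹ * fderiv ℝ χ (((n : ℝ) + 1)⁻¹ • z) a : ℝ) : ℂ) *
            v z := by
        change G.vectorField j (cutoffMul χ v n).1 z = _
        rw [G.vectorField_eq j ((cutoffMul χ v n).2.1.differentiable (by simp)), G.schwartzX_apply,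
          ← ha]
        have h1 : HasFDerivAt (fun z : HPoint d₁ d₂ => χ (((n : ℝ) + 1)⁻¹ • z))
            ((fderiv ℝ χ (((n : ℝ) + 1)⁻¹ • z)).comp
              (((n : ℝ) + 1)⁻¹ • ContinuousLinearMap.id ℝ _)) z :=
          (((χ.contDiff (n := 1)).differentiable one_ne_zero) _).hasFDerivAt.comp z
            ((((n : ℝ) + 1)⁻¹ • ContinuousLinearMap.id ℝ (HPoint d₁ d₂)).hasFDerivAt)
        have h2 := ((Complex.ofRealCLM.hasFDerivAt.comp z h1).mul
          (v.differentiableAt (x := z)).hasFDerivAt).fderiv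
        refine (congrArg (fun L : HPoint d₁ d₂ →L[ℝ] ℂ => L a) h2).trans ?_
        simp
        ring
      have e3 : (G.X j (cutoffMul χ v n)).1 z - G.schwartzX j v z =
          ((χ (((n : ℝ) + 1)⁻¹ • z) - 1 : ℝ) : ℂ) * G.schwartzX j v z +
          ((((n : ℝ) + 1)⁻¹ * fderiv ℝ χ (((n : ℝ) + 1)⁻¹ • z) a : ℝ) : ℂ) * v z := by
        rw [e2]
        push_cast
        ring
      have hn : (0 : ℝ) ≤ ((n : ℝ) + 1)⁻¹ := by positivity
      have h3 : ‖fderiv ℝ χ (((n : ℝ) + 1)⁻¹ • z) a‖ ≤ C * (1 + ‖z‖) :=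
        (ContinuousLinearMap.le_opNorm _ _).trans
          (mul_le_mul (hC _) (G.norm_hField_le j z) (norm_nonneg _) hC0)
      rw [e3]
      refine (norm_add_le _ _).trans ?_
      rw [norm_mul, norm_mul, Complex.norm_real, Complex.norm_real, norm_mul,
        Real.norm_of_nonneg hn]
      have h4 := hχ1 (((n : ℝ) + 1)⁻¹ • z)
      rw [norm_smul, Real.norm_of_nonneg hn] at h4
      calc _ ≤ (((n : ℝ) + 1)⁻¹ * ‖z‖) * ‖G.schwartzX j v z‖ +
            (((n : ℝ) + 1)⁻¹ * (C * (1 + ‖z‖))) * ‖v z‖ := by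
            gcongr
            exact h4
        _ = _ := by
            simp only [Pi.add_apply]
            ring
  exact mem_closure_of_tendsto hlim (Filter.Eventually.of_forall fun n => ⟨_, rfl⟩)

/-- Integration by parts against Schwartz functions, by density from test functions. -/
theorem inner_testToL2_X (j : Fin d₁) (φ : testFunctions d₁ d₂) (v : 𝓢(HPoint d₁ d₂, ℂ)) :
    ⟪testToL2 d₁ d₂ (G.X j φ), schwartzToL2 v⟫_ℂ =
      -⟪testToL2 d₁ d₂ φ, schwartzToL2 (G.schwartzX j v)⟫_ℂ := by
  have key : (G.formDomain : Set (FormSpace d₁ d₂)) ⊆ {u : FormSpace d₁ d₂ |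
      ⟪testToL2 d₁ d₂ (G.X j φ), u.fst⟫_ℂ = -⟪testToL2 d₁ d₂ φ, u.snd j⟫_ℂ} := by
    refine closure_minimal ?_ (isClosed_eq ?_ ?_)
    · rintro _ ⟨ψ, rfl⟩
      exact G.inner_X j ψ φ
    · exact continuous_const.inner (WithLp.fstL 2 ℂ _ _).continuous
    · refine (continuous_const.inner ?_).neg
      exact ((PiLp.proj 2 (fun _ : Fin d₁ => HL2 d₁ d₂) j (𝕜 := ℂ)).continuous).comp
        (WithLp.sndL 2 ℂ (HL2 d₁ d₂) (PiLp 2 fun _ : Fin d₁ => HL2 d₁ d₂)).continuous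
  exact key (G.schwartzGraph_mem v)

/-- `R (1 + L) v = v` for Schwartz functions `v`. -/
theorem resolventOp_schwartz (v : 𝓢(HPoint d₁ d₂, ℂ)) :
    G.resolventOp (schwartzToL2 v - ∑ j, schwartzToL2 (G.schwartzX j (G.schwartzX j v))) =
      schwartzToL2 v := by
  have key : (G.formDomain : Set (FormSpace d₁ d₂)) ⊆ {u : FormSpace d₁ d₂ |
      ⟪u.fst, schwartzToL2 v - ∑ j, schwartzToL2 (G.schwartzX j (G.schwartzX j v))⟫_ℂ =
        ⟪u, G.schwartzGraph v⟫_ℂ} := by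
    refine closure_minimal ?_ (isClosed_eq ?_ ?_)
    · rintro _ ⟨ψ, rfl⟩
      simp only [mem_ofPred_eq, WithLp.prod_inner_apply, PiLp.inner_apply]
      change ⟪testToL2 d₁ d₂ ψ, _⟫_ℂ = ⟪testToL2 d₁ d₂ ψ, schwartzToL2 v⟫_ℂ +
        ∑ j, ⟪testToL2 d₁ d₂ (G.X j ψ), schwartzToL2 (G.schwartzX j v)⟫_ℂ
      rw [inner_sub_right, inner_sum, sub_eq_add_neg, ← Finset.sum_neg_distrib]
      simp only [G.inner_testToL2_X]
    · exact (WithLp.fstL 2 ℂ _ _).continuous.inner continuous_const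
    · exact continuous_id.inner continuous_const
  exact fstCompAdjoint_apply G.formDomain _ (G.schwartzGraph v) (G.schwartzGraph_mem v)
    fun u hu => key hu

/-- The left translate of a test function. -/
def translateTest (a : HPoint d₁ d₂) (φ : testFunctions d₁ d₂) : testFunctions d₁ d₂ :=
  ⟨fun z => φ.1 (G.mul (-a) z), by
    refine ⟨φ.2.1.comp ?_, φ.2.2.comp_homeomorph (G.mulLeft (-a))⟩
    unfold mul bracket
    refine (contDiff_const.add contDiff_fst).prodMk ((contDiff_const.add contDiff_snd).add
      (ContDiff.const_smul _ (contDiff_euclidean.2 fun i => ?_)))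
    exact contDiff_const.inner ℝ contDiff_fst⟩

theorem testToL2_translateTest (a : HPoint d₁ d₂) (φ : testFunctions d₁ d₂) :
    testToL2 d₁ d₂ (G.translateTest a φ) = G.transL a (testToL2 d₁ d₂ φ) :=
  (Lp.toLp_compMeasurePreserving (testFunctions_memLp φ) (G.measurePreserving_mul_left (-a))).symm

theorem X_translateTest (a : HPoint d₁ d₂) (j : Fin d₁) (φ : testFunctions d₁ d₂) :
    G.X j (G.translateTest a φ) = G.translateTest a (G.X j φ) := by
  ext z
  change deriv (fun t : ℝ => φ.1 (G.mul (-a) (G.mul z (t • EuclideanSpace.single j 1, 0)))) 0 =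
    deriv (fun t : ℝ => φ.1 (G.mul (G.mul (-a) z) (t • EuclideanSpace.single j 1, 0))) 0
  simp only [mul_assoc]

/-- Left translation on the form space. -/
def transForm (a : HPoint d₁ d₂) (u : FormSpace d₁ d₂) : FormSpace d₁ d₂ :=
  WithLp.toLp 2 (G.transL a u.fst, WithLp.toLp 2 fun j => G.transL a (u.snd j))

theorem transForm_mem (a : HPoint d₁ d₂) {u : FormSpace d₁ d₂} (hu : u ∈ G.formDomain) :
    G.transForm a u ∈ G.formDomain := by
  have key : (G.formDomain : Set (FormSpace d₁ d₂)) ⊆ G.transForm a ⁻¹' G.formDomain := by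
    refine closure_minimal ?_ (IsClosed.preimage ?_
      (LinearMap.range G.formGraph).isClosed_topologicalClosure)
    · rintro _ ⟨ψ, rfl⟩
      refine (LinearMap.range G.formGraph).le_topologicalClosure ⟨G.translateTest a ψ, ?_⟩
      simp only [formGraph, transForm, LinearMap.coe_mk, AddHom.coe_mk, X_translateTest,
        testToL2_translateTest]
      rfl
    · refine (WithLp.prod_continuous_toLp 2 _ _).comp (Continuous.prodMk ?_ ?_)
      · exact (G.transL a).continuous.comp (WithLp.fstL 2 ℂ _ _).continuous
      · refine (PiLp.continuous_toLp 2 _).comp (continuous_pi fun j => ?_)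
        exact (G.transL a).continuous.comp
          (((PiLp.proj 2 (fun _ : Fin d₁ => HL2 d₁ d₂) j (𝕜 := ℂ)).continuous).comp
          (WithLp.sndL 2 ℂ (HL2 d₁ d₂) (PiLp 2 fun _ : Fin d₁ => HL2 d₁ d₂)).continuous)
  exact key hu

theorem transL_neg_transL (a : HPoint d₁ d₂) (f : HL2 d₁ d₂) :
    G.transL a (G.transL (-a) f) = f := by
  refine Lp.ext ?_
  have h1 := (G.measurePreserving_mul_left (-a)).quasiMeasurePreserving.ae_eq_comp
    (G.coeFn_transL (-a) f)
  filter_upwards [G.coeFn_transL a (G.transL (-a) f), h1] with z h2 h3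
  rw [h2]
  refine h3.trans ?_
  simp [mul_cancel_neg]

theorem inner_transL (a : HPoint d₁ d₂) (f g : HL2 d₁ d₂) :
    ⟪f, G.transL a g⟫_ℂ = ⟪G.transL (-a) f, g⟫_ℂ := by
  rw [← (G.transL a).inner_map_map (G.transL (-a) f), transL_neg_transL]

/-- The weak formulation that characterises `fstCompAdjoint V f`. -/
theorem exists_fstCompAdjoint {A B : Type*} [NormedAddCommGroup A] [InnerProductSpace ℂ A]
    [CompleteSpace A] [NormedAddCommGroup B] [InnerProductSpace ℂ B]
    (V : Submodule ℂ (WithLp 2 (A × B))) [CompleteSpace V] (f : A) :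
    ∃ u ∈ V, u.fst = fstCompAdjoint V f ∧ ∀ v ∈ V, ⟪v.fst, f⟫_ℂ = ⟪v, u⟫_ℂ := by
  refine ⟨_, (ContinuousLinearMap.adjoint ((WithLp.fstL 2 ℂ A B).comp V.subtypeL) f).2, rfl,
    fun v hv => ?_⟩
  exact (ContinuousLinearMap.adjoint_inner_right ((WithLp.fstL 2 ℂ A B).comp V.subtypeL)
    (⟨v, hv⟩ : V) f).symm

/-- The resolvent commutes with left translations, since these preserve the form domain and the
form. -/
theorem transL_resolventOp (a : HPoint d₁ d₂) (f : HL2 d₁ d₂) :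
    G.transL a (G.resolventOp f) = G.resolventOp (G.transL a f) := by
  obtain ⟨u, hu, h1, h2⟩ := exists_fstCompAdjoint G.formDomain f
  refine ((fstCompAdjoint_apply G.formDomain _ (G.transForm a u) (G.transForm_mem a hu)
    fun v hv => ?_).trans ?_).symm
  · rw [G.inner_transL]
    refine (h2 _ (G.transForm_mem (-a) hv)).trans ?_
    simp only [WithLp.prod_inner_apply, PiLp.inner_apply]
    change ⟪G.transL (-a) v.fst, u.fst⟫_ℂ + ∑ j, ⟪G.transL (-a) (v.snd j), u.snd j⟫_ℂ =
      ⟪v.fst, G.transL a u.fst⟫_ℂ + ∑ j, ⟪v.snd j, G.transL a (u.snd j)⟫_ℂ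
    simp only [G.inner_transL]
  · change G.transL a u.fst = _
    rw [h1]
    rfl

theorem multiplier_transL {m : ℝ → ℂ} (hm : IsSymbol m) (a : HPoint d₁ d₂) (f : HL2 d₁ d₂) :
    G.multiplier m (G.transL a f) = G.transL a (G.multiplier m f) :=
  (funCalc_commute G.resolventOp_props (S := (G.transL a).toContinuousLinearMap)
    (G.transL_resolventOp a) hm f).symm

end HTypeGroup
end

noncomputable section

/-! ### The heat equation in Hilbert space -/

section HeatUniqueness

variable {H : Type*} [NormedAddCommGroup H] [InnerProductSpace ℂ H] [CompleteSpace H]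
  {R : H →L[ℂ] H}

/-- Second order Taylor bound for `e^{-x}`, uniform on the half line. -/
theorem exp_neg_taylor {a b : ℝ} (ha : 0 ≤ a) (hb : 0 ≤ b) :
    |Real.exp (-b) - Real.exp (-a) + (b - a) * Real.exp (-a)| ≤ (b - a) ^ 2 := by
  have h1 : 0 ≤ Real.exp (-b) - Real.exp (-a) + (b - a) * Real.exp (-a) := by
    have h2 := Real.add_one_le_exp (-(b - a))
    have h3 : Real.exp (-b) = Real.exp (-a) * Real.exp (-(b - a)) := by
      rw [← Real.exp_add]
      congr 1
      ring
    have := mul_le_mul_of_nonneg_left h2 (Real.exp_pos (-a)).le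
    rw [← h3] at this
    linarith
  rw [abs_of_nonneg h1]
  rcases le_total a b with h | h
  · have h2 : Real.exp (-(b - a)) ≤ (1 + (b - a))⁻¹ := by
      rw [Real.exp_neg]
      exact inv_anti₀ (by linarith) (by linarith [Real.add_one_le_exp (b - a)])
    have h3 : Real.exp (-b) = Real.exp (-a) * Real.exp (-(b - a)) := by
      rw [← Real.exp_add]
      congr 1
      ring
    have h4 : (1 + (b - a))⁻¹ - 1 + (b - a) ≤ (b - a) ^ 2 := by
      have : (1 + (b - a))⁻¹ - 1 + (b - a) = (b - a) ^ 2 / (1 + (b - a)) := by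
        field_simp [show (1 + (b - a)) ≠ 0 by linarith]
        ring
      rw [this]
      exact div_le_self (sq_nonneg _) (by linarith)
    have h5 : Real.exp (-a) ≤ 1 := Real.exp_le_one_iff.2 (by linarith)
    calc _ = Real.exp (-a) * (Real.exp (-(b - a)) - 1 + (b - a)) := by rw [h3]; ring
      _ ≤ Real.exp (-a) * (b - a) ^ 2 := by gcongr; linarith
      _ ≤ _ := mul_le_of_le_one_left (sq_nonneg _) h5
  · have h2 := Real.add_one_le_exp (-(a - b))
    have h3 : Real.exp (-a) = Real.exp (-b) * Real.exp (-(a - b)) := by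
      rw [← Real.exp_add]
      congr 1
      ring
    have h5 : Real.exp (-b) ≤ 1 := Real.exp_le_one_iff.2 (by linarith)
    calc _ = Real.exp (-b) * (1 - (1 + (a - b)) * Real.exp (-(a - b))) := by rw [h3]; ring
      _ ≤ Real.exp (-b) * (a - b) ^ 2 := by gcongr; nlinarith
      _ ≤ (a - b) ^ 2 := mul_le_of_le_one_left (sq_nonneg _) h5
      _ = _ := by ring

/-- The symbol `e^{-u x}` of the heat semigroup. -/
def heatSym (u x : ℝ) : ℂ := (Real.exp (-(u * x)) : ℝ)

theorem isSymbol_heatSym {u : ℝ} (hu : 0 ≤ u) : IsSymbol (heatSym u) := by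
  refine ⟨by unfold heatSym; fun_prop, 1, fun x hx => ?_⟩
  rw [heatSym, Complex.norm_real, Real.norm_of_nonneg (Real.exp_pos _).le, Real.exp_le_one_iff]
  have := mul_nonneg hu hx
  linarith

theorem norm_inv_one_add {x : ℝ} (hx : 0 ≤ x) : ‖((1 + x : ℝ) : ℂ)⁻¹‖ = (1 + x)⁻¹ := by
  rw [norm_inv, Complex.norm_real, Real.norm_of_nonneg (by linarith)]

theorem IsResolvent.injective (hR : IsResolvent R) {f g : H} (h : R f = R g) : f = g := by
  have hsa : ContinuousLinearMap.adjoint R = R := (IsSelfAdjoint.of_nonneg hR.1)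
  have h2 : (fun v : H => inner ℂ f v) = fun v => inner ℂ g v := by
    refine hR.2.2.equalizer (by fun_prop) (by fun_prop) ?_
    funext v
    simp only [Function.comp_apply]
    rw [← hsa, ContinuousLinearMap.adjoint_inner_right, ContinuousLinearMap.adjoint_inner_right, h]
  exact ext_inner_right ℂ fun v => congrFun h2 v

/-- `e^{-u A} (1 + A)^{-2}` is differentiable in the operator norm. -/
theorem hasDerivAt_heat_resolvent (hR : IsResolvent R) {u : ℝ} (hu : 0 < u) :
    HasDerivAt (fun u => funCalc R (fun x => heatSym u x *
      (((1 + x : ℝ) : ℂ)⁻¹ * ((1 + x : ℝ) : ℂ)⁻¹)))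
      (-(funCalc R (heatSym u) ∘L R - funCalc R (heatSym u) ∘L (R ∘L R))) u := by
  have hs : ∀ u : ℝ, 0 ≤ u → IsSymbol fun x => heatSym u x *
      (((1 + x : ℝ) : ℂ)⁻¹ * ((1 + x : ℝ) : ℂ)⁻¹) := fun u hu =>
    (isSymbol_heatSym hu).mul (IsSymbol.inv_one_add.mul IsSymbol.inv_one_add)
  have hF' : IsSymbol fun x => -(heatSym u x * ((1 + x : ℝ) : ℂ)⁻¹ - heatSym u x *
      (((1 + x : ℝ) : ℂ)⁻¹ * ((1 + x : ℝ) : ℂ)⁻¹)) :=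
    (((isSymbol_heatSym hu.le).mul IsSymbol.inv_one_add).sub (hs u hu.le)).neg
  have h1 : funCalc R (fun x => -(heatSym u x * ((1 + x : ℝ) : ℂ)⁻¹ - heatSym u x *
      (((1 + x : ℝ) : ℂ)⁻¹ * ((1 + x : ℝ) : ℂ)⁻¹))) =
      -(funCalc R (heatSym u) ∘L R - funCalc R (heatSym u) ∘L (R ∘L R)) := by
    have e : ∀ m : ℝ → ℂ, IsSymbol m → (funCalc R fun x => -m x) = -funCalc R m := by
      intro m hm
      rw [← neg_one_smul ℂ, ← funCalc_smul hR hm]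
      exact funCalc_congr hR fun x _ => by ring
    rw [e _ (((isSymbol_heatSym hu.le).mul IsSymbol.inv_one_add).sub (hs u hu.le)),
      funCalc_sub hR ((isSymbol_heatSym hu.le).mul IsSymbol.inv_one_add) (hs u hu.le),
      ← funCalc_mul hR (isSymbol_heatSym hu.le) IsSymbol.inv_one_add,
      ← funCalc_mul hR (isSymbol_heatSym hu.le) (IsSymbol.inv_one_add.mul IsSymbol.inv_one_add),
      ← funCalc_mul hR IsSymbol.inv_one_add IsSymbol.inv_one_add, funCalc_inv_one_add hR]
  rw [← h1]
  refine hasDerivAt_funCalc hR (K := 1) (U := Ioi 0) (Ioi_mem_nhds hu) hu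
    (fun s hs' => hs s (le_of_lt hs')) hF' fun s hs' x hx => ?_
  have hx0 : (0 : ℝ) ≤ x := hx
  have hs0 : (0 : ℝ) < s := hs'
  have h2 := exp_neg_taylor (mul_nonneg hu.le hx0) (mul_nonneg hs0.le hx0)
  have h3 : heatSym s x * (((1 + x : ℝ) : ℂ)⁻¹ * ((1 + x : ℝ) : ℂ)⁻¹) -
      heatSym u x * (((1 + x : ℝ) : ℂ)⁻¹ * ((1 + x : ℝ) : ℂ)⁻¹) -
      (s - u) * -(heatSym u x * ((1 + x : ℝ) : ℂ)⁻¹ - heatSym u x *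
      (((1 + x : ℝ) : ℂ)⁻¹ * ((1 + x : ℝ) : ℂ)⁻¹)) =
      ((Real.exp (-(s * x)) - Real.exp (-(u * x)) + (s * x - u * x) * Real.exp (-(u * x)) : ℝ) : ℂ) *
        (((1 + x : ℝ) : ℂ)⁻¹ * ((1 + x : ℝ) : ℂ)⁻¹) := by
    have : ((1 + x : ℝ) : ℂ) ≠ 0 := by exact_mod_cast (by linarith : (1 + x) ≠ 0)
    unfold heatSym
    field_simp
    push_cast
    ring
  rw [h3, norm_mul, norm_mul, norm_inv_one_add hx0, Complex.norm_real, Real.norm_eq_abs, one_mul,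
    ← mul_inv, ← div_eq_mul_inv, div_le_iff₀ (by positivity)]
  refine h2.trans ?_
  have : (s * x - u * x) ^ 2 = (s - u) ^ 2 * (x * x) := by ring
  rw [this]
  gcongr <;> linarith

/-- A curve with `A' = -e^r L A` is moved by the heat semigroup of `L`. Here `B r` plays the role of
`-L (A r)`, which is expressed through the resolvent. -/
theorem heat_unique (hR : IsResolvent R) {A B : ℝ → H}
    (hA : ∀ r, HasDerivAt A (Real.exp r • B r) r) (hB : ∀ r, R (A r - B r) = A r)
    {a b : ℝ} (hab : a ≤ b) :
    funCalc R (heatSym (Real.exp b - Real.exp a)) (A a) = A b := by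
  set S : ℝ → H →L[ℂ] H := fun u => funCalc R (fun x => heatSym u x *
      (((1 + x : ℝ) : ℂ)⁻¹ * ((1 + x : ℝ) : ℂ)⁻¹)) with hS
  have hs : ∀ u : ℝ, 0 ≤ u → IsSymbol fun x => heatSym u x *
      (((1 + x : ℝ) : ℂ)⁻¹ * ((1 + x : ℝ) : ℂ)⁻¹) := fun u hu =>
    (isSymbol_heatSym hu).mul (IsSymbol.inv_one_add.mul IsSymbol.inv_one_add)
  have hSeq : ∀ u, 0 ≤ u → ∀ f, S u f = R (R (funCalc R (heatSym u) f)) := by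
    intro u hu f
    have h1 : S u = funCalc R (fun x => (((1 + x : ℝ) : ℂ)⁻¹ * ((1 + x : ℝ) : ℂ)⁻¹) *
        heatSym u x) := funCalc_congr hR fun x _ => mul_comm _ _
    rw [h1, ← funCalc_mul hR (IsSymbol.inv_one_add.mul IsSymbol.inv_one_add) (isSymbol_heatSym hu),
      ← funCalc_mul hR IsSymbol.inv_one_add IsSymbol.inv_one_add, funCalc_inv_one_add hR]
    rfl
  -- Continuity up to `u = 0`, where the differentiability is not available.
  have hlip : ∀ u v, 0 ≤ u → 0 ≤ v → ‖S u - S v‖ ≤ 1 * ‖u - v‖ := by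
    intro u v hu hv
    rw [hS, ← funCalc_sub hR (hs u hu) (hs v hv)]
    refine norm_funCalc_le hR ((hs u hu).sub (hs v hv)).1 fun x hx => ?_
    have hx0 : (0 : ℝ) ≤ x := hx
    rw [← sub_mul, norm_mul, norm_mul, norm_inv_one_add hx0, heatSym, heatSym, ← Complex.ofReal_sub,
      Complex.norm_real, ← mul_inv, ← div_eq_mul_inv, div_le_iff₀ (by positivity)]
    have h2 : ‖Real.exp (-(u * x)) - Real.exp (-(v * x))‖ ≤ |u * x - v * x| := by
      rw [Real.norm_eq_abs, abs_le]
      have a1 := Real.add_one_le_exp (-(u * x) - -(v * x))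
      have a2 := Real.add_one_le_exp (-(v * x) - -(u * x))
      have b1 : Real.exp (-(u * x)) ≤ 1 := Real.exp_le_one_iff.2 (by nlinarith)
      have b2 : Real.exp (-(v * x)) ≤ 1 := Real.exp_le_one_iff.2 (by nlinarith)
      rw [Real.exp_sub, le_div_iff₀ (Real.exp_pos _)] at a1 a2
      have c1 := le_abs_self (u * x - v * x)
      have c2 := neg_abs_le (u * x - v * x)
      have p1 := Real.exp_pos (-(u * x))
      have p2 := Real.exp_pos (-(v * x))
      have c0 := abs_nonneg (u * x - v * x)
      constructor <;> nlinarith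
    refine h2.trans ?_
    rw [← sub_mul, abs_mul, abs_of_nonneg hx0, one_mul, Real.norm_eq_abs]
    gcongr
    nlinarith
  have hSc : ContinuousOn S (Ici 0) :=
    (LipschitzOnWith.of_dist_le_mul (K := 1) fun u hu v hv => by
      rw [dist_eq_norm, dist_eq_norm]
      exact hlip u v hu hv).continuousOn
  have hcont : ContinuousOn (fun r => S (Real.exp b - Real.exp r) (A r)) (Icc a b) := by
    refine ContinuousOn.clm_apply (hSc.comp (by fun_prop) fun r hr => ?_)
      (fun r _ => (hA r).continuousAt.continuousWithinAt)
    simpa using Real.exp_le_exp.2 hr.2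
  -- The curve `r ↦ e^{-(e^b - e^r) L} (1 + L)^{-2} A r` is constant. The factor `(1 + L)^{-2}` makes the
  -- semigroup differentiable in norm, and is removed at the end by the injectivity of `R`.
  have hder : ∀ r ∈ Ico a b, HasDerivWithinAt (fun r => S (Real.exp b - Real.exp r) (A r)) 0
      (Ici r) r := by
    intro r hr
    have hu : 0 < Real.exp b - Real.exp r := by simpa using Real.exp_lt_exp.2 hr.2
    have h1 := (hasDerivAt_heat_resolvent hR hu).scomp r
      ((Real.hasDerivAt_exp r).const_sub (Real.exp b))
    have h2 := (((ContinuousLinearMap.restrictScalarsL ℂ H H ℝ ℝ).hasFDerivAt.comp_hasDerivAt r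
      h1).clm_apply (hA r)).hasDerivWithinAt (s := Ici r)
    refine h2.congr_deriv ?_
    have h3 := hB r
    have h4 : R (B r) = R (A r) - A r := by
      rw [map_sub] at h3
      exact eq_sub_of_add_eq (by rw [← eq_sub_iff_add_eq']; exact h3.symm)
    have h5 : S (Real.exp b - Real.exp r) (B r) =
        funCalc R (heatSym (Real.exp b - Real.exp r)) (R (R (B r))) := by
      simp only [hS]
      rw [← funCalc_mul hR (isSymbol_heatSym hu.le)
        (IsSymbol.inv_one_add.mul IsSymbol.inv_one_add),
        ← funCalc_mul hR IsSymbol.inv_one_add IsSymbol.inv_one_add, funCalc_inv_one_add hR]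
      rfl
    change (-Real.exp r) • (-(funCalc R (heatSym (Real.exp b - Real.exp r)) (R (A r)) -
      funCalc R (heatSym (Real.exp b - Real.exp r)) (R (R (A r))))) +
      S (Real.exp b - Real.exp r) (Real.exp r • B r) = 0
    rw [ContinuousLinearMap.map_smul_of_tower, h5, h4, map_sub, map_sub]
    module
  have h := constant_of_has_deriv_right_zero hcont hder b ⟨hab, le_rfl⟩
  simp only [sub_self] at h
  rw [hSeq _ le_rfl, hSeq _ (by simpa using Real.exp_le_exp.2 hab)] at h
  have h2 := hR.injective (hR.injective h)
  rw [← h2, funCalc_congr hR (m₂ := fun _ => 1) (by intro x _; simp [heatSym]), funCalc_one hR]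
  rfl

end HeatUniqueness
end

noncomputable section

/-! ### Dilations and the heat semigroup -/

section Dilation

variable {d₁ d₂ : ℕ}

/-- The automorphic dilation `(x, u) ↦ (e^{-r/2} x, e^{-r} u)`. -/
def dilL (r : ℝ) : HPoint d₁ d₂ →L[ℝ] HPoint d₁ d₂ :=
  (Real.exp (-r / 2) • ContinuousLinearMap.fst ℝ _ _).prod
    (Real.exp (-r) • ContinuousLinearMap.snd ℝ _ _)

theorem dilL_apply (r : ℝ) (z : HPoint d₁ d₂) :
    dilL r z = (Real.exp (-r / 2) • z.1, Real.exp (-r) • z.2) := rfl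

theorem dilL_dilL (r s : ℝ) (z : HPoint d₁ d₂) : dilL r (dilL s z) = dilL (r + s) z := by
  simp only [dilL_apply, smul_smul, ← Real.exp_add]
  ring_nf

theorem dilL_zero (z : HPoint d₁ d₂) : dilL 0 z = z := by simp [dilL_apply]

/-- The dilation as a linear isomorphism. -/
def dilEquiv (r : ℝ) : HPoint d₁ d₂ ≃L[ℝ] HPoint d₁ d₂ :=
  ContinuousLinearEquiv.equivOfInverse (dilL r) (dilL (-r))
    (fun z => by rw [dilL_dilL, neg_add_cancel, dilL_zero])
    (fun z => by rw [dilL_dilL, add_neg_cancel, dilL_zero])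

/-- The dilates `v_r(x, u) = e^{-r Q / 2} v(e^{-r/2} x, e^{-r} u)`, where `Q = d₁ + 2 d₂`; they have
the same integral as `v`. -/
def dilate (v : 𝓢(HPoint d₁ d₂, ℂ)) (r : ℝ) : 𝓢(HPoint d₁ d₂, ℂ) :=
  Real.exp (-((d₁ / 2 + d₂) * r)) •
    SchwartzMap.compCLMOfContinuousLinearEquiv ℂ (dilEquiv r) v

theorem dilate_apply (v : 𝓢(HPoint d₁ d₂, ℂ)) (r : ℝ) (z : HPoint d₁ d₂) :
    dilate v r z = Real.exp (-((d₁ / 2 + d₂) * r)) * v (dilL r z) := rfl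

theorem dilate_zero (v : 𝓢(HPoint d₁ d₂, ℂ)) : dilate v 0 = v := by
  ext z
  simp [dilate_apply, dilL_zero]

theorem dilate_add (v : 𝓢(HPoint d₁ d₂, ℂ)) (r s : ℝ) :
    dilate v (r + s) = dilate (dilate v r) s := by
  ext z
  rw [dilate_apply, dilate_apply, dilate_apply, dilL_dilL, mul_add, neg_add, Real.exp_add]
  push_cast
  ring

/-- The generator `-(Q / 2 + ½ x·∂_x + u·∂_u)` of the dilations. -/
def dilGen (v : 𝓢(HPoint d₁ d₂, ℂ)) : 𝓢(HPoint d₁ d₂, ℂ) :=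
  -((d₁ / 2 + d₂ : ℝ) • v + SchwartzMap.compCLMOfContinuousLinearEquiv ℂ (freqEquiv d₁ d₂).symm
    (freqEuler (SchwartzMap.compCLMOfContinuousLinearEquiv ℂ (freqEquiv d₁ d₂) v)))

theorem dilGen_apply (v : 𝓢(HPoint d₁ d₂, ℂ)) (z : HPoint d₁ d₂) :
    dilGen v z = -((d₁ / 2 + d₂ : ℝ) * v z + fderiv ℝ v z ((1 / 2 : ℝ) • z.1, z.2)) := by
  have h : (SchwartzMap.compCLMOfContinuousLinearEquiv ℂ (freqEquiv d₁ d₂).symm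
      (freqEuler (SchwartzMap.compCLMOfContinuousLinearEquiv ℂ (freqEquiv d₁ d₂) v))) z =
      fderiv ℝ v z ((1 / 2 : ℝ) • z.1, z.2) := by
    rw [SchwartzMap.compCLMOfContinuousLinearEquiv_apply, Function.comp_apply, freqEuler_apply,
      SchwartzMap.compCLMOfContinuousLinearEquiv_apply, ContinuousLinearEquiv.comp_right_fderiv]
    simp
  rw [← h]
  rfl

theorem hasDerivAt_dilate (v : 𝓢(HPoint d₁ d₂, ℂ)) (r : ℝ) (z : HPoint d₁ d₂) :
    HasDerivAt (fun r => dilate v r z) (dilate (dilGen v) r z) r := by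
  have h1 : HasDerivAt (fun r : ℝ => (dilL r z : HPoint d₁ d₂))
      (-((1 / 2 : ℝ) • (dilL r z).1, (dilL r z).2)) r := by
    have e1 : HasDerivAt (fun r : ℝ => Real.exp (-r / 2)) (Real.exp (-r / 2) * (-1 / 2)) r :=
      ((hasDerivAt_id r).neg.div_const 2).exp
    have e2 : HasDerivAt (fun r : ℝ => Real.exp (-r)) (Real.exp (-r) * (-1)) r :=
      (hasDerivAt_id r).neg.exp
    refine ((e1.smul_const z.1).prodMk (e2.smul_const z.2)).congr_deriv ?_
    simp only [dilL_apply, Prod.neg_mk, smul_smul]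
    refine Prod.ext ?_ ?_
    · simp only [← neg_smul]
      congr 1
      ring
    · simp
  have h2 : HasDerivAt (fun r : ℝ => Real.exp (-((d₁ / 2 + d₂) * r)))
      (Real.exp (-((d₁ / 2 + d₂) * r)) * (-(d₁ / 2 + d₂))) r := by
    have := (((hasDerivAt_id r).const_mul ((d₁ : ℝ) / 2 + d₂)).neg).exp
    simpa using! this
  have h3 := (v.differentiableAt (x := dilL r z)).hasFDerivAt.comp_hasDerivAt r h1
  refine (h2.ofReal_comp.mul h3).congr_deriv ?_
  rw [dilate_apply, dilGen_apply, map_neg]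
  simp only [Function.comp_apply]
  push_cast
  ring

/-- Dilations with `|r| ≤ 1` shrink `1 + ‖z‖` by at most a factor `e`. -/
theorem one_add_norm_le_dilL {r : ℝ} (hr : |r| ≤ 1) (z : HPoint d₁ d₂) :
    1 + ‖z‖ ≤ Real.exp 1 * (1 + ‖dilL r z‖) := by
  have h1 := (abs_le.1 hr).2
  have e1 : 1 ≤ Real.exp 1 * Real.exp (-r / 2) := by
    rw [← Real.exp_add]
    exact Real.one_le_exp (by linarith)
  have e2 : 1 ≤ Real.exp 1 * Real.exp (-r) := by
    rw [← Real.exp_add]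
    exact Real.one_le_exp (by linarith)
  have h2 : ‖z‖ ≤ Real.exp 1 * ‖dilL r z‖ := by
    rw [Prod.norm_def]
    refine max_le ?_ ?_
    · have := norm_fst_le (dilL r z)
      rw [dilL_apply, norm_smul, Real.norm_of_nonneg (Real.exp_pos _).le] at this
      calc ‖z.1‖ ≤ (Real.exp 1 * Real.exp (-r / 2)) * ‖z.1‖ :=
            le_mul_of_one_le_left (norm_nonneg _) e1
        _ ≤ _ := by
            rw [mul_assoc]
            gcongr
            exact this
    · have := norm_snd_le (dilL r z)
      rw [dilL_apply, norm_smul, Real.norm_of_nonneg (Real.exp_pos _).le] at this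
      calc ‖z.2‖ ≤ (Real.exp 1 * Real.exp (-r)) * ‖z.2‖ :=
            le_mul_of_one_le_left (norm_nonneg _) e2
        _ ≤ _ := by
            rw [mul_assoc]
            gcongr
            exact this
  have h3 : 1 ≤ Real.exp 1 := Real.one_le_exp zero_le_one
  linarith

/-- The dilates with `|r| ≤ 1` decay uniformly. -/
theorem exists_dilate_decay (v : 𝓢(HPoint d₁ d₂, ℂ)) (k : ℕ) :
    ∃ C, 0 ≤ C ∧ ∀ r, |r| ≤ 1 → ∀ z, ‖dilate v r z‖ * (1 + ‖z‖) ^ k ≤ C := by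
  obtain ⟨C, hC0, hC⟩ := HTypeGroup.exists_schwartz_decay v k
  refine ⟨Real.exp (d₁ / 2 + d₂) * (Real.exp 1 ^ k * C), by positivity, fun r hr z => ?_⟩
  rw [dilate_apply, norm_mul, Complex.norm_real, Real.norm_of_nonneg (Real.exp_pos _).le, mul_assoc]
  have h1 : Real.exp (-((d₁ / 2 + d₂) * r)) ≤ Real.exp (d₁ / 2 + d₂) := by
    refine Real.exp_le_exp.2 ?_
    have := (abs_le.1 hr).1
    have h0 : (0 : ℝ) ≤ d₁ / 2 + d₂ := by positivity
    nlinarith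
  refine mul_le_mul h1 ?_ (by positivity) (by positivity)
  calc _ ≤ ‖v (dilL r z)‖ * (Real.exp 1 * (1 + ‖dilL r z‖)) ^ k := by
        gcongr
        exact one_add_norm_le_dilL hr z
    _ = Real.exp 1 ^ k * (‖v (dilL r z)‖ * (1 + ‖dilL r z‖) ^ k) := by rw [mul_pow]; ring
    _ ≤ _ := by gcongr; exact hC _

/-- Taylor's inequality of second order on `[-1, 1]`. -/
theorem norm_taylor_le {f f' f'' : ℝ → ℂ} (hf : ∀ r, HasDerivAt f (f' r) r)
    (hf' : ∀ r, HasDerivAt f' (f'' r) r) {M : ℝ} (hM : ∀ r, |r| ≤ 1 → ‖f'' r‖ ≤ M) {r : ℝ}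
    (hr : |r| ≤ 1) : ‖f r - f 0 - r * f' 0‖ ≤ M * r ^ 2 := by
  have hsub : ∀ s ∈ uIcc 0 r, |s| ≤ |r| := by
    intro s hs
    rcases le_total 0 r with h | h
    · rw [uIcc_of_le h] at hs
      rw [abs_of_nonneg hs.1, abs_of_nonneg h]
      exact hs.2
    · rw [uIcc_of_ge h] at hs
      rw [abs_of_nonpos hs.2, abs_of_nonpos h]
      linarith [hs.1]
  have h1 : ∀ s ∈ uIcc 0 r, ‖f' s - f' 0‖ ≤ M * |r| := by
    intro s hs
    have := (convex_uIcc 0 r).norm_image_sub_le_of_norm_hasDerivWithin_le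
      (fun x _ => (hf' x).hasDerivWithinAt) (fun x hx => hM x ((hsub x hx).trans hr))
      left_mem_uIcc hs
    refine this.trans ?_
    have hM0 : 0 ≤ M := (norm_nonneg _).trans (hM r hr)
    rw [sub_zero, Real.norm_eq_abs]
    exact mul_le_mul_of_nonneg_left (hsub s hs) hM0
  have h2 : ∀ s, HasDerivAt (fun s : ℝ => f s - s * f' 0) (f' s - f' 0) s := by
    intro s
    have := (hf s).sub (((hasDerivAt_id s).ofReal_comp).mul_const (f' 0))
    refine this.congr_deriv ?_
    simp
  have h3 := (convex_uIcc 0 r).norm_image_sub_le_of_norm_hasDerivWithin_le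
    (fun x _ => (h2 x).hasDerivWithinAt) h1 left_mem_uIcc right_mem_uIcc
  have e : f r - f 0 - r * f' 0 = (f r - r * f' 0) - (f 0 - ((0 : ℝ) : ℂ) * f' 0) := by
    push_cast
    ring
  rw [e]
  refine h3.trans_eq ?_
  rw [sub_zero, Real.norm_eq_abs, mul_assoc, ← sq, sq_abs]

open HTypeGroup in
/-- The dilates form a differentiable curve in `L²`. -/
theorem hasDerivAt_schwartzToL2_dilate (v : 𝓢(HPoint d₁ d₂, ℂ)) (r : ℝ) :
    HasDerivAt (fun r => schwartzToL2 (dilate v r)) (schwartzToL2 (dilate (dilGen v) r)) r := by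
  -- By the group property of the dilates it suffices to differentiate at `r = 0`.
  have key : ∀ v : 𝓢(HPoint d₁ d₂, ℂ),
      HasDerivAt (fun r => schwartzToL2 (dilate v r)) (schwartzToL2 (dilGen v)) 0 := by
    intro v
    obtain ⟨C, hC0, hC⟩ := exists_dilate_decay (dilGen (dilGen v)) (d₁ + d₂ + 1)
    set u : HPoint d₁ d₂ → ℝ := fun z => ((1 + ‖z‖) ^ (d₁ + d₂ + 1))⁻¹ with hu
    have hu2 : MemLp u 2 (volume : Measure (HPoint d₁ d₂)) := by
      refine memLp_two_of_decay (C := 1) ?_ fun z => ?_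
      · have : Continuous u := by
          refine Continuous.inv₀ (by fun_prop) fun z => by positivity
        exact this.aestronglyMeasurable
      · rw [hu, Real.norm_of_nonneg (by positivity), inv_mul_cancel₀ (by positivity)]
    rw [hasDerivAt_iff_isLittleO]
    have hO : (fun r => schwartzToL2 (dilate v r) - schwartzToL2 (dilate v 0) -
        (r - 0) • schwartzToL2 (dilGen v)) =O[nhds 0] fun r : ℝ => (r - 0) ^ 2 := by
      refine Asymptotics.IsBigO.of_bound (C * (eLpNorm u 2 volume).toReal) ?_
      filter_upwards [Metric.closedBall_mem_nhds (0 : ℝ) one_pos] with r hr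
      have hr1 : |r| ≤ 1 := by simpa using hr
      have h1 : ∀ᵐ z, ‖(schwartzToL2 (dilate v r) - schwartzToL2 (dilate v 0) -
          (r - 0) • schwartzToL2 (dilGen v) : HL2 d₁ d₂) z‖ ≤ (C * r ^ 2) * ‖u z‖ := by
        filter_upwards [Lp.coeFn_sub (schwartzToL2 (dilate v r) - schwartzToL2 (dilate v 0))
          ((r - 0) • schwartzToL2 (dilGen v)), Lp.coeFn_sub (schwartzToL2 (dilate v r))
          (schwartzToL2 (dilate v 0)), Lp.coeFn_smul (r - 0) (schwartzToL2 (dilGen v)),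
          (dilate v r).coeFn_toLp 2, (dilate v 0).coeFn_toLp 2, (dilGen v).coeFn_toLp 2]
          with z e1 e2 e3 e4 e5 e6
        rw [e1, Pi.sub_apply, e2, Pi.sub_apply, e3, Pi.smul_apply, e4, e5, e6, sub_zero]
        have := norm_taylor_le (f := fun r => dilate v r z) (f' := fun r => dilate (dilGen v) r z)
          (fun s => hasDerivAt_dilate v s z) (fun s => hasDerivAt_dilate (dilGen v) s z)
          (M := C * u z) (fun s hs => by
            rw [hu, ← div_eq_mul_inv, le_div_iff₀ (by positivity)]
            exact hC s hs z) hr1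
        rw [dilate_zero (dilGen v)] at this
        refine this.trans_eq ?_
        rw [Real.norm_of_nonneg (by rw [hu]; positivity)]
        ring
      have h2 := Lp.norm_le_mul_norm_of_ae_le_mul (f := (schwartzToL2 (dilate v r) -
        schwartzToL2 (dilate v 0) - (r - 0) • schwartzToL2 (dilGen v) : HL2 d₁ d₂))
        (g := hu2.toLp u) (c := C * r ^ 2) (by
          filter_upwards [h1, hu2.coeFn_toLp] with z a1 a2
          rwa [a2])
      rw [Lp.norm_toLp] at h2
      refine h2.trans_eq ?_
      rw [sub_zero, Real.norm_of_nonneg (sq_nonneg r)]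
      ring
    refine hO.trans_isLittleO ?_
    simpa using (Asymptotics.isLittleO_pow_pow (𝕜 := ℝ) one_lt_two)
  have h1 := key (dilate v r)
  have h2 : dilGen (dilate v r) = dilate (dilGen v) r := by
    ext z
    have e1 := hasDerivAt_dilate (dilate v r) 0 z
    simp only [← dilate_add, dilate_zero] at e1
    have e2 : HasDerivAt (fun s : ℝ => dilate v (r + s) z) (dilate (dilGen v) r z) 0 := by
      have := hasDerivAt_dilate v r z
      rw [← add_zero r] at this
      simpa using this.comp_const_add r 0
    exact e1.unique e2
  simp only [← dilate_add, h2] at h1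
  rw [← sub_self r] at h1
  simpa using h1.comp_sub_const r r

open HTypeGroup

variable (G : HTypeGroup d₁ d₂)

/-- The vector fields `X_j` are homogeneous of degree `1`, that is `1 / 2` in the parameter `r`. -/
theorem HTypeGroup.schwartzX_dilate (j : Fin d₁) (v : 𝓢(HPoint d₁ d₂, ℂ)) (r : ℝ) :
    G.schwartzX j (dilate v r) = Real.exp (-r / 2) • dilate (G.schwartzX j v) r := by
  ext z
  rw [smul_apply, G.schwartzX_apply, dilate_apply, G.schwartzX_apply]
  have h1 : fderiv ℝ (dilate v r) z = Real.exp (-((d₁ / 2 + d₂) * r)) •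
      (fderiv ℝ v (dilL r z)).comp (dilL r) := by
    have := ((v.differentiableAt (x := dilL r z)).hasFDerivAt.comp z
      (dilL r).hasFDerivAt).const_smul (Real.exp (-((d₁ / 2 + d₂) * r)))
    exact this.fderiv
  have h2 : dilL r ((EuclideanSpace.single j 1,
      (1 / 2 : ℝ) • G.bracket z.1 (EuclideanSpace.single j 1)) : HPoint d₁ d₂) =
      Real.exp (-r / 2) • ((EuclideanSpace.single j 1,
        (1 / 2 : ℝ) • G.bracket (dilL r z).1 (EuclideanSpace.single j 1)) : HPoint d₁ d₂) := by
    simp only [dilL_apply, bracket_smul_left]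
    refine Prod.ext rfl ?_
    have : Real.exp (-r) = Real.exp (-r / 2) * Real.exp (-r / 2) := by
      rw [← Real.exp_add]
      congr 1
      ring
    simp only [Prod.smul_mk, this]
    module
  rw [h1, smul_apply, ContinuousLinearMap.comp_apply, h2, map_smul]
  simp only [Complex.real_smul]
  ring

/-- The dilates `p_r` of the heat kernel satisfy `∂_r p_r = e^r ∑ X_j² p_r`, which is the heat
equation in the time `e^r`. -/
theorem HTypeGroup.sum_schwartzX_dilate_heatKernel (hd : 2 ≤ d₁) (r : ℝ) :
    dilate (dilGen (heatKernel d₁ d₂ hd)) r =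
      Real.exp r • ∑ j, G.schwartzX j (G.schwartzX j (dilate (heatKernel d₁ d₂ hd) r)) := by
  have h1 : dilGen (heatKernel d₁ d₂ hd) =
      ∑ j, G.schwartzX j (G.schwartzX j (heatKernel d₁ d₂ hd)) := by
    ext z
    rw [dilGen_apply, sum_apply, ← G.sum_schwartzX_heatKernel hd z, neg_neg]
  have hs : ∀ (j : Fin d₁) (c : ℝ) (v : 𝓢(HPoint d₁ d₂, ℂ)),
      G.schwartzX j (c • v) = c • G.schwartzX j v := by
    intro j c v
    ext z
    rw [smul_apply, G.schwartzX_apply, G.schwartzX_apply]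
    have : fderiv ℝ (c • v : 𝓢(HPoint d₁ d₂, ℂ)) z = c • fderiv ℝ v z :=
      ((v.differentiableAt (x := z)).hasFDerivAt.const_smul c).fderiv
    rw [this, smul_apply]
  have h2 : Real.exp r * (Real.exp (-r / 2) * Real.exp (-r / 2)) = 1 := by
    rw [← Real.exp_add, ← Real.exp_add, ← Real.exp_zero]
    congr 1
    ring
  simp only [G.schwartzX_dilate, hs, smul_smul, ← Finset.smul_sum, h2, one_smul]
  rw [h1]
  ext z
  simp [dilate_apply, sum_apply, Finset.mul_sum]

/-- The heat kernel at time `e^r`, as an element of `L²`. -/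
abbrev heatL2 (d₁ d₂ : ℕ) (hd : 2 ≤ d₁) (r : ℝ) : HL2 d₁ d₂ :=
  schwartzToL2 (dilate (heatKernel d₁ d₂ hd) r)

/-- The semigroup property of the heat kernels. -/
theorem HTypeGroup.multiplier_heatL2 (hd : 2 ≤ d₁) {a b : ℝ} (hab : a ≤ b) :
    G.multiplier (heatSym (Real.exp b - Real.exp a)) (heatL2 d₁ d₂ hd a) = heatL2 d₁ d₂ hd b := by
  refine heat_unique G.resolventOp_props (A := heatL2 d₁ d₂ hd)
    (B := fun r => ∑ j, schwartzToL2
      (G.schwartzX j (G.schwartzX j (dilate (heatKernel d₁ d₂ hd) r)))) (fun r => ?_)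
    (fun r => G.resolventOp_schwartz _) hab
  refine (hasDerivAt_schwartzToL2_dilate (heatKernel d₁ d₂ hd) r).congr_deriv ?_
  rw [G.sum_schwartzX_dilate_heatKernel hd]
  have h := map_sum (SchwartzMap.toLpCLM ℝ ℂ 2 (volume : Measure (HPoint d₁ d₂)))
    (fun j => G.schwartzX j (G.schwartzX j (dilate (heatKernel d₁ d₂ hd) r))) Finset.univ
  have h' := map_smul (SchwartzMap.toLpCLM ℝ ℂ 2 (volume : Measure (HPoint d₁ d₂))) (Real.exp r)
    (∑ j, G.schwartzX j (G.schwartzX j (dilate (heatKernel d₁ d₂ hd) r)))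
  exact h'.trans (congrArg _ h)

end Dilation
end

noncomputable section

/-! ### The heat semigroup as convolution with the heat kernel -/

open HTypeGroup

section HeatConvolution

variable {d₁ d₂ : ℕ} (G : HTypeGroup d₁ d₂)

theorem map_dilL_volume (r : ℝ) : Measure.map (dilL r) (volume : Measure (HPoint d₁ d₂)) =
    ENNReal.ofReal (Real.exp ((d₁ / 2 + d₂) * r)) • volume := by
  have h1 : ∀ (n : ℕ) (c : ℝ), Measure.map (fun x : EuclideanSpace ℝ (Fin n) => Real.exp c • x)
      volume = ENNReal.ofReal (Real.exp (-(n * c))) • volume := by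
    intro n c
    rw [Measure.map_addHaar_smul volume (Real.exp_ne_zero c)]
    congr 2
    rw [finrank_euclideanSpace_fin, ← Real.exp_nat_mul, ← Real.exp_neg,
      abs_of_pos (Real.exp_pos _)]
  have h2 : (dilL r : HPoint d₁ d₂ → HPoint d₁ d₂) = Prod.map (fun x => Real.exp (-r / 2) • x)
      (fun u => Real.exp (-r) • u) := rfl
  have h3 : SFinite (Measure.map (fun x : EuclideanSpace ℝ (Fin d₁) => Real.exp (-r / 2) • x)
      volume) := by
    rw [h1]
    infer_instance
  rw [h2, Measure.volume_eq_prod, ← Measure.map_prod_map _ _ (by fun_prop) (by fun_prop), h1, h1,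
    Measure.prod_smul_left, Measure.prod_smul_right, smul_smul, ← ENNReal.ofReal_mul (by positivity),
    ← Real.exp_add]
  congr 3
  ring

theorem integral_comp_dilL {E : Type*} [NormedAddCommGroup E] [NormedSpace ℝ E] (r : ℝ)
    (F : HPoint d₁ d₂ → E) :
    ∫ w, F (dilL r w) = Real.exp ((d₁ / 2 + d₂) * r) • ∫ w, F w := by
  have h1 : MeasurableEmbedding (dilL r : HPoint d₁ d₂ → HPoint d₁ d₂) :=
    (dilEquiv r).toHomeomorph.measurableEmbedding
  rw [← h1.integral_map, map_dilL_volume, integral_smul_measure, ENNReal.toReal_ofReal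
    (Real.exp_pos _).le]

/-- Change of variables in an integral against the dilates. -/
theorem integral_dilate_mul (v : 𝓢(HPoint d₁ d₂, ℂ)) (r : ℝ) (Ψ : HPoint d₁ d₂ → ℂ) :
    ∫ w, dilate v r w * Ψ w = ∫ w, v w * Ψ (dilL (-r) w) := by
  have h1 := integral_comp_dilL r fun w : HPoint d₁ d₂ => v w * Ψ (dilL (-r) w)
  simp only [dilL_dilL, neg_add_cancel, dilL_zero] at h1
  have h2 : ∀ w, dilate v r w * Ψ w =
      (Real.exp (-((d₁ / 2 + d₂) * r)) : ℝ) • (v (dilL r w) * Ψ w) := by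
    intro w
    rw [dilate_apply, Complex.real_smul]
    ring
  simp only [h2]
  rw [integral_smul, h1, smul_smul, ← Real.exp_add, neg_add_cancel, Real.exp_zero, one_smul]

theorem HTypeGroup.convLp_congr {h h' : HPoint d₁ d₂ → ℂ} (hh : Integrable h)
    (hh' : Integrable h') (he : h =ᵐ[volume] h') (p : ℝ≥0∞) [Fact (1 ≤ p)] :
    G.convLp h hh p = G.convLp h' hh' p := by
  ext1 f
  refine Lp.ext ?_
  filter_upwards [G.coeFn_convLp hh p f, G.coeFn_convLp hh' p f] with z h1 h2
  rw [h1, h2, G.conv_congr_ae (Filter.EventuallyEq.refl _ _) he]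

/-- Convolution with the dilates of a Schwartz function is weakly continuous. -/
theorem HTypeGroup.tendsto_inner_conv_dilate (v : 𝓢(HPoint d₁ d₂, ℂ)) {l : Filter ℝ}
    [l.IsCountablyGenerated] {b : ℝ → ℝ} {T : HPoint d₁ d₂ → HPoint d₁ d₂}
    (hT : ∀ w, Filter.Tendsto (fun a => dilL (-(b a)) w) l (nhds (T w))) (f φ : HL2 d₁ d₂) :
    Filter.Tendsto (fun a => ⟪φ, G.convLp (dilate v (b a)) (dilate v (b a)).integrable 2 f⟫_ℂ) l
      (nhds (∫ w, v w * ⟪φ, G.transR (T w) f⟫_ℂ)) := by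
  simp only [G.inner_convLp_eq, integral_dilate_mul]
  have hc : Continuous fun w => ⟪φ, G.transR w f⟫_ℂ := continuous_const.inner (G.continuous_transR f)
  refine tendsto_integral_filter_of_dominated_convergence (fun w => ‖v w‖ * (‖φ‖ * ‖f‖))
    (Filter.Eventually.of_forall fun a => ?_) (Filter.Eventually.of_forall fun a =>
      Filter.Eventually.of_forall fun w => ?_) (v.integrable.norm.mul_const _)
    (Filter.Eventually.of_forall fun w => ?_)
  · exact (v.continuous.mul (hc.comp (dilL _).continuous)).aestronglyMeasurable
  · rw [norm_mul]
    refine mul_le_mul_of_nonneg_left ?_ (norm_nonneg _)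
    exact (norm_inner_le_norm _ _).trans_eq (by rw [LinearIsometry.norm_map])
  · exact tendsto_const_nhds.mul ((hc.tendsto _).comp (hT w))

theorem HTypeGroup.transR_zero (f : HL2 d₁ d₂) : G.transR 0 f = f := by
  refine Lp.ext ?_
  filter_upwards [G.coeFn_transR 0 f] with z hz
  rw [hz, neg_zero, mul_zero]

/-- The same as `map_conv`, with functions in place of classes. -/
theorem HTypeGroup.map_conv_of_ae {S : HL2 d₁ d₂ →L[ℂ] HL2 d₁ d₂}
    (hS : ∀ y f, S (G.transL y f) = G.transL y (S f)) {a : HL2 d₁ d₂} {v w : HPoint d₁ d₂ → ℂ}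
    (ha : a =ᵐ[volume] v) (hb : S a =ᵐ[volume] w) (hv : Integrable v) (hw : Integrable w)
    (f : HL2 d₁ d₂) : S (G.convLp v hv 2 f) = G.convLp w hw 2 f := by
  rw [← G.convLp_congr (hv.congr ha.symm) hv ha, ← G.convLp_congr (hw.congr hb.symm) hw hb]
  exact G.map_conv hS _ _ f

theorem heatL2_ae (hd : 2 ≤ d₁) (r : ℝ) :
    heatL2 d₁ d₂ hd r =ᵐ[volume] dilate (heatKernel d₁ d₂ hd) r :=
  (dilate (heatKernel d₁ d₂ hd) r).coeFn_toLp 2 volume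

/-- `e^{-tL} f = f * p_t`, with `t = e^r`. -/
theorem HTypeGroup.multiplier_heatSym (hd : 2 ≤ d₁) (r : ℝ) (f : HL2 d₁ d₂) :
    G.multiplier (heatSym (Real.exp r)) f =
      G.convLp (dilate (heatKernel d₁ d₂ hd) r) (SchwartzMap.integrable _) 2 f := by
  set p := heatKernel d₁ d₂ hd with hp
  -- The semigroup property moves `f * p_a` to `f * p_b` with `e^b = e^a + e^r`. As `a → -∞`, the left side
  -- tends to `f` because `p_a` is an approximate identity, and `b` tends to `r`.
  set b : ℝ → ℝ := fun a => Real.log (Real.exp a + Real.exp r) with hb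
  have hbe : ∀ a, Real.exp (b a) - Real.exp a = Real.exp r := by
    intro a
    rw [hb]
    simp only []
    rw [Real.exp_log (by positivity)]
    ring
  have hab : ∀ a, a ≤ b a := by
    intro a
    have := hbe a
    rw [← Real.exp_le_exp]
    linarith [Real.exp_pos r]
  have h1 : ∀ a, G.multiplier (heatSym (Real.exp r))
      (G.convLp (dilate p a) (dilate p a).integrable 2 f) =
      G.convLp (dilate p (b a)) (dilate p (b a)).integrable 2 f := by
    intro a
    have e1 := G.multiplier_heatL2 hd (hab a)
    rw [hbe] at e1
    refine G.map_conv_of_ae (S := G.multiplier (heatSym (Real.exp r)))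
      (fun y f => G.multiplier_transL (isSymbol_heatSym (Real.exp_pos r).le) y f)
      (heatL2_ae hd a) ?_ _ _ f
    rw [e1]
    exact heatL2_ae hd (b a)
  refine ext_inner_left ℂ fun φ => ?_
  have h2 : Filter.Tendsto (fun a => ⟪φ, G.convLp (dilate p (b a))
      (dilate p (b a)).integrable 2 f⟫_ℂ) Filter.atBot
      (nhds ⟪φ, G.convLp (dilate p r) (SchwartzMap.integrable _) 2 f⟫_ℂ) := by
    have hbr : Filter.Tendsto b Filter.atBot (nhds r) := by
      have := ((Real.tendsto_exp_atBot.add_const (Real.exp r)).log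
        (by rw [zero_add]; exact Real.exp_ne_zero r))
      simpa using this
    have := G.tendsto_inner_conv_dilate p (b := b) (l := Filter.atBot) (T := fun w => dilL (-r) w)
      (fun w => by
        have hc : Continuous fun c : ℝ => dilL (-c) w := by
          simp only [dilL_apply]
          fun_prop
        exact (hc.tendsto r).comp hbr) f φ
    rw [← integral_dilate_mul p r fun w => ⟪φ, G.transR w f⟫_ℂ] at this
    rwa [G.inner_convLp_eq]
  have h3 : Filter.Tendsto (fun a => ⟪φ, G.convLp (dilate p (b a))
      (dilate p (b a)).integrable 2 f⟫_ℂ) Filter.atBot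
      (nhds ⟪φ, G.multiplier (heatSym (Real.exp r)) f⟫_ℂ) := by
    have e1 : ∀ g : HL2 d₁ d₂, ⟪φ, G.multiplier (heatSym (Real.exp r)) g⟫_ℂ =
        ⟪ContinuousLinearMap.adjoint (G.multiplier (heatSym (Real.exp r))) φ, g⟫_ℂ := fun g =>
      (ContinuousLinearMap.adjoint_inner_left _ _ _).symm
    simp only [← h1, e1]
    have := G.tendsto_inner_conv_dilate p (b := fun a => a) (l := Filter.atBot) (T := fun w => 0)
      (fun w => by
        have t1 : Filter.Tendsto (fun a : ℝ => Real.exp (-(-a) / 2)) Filter.atBot (nhds 0) :=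
          Real.tendsto_exp_atBot.comp (by
            simpa using Filter.tendsto_id.atBot_div_const (two_pos : (0 : ℝ) < 2))
        have t2 : Filter.Tendsto (fun a : ℝ => Real.exp (-(-a))) Filter.atBot (nhds 0) := by
          simpa using Real.tendsto_exp_atBot
        have t3 := (t1.smul_const w.1).prodMk_nhds (t2.smul_const w.2)
        rw [zero_smul, zero_smul] at t3
        exact t3) f
      (ContinuousLinearMap.adjoint (G.multiplier (heatSym (Real.exp r))) φ)
    simp only [G.transR_zero] at this
    rwa [integral_mul_const, integral_heatKernel, one_mul] at this
  exact tendsto_nhds_unique h3 h2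

end HeatConvolution
end

noncomputable section

/-! ### Subadditive weights and their commutators with convolutions -/

open HTypeGroup

section Weights

variable {d₁ d₂ : ℕ} (G : HTypeGroup d₁ d₂)

/-- A continuous nonnegative symmetric function on the group that is subadditive for the group
law. -/
structure HTypeGroup.IsGauge (n : HPoint d₁ d₂ → ℝ) : Prop where
  continuous : Continuous n
  nonneg : ∀ z, 0 ≤ n z
  neg : ∀ z, n (-z) = n z
  mul_le : ∀ a b, n (G.mul a b) ≤ n a + n b

/-- The homogeneous gauge `max(|x|, |u|^{1/2})`. -/
def hGauge (z : HPoint d₁ d₂) : ℝ := max ‖z.1‖ √‖z.2‖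

theorem HTypeGroup.isGauge_hGauge : G.IsGauge hGauge where
  continuous := by
    unfold hGauge
    fun_prop
  nonneg z := (norm_nonneg _).trans (le_max_left _ _)
  neg z := by simp [hGauge]
  mul_le a b := by
    have h1 : ‖a.1‖ ≤ hGauge a := le_max_left _ _
    have h2 : ‖b.1‖ ≤ hGauge b := le_max_left _ _
    have h3 : ‖a.2‖ ≤ hGauge a ^ 2 := Real.sqrt_le_left (by unfold hGauge; positivity) |>.1
      (le_max_right _ _)
    have h4 : ‖b.2‖ ≤ hGauge b ^ 2 := Real.sqrt_le_left (by unfold hGauge; positivity) |>.1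
      (le_max_right _ _)
    have h5 := norm_nonneg a.1
    have h6 := norm_nonneg b.1
    refine max_le ((norm_add_le _ _).trans (add_le_add h1 h2)) ?_
    rw [Real.sqrt_le_left (by linarith)]
    have h7 : ‖(1 / 2 : ℝ) • G.bracket a.1 b.1‖ ≤ 1 / 2 * (hGauge a * hGauge b) := by
      rw [norm_smul, Real.norm_of_nonneg (by norm_num)]
      refine mul_le_mul_of_nonneg_left ((G.norm_bracket_le _ _).trans ?_) (by norm_num)
      exact mul_le_mul h1 h2 h6 (h5.trans h1)
    have h8 : ‖(G.mul a b).2‖ ≤ ‖a.2‖ + ‖b.2‖ + ‖(1 / 2 : ℝ) • G.bracket a.1 b.1‖ := norm_add₃_le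
    have h9 : 0 ≤ hGauge a * hGauge b := mul_nonneg (h5.trans h1) (h6.trans h2)
    nlinarith

theorem one_add_norm_le_hGauge (z : HPoint d₁ d₂) : 1 + ‖z‖ ≤ (1 + hGauge z) ^ 2 := by
  have h1 : ‖z.1‖ ≤ hGauge z := le_max_left _ _
  have h0 := (norm_nonneg _).trans h1
  have h2 : ‖z.2‖ ≤ hGauge z ^ 2 := (Real.sqrt_le_left h0).1 (le_max_right _ _)
  rw [Prod.norm_def]
  have : max ‖z.1‖ ‖z.2‖ ≤ 2 * hGauge z + hGauge z ^ 2 := max_le (by nlinarith) (by nlinarith)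
  nlinarith

theorem one_add_hGauge_le (z : HPoint d₁ d₂) : 1 + hGauge z ≤ 2 * (1 + ‖z‖) := by
  have h1 : ‖z.1‖ ≤ ‖z‖ := norm_fst_le z
  have h2 : ‖z.2‖ ≤ ‖z‖ := norm_snd_le z
  have h3 : √‖z.2‖ ≤ 1 + ‖z‖ := (Real.sqrt_le_left (by positivity)).2 (by
    nlinarith [norm_nonneg z])
  have : hGauge z ≤ 1 + ‖z‖ := max_le (by linarith) h3
  linarith [norm_nonneg z]

theorem HTypeGroup.dilL_mul (r : ℝ) (a b : HPoint d₁ d₂) :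
    dilL r (G.mul a b) = G.mul (dilL r a) (dilL r b) := by
  simp only [mul, dilL_apply, bracket_smul_left, bracket_smul_right, smul_add, smul_smul]
  congr 3
  rw [← _root_.mul_assoc, _root_.mul_assoc (1 / 2 : ℝ), ← Real.exp_add, mul_comm]
  ring_nf

theorem HTypeGroup.IsGauge.comp_dilL {n : HPoint d₁ d₂ → ℝ} (hn : G.IsGauge n) (r : ℝ) :
    G.IsGauge fun z => n (dilL r z) where
  continuous := hn.continuous.comp (dilL r).continuous
  nonneg _ := hn.nonneg _
  neg z := by rw [map_neg, hn.neg]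
  mul_le a b := by
    rw [G.dilL_mul]
    exact hn.mul_le _ _

/-- The bounded weight `min(1 + n, M)`. -/
def cutWeight (n : HPoint d₁ d₂ → ℝ) (M : ℝ) (z : HPoint d₁ d₂) : ℝ := min (1 + n z) M

/-- The difference of two `k`-th powers is of order `k - 1`, with a loss that is polynomial in the
difference of the bases. -/
theorem abs_pow_sub_pow_le_mul {a b c : ℝ} (ha : 1 ≤ a) (hb : 1 ≤ b) (hab : |a - b| ≤ c) (k : ℕ) :
    |a ^ k - b ^ k| ≤ k * (1 + c) ^ k * b ^ (k - 1) := by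
  rcases Nat.eq_zero_or_pos k with rfl | hk
  · simp
  have hc : 0 ≤ c := (abs_nonneg _).trans hab
  have h1 : max |a| |b| ≤ (1 + c) * b := by
    rw [abs_of_nonneg (by linarith), abs_of_nonneg (by linarith)]
    refine max_le ?_ (by nlinarith)
    nlinarith [(abs_le.1 hab).2]
  calc |a ^ k - b ^ k| ≤ |a - b| * k * max |a| |b| ^ (k - 1) := abs_pow_sub_pow_le a b k
    _ ≤ (1 + c) * k * ((1 + c) * b) ^ (k - 1) := by gcongr; linarith
    _ = k * (1 + c) ^ k * b ^ (k - 1) := by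
      obtain ⟨m, rfl⟩ : ∃ m, k = m + 1 := ⟨k - 1, (Nat.sub_add_cancel hk).symm⟩
      rw [mul_pow, Nat.add_sub_cancel]
      ring

variable {G} in
/-- The weight is Lipschitz along right translations, uniformly in `M`. -/
theorem HTypeGroup.IsGauge.abs_cutWeight_sub_le {n : HPoint d₁ d₂ → ℝ} (hn : G.IsGauge n) (M : ℝ)
    (z w : HPoint d₁ d₂) : |cutWeight n M z - cutWeight n M (G.mul z (-w))| ≤ n w := by
  refine (abs_min_sub_min_le_max _ _ _ _).trans ?_
  rw [sub_self, abs_zero, add_sub_add_left_eq_sub, max_le_iff]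
  refine ⟨?_, hn.nonneg w⟩
  have h1 := hn.mul_le z (-w)
  have h2 := hn.mul_le (G.mul z (-w)) w
  rw [mul_neg_cancel'] at h2
  rw [hn.neg] at h1
  rw [abs_le]
  constructor <;> linarith

variable {G} in
theorem HTypeGroup.IsGauge.one_le_cutWeight {n : HPoint d₁ d₂ → ℝ} (hn : G.IsGauge n) {M : ℝ}
    (hM : 1 ≤ M) (z : HPoint d₁ d₂) : 1 ≤ cutWeight n M z :=
  le_min (by linarith [hn.nonneg z]) hM

theorem memLp_mul_of_bounded {w : HPoint d₁ d₂ → ℝ} (hw : Continuous w) {C : ℝ}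
    (hC : ∀ z, |w z| ≤ C) (f : HL2 d₁ d₂) : MemLp (fun z => (w z : ℂ) * f z) 2 volume :=
  (Lp.memLp f).of_le_mul (c := C) ((Complex.continuous_ofReal.comp hw).aestronglyMeasurable.mul
    (Lp.memLp f).1) (Filter.Eventually.of_forall fun z => by
      rw [norm_mul, Complex.norm_real]
      exact mul_le_mul_of_nonneg_right (hC z) (norm_nonneg _))

/-- Multiplication by a continuous bounded function, on `L²`. -/
def mulL2 (w : HPoint d₁ d₂ → ℝ) (hw : Continuous w) (C : ℝ) (hC : ∀ z, |w z| ≤ C) :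
    HL2 d₁ d₂ →L[ℂ] HL2 d₁ d₂ :=
  LinearMap.mkContinuous
    { toFun := fun f => (memLp_mul_of_bounded hw hC f).toLp _
      map_add' := fun f g => by
        rw [← MemLp.toLp_add]
        refine MemLp.toLp_congr _ _ ?_
        filter_upwards [Lp.coeFn_add f g] with z hz
        simp only [Pi.add_apply] at hz ⊢
        rw [hz, mul_add]
      map_smul' := fun c f => by
        rw [RingHom.id_apply, ← MemLp.toLp_const_smul]
        refine MemLp.toLp_congr _ _ ?_
        filter_upwards [Lp.coeFn_smul c f] with z hz
        simp only [Pi.smul_apply, smul_eq_mul] at hz ⊢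
        rw [hz, mul_left_comm] }
    C fun f => by
      refine Lp.norm_le_mul_norm_of_ae_le_mul ?_
      filter_upwards [(memLp_mul_of_bounded hw hC f).coeFn_toLp] with z hz
      change ‖(memLp_mul_of_bounded hw hC f).toLp _ z‖ ≤ _
      rw [hz, norm_mul, Complex.norm_real]
      exact mul_le_mul_of_nonneg_right (hC z) (norm_nonneg _)

theorem coeFn_mulL2 (w : HPoint d₁ d₂ → ℝ) (hw : Continuous w) (C : ℝ) (hC : ∀ z, |w z| ≤ C)
    (f : HL2 d₁ d₂) : mulL2 w hw C hC f =ᵐ[volume] fun z => (w z : ℂ) * f z :=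
  (memLp_mul_of_bounded hw hC f).coeFn_toLp

variable {G}

/-- Multiplication by the `k`-th power of the weight `min(1 + n, M)`. -/
def HTypeGroup.IsGauge.weightL2 {n : HPoint d₁ d₂ → ℝ} (hn : G.IsGauge n) {M : ℝ} (hM : 1 ≤ M)
    (k : ℕ) : HL2 d₁ d₂ →L[ℂ] HL2 d₁ d₂ :=
  mulL2 (fun z => cutWeight n M z ^ k)
    (by
      have := hn.continuous
      unfold cutWeight
      fun_prop) (M ^ k) fun z => by
    have := hn.one_le_cutWeight hM z
    rw [abs_of_nonneg (by positivity)]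
    exact pow_le_pow_left₀ (zero_le_one.trans this) (min_le_right _ _) k

theorem HTypeGroup.IsGauge.coeFn_weightL2 {n : HPoint d₁ d₂ → ℝ} (hn : G.IsGauge n) {M : ℝ}
    (hM : 1 ≤ M) (k : ℕ) (f : HL2 d₁ d₂) :
    hn.weightL2 hM k f =ᵐ[volume] fun z => ((cutWeight n M z ^ k : ℝ) : ℂ) * f z :=
  coeFn_mulL2 _ _ _ _ f

/-- The commutator of the weight of order `k` with a convolution is of order `k - 1`. -/
theorem HTypeGroup.IsGauge.norm_commutator_le {n : HPoint d₁ d₂ → ℝ} (hn : G.IsGauge n) {M : ℝ}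
    (hM : 1 ≤ M) (k : ℕ) {v : HPoint d₁ d₂ → ℂ} (hv : Integrable v)
    (hvk : Integrable fun w => (1 + n w) ^ k * ‖v w‖) (f : HL2 d₁ d₂) :
    ‖hn.weightL2 hM k (G.convLp v hv 2 f) - G.convLp v hv 2 (hn.weightL2 hM k f)‖ ≤
      (k * ∫ w, (1 + n w) ^ k * ‖v w‖) * ‖hn.weightL2 hM (k - 1) f‖ := by
  set θ := cutWeight n M with hθ
  have hθ1 : ∀ z, 1 ≤ θ z := hn.one_le_cutWeight hM
  set h' : HPoint d₁ d₂ → ℂ := fun w => ((k * ((1 + n w) ^ k * ‖v w‖) : ℝ) : ℂ) with hh'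
  have hi' : Integrable h' := (hvk.const_mul (k : ℝ)).ofReal
  have hn' : ∀ w, ‖h' w‖ = k * ((1 + n w) ^ k * ‖v w‖) := fun w => by
    have := hn.nonneg w
    rw [hh', Complex.norm_real, Real.norm_of_nonneg (by positivity)]
  have e1 : eLpNorm h' 1 volume = ENNReal.ofReal (k * ∫ w, (1 + n w) ^ k * ‖v w‖) := by
    rw [eLpNorm_one_eq_lintegral_enorm, ← ofReal_integral_norm_eq_lintegral_enorm hi']
    simp only [hn']
    rw [integral_const_mul]
  have e0 : (0 : ℝ) ≤ k * ∫ w, (1 + n w) ^ k * ‖v w‖ := by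
    refine mul_nonneg (Nat.cast_nonneg _) (integral_nonneg fun w => ?_)
    have := hn.nonneg w
    positivity
  have key : ∀ᵐ z, ‖(hn.weightL2 hM k (G.convLp v hv 2 f) -
      G.convLp v hv 2 (hn.weightL2 hM k f) : HL2 d₁ d₂) z‖ₑ ≤
        ∫⁻ w, ‖hn.weightL2 hM (k - 1) f (G.mul z (-w))‖ₑ * ‖h' w‖ₑ := by
    filter_upwards [Lp.coeFn_sub (hn.weightL2 hM k (G.convLp v hv 2 f))
      (G.convLp v hv 2 (hn.weightL2 hM k f)), hn.coeFn_weightL2 hM k (G.convLp v hv 2 f),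
      G.coeFn_convLp hv 2 f, G.coeFn_convLp hv 2 (hn.weightL2 hM k f),
      G.ae_integrable_conv one_le_two (Lp.memLp f) hv,
      G.ae_integrable_conv one_le_two (Lp.memLp (hn.weightL2 hM k f)) hv] with z h1 h2 h3 h4 h5 h6
    have h7 := (G.measurePreserving_mul_neg z).quasiMeasurePreserving.ae_eq_comp
      (hn.coeFn_weightL2 hM k f)
    have h8 := (G.measurePreserving_mul_neg z).quasiMeasurePreserving.ae_eq_comp
      (hn.coeFn_weightL2 hM (k - 1) f)
    rw [h1, Pi.sub_apply, h2, h3, h4, conv, conv, ← integral_const_mul,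
      ← integral_sub (h5.const_mul _) h6]
    refine (enorm_integral_le_lintegral_enorm _).trans (lintegral_mono_ae ?_)
    filter_upwards [h7, h8] with w h9 h10
    simp only [Function.comp_apply] at h9 h10
    rw [h9, h10, ← enorm_mul, enorm_le_iff_norm_le]
    -- The integrand of the commutator contains `θ(z)^k - θ(z w⁻¹)^k`.
    have h11 := abs_pow_sub_pow_le_mul (hθ1 z) (hθ1 (G.mul z (-w)))
      (hn.abs_cutWeight_sub_le M z w) k
    have h12 : ((θ z ^ k : ℝ) : ℂ) * (f (G.mul z (-w)) * v w) -
        ((θ (G.mul z (-w)) ^ k : ℝ) : ℂ) * f (G.mul z (-w)) * v w =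
        ((θ z ^ k - θ (G.mul z (-w)) ^ k : ℝ) : ℂ) * (f (G.mul z (-w)) * v w) := by
      push_cast
      ring
    have h13 := hθ1 (G.mul z (-w))
    rw [h12, norm_mul, norm_mul, norm_mul, norm_mul, hn', Complex.norm_real, Complex.norm_real,
      Real.norm_eq_abs, Real.norm_of_nonneg (by positivity)]
    calc _ ≤ (k * (1 + n w) ^ k * θ (G.mul z (-w)) ^ (k - 1)) *
          (‖f (G.mul z (-w))‖ * ‖v w‖) := by gcongr
      _ = _ := by ring
  rw [Lp.norm_def, Lp.norm_def (hn.weightL2 hM (k - 1) f), ← ENNReal.toReal_ofReal e0, ← e1,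
    ← ENNReal.toReal_mul]
  refine ENNReal.toReal_mono (ENNReal.mul_ne_top (by rw [e1]; exact ENNReal.ofReal_ne_top)
    (Lp.memLp _).2.ne) ?_
  rw [mul_comm]
  refine le_trans ?_ (G.eLpNorm_lconv_le (Lp.memLp (hn.weightL2 hM (k - 1) f)).1 hi'.1 one_le_two)
  refine eLpNorm_mono_enorm_ae ?_
  filter_upwards [key] with z hz
  rwa [enorm_eq_self]

end Weights
end

noncomputable section

/-! ### Unitary groups and weighted estimates -/

section UnitaryGroup

variable {H : Type*} [NormedAddCommGroup H] [InnerProductSpace ℂ H] [CompleteSpace H]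
  {R : H →L[ℂ] H} {α : ℝ → ℝ}

/-- The symbol `e^{iτα}`. -/
def unitarySym (α : ℝ → ℝ) (τ x : ℝ) : ℂ := Complex.exp (Complex.I * (τ * α x))

theorem norm_unitarySym (α : ℝ → ℝ) (τ x : ℝ) : ‖unitarySym α τ x‖ = 1 := by
  rw [unitarySym, ← Complex.ofReal_mul, mul_comm, Complex.norm_exp_ofReal_mul_I]

theorem isSymbol_unitarySym (hα : ContinuousOn α (Ici 0)) (τ : ℝ) : IsSymbol (unitarySym α τ) := by
  refine ⟨?_, 1, fun x _ => (norm_unitarySym α τ x).le⟩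
  unfold unitarySym
  have : ContinuousOn (fun x => (α x : ℂ)) (Ici 0) :=
    Complex.continuous_ofReal.comp_continuousOn hα
  fun_prop

theorem isSymbol_ofReal (hα : ContinuousOn α (Ici 0)) (h1 : ∀ x ∈ Ici (0 : ℝ), |α x| ≤ 1) :
    IsSymbol fun x => (α x : ℂ) :=
  ⟨Complex.continuous_ofReal.comp_continuousOn hα, 1, fun x hx => by
    rw [Complex.norm_real]
    exact h1 x hx⟩

theorem norm_funCalc_unitarySym_le (hR : IsResolvent R) (hα : ContinuousOn α (Ici 0)) (τ : ℝ)
    (h : H) : ‖funCalc R (unitarySym α τ) h‖ ≤ ‖h‖ := by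
  simpa using norm_funCalc_apply_le hR (isSymbol_unitarySym hα τ).1
    (fun x _ => (norm_unitarySym α τ x).le) h

theorem funCalc_unitarySym_neg (hR : IsResolvent R) (hα : ContinuousOn α (Ici 0)) (τ : ℝ) (h : H) :
    funCalc R (unitarySym α τ) (funCalc R (unitarySym α (-τ)) h) = h := by
  rw [funCalc_mul_apply hR (isSymbol_unitarySym hα τ) (isSymbol_unitarySym hα (-τ))]
  have : (fun x => unitarySym α τ x * unitarySym α (-τ) x) = fun _ => 1 := by
    funext x
    rw [unitarySym, unitarySym, ← Complex.exp_add]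
    simp
  rw [this, funCalc_one hR]
  rfl

theorem hasDerivAt_funCalc_unitarySym (hR : IsResolvent R) (hα : ContinuousOn α (Ici 0))
    (h1 : ∀ x ∈ Ici (0 : ℝ), |α x| ≤ 1) (τ : ℝ) :
    HasDerivAt (fun s => funCalc R (unitarySym α s))
      (Complex.I • (funCalc R (fun x => (α x : ℂ)) ∘L funCalc R (unitarySym α τ))) τ := by
  have hs := isSymbol_ofReal hα h1
  have e1 : Complex.I • (funCalc R (fun x => (α x : ℂ)) ∘L funCalc R (unitarySym α τ)) =
      funCalc R fun x => Complex.I * (α x * unitarySym α τ x) := by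
    rw [funCalc_mul hR hs (isSymbol_unitarySym hα τ), ← funCalc_smul hR
      (hs.mul (isSymbol_unitarySym hα τ))]
  rw [e1]
  refine hasDerivAt_funCalc hR (K := 1) (Metric.ball_mem_nhds τ one_pos)
    (Metric.mem_ball_self one_pos) (fun s _ => isSymbol_unitarySym hα s)
    ((IsSymbol.const _).mul (hs.mul (isSymbol_unitarySym hα τ))) fun s hs x hx => ?_
  have e2 : unitarySym α s x = unitarySym α τ x * Complex.exp (Complex.I * ((s - τ) * α x)) := by
    rw [unitarySym, unitarySym, ← Complex.exp_add]
    congr 1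
    ring
  have e3 : unitarySym α s x - unitarySym α τ x - (s - τ) * (Complex.I * (α x * unitarySym α τ x)) =
      unitarySym α τ x * (Complex.exp (Complex.I * ((s - τ) * α x)) - 1 -
        Complex.I * ((s - τ) * α x)) := by
    rw [e2]
    ring
  have e4 : ‖Complex.I * (((s : ℂ) - τ) * α x)‖ = |s - τ| * |α x| := by
    rw [norm_mul, Complex.norm_I, one_mul, norm_mul, ← Complex.ofReal_sub, Complex.norm_real,
      Complex.norm_real]
    rfl
  have e5 : |s - τ| ≤ 1 := by
    have := Metric.mem_ball.1 hs
    rw [Real.dist_eq] at this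
    exact this.le
  rw [e3, norm_mul, norm_unitarySym, one_mul, one_mul]
  refine (Complex.norm_exp_sub_one_sub_id_le ?_).trans ?_
  · rw [e4]
    exact mul_le_one₀ e5 (abs_nonneg _) (h1 x hx)
  · rw [e4, ← sq_abs (s - τ)]
    refine pow_le_pow_left₀ (by positivity) ?_ 2
    exact mul_le_of_le_one_right (abs_nonneg _) (h1 x hx)

/-- A bound for the commutator of `W` with `α(L)` along the orbit `e^{isα(L)} h` bounds the growth
of `W e^{iτα(L)} h`. -/
theorem norm_funCalc_unitarySym_le_of_commutator (hR : IsResolvent R) (hα : ContinuousOn α (Ici 0))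
    (h1 : ∀ x ∈ Ici (0 : ℝ), |α x| ≤ 1) (W : H →L[ℂ] H) (h : H) {τ P : ℝ}
    (hP : ∀ s, |s| ≤ |τ| → ‖W (funCalc R (fun x => (α x : ℂ)) (funCalc R (unitarySym α s) h)) -
      funCalc R (fun x => (α x : ℂ)) (W (funCalc R (unitarySym α s) h))‖ ≤ P) :
    ‖W (funCalc R (unitarySym α τ) h)‖ ≤ ‖W h‖ + |τ| * P := by
  set A := funCalc R (fun x => (α x : ℂ)) with hA
  set E := fun s => funCalc R (unitarySym α s) with hE
  have hs := isSymbol_ofReal hα h1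
  have hEd : ∀ s, HasDerivAt E (Complex.I • (A ∘L E s)) s :=
    hasDerivAt_funCalc_unitarySym hR hα h1
  have hEA : ∀ s g, A (E s g) = E s (A g) := by
    intro s g
    simp only [hA, hE]
    rw [funCalc_mul_apply hR hs (isSymbol_unitarySym hα s),
      funCalc_mul_apply hR (isSymbol_unitarySym hα s) hs]
    simp only [mul_comm]
  -- The derivative of this curve is `i E(-s) [W, A] E(s) h`, and `E` is unitary.
  set u : ℝ → H := fun s => E (-s) (W (E s h)) with hu
  have hud : ∀ s, HasDerivAt u (Complex.I • E (-s) (W (A (E s h)) - A (W (E s h)))) s := by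
    intro s
    have d1 : HasDerivAt (fun s => E s h) ((Complex.I • (A ∘L E s)) h) s := by
      have := ((ContinuousLinearMap.apply ℂ H h).restrictScalars ℝ).hasFDerivAt.comp_hasDerivAt s
        (hEd s)
      exact this
    have d2 : HasDerivAt (fun s => W (E s h)) (W ((Complex.I • (A ∘L E s)) h)) s :=
      (W.restrictScalars ℝ).hasFDerivAt.comp_hasDerivAt s d1
    have d3 : HasDerivAt (fun s => E (-s)) (-(Complex.I • (A ∘L E (-s)))) s := by
      have := (hEd (-s)).scomp s (hasDerivAt_neg s)
      simpa using! this
    have d4 := ((ContinuousLinearMap.restrictScalarsL ℂ H H ℝ ℝ).hasFDerivAt.comp_hasDerivAt s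
      d3).clm_apply d2
    refine d4.congr_deriv ?_
    change (-(Complex.I • (A ∘L E (-s)))) (W (E s h)) + E (-s) (W (Complex.I • A (E s h))) = _
    rw [neg_apply, smul_apply, map_smul, map_smul, map_sub, smul_sub]
    change -(Complex.I • A (E (-s) (W (E s h)))) + _ = _
    rw [hEA]
    abel
  have hn : ∀ s g, ‖E s g‖ ≤ ‖g‖ := norm_funCalc_unitarySym_le hR hα
  have hmv := (convex_Icc (-|τ|) |τ|).norm_image_sub_le_of_norm_hasDerivWithin_le (C := P)
    (f := u) (x := 0) (y := τ) (fun s _ => (hud s).hasDerivWithinAt) (fun s hs => by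
      rw [norm_smul, Complex.norm_I, one_mul]
      exact (hn _ _).trans (hP s (abs_le.2 hs))) ⟨by simp, by simp⟩ ⟨neg_abs_le _, le_abs_self _⟩
  have hE0 : ∀ g, E 0 g = g := by
    intro g
    have : unitarySym α 0 = fun _ => 1 := by
      funext x
      simp [unitarySym]
    simp only [hE]
    rw [this, funCalc_one hR]
    rfl
  have e1 : W (E τ h) = E τ (u τ) := (funCalc_unitarySym_neg hR hα τ _).symm
  have e2 : u 0 = W h := by
    simp only [hu, neg_zero, hE0]
  have e3 : ‖u τ‖ ≤ ‖u 0‖ + ‖u τ - u 0‖ := by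
    simpa using norm_add_le (u 0) (u τ - u 0)
  rw [sub_zero, Real.norm_eq_abs] at hmv
  calc ‖W (E τ h)‖ ≤ ‖u τ‖ := by rw [e1]; exact hn _ _
    _ ≤ ‖W h‖ + |τ| * P := by rw [← e2]; linarith

end UnitaryGroup

section WeightedGrowth

variable {d₁ d₂ : ℕ} {G : HTypeGroup d₁ d₂} {α : ℝ → ℝ}

/-- Polynomial growth of weighted norms along the unitary group of a convolution operator. -/
theorem HTypeGroup.IsGauge.norm_weightL2_unitarySym_le {n : HPoint d₁ d₂ → ℝ} (hn : G.IsGauge n)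
    {M : ℝ} (hM : 1 ≤ M) {v : HPoint d₁ d₂ → ℂ} (hv : Integrable v)
    (hvk : ∀ k : ℕ, Integrable fun w => (1 + n w) ^ k * ‖v w‖)
    (hα : ContinuousOn α (Ici 0)) (h1 : ∀ x ∈ Ici (0 : ℝ), |α x| ≤ 1)
    (hA : ∀ f, G.multiplier (fun x => (α x : ℂ)) f = G.convLp v hv 2 f) (h : HL2 d₁ d₂) {B D : ℝ}
    {K : ℕ} (hD0 : 0 ≤ D) (hB : ∀ k ≤ K, ‖hn.weightL2 hM k h‖ ≤ B)
    (hD : ∀ k ≤ K, k * ∫ w, (1 + n w) ^ k * ‖v w‖ ≤ D) (k : ℕ) (hk : k ≤ K) (τ : ℝ) :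
    ‖hn.weightL2 hM k (G.multiplier (unitarySym α τ) h)‖ ≤ B * (1 + D * |τ|) ^ k := by
  have hB0 : 0 ≤ B := (norm_nonneg _).trans (hB 0 (Nat.zero_le _))
  induction k generalizing τ with
  | zero =>
    have := norm_funCalc_unitarySym_le_of_commutator G.resolventOp_props hα h1
      (hn.weightL2 hM 0) h (τ := τ) (P := 0) fun s _ => by
        change ‖hn.weightL2 hM 0 (G.multiplier (fun x => (α x : ℂ)) _) -
          G.multiplier (fun x => (α x : ℂ)) (hn.weightL2 hM 0 _)‖ ≤ 0
        rw [hA, hA]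
        refine (hn.norm_commutator_le hM 0 hv (hvk 0) _).trans_eq ?_
        simp
    rw [MulZeroClass.mul_zero, add_zero] at this
    rw [pow_zero, mul_one]
    exact this.trans (hB 0 hk)
  | succ k ih =>
    have := norm_funCalc_unitarySym_le_of_commutator G.resolventOp_props hα h1
      (hn.weightL2 hM (k + 1)) h (τ := τ) (P := D * (B * (1 + D * |τ|) ^ k)) fun s hs => by
        change ‖hn.weightL2 hM (k + 1) (G.multiplier (fun x => (α x : ℂ)) _) -
          G.multiplier (fun x => (α x : ℂ)) (hn.weightL2 hM (k + 1) _)‖ ≤ _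
        rw [hA, hA]
        refine (hn.norm_commutator_le hM (k + 1) hv (hvk _) _).trans ?_
        refine mul_le_mul (hD _ hk) ((ih (by omega) s).trans ?_) (norm_nonneg _) hD0
        gcongr
    refine this.trans ((add_le_add_left (hB _ hk) _).trans ?_)
    have h2 : 1 ≤ (1 + D * |τ|) ^ k := one_le_pow₀ (by
      have := mul_nonneg hD0 (abs_nonneg τ)
      linarith)
    have h3 : B * 1 ≤ B * (1 + D * |τ|) ^ k := mul_le_mul_of_nonneg_left h2 hB0
    rw [pow_succ]
    linarith

end WeightedGrowth
end

noncomputable section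

/-! ### Functions of the heat operator -/

open scoped FourierTransform

section LogPull

/-- The function `R(-log u) u^{-(n+1)}`, extended to an even or odd function of `u`. For `n = 0` and
`u = e^{-x}` it is `R(x) e^x`. Lean's value `Real.log u = log |u|` for negative `u` makes it smooth
on the whole line when `R` is smooth with bounded support. -/
def logPull (R : ℝ → ℂ) (n : ℕ) (u : ℝ) : ℂ := R (-Real.log u) * (u : ℂ)⁻¹ ^ (n + 1)

variable {R : ℝ → ℂ} {B : ℝ}

theorem logPull_eq_zero_of_lt (hR : ∀ x, B < |x| → R x = 0) (n : ℕ) {u : ℝ}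
    (hu : |u| < Real.exp (-B)) : logPull R n u = 0 := by
  rcases eq_or_ne u 0 with rfl | h0
  · simp [logPull]
  have h1 : Real.log u < -B := by
    rw [← Real.log_abs, ← Real.log_exp (-B)]
    exact Real.log_lt_log (abs_pos.2 h0) hu
  rw [logPull, hR _ (lt_of_lt_of_le (by linarith) (le_abs_self _)), zero_mul]

theorem logPull_eq_zero_of_gt (hR : ∀ x, B < |x| → R x = 0) (n : ℕ) {u : ℝ}
    (hu : Real.exp B < |u|) : logPull R n u = 0 := by
  have h1 : B < Real.log u := by
    rw [← Real.log_abs, ← Real.log_exp B]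
    exact Real.log_lt_log (Real.exp_pos _) hu
  rw [logPull, hR _ (by rw [abs_neg]; exact lt_of_lt_of_le h1 (le_abs_self _)), zero_mul]

theorem norm_logPull_le (hR : ∀ x, B < |x| → R x = 0) (n : ℕ) {ε : ℝ} (hε : ∀ x, ‖R x‖ ≤ ε) (u : ℝ) :
    ‖logPull R n u‖ ≤ Real.exp B ^ (n + 1) * ε := by
  have hε0 : 0 ≤ ε := (norm_nonneg _).trans (hε 0)
  rcases lt_or_ge |u| (Real.exp (-B)) with hu | hu
  · rw [logPull_eq_zero_of_lt hR n hu, norm_zero]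
    positivity
  · rw [logPull, norm_mul, mul_comm, norm_pow, norm_inv, Complex.norm_real, Real.norm_eq_abs]
    have : |u|⁻¹ ≤ Real.exp B := by
      rw [← inv_inv (Real.exp B), ← Real.exp_neg]
      exact inv_anti₀ (Real.exp_pos _) hu
    gcongr
    exact hε _

theorem hasDerivAt_logPull (hRd : ContDiff ℝ ∞ R) (hR : ∀ x, B < |x| → R x = 0) (n : ℕ) (u : ℝ) :
    HasDerivAt (logPull R n)
      (logPull (fun x => -(deriv R x + (n + 1) * R x)) (n + 1) u) u := by
  rcases eq_or_ne u 0 with rfl | h0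
  · have h1 : logPull R n =ᶠ[nhds 0] fun _ => 0 := by
      filter_upwards [Metric.ball_mem_nhds (0 : ℝ) (Real.exp_pos (-B))] with u hu
      exact logPull_eq_zero_of_lt hR n (by simpa using hu)
    refine ((hasDerivAt_const (0 : ℝ) (0 : ℂ)).congr_of_eventuallyEq h1).congr_deriv ?_
    simp [logPull]
  · have h1 : HasDerivAt R (deriv R (-Real.log u)) (-Real.log u) :=
      (hRd.differentiable (by simp) _).hasDerivAt
    have h2 := h1.scomp u (Real.hasDerivAt_log h0).neg
    have h3 : HasDerivAt (fun u : ℝ => (u : ℂ)⁻¹) (-((u : ℂ) ^ 2)⁻¹) u := by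
      have hu : (u : ℂ) ≠ 0 := by exact_mod_cast h0
      simpa using! (hasDerivAt_inv hu).comp_ofReal
    refine (h2.mul (h3.fun_pow (n + 1))).congr_deriv ?_
    rw [logPull, Complex.real_smul, ← inv_pow, Nat.add_sub_cancel]
    push_cast
    simp only [Function.comp_apply, Pi.neg_apply]
    ring

theorem norm_iteratedDeriv_logPull_le (B : ℝ) (j n : ℕ) : ∃ C : ℝ, 0 ≤ C ∧ ∀ (R : ℝ → ℂ) (ε : ℝ),
    ContDiff ℝ ∞ R → (∀ x, B < |x| → R x = 0) →
      (∀ i ≤ j, ∀ x, ‖iteratedDeriv i R x‖ ≤ ε) →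
        ∀ u, ‖iteratedDeriv j (logPull R n) u‖ ≤ C * ε := by
  induction j generalizing n with
  | zero =>
    refine ⟨Real.exp B ^ (n + 1), by positivity, fun R ε _ hR hε u => ?_⟩
    rw [iteratedDeriv_zero]
    exact norm_logPull_le hR n (fun x => by simpa using hε 0 le_rfl x) u
  | succ j ih =>
    obtain ⟨C, hC0, hC⟩ := ih (n + 1)
    refine ⟨C * (n + 2), by positivity, fun R ε hRd hR hε u => ?_⟩
    have hd : ContDiff ℝ ∞ (deriv R) := (contDiff_infty_iff_deriv.1 hRd).2
    rw [iteratedDeriv_succ', funext fun u => (hasDerivAt_logPull hRd hR n u).deriv, mul_assoc]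
    refine hC _ _ ((hd.add (contDiff_const.mul hRd)).neg) (fun x hx => ?_) (fun i hi x => ?_) u
    · have : R =ᶠ[nhds x] fun _ => 0 := by
        filter_upwards [(isOpen_lt continuous_const continuous_abs).mem_nhds hx] with y hy
        exact hR y hy
      rw [this.deriv_eq, hR x hx]
      simp
    · have e1 : iteratedDeriv i (fun x => -(deriv R x + (n + 1) * R x)) x =
          -(iteratedDeriv (i + 1) R x + (n + 1) * iteratedDeriv i R x) := by
        rw [iteratedDeriv_fun_neg, iteratedDeriv_fun_add (hd.contDiffAt.of_le (mod_cast le_top))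
          ((contDiff_const.mul hRd).contDiffAt.of_le (mod_cast le_top)), iteratedDeriv_const_mul_field,
          iteratedDeriv_succ']
      rw [e1, norm_neg]
      refine (norm_add_le _ _).trans ?_
      have h1 := hε (i + 1) (by omega) x
      have h2 := hε i (by omega) x
      have h3 : ‖((n : ℂ) + 1)‖ = n + 1 := by exact_mod_cast Complex.norm_natCast (n + 1)
      rw [norm_mul, h3]
      nlinarith [mul_le_mul_of_nonneg_left h2 (by positivity : (0 : ℝ) ≤ n + 1)]

theorem contDiff_logPull (hRd : ContDiff ℝ ∞ R) (hR : ∀ x, B < |x| → R x = 0) (n : ℕ) :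
    ContDiff ℝ ∞ (logPull R n) := by
  rw [contDiff_infty]
  intro m
  induction m generalizing n R with
  | zero =>
    exact contDiff_zero.2 (continuous_iff_continuousAt.2 fun u =>
      (hasDerivAt_logPull hRd hR n u).continuousAt)
  | succ m ih =>
    have hd : ContDiff ℝ ∞ (deriv R) := (contDiff_infty_iff_deriv.1 hRd).2
    rw [Nat.cast_succ, contDiff_succ_iff_deriv]
    refine ⟨fun u => (hasDerivAt_logPull hRd hR n u).differentiableAt, by simp, ?_⟩
    rw [funext fun u => (hasDerivAt_logPull hRd hR n u).deriv]
    refine ih ((hd.add (contDiff_const.mul hRd)).neg) (fun x hx => ?_) (n + 1)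
    have : R =ᶠ[nhds x] fun _ => 0 := by
      filter_upwards [(isOpen_lt continuous_const continuous_abs).mem_nhds hx] with y hy
      exact hR y hy
    rw [this.deriv_eq, hR x hx]
    simp

theorem hasCompactSupport_logPull (hR : ∀ x, B < |x| → R x = 0) (n : ℕ) :
    HasCompactSupport (logPull R n) :=
  HasCompactSupport.of_support_subset_isCompact
    (isCompact_Icc (a := -Real.exp B) (b := Real.exp B)) fun u hu => by
      by_contra h
      exact hu (logPull_eq_zero_of_gt hR n (not_le.1 fun h' => h (abs_le.1 h')))

/-- Decay of the Fourier transform of `logPull R 0`, linear in finitely many derivatives of `R`. -/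
theorem exists_fourier_logPull_le (B : ℝ) (m : ℕ) : ∃ C : ℝ, 0 ≤ C ∧ ∀ (R : ℝ → ℂ) (ε : ℝ),
    ContDiff ℝ ∞ R → (∀ x, B < |x| → R x = 0) →
      (∀ i ≤ m, ∀ x, ‖iteratedDeriv i R x‖ ≤ ε) →
        ∀ ξ : ℝ, (1 + |ξ|) ^ m * ‖𝓕 (logPull R 0) ξ‖ ≤ C * ε := by
  have key : ∀ j ≤ m, ∃ C : ℝ, 0 ≤ C ∧ ∀ (R : ℝ → ℂ) (ε : ℝ),
      ContDiff ℝ ∞ R → (∀ x, B < |x| → R x = 0) →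
      (∀ i ≤ m, ∀ x, ‖iteratedDeriv i R x‖ ≤ ε) →
        ∀ ξ : ℝ, |ξ| ^ j * ‖𝓕 (logPull R 0) ξ‖ ≤ C * ε := by
    intro j hj
    obtain ⟨C, hC0, hC⟩ := norm_iteratedDeriv_logPull_le B j 0
    refine ⟨2 * Real.exp B * C, by positivity, fun R ε hRd hR hε ξ => ?_⟩
    have hG := contDiff_logPull hRd hR 0
    have hGc := hasCompactSupport_logPull hR 0
    have hGj : ∀ i : ℕ, HasCompactSupport (iteratedDeriv i (logPull R 0)) := fun i => by
      induction i with
      | zero => simpa using hGc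
      | succ i ih => rw [iteratedDeriv_succ]; exact ih.deriv
    have hGi : ∀ i : ℕ, Integrable (iteratedDeriv i (logPull R 0)) := fun i =>
      (hG.continuous_iteratedDeriv i (mod_cast le_top)).integrable_of_hasCompactSupport (hGj i)
    have h1 := congrFun (Real.fourier_iteratedDeriv (N := ⊤) (n := j) hG
      (fun i _ => hGi i) (by simp)) ξ
    have h2 : ‖𝓕 (iteratedDeriv j (logPull R 0)) ξ‖ ≤ 2 * Real.exp B * C * ε := by
      rw [Real.fourier_real_eq_integral_exp_smul]
      have h3 : ∀ u ∉ Icc (-Real.exp B) (Real.exp B), iteratedDeriv j (logPull R 0) u = 0 := by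
        intro u hu
        have h4 : logPull R 0 =ᶠ[nhds u] fun _ => 0 := by
          have hu' : u ∈ {u : ℝ | Real.exp B < |u|} := not_le.1 fun h' => hu (abs_le.1 h')
          filter_upwards [(isOpen_lt continuous_const continuous_abs).mem_nhds hu'] with y hy
          exact logPull_eq_zero_of_gt hR 0 hy
        rw [h4.iteratedDeriv_eq]
        simp
      rw [← setIntegral_eq_integral_of_forall_compl_eq_zero (s := Icc (-Real.exp B) (Real.exp B))
        (fun u hu => by rw [h3 u hu, smul_zero])]
      refine (norm_setIntegral_le_of_norm_le_const (C := C * ε) (by simp) fun u _ => ?_).trans_eq ?_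
      · rw [norm_smul, Complex.norm_exp_ofReal_mul_I, one_mul]
        exact hC R ε hRd hR (fun i hi => hε i (hi.trans hj)) u
      · rw [Measure.real, Real.volume_Icc, ENNReal.toReal_ofReal (by
          linarith [Real.exp_pos B])]
        ring
    refine le_trans ?_ h2
    rw [h1, norm_smul, norm_pow]
    gcongr
    rw [norm_mul, Complex.norm_real, norm_mul, norm_mul, Complex.norm_I, Complex.norm_real]
    simp only [Complex.norm_ofNat, mul_one, Real.norm_eq_abs]
    rw [abs_of_pos Real.pi_pos]
    nlinarith [Real.pi_gt_three, abs_nonneg ξ]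
  obtain ⟨C, hC0, hC⟩ := key 0 (Nat.zero_le _)
  obtain ⟨C', hC0', hC'⟩ := key m le_rfl
  refine ⟨2 ^ (m - 1) * (C + C'), by positivity, fun R ε hRd hR hε ξ => ?_⟩
  have h1 := hC R ε hRd hR hε ξ
  have h2 := hC' R ε hRd hR hε ξ
  rw [pow_zero, one_mul] at h1
  have h3 := add_pow_le zero_le_one (abs_nonneg ξ) m
  rw [one_pow] at h3
  calc _ ≤ (2 ^ (m - 1) * (1 + |ξ| ^ m)) * ‖𝓕 (logPull R 0) ξ‖ := by gcongr
    _ = 2 ^ (m - 1) * (‖𝓕 (logPull R 0) ξ‖ + |ξ| ^ m * ‖𝓕 (logPull R 0) ξ‖) := by ring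
    _ ≤ 2 ^ (m - 1) * (C * ε + C' * ε) := by gcongr
    _ = _ := by ring

theorem integrable_fourier_logPull (hRd : ContDiff ℝ ∞ R) (hR : ∀ x, B < |x| → R x = 0) :
    Integrable (𝓕 (logPull R 0)) := by
  have h := ((hasCompactSupport_logPull hR 0).toSchwartzMap (contDiff_logPull hRd hR 0))
  have h1 := (𝓕 ((hasCompactSupport_logPull hR 0).toSchwartzMap
    (contDiff_logPull hRd hR 0))).integrable (μ := volume)
  rw [SchwartzMap.fourier_coe] at h1
  exact h1

/-- `R(tx) e^{tx}` as a superposition of the unitary symbols `e^{iτ e^{-tx}}`. -/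
theorem mul_exp_eq_integral_unitarySym (hRd : ContDiff ℝ ∞ R) (hR : ∀ x, B < |x| → R x = 0)
    (t x : ℝ) : R (t * x) * Real.exp (t * x) =
      ∫ ξ : ℝ, 𝓕 (logPull R 0) ξ *
        unitarySym (fun x => Real.exp (-(t * x))) (2 * Real.pi * ξ) x := by
  have hinv := congrFun ((contDiff_logPull hRd hR 0).continuous.fourierInv_fourier_eq
    ((contDiff_logPull hRd hR 0).continuous.integrable_of_hasCompactSupport
      (hasCompactSupport_logPull hR 0)) (integrable_fourier_logPull hRd hR)) (Real.exp (-(t * x)))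
  rw [Real.fourierInv_eq'] at hinv
  have e1 : logPull R 0 (Real.exp (-(t * x))) = R (t * x) * Real.exp (t * x) := by
    rw [logPull, Real.log_exp, neg_neg, zero_add, pow_one, ← Complex.ofReal_inv, ← Real.exp_neg,
      neg_neg]
  rw [← e1, ← hinv]
  refine integral_congr_ae (Filter.Eventually.of_forall fun ξ => ?_)
  simp only [smul_eq_mul, RCLike.inner_apply, conj_trivial, unitarySym]
  rw [mul_comm]
  congr 2
  push_cast
  ring

end LogPull
end

noncomputable section

/-! ### Integrable convolution kernels of smooth multipliers -/

open HTypeGroup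
open scoped FourierTransform

section Dilations

variable {d₁ d₂ : ℕ}

theorem measurableEmbedding_dilL (r : ℝ) :
    MeasurableEmbedding (dilL r : HPoint d₁ d₂ → HPoint d₁ d₂) :=
  (dilEquiv r).toHomeomorph.measurableEmbedding

theorem integrable_comp_dilL (r : ℝ) {F : HPoint d₁ d₂ → ℝ} (hF : Integrable F) :
    Integrable fun z => F (dilL r z) := by
  refine ((measurableEmbedding_dilL r).integrable_map_iff).1 ?_
  rw [map_dilL_volume]
  exact hF.smul_measure ENNReal.ofReal_ne_top

/-- Composition with `dilL r` multiplies `L²` norms by the square root of its inverse Jacobian. -/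
theorem eLpNorm_comp_dilL {E : Type*} [NormedAddCommGroup E] (r : ℝ) (F : HPoint d₁ d₂ → E) :
    eLpNorm (fun z => F (dilL r z)) 2 volume =
      ENNReal.ofReal (Real.exp ((d₁ / 2 + d₂) * r / 2)) * eLpNorm F 2 volume := by
  have h := (measurableEmbedding_dilL (d₁ := d₁) (d₂ := d₂) r).eLpNorm_map_measure (μ := volume)
    (g := F) (p := 2)
  rw [map_dilL_volume, eLpNorm_smul_measure_of_ne_top (by simp), smul_eq_mul] at h
  rw [show (fun z => F (dilL r z)) = F ∘ dilL r from rfl, ← h,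
    ENNReal.ofReal_rpow_of_pos (Real.exp_pos _), ← Real.exp_mul]
  congr 3
  simp
  ring

theorem one_add_hGauge_pow_le (k : ℕ) (z : HPoint d₁ d₂) :
    (1 + hGauge z) ^ k ≤ 2 ^ k * (1 + ‖z‖) ^ k := by
  have h0 : 0 ≤ hGauge z := (norm_nonneg _).trans (le_max_left _ _)
  rw [← mul_pow]
  exact pow_le_pow_left₀ (by linarith) (one_add_hGauge_le z) k

theorem continuous_hGauge : Continuous (hGauge : HPoint d₁ d₂ → ℝ) := by
  unfold hGauge
  fun_prop

theorem memLp_hGauge_pow_mul (k : ℕ) (v : 𝓢(HPoint d₁ d₂, ℂ)) :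
    MemLp (fun z => (1 + hGauge z) ^ k * ‖v z‖) 2 (volume : Measure (HPoint d₁ d₂)) := by
  obtain ⟨C, -, hC⟩ := exists_schwartz_decay v (k + (d₁ + d₂ + 1))
  refine memLp_two_of_decay (C := 2 ^ k * C) ?_ fun z => ?_
  · exact (((continuous_const.add continuous_hGauge).pow k).mul
      v.continuous.norm).aestronglyMeasurable
  · have h0 : 0 ≤ hGauge z := (norm_nonneg _).trans (le_max_left _ _)
    rw [Real.norm_of_nonneg (by positivity)]
    calc _ ≤ (2 ^ k * (1 + ‖z‖) ^ k) * ‖v z‖ * (1 + ‖z‖) ^ (d₁ + d₂ + 1) := by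
          gcongr
          exact one_add_hGauge_pow_le k z
      _ = 2 ^ k * (‖v z‖ * (1 + ‖z‖) ^ (k + (d₁ + d₂ + 1))) := by ring
      _ ≤ _ := by gcongr; exact hC z

/-- The exponent is large enough for square integrability because `(1 + N)²` dominates `1 + ‖z‖`. -/
theorem memLp_inv_hGauge_pow :
    MemLp (fun z => ((1 + hGauge z) ^ (2 * (d₁ + d₂ + 1)))⁻¹) 2
      (volume : Measure (HPoint d₁ d₂)) := by
  have h0 : ∀ z : HPoint d₁ d₂, 0 ≤ hGauge z := fun z => (norm_nonneg _).trans (le_max_left _ _)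
  refine memLp_two_of_decay (C := 1) ?_ fun z => ?_
  · refine (Continuous.inv₀ ((continuous_const.add continuous_hGauge).pow _)
      fun z => ?_).aestronglyMeasurable
    exact (pow_pos (add_pos_of_pos_of_nonneg one_pos (h0 z)) _).ne'
  · have := h0 z
    rw [Real.norm_of_nonneg (by positivity), inv_mul_le_iff₀ (by positivity), mul_one, pow_mul]
    exact pow_le_pow_left₀ (by positivity) (one_add_norm_le_hGauge z) _

theorem integrable_hGauge_pow_mul (k : ℕ) (v : 𝓢(HPoint d₁ d₂, ℂ)) :
    Integrable (fun z => (1 + hGauge z) ^ k * ‖v z‖) (volume : Measure (HPoint d₁ d₂)) := by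
  have h0 : ∀ z : HPoint d₁ d₂, 0 ≤ hGauge z := fun z => (norm_nonneg _).trans (le_max_left _ _)
  have h := memLp_inv_hGauge_pow.integrable_mul
    (memLp_hGauge_pow_mul (k + 2 * (d₁ + d₂ + 1)) v)
  refine h.congr (Filter.Eventually.of_forall fun z => ?_)
  have := h0 z
  simp only [Pi.mul_apply]
  rw [pow_add]
  field_simp

theorem norm_dilate (v : 𝓢(HPoint d₁ d₂, ℂ)) (r : ℝ) (z : HPoint d₁ d₂) :
    ‖dilate v r z‖ = Real.exp (-((d₁ / 2 + d₂) * r)) * ‖v (dilL r z)‖ := by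
  rw [dilate_apply, norm_mul, Complex.norm_real, Real.norm_of_nonneg (Real.exp_pos _).le]

theorem integral_gauge_pow_mul_dilate (k : ℕ) (v : 𝓢(HPoint d₁ d₂, ℂ)) (r : ℝ) :
    ∫ z, (1 + hGauge (dilL r z)) ^ k * ‖dilate v r z‖ = ∫ z, (1 + hGauge z) ^ k * ‖v z‖ := by
  have h1 : ∀ z, (1 + hGauge (dilL r z)) ^ k * ‖dilate v r z‖ =
      Real.exp (-((d₁ / 2 + d₂) * r)) *
        (fun z => (1 + hGauge z) ^ k * ‖v z‖) (dilL r z) := fun z => by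
    rw [norm_dilate]
    ring
  simp only [h1]
  rw [integral_const_mul, integral_comp_dilL r fun z => (1 + hGauge z) ^ k * ‖v z‖, smul_eq_mul,
    ← _root_.mul_assoc, ← Real.exp_add, neg_add_cancel, Real.exp_zero, one_mul]

theorem integrable_gauge_pow_mul_dilate (k : ℕ) (v : 𝓢(HPoint d₁ d₂, ℂ)) (r : ℝ) :
    Integrable fun z => (1 + hGauge (dilL r z)) ^ k * ‖dilate v r z‖ := by
  refine ((integrable_comp_dilL r (integrable_hGauge_pow_mul k v)).const_mul
    (Real.exp (-((d₁ / 2 + d₂) * r)))).congr (Filter.Eventually.of_forall fun z => ?_)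
  simp only [norm_dilate]
  ring

theorem eLpNorm_gauge_pow_mul_dilate (k : ℕ) (v : 𝓢(HPoint d₁ d₂, ℂ)) (r : ℝ) :
    eLpNorm (fun z => (1 + hGauge (dilL r z)) ^ k * ‖dilate v r z‖) 2 volume =
      ENNReal.ofReal (Real.exp (-((d₁ / 2 + d₂) * r / 2))) *
        eLpNorm (fun z => (1 + hGauge z) ^ k * ‖v z‖) 2 volume := by
  have h1 : (fun z => (1 + hGauge (dilL r z)) ^ k * ‖dilate v r z‖) =
      Real.exp (-((d₁ / 2 + d₂) * r)) •
        fun z => (fun z => (1 + hGauge z) ^ k * ‖v z‖) (dilL r z) := by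
    funext z
    simp only [Pi.smul_apply, smul_eq_mul, norm_dilate]
    ring
  rw [h1, eLpNorm_const_smul, eLpNorm_comp_dilL r fun z => (1 + hGauge z) ^ k * ‖v z‖,
    Real.enorm_of_nonneg (Real.exp_pos _).le, ← _root_.mul_assoc, ← ENNReal.ofReal_mul (Real.exp_pos _).le,
    ← Real.exp_add]
  congr 3
  ring

end Dilations

section Kernel

variable {d₁ d₂ : ℕ} {G : HTypeGroup d₁ d₂}

/-- Uniform bounds for the cut-off weighted `L²` norms give an `L¹` bound. -/
theorem HTypeGroup.IsGauge.eLpNorm_one_le {n : HPoint d₁ d₂ → ℝ} (hn : G.IsGauge n) (k : ℕ)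
    (f : HL2 d₁ d₂) {b : ℝ} (hb : ∀ (M : ℝ) (hM : 1 ≤ M), ‖hn.weightL2 hM k f‖ ≤ b) :
    eLpNorm f 1 volume ≤
      eLpNorm (fun z => ((1 + n z) ^ k)⁻¹) 2 volume * ENNReal.ofReal b := by
  have hM : ∀ m : ℕ, (1 : ℝ) ≤ m + 1 := fun m => by
    have := Nat.cast_nonneg (α := ℝ) m
    linarith
  have hpos : ∀ z, 0 < 1 + n z := fun z => by
    have := hn.nonneg z
    linarith
  have h1 : eLpNorm (fun z => (((1 + n z) ^ k : ℝ) : ℂ) * f z) 2 volume ≤ ENNReal.ofReal b := by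
    refine (Lp.eLpNorm_lim_le_liminf_eLpNorm (f := fun (m : ℕ) z => hn.weightL2 (hM m) k f z)
      (fun m => (Lp.memLp _).1) _ ?_).trans ?_
    · filter_upwards [ae_all_iff.2 fun m : ℕ => hn.coeFn_weightL2 (hM m) k f] with z hz
      simp only [hz]
      refine tendsto_const_nhds.congr' ?_
      filter_upwards [Filter.eventually_ge_atTop ⌈1 + n z⌉₊] with m hm
      have : 1 + n z ≤ (m : ℝ) + 1 := (Nat.ceil_le.1 hm).trans (by linarith)
      rw [cutWeight, min_eq_left this]
    · refine Filter.liminf_le_of_frequently_le' (Filter.Frequently.of_forall fun m => ?_)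
      rw [← ENNReal.ofReal_toReal (Lp.memLp (hn.weightL2 (hM m) k f)).2.ne]
      exact ENNReal.ofReal_le_ofReal ((Lp.norm_def _).symm.trans_le (hb _ (hM m)))
  have h2 : (f : HPoint d₁ d₂ → ℂ) = (fun z => ((1 + n z) ^ k)⁻¹) •
      fun z => (((1 + n z) ^ k : ℝ) : ℂ) * f z := by
    funext z
    have := (pow_pos (hpos z) k).ne'
    rw [Pi.smul_apply', Complex.real_smul, ← _root_.mul_assoc, ← Complex.ofReal_mul,
      inv_mul_cancel₀ this, Complex.ofReal_one, one_mul]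
  have hc := hn.continuous
  calc eLpNorm f 1 volume = eLpNorm ((fun z => ((1 + n z) ^ k)⁻¹) •
      fun z => (((1 + n z) ^ k : ℝ) : ℂ) * f z) 1 volume := by rw [← h2]
    _ ≤ eLpNorm (fun z => ((1 + n z) ^ k)⁻¹) 2 volume *
        eLpNorm (fun z => (((1 + n z) ^ k : ℝ) : ℂ) * f z) 2 volume := by
      refine eLpNorm_smul_le_mul_eLpNorm ?_ ?_
      · exact (Complex.continuous_ofReal.comp (by fun_prop)).aestronglyMeasurable.mul
          (Lp.memLp f).1
      · exact (Continuous.inv₀ (by fun_prop) fun z =>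
          (pow_pos (hpos z) k).ne').aestronglyMeasurable
    _ ≤ _ := by gcongr

variable {R : ℝ → ℂ} {B : ℝ}

theorem isSymbol_mul_exp (hRd : ContDiff ℝ ∞ R) (hR : ∀ x, B < |x| → R x = 0) {t : ℝ} (ht : 0 ≤ t) :
    IsSymbol fun x => R (t * x) * Real.exp (t * x) := by
  have h1 : IsSymbol fun x => R x * Real.exp x := by
    refine isSymbol_of_continuous_of_hasCompactSupport
      (hRd.continuous.mul (Complex.continuous_ofReal.comp Real.continuous_exp)) ?_
    refine HasCompactSupport.of_support_subset_isCompact (isCompact_Icc (a := -B) (b := B))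
      fun u hu => ?_
    by_contra h
    refine hu ?_
    simp only []
    rw [hR u (not_le.1 fun h' => h (abs_le.1 h')), zero_mul]
  exact h1.comp_mul ht

/-- Weighted `L²` bounds for `R(tL) e^{tL}` applied to the heat kernel at time `t = e^r`. -/
theorem HTypeGroup.exists_norm_weightL2_le (G : HTypeGroup d₁ d₂) (hd : 2 ≤ d₁) (B : ℝ) (k : ℕ) :
    ∃ C : ℝ, 0 ≤ C ∧ ∀ (R : ℝ → ℂ) (ε : ℝ), ContDiff ℝ ∞ R → (∀ x, B < |x| → R x = 0) →
      (∀ i ≤ k + 2, ∀ x, ‖iteratedDeriv i R x‖ ≤ ε) → ∀ (r M : ℝ) (hM : 1 ≤ M),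
        ‖(G.isGauge_hGauge.comp_dilL G r).weightL2 hM k
          (G.multiplier (fun x => R (Real.exp r * x) * Real.exp (Real.exp r * x))
            (heatL2 d₁ d₂ hd r))‖ ≤ C * ε * Real.exp (-((d₁ / 2 + d₂) * r / 2)) := by
  set v := heatKernel d₁ d₂ hd with hv
  -- The growth of order `k` in the frequency and the integrability over the frequencies use `k + 2`
  -- derivatives of `R`.
  obtain ⟨A, hA0, hA⟩ := exists_fourier_logPull_le B (k + 2)
  set D : ℝ := k * ∫ w : HPoint d₁ d₂, (1 + hGauge w) ^ k * ‖v w‖ with hD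
  have hg0 : ∀ z : HPoint d₁ d₂, 0 ≤ hGauge z := G.isGauge_hGauge.nonneg
  have hD0 : 0 ≤ D := mul_nonneg (Nat.cast_nonneg _) (integral_nonneg fun w => by
    have := hg0 w
    positivity)
  set Y : ℝ := (eLpNorm (fun z : HPoint d₁ d₂ => (1 + hGauge z) ^ k * ‖v z‖) 2 volume).toReal
    with hY
  set J : ℝ := ∫ ξ : ℝ, (1 + ‖ξ‖) ^ (-(2 : ℝ)) with hJ
  have hJi : Integrable fun ξ : ℝ => (1 + ‖ξ‖) ^ (-(2 : ℝ)) :=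
    integrable_one_add_norm (by simp)
  have hJ0 : 0 ≤ J := integral_nonneg fun ξ => by positivity
  have hY0 : 0 ≤ Y := ENNReal.toReal_nonneg
  refine ⟨A * (1 + 2 * Real.pi * D) ^ k * Y * J, by positivity, fun R ε hRd hR hε r M hM => ?_⟩
  have hn := G.isGauge_hGauge.comp_dilL G r
  set t := Real.exp r with ht
  have ht0 : 0 < t := Real.exp_pos r
  set b : ℝ := Real.exp (-((d₁ / 2 + d₂) * r / 2)) * Y with hb
  set α : ℝ → ℝ := fun x => Real.exp (-(t * x)) with hα
  have hαc : ContinuousOn α (Ici 0) := by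
    rw [hα]
    fun_prop
  have hα1 : ∀ x ∈ Ici (0 : ℝ), |α x| ≤ 1 := fun x hx => by
    rw [abs_of_pos (Real.exp_pos _), Real.exp_le_one_iff]
    have := mul_nonneg ht0.le hx
    linarith
  set h := heatL2 d₁ d₂ hd r with hh
  have hB : ∀ j ≤ k, ‖hn.weightL2 hM j h‖ ≤ b := by
    intro j hj
    rw [Lp.norm_def, hb, ← ENNReal.toReal_ofReal (Real.exp_pos (-((d₁ / 2 + d₂) * r / 2))).le, hY,
      ← ENNReal.toReal_mul, ← eLpNorm_gauge_pow_mul_dilate]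
    refine ENNReal.toReal_mono ?_ (eLpNorm_mono_ae ?_)
    · rw [eLpNorm_gauge_pow_mul_dilate]
      exact ENNReal.mul_ne_top ENNReal.ofReal_ne_top (memLp_hGauge_pow_mul k v).2.ne
    · filter_upwards [hn.coeFn_weightL2 hM j h, heatL2_ae hd r] with z h1 h2
      have h3 := hn.one_le_cutWeight hM z
      have h4 := hg0 (dilL r z)
      rw [h1, h2, norm_mul, norm_mul, norm_norm, Complex.norm_real,
        Real.norm_of_nonneg (by positivity), Real.norm_of_nonneg (by positivity)]
      gcongr
      exact (pow_le_pow_right₀ h3 hj).trans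
        (pow_le_pow_left₀ (zero_le_one.trans h3) (min_le_left _ _) k)
  have hDk : ∀ j ≤ k, j * ∫ w, (1 + hGauge (dilL r w)) ^ j * ‖dilate v r w‖ ≤ D := by
    intro j hj
    rw [integral_gauge_pow_mul_dilate]
    refine mul_le_mul (Nat.cast_le.2 hj) ?_ (integral_nonneg fun w => ?_) (Nat.cast_nonneg _)
    · refine integral_mono (integrable_hGauge_pow_mul j v) (integrable_hGauge_pow_mul k v)
        fun w => ?_
      have := hg0 w
      simp only []
      gcongr
      linarith
    · have := hg0 w
      positivity
  have key := hn.norm_weightL2_unitarySym_le hM (dilate v r).integrable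
    (fun j => integrable_gauge_pow_mul_dilate j v r) hαc hα1 (fun f => G.multiplier_heatSym hd r f)
    h hD0 hB hDk k le_rfl
  set Gh : ℝ → ℂ := 𝓕 (logPull R 0) with hGh
  have hGi : Integrable Gh := integrable_fourier_logPull hRd hR
  have hGb : ∀ ξ, ‖Gh ξ‖ ≤ A * ε * ((1 + |ξ|) ^ (k + 2))⁻¹ := fun ξ => by
    rw [← div_eq_mul_inv, le_div_iff₀ (by positivity), mul_comm]
    exact hA R ε hRd hR hε ξ
  have hGc : Continuous Gh := by
    have := (𝓕 ((hasCompactSupport_logPull hR 0).toSchwartzMap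
      (contDiff_logPull hRd hR 0))).continuous
    rw [SchwartzMap.fourier_coe] at this
    exact this
  have hε0 : 0 ≤ ε := (norm_nonneg _).trans (hε 0 (Nat.zero_le _) 0)
  set F : ℝ → ℝ → ℂ := fun ξ x => Gh ξ * unitarySym α (2 * Real.pi * ξ) x with hF
  have hFn : ∀ ξ x, ‖F ξ x‖ = ‖Gh ξ‖ := fun ξ x => by
    rw [hF, norm_mul, norm_unitarySym, mul_one]
  have hFc : ContinuousOn (Function.uncurry F) (univ ×ˢ Ici 0) := by
    refine Continuous.continuousOn ?_
    simp only [hF, hα, unitarySym, Function.uncurry_def]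
    fun_prop
  have hint := funCalc_integral G.resolventOp_props hFc hGi.norm (C := A * ε) (fun ξ => by
    refine (hGb ξ).trans (mul_le_of_le_one_right (by positivity) (inv_le_one_of_one_le₀ ?_))
    exact one_le_pow₀ (by linarith [abs_nonneg ξ])) (fun ξ x _ => (hFn ξ x).le) h
  have e1 : (fun x => R (t * x) * (Real.exp (t * x) : ℂ)) = fun x => ∫ ξ, F ξ x :=
    funext fun x => by
      have := mul_exp_eq_integral_unitarySym hRd hR t x
      push_cast at this
      exact_mod_cast this
  have e2 : ∀ ξ, funCalc G.resolventOp (F ξ) h =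
      Gh ξ • G.multiplier (unitarySym α (2 * Real.pi * ξ)) h := fun ξ => by
    rw [hF, funCalc_smul G.resolventOp_props (isSymbol_unitarySym hαc _)]
    rfl
  have e3 : G.multiplier (fun x => R (t * x) * (Real.exp (t * x) : ℂ)) h =
      ∫ ξ, Gh ξ • G.multiplier (unitarySym α (2 * Real.pi * ξ)) h := by
    rw [e1, ← integral_congr_ae (Filter.Eventually.of_forall e2)]
    exact hint.2
  have hi : Integrable fun ξ => Gh ξ • G.multiplier (unitarySym α (2 * Real.pi * ξ)) h :=
    hint.1.congr (Filter.Eventually.of_forall e2)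
  rw [e3, ← ContinuousLinearMap.integral_comp_comm _ hi]
  have hbound : ∀ ξ : ℝ, ‖hn.weightL2 hM k
      (Gh ξ • G.multiplier (unitarySym α (2 * Real.pi * ξ)) h)‖ ≤
        (A * ε * b * (1 + 2 * Real.pi * D) ^ k) * (1 + ‖ξ‖) ^ (-(2 : ℝ)) := by
    intro ξ
    have hb0 : 0 ≤ b := by positivity
    have h1 := key (2 * Real.pi * ξ)
    have h2 : 1 + D * |2 * Real.pi * ξ| ≤ (1 + 2 * Real.pi * D) * (1 + |ξ|) := by
      rw [abs_mul, abs_of_pos Real.two_pi_pos]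
      have : 0 ≤ 2 * Real.pi * D := by positivity
      nlinarith [abs_nonneg ξ]
    have h3 : (1 + |ξ|) ^ (-(2 : ℝ)) = ((1 + |ξ|) ^ 2)⁻¹ := by
      rw [Real.rpow_neg (by positivity)]
      norm_cast
    rw [map_smul, norm_smul, Real.norm_eq_abs, h3]
    have h4 : (0 : ℝ) < 1 + |ξ| := by positivity
    calc _ ≤ (A * ε * ((1 + |ξ|) ^ (k + 2))⁻¹) *
          (b * ((1 + 2 * Real.pi * D) * (1 + |ξ|)) ^ k) := by
          refine mul_le_mul (hGb ξ) (h1.trans ?_) (norm_nonneg _) (by positivity)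
          gcongr
      _ = _ := by
        rw [mul_pow, pow_add]
        field_simp
  refine (norm_integral_le_of_norm_le (hJi.const_mul _)
    (Filter.Eventually.of_forall hbound)).trans_eq ?_
  rw [integral_const_mul, hb]
  ring

/-- For `R` smooth with support in `[-B, B]`, the operators `R(tL)`, `t > 0`, are convolutions with
functions whose `L¹` norms are bounded by finitely many derivatives of `R`, uniformly in `t`. -/
theorem HTypeGroup.exists_kernel (G : HTypeGroup d₁ d₂) (hd : 2 ≤ d₁) (B : ℝ) :
    ∃ C : ℝ, 0 ≤ C ∧ ∃ m : ℕ, ∀ (R : ℝ → ℂ) (ε : ℝ), ContDiff ℝ ∞ R →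
      (∀ x, B < |x| → R x = 0) → (∀ i ≤ m, ∀ x, ‖iteratedDeriv i R x‖ ≤ ε) → ∀ r : ℝ,
        ∃ (κ : HPoint d₁ d₂ → ℂ) (hκ : Integrable κ), ∫ z, ‖κ z‖ ≤ C * ε ∧
          ∀ f, G.multiplier (fun x => R (Real.exp r * x)) f = G.convLp κ hκ 2 f := by
  -- With this exponent `(1 + N)^{-k}` is square integrable. The factors from dilating this weight and from
  -- the `L²` norm of the heat kernel are reciprocal, so the bound is uniform in `r`.
  set k := 2 * (d₁ + d₂ + 1) with hk
  obtain ⟨C, hC0, hC⟩ := G.exists_norm_weightL2_le hd B k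
  set Z := (eLpNorm (fun z : HPoint d₁ d₂ => ((1 + hGauge z) ^ k)⁻¹) 2 volume).toReal with hZ
  refine ⟨Z * C, by positivity, k + 2, fun R ε hRd hR hε r => ?_⟩
  have hε0 : 0 ≤ ε := (norm_nonneg _).trans (hε 0 (Nat.zero_le _) 0)
  have ht0 : 0 < Real.exp r := Real.exp_pos r
  set m' : ℝ → ℂ := fun x => R (Real.exp r * x) * Real.exp (Real.exp r * x) with hm'
  have hs : IsSymbol m' := isSymbol_mul_exp hRd hR ht0.le
  set κ := G.multiplier m' (heatL2 d₁ d₂ hd r) with hκ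
  have h1 := (G.isGauge_hGauge.comp_dilL G r).eLpNorm_one_le k κ
    (b := C * ε * Real.exp (-((d₁ / 2 + d₂) * r / 2))) (fun M hM => hC R ε hRd hR hε r M hM)
  have h2 : eLpNorm κ 1 volume ≤ ENNReal.ofReal (Z * C * ε) := by
    refine h1.trans_eq ?_
    rw [eLpNorm_comp_dilL r fun z : HPoint d₁ d₂ => ((1 + hGauge z) ^ k)⁻¹,
      ← ENNReal.ofReal_toReal memLp_inv_hGauge_pow.2.ne, ← ENNReal.ofReal_mul (by positivity),
      ← ENNReal.ofReal_mul (by positivity)]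
    congr 1
    have : Real.exp ((d₁ / 2 + d₂) * r / 2) * Real.exp (-((d₁ / 2 + d₂) * r / 2)) = 1 := by
      rw [← Real.exp_add, add_neg_cancel, Real.exp_zero]
    linear_combination (Z * C * ε) * this
  have hi : Integrable κ (volume : Measure (HPoint d₁ d₂)) :=
    memLp_one_iff_integrable.1 ⟨(Lp.memLp κ).1, h2.trans_lt ENNReal.ofReal_lt_top⟩
  refine ⟨κ, hi, ?_, fun f => ?_⟩
  · rw [integral_norm_eq_lintegral_enorm hi.1, ← eLpNorm_one_eq_lintegral_enorm]
    exact ENNReal.toReal_le_of_le_ofReal (by positivity) h2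
  -- `R(tL) f = R(tL) e^{tL} (f * p_t) = f * κ`
  · rw [← G.map_conv_of_ae (S := G.multiplier m') (fun y f => G.multiplier_transL hs y f)
      (heatL2_ae hd r) (Filter.EventuallyEq.refl _ _) (SchwartzMap.integrable _) hi f,
      ← G.multiplier_heatSym hd r f]
    refine Eq.trans ?_ (funCalc_mul_apply G.resolventOp_props hs
      (isSymbol_heatSym ht0.le) f).symm
    refine DFunLike.congr_fun (congrArg (funCalc G.resolventOp) (funext fun x => ?_)) f
    rw [hm', heatSym]
    simp only []
    rw [_root_.mul_assoc, ← Complex.ofReal_mul, ← Real.exp_add, add_neg_cancel, Real.exp_zero,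
      Complex.ofReal_one, mul_one]

end Kernel
end

noncomputable section

/-! ### `L^p` bounds for the remainder -/

section LpBounds

variable {d₁ d₂ : ℕ} {χ : ℝ → ℂ} (hχ : ContDiff ℝ ∞ χ) (hc : HasCompactSupport χ)

/-- The kernel of `ρ_l(L / l²)` has an `L¹` norm controlled by finitely many derivatives of `ρ_l`,
all of which decay faster than any power of `l`, while the support stays in a fixed compact set. -/
theorem HTypeGroup.exists_Lp_bound_remainder (G : HTypeGroup d₁ d₂) (g : smoothDyadic) (N : ℕ) :
    ∃ C : ℝ, ∀ l : ℝ, 1 ≤ l → ∀ (p : ℝ≥0∞) [Fact (1 ≤ p)],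
      ∃ T : Lp ℂ p (volume : Measure (HPoint d₁ d₂)) →L[ℂ]
          Lp ℂ p (volume : Measure (HPoint d₁ d₂)),
        ‖T‖ ≤ C * l ^ (-(N : ℤ)) ∧
        ∀ (f : HL2 d₁ d₂) (f' : Lp ℂ p (volume : Measure (HPoint d₁ d₂))),
          f =ᵐ[volume] f' →
            T f' =ᵐ[volume] G.multiplier (fun x => remainder hχ hc g l ((l ^ 2)⁻¹ * x)) f := by
  have hd : 2 ≤ d₁ := by
    obtain ⟨j, hj⟩ := G.d₁_even
    have := G.d₁_pos
    omega
  obtain ⟨B, hB⟩ := hc.isBounded.exists_norm_le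
  obtain ⟨C, hC0, m, hC⟩ := G.exists_kernel hd B
  choose A hA0 hA using fun i => exists_norm_iteratedDeriv_remainder_le hχ hc g i N
  have hA' : 0 ≤ ∑ i ∈ Finset.range (m + 1), A i := Finset.sum_nonneg fun i _ => hA0 i
  refine ⟨C * ∑ i ∈ Finset.range (m + 1), A i, fun l hl p _ => ?_⟩
  have hl0 : 0 < l := by linarith
  obtain ⟨κ, hκ, hκn, hκf⟩ := hC (remainder hχ hc g l)
    ((∑ i ∈ Finset.range (m + 1), A i) * l ^ (-(N : ℤ))) (contDiff_remainder hχ hc g l)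
    (fun x hx => remainder_eq_zero hχ hc g l (by
      by_contra h
      exact absurd (hB x (subset_closure h)) (not_le.2 hx)))
    (fun i hi x => by
      rw [zpow_neg, zpow_natCast, ← div_eq_mul_inv, le_div_iff₀ (by positivity), mul_comm]
      exact (hA i l hl x).trans (Finset.single_le_sum (fun i _ => hA0 i)
        (Finset.mem_range.2 (by omega)))) (Real.log (l ^ 2)⁻¹)
  rw [Real.exp_log (by positivity)] at hκf
  refine ⟨G.convLp κ hκ p, (G.norm_convLp_le hκ p).trans (hκn.trans_eq (by ring)),
    fun f f' hff' => ?_⟩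
  rw [hκf]
  filter_upwards [G.coeFn_convLp hκ p f', G.coeFn_convLp hκ 2 f] with z h1 h2
  rw [h1, h2, G.conv_congr_ae hff' (Filter.EventuallyEq.refl _ _)]

end LpBounds

theorem proposition4p1 (χ₁ : ℝ → ℂ) (hχ : ContDiff ℝ ∞ χ₁) (hχc : HasCompactSupport χ₁)
    (hχ1 : ∀ s ∈ Set.Icc (1 / 4 : ℝ) 4, χ₁ s = 1) :
    ∃ a ρ : smoothDyadic →ₗ[ℂ] (ℝ → ℝ → ℂ),
      -- smoothness in `(l, s)` and supports
      (∀ g : smoothDyadic,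
        ContDiffOn ℝ ∞ (fun q : ℝ × ℝ => a g q.1 q.2) (Set.Ioi 0 ×ˢ Set.univ) ∧
        ContDiffOn ℝ ∞ (fun q : ℝ × ℝ => ρ g q.1 q.2) (Set.Ioi 0 ×ˢ Set.univ) ∧
        ∀ l : ℝ, 1 ≤ l →
          tsupport (a g l) ⊆ Set.Icc (1 / 16) 4 ∧ tsupport (ρ g l) ⊆ tsupport χ₁) ∧
      -- symbol estimates for the amplitudes
      (∃ c : ℕ → ℝ, ∀ K N₁ N₂ : ℕ, 2 ≤ K → (N₁ + N₂ : ℝ) < ((K : ℝ) - 1) / 2 →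
        ∀ (g : smoothDyadic) (l : ℝ), 1 ≤ l → ∀ s : ℝ,
          ‖mixedDeriv N₁ N₂ (a g) l s‖ ≤ c K * l ^ (-(N₂ : ℤ)) * cNorm K g) ∧
      -- estimates for the remainders
      (∃ c : ℕ → ℕ → ℝ, ∀ K N₁ N₂ : ℕ, 2 ≤ K → N₁ ≤ K - 2 →
        ∀ (g : smoothDyadic) (l : ℝ), 1 ≤ l → ∀ s : ℝ,
          ‖mixedDeriv N₁ N₂ (ρ g) l s‖ ≤ c K N₂ * l ^ ((N₁ : ℤ) + 1 - K) * cNorm K g) ∧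
      -- the functions `l ^ N ρ_l` are bounded in the Schwartz space
      (∀ (g : smoothDyadic) (N : ℕ), ∃ Φ : ℝ → 𝓢(ℝ, ℂ),
        (∀ l : ℝ, 1 ≤ l → ∀ s : ℝ, Φ l s = (l : ℂ) ^ N * ρ g l s) ∧
        Bornology.IsVonNBounded ℂ (Φ '' Set.Ici 1)) ∧
      ∀ {d₁ d₂ : ℕ} (G : HTypeGroup d₁ d₂) (g : smoothDyadic),
        -- the operator identity, on `L²(G)`
        (∀ l : ℝ, 1 ≤ l → ∀ f : HL2 d₁ d₂,
          Integrable (fun s : ℝ => (Complex.exp (Complex.I * (l / (4 * s))) * a g l s) •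
            G.multiplier (fun x => Complex.exp (Complex.I * (s * x / l))) f) ∧
          G.multiplier (fun x => g.1 (l⁻¹ * √x))
              (G.multiplier (fun x => Complex.exp (Complex.I * √x)) f) =
            G.multiplier (fun x => χ₁ ((l ^ 2)⁻¹ * x))
              ((√l : ℂ) • ∫ s : ℝ, (Complex.exp (Complex.I * (l / (4 * s))) * a g l s) •
                G.multiplier (fun x => Complex.exp (Complex.I * (s * x / l))) f) +
            G.multiplier (fun x => ρ g l ((l ^ 2)⁻¹ * x)) f) ∧
        -- bounds on `L^p(G)`
        ∀ N : ℕ, ∃ C : ℝ, ∀ l : ℝ, 1 ≤ l → ∀ (p : ℝ≥0∞) [Fact (1 ≤ p)],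
          ∃ T : Lp ℂ p (volume : Measure (HPoint d₁ d₂)) →L[ℂ]
              Lp ℂ p (volume : Measure (HPoint d₁ d₂)),
            ‖T‖ ≤ C * l ^ (-(N : ℤ)) ∧
            ∀ (f : HL2 d₁ d₂) (f' : Lp ℂ p (volume : Measure (HPoint d₁ d₂))),
              f =ᵐ[volume] f' →
                T f' =ᵐ[volume] G.multiplier (fun x => ρ g l ((l ^ 2)⁻¹ * x)) f := by
  refine ⟨amplitude, remainder hχ hχc, fun g => ⟨contDiffOn_amplitude g,
    contDiffOn_remainder hχ hχc g, fun l _ => ⟨tsupport_amplitude g l,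
      tsupport_remainder hχ hχc g l⟩⟩, exists_norm_mixedDeriv_amplitude_le,
    exists_norm_mixedDeriv_remainder_le hχ hχc, exists_schwartz_remainder hχ hχc,
    fun {d₁ d₂} G g => ⟨fun l hl f => ?_, G.exists_Lp_bound_remainder hχ hχc g⟩⟩
  exact funCalc_wave_eq G.resolventOp_props hχ hχc hχ1 g (by linarith) f
end
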